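/- Let $(M,g)$ be a non-empty smooth five-dimensional Lorentzian manifold of signature $(-,+,+,+,+)$, with Weyl tensor $C_{abcd}$. For $k\ge 0$, $g$ is called *$k$-universal* if every conserved ($\nabla^aT_{ab}=0$) symmetric rank-2 tensor $T_{ab}$ constructed as a contraction of a polynomial in the metric, the Riemann tensor and its covariant derivatives up to order $k$ is a multiple of the metric; $g$ is *universal* if it is $k$-universal for all $k$. A null frame at a point consists of vectors $\ell,n,m^{(2)},m^{(3)},m^{(4)}$ with $\ell\cdot n=1$, $m^{(i)}\cdot m^{(j)}=\delta_{ij}$ and all other scalar products zero. The boost weight of a frame component of $C$ is the number of its indices equal to $\ell$ minus the number of its indices equal to $n$; the boost order of $C$ in the frame is the largest boost weight of a non-vanishing component. The Weyl tensor is of *genuine type II* (including type D, excluding types III, N and O) at a point if in some null frame its boost order is at most $0$, but in no null frame is it at most $-1$; $(M,g)$ is of genuine type II if this holds at every point. Put $S^{(2)}_{ab}=C_{acde}C_b{}^{cde}$ and $S^{(3)}_{ab}=C^{cdef}C_{cdga}C_{ef}{}^{g}{}_{b}$. Then: 1. $(M,g)$ is not both universal and of genuine type II. 2. $(M,g)$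 is not both $0$-universal and of genuine type II. 3. If at a point $x\in M$ there are constants $K,K'$ with $S^{(2)}_{ab}=Kg_{ab}$ and $S^{(3)}_{ab}=K'g_{ab}$, then in every null frame at $x$ in which all Weyl components of positive boost weight vanish, all Weyl components of boost weight zero vanish as well. -/

import Mathlib

open scoped Manifold ContDiff

noncomputable section

namespace Lorentz

/-! ### Tensor calculus in a coordinate chart -/

/-- Components of a covariant tensor field of rank `r` on (an open part of) `ℝⁿ`. -/
abbrev TensorField (n r : ℕ) : Type :=
  EuclideanSpace ℝ (Fin n) → (Fin r → Fin n) → ℝ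

/-- Components of a metric on (an open part of) `ℝⁿ`. -/
abbrev MetricField (n : ℕ) : Type :=
  EuclideanSpace ℝ (Fin n) → Matrix (Fin n) (Fin n) ℝ

/-- The partial derivative `∂ᵢ f`. -/
def pd {n : ℕ} (i : Fin n) (f : EuclideanSpace ℝ (Fin n) → ℝ) (y : EuclideanSpace ℝ (Fin n)) : ℝ :=
  fderiv ℝ f y (EuclideanSpace.single i 1)

/-- Christoffel symbols `Γᵏᵢⱼ = ½ gᵏˡ (∂ᵢ gⱼₗ + ∂ⱼ gᵢₗ - ∂ₗ gᵢⱼ)` of the Levi-Civita connection. -/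
def christoffel {n : ℕ} (G : MetricField n) (k i j : Fin n) (y : EuclideanSpace ℝ (Fin n)) : ℝ :=
  (1 / 2) * ∑ l, (G y)⁻¹ k l *
    (pd i (fun z => G z j l) y + pd j (fun z => G z i l) y - pd l (fun z => G z i j) y)

/-- Covariant derivative of a covariant tensor field; the new (derivative) index comes first. -/
def covDeriv {n r : ℕ} (G : MetricField n) (T : TensorField n r) : TensorField n (r + 1) :=
  fun y i => pd (i 0) (fun z => T z (Fin.tail i)) y
    - ∑ s : Fin r, ∑ m : Fin n,
        christoffel G m (i 0) (Fin.tail i s) y * T y (Function.update (Fin.tail i) s m)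

/-- `Rᵃ_{bcd} = ∂_c Γᵃ_{db} - ∂_d Γᵃ_{cb} + Γᵃ_{ce} Γᵉ_{db} - Γᵃ_{de} Γᵉ_{cb}`. -/
def riemannUp {n : ℕ} (G : MetricField n) (y : EuclideanSpace ℝ (Fin n)) (a b c d : Fin n) : ℝ :=
  pd c (christoffel G a d b) y - pd d (christoffel G a c b) y
    + ∑ e, (christoffel G a c e y * christoffel G e d b y
      - christoffel G a d e y * christoffel G e c b y)

/-- The Riemann tensor `R_{abcd}`. -/
def riemann {n : ℕ} (G : MetricField n) (y : EuclideanSpace ℝ (Fin n)) (a b c d : Fin n) : ℝ :=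
  ∑ e, G y a e * riemannUp G y e b c d

/-- The Ricci tensor `R_{bd} = Rᵃ_{bad}`. -/
def ricci {n : ℕ} (G : MetricField n) (y : EuclideanSpace ℝ (Fin n)) (b d : Fin n) : ℝ :=
  ∑ a, riemannUp G y a b a d

/-- The Ricci scalar. -/
def scalarCurv {n : ℕ} (G : MetricField n) (y : EuclideanSpace ℝ (Fin n)) : ℝ :=
  ∑ a, ∑ b, (G y)⁻¹ a b * ricci G y a b

/-- The Weyl tensor `C_{abcd}`, the totally trace-free part of the Riemann tensor (for `n ≥ 3`). -/
def weyl {n : ℕ} (G : MetricField n) (y : EuclideanSpace ℝ (Fin n)) (a b c d : Fin n) : ℝ :=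
  riemann G y a b c d
    - 1 / ((n : ℝ) - 2) *
      (G y a c * ricci G y b d - G y a d * ricci G y b c
        - G y b c * ricci G y a d + G y b d * ricci G y a c)
    + scalarCurv G y / (((n : ℝ) - 1) * ((n : ℝ) - 2)) *
      (G y a c * G y b d - G y a d * G y b c)

/-- The `j`-th covariant derivative `∇ʲ R_{abcd}` of the Riemann tensor. -/
def nablaRiemann {n : ℕ} (G : MetricField n) : (j : ℕ) → TensorField n (4 + j)
  | 0 => fun y i => riemann G y (i 0) (i 1) (i 2) (i 3)
  | j + 1 => covDeriv G (nablaRiemann G j)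

/-! ### Polynomial curvature tensors -/

/-- Formal expressions for the covariant tensors of rank `r` that are constructed polynomially, by
linear combinations, tensor products, permutations of indices and contractions, from the metric and
from the covariant derivatives `∇ʲ Riem` of orders `j ≤ k`. -/
inductive CurvExpr (k : ℕ) : ℕ → Type
  | metric : CurvExpr k 2
  | riem (j : ℕ) (hj : j ≤ k) : CurvExpr k (4 + j)
  | smul {r : ℕ} (c : ℝ) (A : CurvExpr k r) : CurvExpr k r
  | add {r : ℕ} (A B : CurvExpr k r) : CurvExpr k r
  | mul {r s : ℕ} (A : CurvExpr k r) (B : CurvExpr k s) : CurvExpr k (r + s)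
  | perm {r : ℕ} (σ : Equiv.Perm (Fin r)) (A : CurvExpr k r) : CurvExpr k r
  | contract {r : ℕ} (A : CurvExpr k (r + 2)) : CurvExpr k r

/-- The tensor field that an expression denotes for a given metric; `contract` contracts the first
two indices with the inverse metric. -/
def CurvExpr.eval {n k : ℕ} (G : MetricField n) : {r : ℕ} → CurvExpr k r → TensorField n r
  | _, .metric => fun y i => G y (i 0) (i 1)
  | _, .riem j _ => nablaRiemann G j
  | _, .smul c A => fun y i => c * A.eval G y i
  | _, .add A B => fun y i => A.eval G y i + B.eval G y i
  | _, @CurvExpr.mul _ r s A B => fun y i =>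
      A.eval G y (fun p : Fin r => i (Fin.castAdd s p)) *
        B.eval G y (fun p : Fin s => i (Fin.natAdd r p))
  | _, .perm σ A => fun y i => A.eval G y (fun p => i (σ p))
  | _, .contract A => fun y i =>
      ∑ a, ∑ b, (G y)⁻¹ a b * A.eval G y (Fin.cons a (Fin.cons b i))

/-- The divergence `g^{bc} ∇_b T_{ca}` of a tensor field of rank two. -/
def divergence {n : ℕ} (G : MetricField n) (T : TensorField n 2) (y : EuclideanSpace ℝ (Fin n))
    (a : Fin n) : ℝ :=
  ∑ b, ∑ c, (G y)⁻¹ b c * covDeriv G T y ![b, c, a]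

/-! ### Algebra at a point: rank-two contractions, null frames, boost weight

In this section `G` is the matrix of the metric at a point, and `C a b c d` are the components of
a covariant tensor of rank four at that point. -/

/-- `S⁽²⁾_{ab} = C_{acde} C_b^{cde}`. -/
def S2 {n : ℕ} (G : Matrix (Fin n) (Fin n) ℝ) (C : Fin n → Fin n → Fin n → Fin n → ℝ)
    (a b : Fin n) : ℝ :=
  ∑ c, ∑ d, ∑ e, ∑ c', ∑ d', ∑ e',
    G⁻¹ c c' * G⁻¹ d d' * G⁻¹ e e' * (C a c d e * C b c' d' e')

/-- `S⁽³⁾_{ab} = C^{cdef} C_{cdga} C_{ef}^g_b`. -/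
def S3 {n : ℕ} (G : Matrix (Fin n) (Fin n) ℝ) (C : Fin n → Fin n → Fin n → Fin n → ℝ)
    (a b : Fin n) : ℝ :=
  ∑ c, ∑ d, ∑ e, ∑ f, ∑ g, ∑ c', ∑ d', ∑ e', ∑ f', ∑ g',
    G⁻¹ c c' * G⁻¹ d d' * G⁻¹ e e' * G⁻¹ f f' * G⁻¹ g g' *
      (C c' d' e' f' * C c d g a * C e f g' b)

/-- Scalar products of the vectors of a null frame `ℓ, n, m⁽²⁾, …, m⁽ⁿ⁻¹⁾`:
`ℓ·n = 1`, `m⁽ⁱ⁾·m⁽ʲ⁾ = δᵢⱼ`, and all others vanish. -/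
def nullGram {n : ℕ} (a b : Fin n) : ℝ :=
  if ((a : ℕ) = 0 ∧ (b : ℕ) = 1) ∨ ((a : ℕ) = 1 ∧ (b : ℕ) = 0) then 1
  else if a = b ∧ 2 ≤ (a : ℕ) then 1 else 0

/-- `F 0 = ℓ`, `F 1 = n`, `F i = m⁽ⁱ⁾` for `i ≥ 2` (each vector given by its components) is a
null frame. -/
def IsNullFrame {n : ℕ} (G : Matrix (Fin n) (Fin n) ℝ) (F : Fin n → Fin n → ℝ) : Prop :=
  ∀ a b, ∑ i, ∑ j, G i j * F a i * F b j = nullGram a b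

/-- Frame components `C(F_a, F_b, F_c, F_d)`. -/
def frameComp {n : ℕ} (C : Fin n → Fin n → Fin n → Fin n → ℝ) (F : Fin n → Fin n → ℝ)
    (a b c d : Fin n) : ℝ :=
  ∑ i, ∑ j, ∑ k, ∑ l, C i j k l * F a i * F b j * F c k * F d l

/-- Boost weight of a frame index: under the boost `ℓ ↦ λ ℓ`, `n ↦ λ⁻¹ n`, `m⁽ⁱ⁾ ↦ m⁽ⁱ⁾` the frame
vector with index `a` is multiplied by `λ ^ indexWeight a`. -/
def indexWeight {n : ℕ} (a : Fin n) : ℤ :=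
  if (a : ℕ) = 0 then 1 else if (a : ℕ) = 1 then -1 else 0

/-- Boost weight of the frame component with indices `a, b, c, d`. -/
def boostWeight {n : ℕ} (a b c d : Fin n) : ℤ :=
  indexWeight a + indexWeight b + indexWeight c + indexWeight d

/-- The boost order of `C` with respect to the frame `F` is at most `w`: all components of boost
weight greater than `w` vanish. -/
def BoostOrderLE {n : ℕ} (C : Fin n → Fin n → Fin n → Fin n → ℝ) (F : Fin n → Fin n → ℝ)
    (w : ℤ) : Prop :=
  ∀ a b c d, w < boostWeight a b c d → frameComp C F a b c d = 0

/-- Genuine type II (type D included; types III, N and O excluded): the least boost order that `C`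
attains in a null frame is exactly `0`. -/
def IsGenuineTypeII {n : ℕ} (G : Matrix (Fin n) (Fin n) ℝ)
    (C : Fin n → Fin n → Fin n → Fin n → ℝ) : Prop :=
  (∃ F, IsNullFrame G F ∧ BoostOrderLE C F 0) ∧
    ¬ ∃ F, IsNullFrame G F ∧ BoostOrderLE C F (-1)

/-! ### Lorentzian manifolds -/

/-- Components `B(∂ᵢ, ∂ⱼ)`, in the coordinates of a chart `e`, of a field `B` of bilinear forms on
the tangent spaces of an `n`-manifold. Only the values on `e.target` are meaningful. -/
def chartComponents {n : ℕ} {M : Type*} [TopologicalSpace M]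
    [ChartedSpace (EuclideanSpace ℝ (Fin n)) M]
    (B : (x : M) → TangentSpace (𝓡 n) x →ₗ[ℝ] TangentSpace (𝓡 n) x →ₗ[ℝ] ℝ)
    (e : OpenPartialHomeomorph M (EuclideanSpace ℝ (Fin n))) : MetricField n :=
  fun y => Matrix.of fun i j =>
    B (e.symm y)
      (mfderiv (𝓡 n) (𝓡 n) e.symm y (EuclideanSpace.single i (1 : ℝ) : EuclideanSpace ℝ (Fin n)))
      (mfderiv (𝓡 n) (𝓡 n) e.symm y (EuclideanSpace.single j (1 : ℝ) : EuclideanSpace ℝ (Fin n)))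

/-- A smooth metric of Lorentzian signature `(-, +, …, +)` on an `n`-manifold. -/
structure LorentzMetric (n : ℕ) (M : Type*) [TopologicalSpace M]
    [ChartedSpace (EuclideanSpace ℝ (Fin n)) M] where
  /-- the scalar product on each tangent space -/
  form : (x : M) → TangentSpace (𝓡 n) x →ₗ[ℝ] TangentSpace (𝓡 n) x →ₗ[ℝ] ℝ
  symm : ∀ x v w, form x v w = form x w v
  lorentzian : ∀ x, ∃ b : Module.Basis (Fin n) ℝ (TangentSpace (𝓡 n) x), ∀ i j,
    form x (b i) (b j) = if i = j then (if (i : ℕ) = 0 then -1 else 1) else 0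
  smooth : ∀ e ∈ atlas (EuclideanSpace ℝ (Fin n)) M, ∀ i j,
    ContDiffOn ℝ ∞ (fun y => chartComponents form e y i j) e.target

namespace LorentzMetric

variable {n : ℕ} {M : Type*} [TopologicalSpace M] [ChartedSpace (EuclideanSpace ℝ (Fin n)) M]

/-- Components of the metric in a chart. -/
def comp (g : LorentzMetric n M) (e : OpenPartialHomeomorph M (EuclideanSpace ℝ (Fin n))) :
    MetricField n :=
  chartComponents g.form e

/-- The tensor denoted by the expression `T` is symmetric. -/
def IsSymmetric (g : LorentzMetric n M) {k : ℕ} (T : CurvExpr k 2) : Prop :=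
  ∀ e ∈ atlas (EuclideanSpace ℝ (Fin n)) M, ∀ y ∈ e.target, ∀ a b,
    T.eval (g.comp e) y ![a, b] = T.eval (g.comp e) y ![b, a]

/-- The tensor denoted by the expression `T` is conserved. -/
def IsConserved (g : LorentzMetric n M) {k : ℕ} (T : CurvExpr k 2) : Prop :=
  ∀ e ∈ atlas (EuclideanSpace ℝ (Fin n)) M, ∀ y ∈ e.target, ∀ a,
    divergence (g.comp e) (T.eval (g.comp e)) y a = 0

/-- The tensor denoted by the expression `T` is a multiple of the metric. For a conserved tensor
the factor is automatically locally constant. -/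
def IsMultipleOfMetric (g : LorentzMetric n M) {k : ℕ} (T : CurvExpr k 2) : Prop :=
  ∃ c : M → ℝ, ∀ e ∈ atlas (EuclideanSpace ℝ (Fin n)) M, ∀ y ∈ e.target, ∀ a b,
    T.eval (g.comp e) y ![a, b] = c (e.symm y) * g.comp e y a b

/-- `k`-universal: all conserved symmetric tensors of rank two constructed from the metric, the
Riemann tensor and its covariant derivatives up to order `k` are multiples of the metric. -/
def IsKUniversal (g : LorentzMetric n M) (k : ℕ) : Prop :=
  ∀ T : CurvExpr k 2, g.IsSymmetric T → g.IsConserved T → g.IsMultipleOfMetric T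

/-- Universal: `k`-universal for all `k`. -/
def IsUniversal (g : LorentzMetric n M) : Prop :=
  ∀ k, g.IsKUniversal k

/-- The matrix of the metric at `x`, in the preferred chart at `x`. -/
def metricAt (g : LorentzMetric n M) (x : M) : Matrix (Fin n) (Fin n) ℝ :=
  g.comp (chartAt (EuclideanSpace ℝ (Fin n)) x) (chartAt (EuclideanSpace ℝ (Fin n)) x x)

/-- The components of the Weyl tensor at `x`, in the preferred chart at `x`. -/
def weylAt (g : LorentzMetric n M) (x : M) : Fin n → Fin n → Fin n → Fin n → ℝ :=
  weyl (g.comp (chartAt (EuclideanSpace ℝ (Fin n)) x)) (chartAt (EuclideanSpace ℝ (Fin n)) x x)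

/-- The spacetime is of genuine type II (type D included): its Weyl tensor is so at every point. -/
def IsGenuineTypeIISpacetime (g : LorentzMetric n M) : Prop :=
  ∀ x, IsGenuineTypeII (g.metricAt x) (g.weylAt x)

end LorentzMetric

end Lorentz

end

/-!
Why there are no universal spacetimes of genuine type II in dimension five.

*Pointwise algebra.* In a null frame in which the components of positive boost weight vanish, those
of boost weight zero are determined by the `3 × 3` matrix `C (0, i, 1, j)`. The condition
`S⁽²⁾ = K g`, restricted to boost weight zero, forces this matrix, after a rotation of the frame, to
be `s` times a fixed one and `K = 0` (`exists_isNormalized`). So the leading part of the Weyl tensor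
is a multiple `s` of a single tensor, `model`. On it `S⁽³⁾` has vanishing component `(4, 4)` and
component `(0, 1)` a non-zero multiple of `s ^ 3`, so `S⁽³⁾ = K' g` gives `s = 0`
(`weight_zero_of_S2_S3`). This is the third claim.

*Conserved tensors.* The Einstein tensor is conserved, so a `0`-universal metric is Einstein. Then
the Riemann tensor is divergence free, and `R_{acde} R_b^{cde} - g_{ab} R_{cdef} R^{cdef} / 4` is
conserved by the Bianchi identity; hence `S⁽²⁾` of the Riemann tensor, and so that of the Weyl
tensor, is a multiple of the metric. By the algebra above, `S⁽²⁾ = 0` for the Weyl tensor if it has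
type II (`IsEinsteinOn.S2_weyl_eq_zero`).

*Differential consequences.* That `S⁽³⁾` is a multiple of the metric is not needed for the first two
claims; instead the equation `S⁽²⁾ = 0` is differentiated twice. The null directions of type II solve
a system of equations whose linearization at a solution is injective. They need not be chosen
smoothly, but by compactness there are finitely many over a point `x`, and for one of them the
linearized system is solvable in every direction of the base (`exists_tangent_solution`). In
a frame adapted to that null direction, this prescribes the part of highest boost weight of `∇ C` in
terms of `C` (`IsEinsteinOn.covDeriv_of_linearized`). Together with the Bianchi identity and
`∇ S⁽²⁾ = 0` it implies that the contraction of `∇ C` with `∇ C` has vanishing component `(2, 2)`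
(`IsFirstJet.sum_polar_eq_zero`). The same component of `□ S⁽²⁾ = 0` then says that
`C_{2bcd} (□ C)_2^{bcd}` vanishes. The Ricci identity turns `□ C` into an expression quadratic in
the curvature, and on the model this component is a non-zero multiple of `s ^ 3`. So `s = 0`
(`IsSecondJet.eq_zero`), and the Weyl tensor is not of genuine type II at `x`
(`IsEinsteinOn.not_isGenuineTypeII`).
-/

noncomputable section

namespace Lorentz

/-! ### Partial derivatives and smooth matrix fields -/

section Calculus

variable {n : ℕ} {f h : EuclideanSpace ℝ (Fin n) → ℝ} {y : EuclideanSpace ℝ (Fin n)}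
  {U : Set (EuclideanSpace ℝ (Fin n))}

lemma pd_add (i : Fin n) (hf : DifferentiableAt ℝ f y) (hh : DifferentiableAt ℝ h y) :
    pd i (fun z => f z + h z) y = pd i f y + pd i h y := by
  unfold pd; rw [fderiv_fun_add hf hh]; rfl

lemma pd_sub (i : Fin n) (hf : DifferentiableAt ℝ f y) (hh : DifferentiableAt ℝ h y) :
    pd i (fun z => f z - h z) y = pd i f y - pd i h y := by
  unfold pd; rw [fderiv_fun_sub hf hh]; rfl

lemma pd_mul (i : Fin n) (hf : DifferentiableAt ℝ f y) (hh : DifferentiableAt ℝ h y) :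
    pd i (fun z => f z * h z) y = pd i f y * h y + f y * pd i h y := by
  unfold pd; rw [fderiv_fun_mul hf hh]; simp; ring

lemma pd_const (i : Fin n) (c : ℝ) : pd i (fun _ => c) y = 0 := by
  unfold pd; simp

lemma pd_const_mul (i : Fin n) (c : ℝ) (hf : DifferentiableAt ℝ f y) :
    pd i (fun z => c * f z) y = c * pd i f y := by
  unfold pd; rw [fderiv_const_mul hf]; rfl

lemma pd_sum {ι : Type*} (s : Finset ι) (i : Fin n) (F : ι → EuclideanSpace ℝ (Fin n) → ℝ)
    (hF : ∀ j ∈ s, DifferentiableAt ℝ (F j) y) :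
    pd i (fun z => ∑ j ∈ s, F j z) y = ∑ j ∈ s, pd i (F j) y := by
  unfold pd; rw [fderiv_fun_sum hF]; simp

lemma pd_congr (i : Fin n) (hfh : f =ᶠ[nhds y] h) : pd i f y = pd i h y := by
  unfold pd; rw [hfh.fderiv_eq]

lemma pd_congr_on (i : Fin n) (hU : IsOpen U) (hy : y ∈ U) (hfh : ∀ z ∈ U, f z = h z) :
    pd i f y = pd i h y :=
  pd_congr i (Filter.eventuallyEq_of_mem (hU.mem_nhds hy) hfh)

lemma diffAt_of_smooth (hU : IsOpen U) (hf : ContDiffOn ℝ ∞ f U) (hy : y ∈ U) :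
    DifferentiableAt ℝ f y :=
  ((hf.contDiffAt (hU.mem_nhds hy)).differentiableAt (by simp))

lemma smooth_pd (i : Fin n) (hU : IsOpen U) (hf : ContDiffOn ℝ ∞ f U) :
    ContDiffOn ℝ ∞ (pd i f) U := by
  have := hf.fderiv_of_isOpen hU (m := ∞) (by simp)
  exact this.clm_apply contDiffOn_const

lemma pd_comm (i j : Fin n) (hU : IsOpen U) (hf : ContDiffOn ℝ ∞ f U) (hy : y ∈ U) :
    pd i (pd j f) y = pd j (pd i f) y := by
  have hd : DifferentiableAt ℝ (fderiv ℝ f) y := by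
    have := hf.fderiv_of_isOpen hU (m := ∞) (by simp)
    exact (this.contDiffAt (hU.mem_nhds hy)).differentiableAt (by simp)
  have key : ∀ i j : Fin n, pd i (pd j f) y
      = fderiv ℝ (fderiv ℝ f) y (EuclideanSpace.single i 1) (EuclideanSpace.single j 1) := by
    intro i j
    unfold pd
    rw [fderiv_clm_apply hd (differentiableAt_const _)]
    simp
  rw [key, key]
  have hs : IsSymmSndFDerivAt ℝ f y :=
    (hf.contDiffAt (hU.mem_nhds hy)).isSymmSndFDerivAt (by
      simp only [minSmoothness_of_isRCLikeNormedField]; exact WithTop.coe_le_coe.2 (le_top : (2 : ℕ∞) ≤ ⊤))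
  exact hs.eq _ _

/-- All entries of the matrix field are smooth on `U`. -/
def SmoothMat {m k : Type*} (A : EuclideanSpace ℝ (Fin n) → Matrix m k ℝ)
    (U : Set (EuclideanSpace ℝ (Fin n))) : Prop :=
  ∀ a b, ContDiffOn ℝ ∞ (fun y => A y a b) U

/-- Entrywise partial derivative of a matrix field. -/
def pdM {m k : Type*} (i : Fin n) (A : EuclideanSpace ℝ (Fin n) → Matrix m k ℝ)
    (y : EuclideanSpace ℝ (Fin n)) : Matrix m k ℝ :=
  Matrix.of fun a b => pd i (fun z => A z a b) y

variable {A B : EuclideanSpace ℝ (Fin n) → Matrix (Fin n) (Fin n) ℝ}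

lemma SmoothMat.add (hA : SmoothMat A U) (hB : SmoothMat B U) :
    SmoothMat (fun y => A y + B y) U := fun a b => (hA a b).add (hB a b)

lemma SmoothMat.sub (hA : SmoothMat A U) (hB : SmoothMat B U) :
    SmoothMat (fun y => A y - B y) U := fun a b => (hA a b).sub (hB a b)

lemma SmoothMat.mul (hA : SmoothMat A U) (hB : SmoothMat B U) :
    SmoothMat (fun y => A y * B y) U := by
  intro a b
  simp only [Matrix.mul_apply]
  exact ContDiffOn.sum fun j _ => (hA a j).mul (hB j b)

lemma SmoothMat.transpose (hA : SmoothMat A U) : SmoothMat (fun y => (A y).transpose) U :=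
  fun a b => hA b a

lemma SmoothMat.pdM (hU : IsOpen U) (i : Fin n) (hA : SmoothMat A U) : SmoothMat (pdM i A) U :=
  fun a b => smooth_pd i hU (hA a b)

lemma SmoothMat.det (hA : SmoothMat A U) : ContDiffOn ℝ ∞ (fun y => (A y).det) U := by
  simp only [Matrix.det_apply]
  exact ContDiffOn.sum fun σ _ => (contDiffOn_prod fun j _ => hA _ _).const_smul _

lemma SmoothMat.inv (hA : SmoothMat A U) (hdet : ∀ y ∈ U, IsUnit (A y).det) :
    SmoothMat (fun y => (A y)⁻¹) U := by
  intro a b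
  have h1 : ContDiffOn ℝ ∞ (fun y => (A y).adjugate a b) U := by
    simp only [Matrix.adjugate_apply]
    refine SmoothMat.det (A := fun y => (A y).updateRow b (Pi.single a 1)) ?_
    intro c d
    by_cases hc : c = b
    · subst hc; simpa using contDiffOn_const
    · simpa [Matrix.updateRow_apply, hc] using hA c d
  have h2 : ContDiffOn ℝ ∞ (fun y => ((A y).det)⁻¹ * (A y).adjugate a b) U :=
    (hA.det.inv fun y hy => (hdet y hy).ne_zero).mul h1
  refine h2.congr fun y _ => ?_
  simp [Matrix.inv_def]

lemma pdM_add (i : Fin n) (hU : IsOpen U) (hA : SmoothMat A U) (hB : SmoothMat B U) (hy : y ∈ U) :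
    pdM i (fun z => A z + B z) y = pdM i A y + pdM i B y := by
  ext a b
  exact pd_add i (diffAt_of_smooth hU (hA a b) hy) (diffAt_of_smooth hU (hB a b) hy)

lemma pdM_sub (i : Fin n) (hU : IsOpen U) (hA : SmoothMat A U) (hB : SmoothMat B U) (hy : y ∈ U) :
    pdM i (fun z => A z - B z) y = pdM i A y - pdM i B y := by
  ext a b
  exact pd_sub i (diffAt_of_smooth hU (hA a b) hy) (diffAt_of_smooth hU (hB a b) hy)

lemma pdM_mul (i : Fin n) (hU : IsOpen U) (hA : SmoothMat A U) (hB : SmoothMat B U) (hy : y ∈ U) :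
    pdM i (fun z => A z * B z) y = pdM i A y * B y + A y * pdM i B y := by
  ext a b
  simp only [pdM, Matrix.mul_apply, Matrix.of_apply, Matrix.add_apply]
  rw [pd_sum, ← Finset.sum_add_distrib]
  · refine Finset.sum_congr rfl fun j _ => ?_
    exact pd_mul i (diffAt_of_smooth hU (hA a j) hy) (diffAt_of_smooth hU (hB j b) hy)
  · intro j _
    exact (diffAt_of_smooth hU (hA a j) hy).mul (diffAt_of_smooth hU (hB j b) hy)

lemma pdM_transpose (i : Fin n) : pdM i (fun z => (A z).transpose) y = (pdM i A y).transpose := rfl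

lemma pdM_congr_on (i : Fin n) (hU : IsOpen U) (hy : y ∈ U) (h : ∀ z ∈ U, A z = B z) :
    pdM i A y = pdM i B y := by
  ext a b
  exact pd_congr_on i hU hy fun z hz => by rw [h z hz]

lemma pdM_comm (i j : Fin n) (hU : IsOpen U) (hA : SmoothMat A U) (hy : y ∈ U) :
    pdM i (pdM j A) y = pdM j (pdM i A) y := by
  ext a b
  exact pd_comm i j hU (hA a b) hy

end Calculus

/-! ### The Levi-Civita connection -/

section LeviCivita

open Matrix

variable {n : ℕ}

/-- `G` is a smooth field of non-degenerate symmetric matrices on the open set `U`. -/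
structure IsMetricOn (G : MetricField n) (U : Set (EuclideanSpace ℝ (Fin n))) : Prop where
  isOpen : IsOpen U
  smooth : SmoothMat G U
  symm : ∀ y ∈ U, (G y)ᵀ = G y
  det : ∀ y ∈ U, IsUnit (G y).det

/-- The connection matrices `(Γᵢ)ᵃ_b = Γᵃ_{ib}`. -/
def conn (G : MetricField n) (i : Fin n) (y : EuclideanSpace ℝ (Fin n)) :
    Matrix (Fin n) (Fin n) ℝ :=
  of fun a b => christoffel G a i b y

/-- Christoffel symbols of the first kind, `(l, j) ↦ Γ_{l,ij}`. -/
def connLow (G : MetricField n) (i : Fin n) (y : EuclideanSpace ℝ (Fin n)) :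
    Matrix (Fin n) (Fin n) ℝ :=
  of fun l j => (1 / 2) * (pd i (fun z => G z j l) y + pd j (fun z => G z i l) y
    - pd l (fun z => G z i j) y)

/-- The curvature matrices `F_{cd} = ∂_c Γ_d - ∂_d Γ_c + Γ_c Γ_d - Γ_d Γ_c` of the connection. -/
def curv (G : MetricField n) (c d : Fin n) (y : EuclideanSpace ℝ (Fin n)) :
    Matrix (Fin n) (Fin n) ℝ :=
  pdM c (conn G d) y - pdM d (conn G c) y + (conn G c y * conn G d y - conn G d y * conn G c y)

lemma conn_eq_inv_mul (G : MetricField n) (i : Fin n) (y : EuclideanSpace ℝ (Fin n)) :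
    conn G i y = (G y)⁻¹ * connLow G i y := by
  ext a b
  simp only [conn, connLow, christoffel, Matrix.mul_apply, of_apply, Finset.mul_sum]
  exact Finset.sum_congr rfl fun l _ => by ring

lemma riemannUp_eq_curv (G : MetricField n) (y : EuclideanSpace ℝ (Fin n)) (a b c d : Fin n) :
    riemannUp G y a b c d = curv G c d y a b := by
  simp only [riemannUp, curv, Matrix.add_apply, Matrix.sub_apply, Matrix.mul_apply,
    Finset.sum_sub_distrib]
  rfl

lemma riemann_eq_mul_curv (G : MetricField n) (y : EuclideanSpace ℝ (Fin n)) (a b c d : Fin n) :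
    riemann G y a b c d = (G y * curv G c d y) a b := by
  simp only [riemann, riemannUp_eq_curv, Matrix.mul_apply]

lemma curv_antisymm (G : MetricField n) (c d : Fin n) (y : EuclideanSpace ℝ (Fin n)) :
    curv G d c y = - curv G c d y := by
  unfold curv; abel

variable {G : MetricField n} {U : Set (EuclideanSpace ℝ (Fin n))} {y : EuclideanSpace ℝ (Fin n)}

namespace IsMetricOn

lemma apply_symm (hG : IsMetricOn G U) (hy : y ∈ U) (a b : Fin n) : G y a b = G y b a := by
  conv_lhs => rw [← hG.symm y hy]
  rfl

lemma pd_symm (hG : IsMetricOn G U) (hy : y ∈ U) (k a b : Fin n) :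
    pd k (fun z => G z a b) y = pd k (fun z => G z b a) y :=
  pd_congr_on k hG.isOpen hy fun _ hz => hG.apply_symm hz a b

lemma mul_conn (hG : IsMetricOn G U) (hy : y ∈ U) (i : Fin n) :
    G y * conn G i y = connLow G i y := by
  rw [conn_eq_inv_mul, Matrix.mul_nonsing_inv_cancel_left _ _ (hG.det y hy)]

lemma conn_symm (hG : IsMetricOn G U) (hy : y ∈ U) (i j a : Fin n) :
    conn G i y a j = conn G j y a i := by
  simp only [conn, of_apply, christoffel]
  congr 1
  refine Finset.sum_congr rfl fun l _ => ?_
  rw [hG.pd_symm hy l i j]; ring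

/-- The Levi-Civita connection is metric. -/
lemma pdM_eq (hG : IsMetricOn G U) (hy : y ∈ U) (k : Fin n) :
    pdM k G y = (conn G k y)ᵀ * G y + G y * conn G k y := by
  have h1 : (conn G k y)ᵀ * G y = (G y * conn G k y)ᵀ := by
    rw [Matrix.transpose_mul, hG.symm y hy]
  rw [h1, hG.mul_conn hy]
  ext a b
  simp only [pdM, connLow, of_apply, Matrix.add_apply, Matrix.transpose_apply]
  rw [hG.pd_symm hy k b a]
  ring

/-- The Levi-Civita connection is the only torsion-free metric connection. -/
lemma conn_unique (hG : IsMetricOn G U) (hy : y ∈ U) (Γ : Fin n → Matrix (Fin n) (Fin n) ℝ)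
    (hsymm : ∀ i j a, Γ i a j = Γ j a i) (hmet : ∀ k, pdM k G y = (Γ k)ᵀ * G y + G y * Γ k)
    (i : Fin n) : conn G i y = Γ i := by
  have hlow : G y * Γ i = connLow G i y := by
    have hg : ∀ k a b, pd k (fun z => G z a b) y = (G y * Γ k) b a + (G y * Γ k) a b := by
      intro k a b
      have h1 : (Γ k)ᵀ * G y = (G y * Γ k)ᵀ := by
        rw [Matrix.transpose_mul, hG.symm y hy]
      have := congrFun (congrFun (hmet k) a) b
      rw [h1] at this
      simpa only [pdM, of_apply, Matrix.add_apply, Matrix.transpose_apply] using this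
    have hs : ∀ k a b, (G y * Γ k) a b = (G y * Γ b) a k := by
      intro k a b
      simp only [Matrix.mul_apply]
      exact Finset.sum_congr rfl fun m _ => by rw [hsymm k b m]
    ext a b
    simp only [connLow, of_apply, hg]
    rw [hs a b i, hs a i b, hs i b a, hs i a b]
    ring
  rw [conn_eq_inv_mul, ← hlow, Matrix.nonsing_inv_mul_cancel_left _ _ (hG.det y hy)]

lemma smooth_inv (hG : IsMetricOn G U) : SmoothMat (fun y => (G y)⁻¹) U := hG.smooth.inv hG.det

lemma smooth_conn (hG : IsMetricOn G U) (i : Fin n) : SmoothMat (conn G i) U := by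
  have h : SmoothMat (connLow G i) U := by
    intro a b
    exact contDiffOn_const.mul (((smooth_pd _ hG.isOpen (hG.smooth _ _)).add
      (smooth_pd _ hG.isOpen (hG.smooth _ _))).sub (smooth_pd _ hG.isOpen (hG.smooth _ _)))
  have h2 := hG.smooth_inv.mul h
  intro a b
  refine (h2 a b).congr fun y _ => ?_
  rw [conn_eq_inv_mul]

lemma smooth_curv (hG : IsMetricOn G U) (c d : Fin n) : SmoothMat (curv G c d) U :=
  (((hG.smooth_conn d).pdM hG.isOpen c).sub ((hG.smooth_conn c).pdM hG.isOpen d)).add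
    (((hG.smooth_conn c).mul (hG.smooth_conn d)).sub ((hG.smooth_conn d).mul (hG.smooth_conn c)))

/-! ### Symmetries of the curvature -/

lemma curv_skew (hG : IsMetricOn G U) (hy : y ∈ U) (c d : Fin n) :
    (curv G c d y)ᵀ * G y + G y * curv G c d y = 0 := by
  have hU := hG.isOpen
  have key : ∀ c d, pdM c (pdM d G) y = (pdM c (conn G d) y)ᵀ * G y
      + (conn G d y)ᵀ * ((conn G c y)ᵀ * G y + G y * conn G c y)
      + (((conn G c y)ᵀ * G y + G y * conn G c y) * conn G d y + G y * pdM c (conn G d) y) := by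
    intro c d
    have hs := hG.smooth_conn d
    rw [pdM_congr_on c hU hy (fun z hz => hG.pdM_eq hz d),
      pdM_add c hU (hs.transpose.mul hG.smooth) (hG.smooth.mul hs) hy,
      pdM_mul c hU hs.transpose hG.smooth hy, pdM_mul c hU hG.smooth hs hy, hG.pdM_eq hy c]
    rfl
  have h := pdM_comm c d hU hG.smooth hy
  rw [key, key, ← sub_eq_zero] at h
  rw [← h]
  simp only [curv, Matrix.transpose_add, Matrix.transpose_sub, Matrix.transpose_mul]
  noncomm_ring

lemma riemann_antisymm_left (hG : IsMetricOn G U) (hy : y ∈ U) (a b c d : Fin n) :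
    riemann G y b a c d = - riemann G y a b c d := by
  have h1 : (curv G c d y)ᵀ * G y = (G y * curv G c d y)ᵀ := by
    rw [Matrix.transpose_mul, hG.symm y hy]
  have := congrFun (congrFun (hG.curv_skew hy c d) a) b
  rw [h1] at this
  simp only [Matrix.add_apply, Matrix.transpose_apply, Matrix.zero_apply] at this
  rw [riemann_eq_mul_curv, riemann_eq_mul_curv]
  linarith

end IsMetricOn

lemma riemann_antisymm_right (G : MetricField n) (y : EuclideanSpace ℝ (Fin n)) (a b c d : Fin n) :
    riemann G y a b d c = - riemann G y a b c d := by
  rw [riemann_eq_mul_curv, riemann_eq_mul_curv, curv_antisymm, Matrix.mul_neg, Matrix.neg_apply]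

namespace IsMetricOn

lemma pd_conn_symm (hG : IsMetricOn G U) (hy : y ∈ U) (k i j a : Fin n) :
    pdM k (conn G i) y a j = pdM k (conn G j) y a i :=
  pd_congr_on k hG.isOpen hy fun _ hz => hG.conn_symm hz i j a

lemma curv_cyclic (hG : IsMetricOn G U) (hy : y ∈ U) (a b c d : Fin n) :
    curv G c d y a b + curv G d b y a c + curv G b c y a d = 0 := by
  simp only [curv, Matrix.add_apply, Matrix.sub_apply, Matrix.mul_apply]
  rw [hG.pd_conn_symm hy c d b, hG.pd_conn_symm hy d c b, hG.pd_conn_symm hy b d c]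
  have e : ∀ p q r, ∑ j, conn G p y a j * conn G q y j r = ∑ j, conn G p y a j * conn G r y j q :=
    fun p q r => Finset.sum_congr rfl fun j _ => by rw [hG.conn_symm hy q r j]
  rw [e c d b, e d c b, e b c d]
  ring

/-- The first Bianchi identity. -/
lemma riemann_cyclic (hG : IsMetricOn G U) (hy : y ∈ U) (a b c d : Fin n) :
    riemann G y a b c d + riemann G y a c d b + riemann G y a d b c = 0 := by
  simp only [riemann, riemannUp_eq_curv, ← Finset.sum_add_distrib, ← mul_add]
  refine Finset.sum_eq_zero fun e _ => ?_
  rw [hG.curv_cyclic hy e b c d, mul_zero]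

lemma riemann_pair_symm (hG : IsMetricOn G U) (hy : y ∈ U) (a b c d : Fin n) :
    riemann G y a b c d = riemann G y c d a b := by
  have A := hG.riemann_antisymm_left hy
  have B := riemann_antisymm_right G y
  have C := hG.riemann_cyclic hy
  linarith [C a b c d, C b c d a, C c d a b, C d a b c, A a b c d, A a c d b, A a d b c, A b c d a,
    A b d a c, A c d a b, B a b c d, B c d a b, B b d a c, B a c d b, B b c d a, B a d b c,
    B c a b d, B d b c a, B d c a b, B d a b c, A a b d c, A c d b a, A a c b d, A b d c a,
    A b c a d, A a d c b]

end IsMetricOn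

end LeviCivita

/-! ### Covariant derivatives of tensors of arbitrary rank -/

section TensorCalculus

open Matrix

variable {n r : ℕ}

/-- The derivation of the tensor algebra induced by the matrix `M`: the sum over all slots of the
contraction of that slot with `M`. -/
def slotAct (M : Matrix (Fin n) (Fin n) ℝ) (T : (Fin r → Fin n) → ℝ) (i : Fin r → Fin n) : ℝ :=
  ∑ s, ∑ m, M m (i s) * T (Function.update i s m)

/-- Contraction of the first two slots with the matrix `h`. -/
def contr (h : Matrix (Fin n) (Fin n) ℝ) (A : (Fin (r + 2) → Fin n) → ℝ) (i : Fin r → Fin n) : ℝ :=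
  ∑ a, ∑ b, h a b * A (Fin.cons a (Fin.cons b i))

/-- All components of the tensor field are smooth on `U`. -/
def SmoothTen (T : TensorField n r) (U : Set (EuclideanSpace ℝ (Fin n))) : Prop :=
  ∀ i, ContDiffOn ℝ ∞ (fun y => T y i) U

variable {G : MetricField n} {U : Set (EuclideanSpace ℝ (Fin n))} {y : EuclideanSpace ℝ (Fin n)}

lemma covDeriv_cons (G : MetricField n) (T : TensorField n r) (y : EuclideanSpace ℝ (Fin n))
    (e : Fin n) (i : Fin r → Fin n) :
    covDeriv G T y (Fin.cons e i) = pd e (fun z => T z i) y - slotAct (conn G e y) (T y) i := by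
  simp [covDeriv, slotAct, conn]

lemma slotAct_add (M N : Matrix (Fin n) (Fin n) ℝ) (T : (Fin r → Fin n) → ℝ) (i : Fin r → Fin n) :
    slotAct (M + N) T i = slotAct M T i + slotAct N T i := by
  simp [slotAct, add_mul, Finset.sum_add_distrib]

lemma slotAct_neg (M : Matrix (Fin n) (Fin n) ℝ) (T : (Fin r → Fin n) → ℝ) (i : Fin r → Fin n) :
    slotAct (-M) T i = - slotAct M T i := by
  simp [slotAct]

lemma slotAct_sub (M N : Matrix (Fin n) (Fin n) ℝ) (T : (Fin r → Fin n) → ℝ) (i : Fin r → Fin n) :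
    slotAct (M - N) T i = slotAct M T i - slotAct N T i := by
  rw [sub_eq_add_neg, slotAct_add, slotAct_neg, sub_eq_add_neg]

lemma slotAct_sub_right (M : Matrix (Fin n) (Fin n) ℝ) (T S : (Fin r → Fin n) → ℝ)
    (i : Fin r → Fin n) :
    slotAct M (fun j => T j - S j) i = slotAct M T i - slotAct M S i := by
  simp [slotAct, mul_sub, Finset.sum_sub_distrib]

lemma slotAct_cons (M : Matrix (Fin n) (Fin n) ℝ) (T : (Fin (r + 1) → Fin n) → ℝ) (e : Fin n)
    (i : Fin r → Fin n) :
    slotAct M T (Fin.cons e i) = (∑ m, M m e * T (Fin.cons m i))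
      + slotAct M (fun j => T (Fin.cons e j)) i := by
  simp [slotAct, Fin.sum_univ_succ, Fin.cons_update]

/-- The commutator of the derivations induced by two matrices. -/
lemma slotAct_comm (M N : Matrix (Fin n) (Fin n) ℝ) (T : (Fin r → Fin n) → ℝ) (i : Fin r → Fin n) :
    slotAct M (slotAct N T) i - slotAct N (slotAct M T) i = slotAct (N * M - M * N) T i := by
  have expand : ∀ M N : Matrix (Fin n) (Fin n) ℝ, slotAct M (slotAct N T) i
      = ∑ s, ∑ t, ∑ m, ∑ k, M m (i s) * (N k (Function.update i s m t)
        * T (Function.update (Function.update i s m) t k)) := by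
    intro M N
    simp only [slotAct, Finset.mul_sum]
    exact Finset.sum_congr rfl fun s _ => Finset.sum_comm
  have diag : ∀ (M N : Matrix (Fin n) (Fin n) ℝ) (s : Fin r),
      ∑ m, ∑ k, M m (i s) * (N k (Function.update i s m s)
        * T (Function.update (Function.update i s m) s k))
        = ∑ k, (N * M) k (i s) * T (Function.update i s k) := by
    intro M N s
    rw [Finset.sum_comm]
    simp only [Function.update_self, Function.update_idem, Matrix.mul_apply, Finset.sum_mul]
    exact Finset.sum_congr rfl fun k _ => Finset.sum_congr rfl fun m _ => by ring
  rw [expand, expand N M, Finset.sum_comm (f := fun s t => ∑ m, ∑ k, N m (i s) *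
    (M k (Function.update i s m t) * T (Function.update (Function.update i s m) t k))),
    ← Finset.sum_sub_distrib, slotAct_sub, slotAct, slotAct, ← Finset.sum_sub_distrib]
  refine Finset.sum_congr rfl fun s _ => ?_
  rw [← Finset.sum_sub_distrib, Finset.sum_eq_single s, diag, diag]
  · -- contributions of two different slots are symmetric in the two matrices
    intro t _ hts
    rw [sub_eq_zero, Finset.sum_comm]
    refine Finset.sum_congr rfl fun k _ => Finset.sum_congr rfl fun m _ => ?_
    rw [Function.update_of_ne hts, Function.update_of_ne (Ne.symm hts), Function.update_comm hts]
    ring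
  · simp

lemma contr_slotAct (h M : Matrix (Fin n) (Fin n) ℝ) (A : (Fin (r + 2) → Fin n) → ℝ)
    (i : Fin r → Fin n) :
    contr h (slotAct M A) i = slotAct M (contr h A) i + contr (M * h + h * Mᵀ) A i := by
  have h1 : contr h (slotAct M A) i
      = (∑ a, ∑ b, h a b * ∑ m, M m a * A (Fin.cons m (Fin.cons b i)))
        + ((∑ a, ∑ b, h a b * ∑ m, M m b * A (Fin.cons a (Fin.cons m i)))
          + ∑ a, ∑ b, h a b * slotAct M (fun j => A (Fin.cons a (Fin.cons b j))) i) := by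
    simp only [contr, slotAct_cons, mul_add, Finset.sum_add_distrib]
  have h2 : slotAct M (contr h A) i
      = ∑ a, ∑ b, h a b * slotAct M (fun j => A (Fin.cons a (Fin.cons b j))) i := by
    simp only [slotAct, contr, Finset.mul_sum]
    rw [Finset.sum_congr rfl fun s _ => Finset.sum_comm, Finset.sum_comm]
    refine Finset.sum_congr rfl fun a _ => ?_
    rw [Finset.sum_congr rfl fun s _ => Finset.sum_comm, Finset.sum_comm]
    refine Finset.sum_congr rfl fun b _ => Finset.sum_congr rfl fun s _ =>
      Finset.sum_congr rfl fun m _ => by ring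
  have h3 : contr (M * h) A i = ∑ a, ∑ b, h a b * ∑ m, M m a * A (Fin.cons m (Fin.cons b i)) := by
    simp only [contr, Matrix.mul_apply, Finset.sum_mul, Finset.mul_sum]
    rw [Finset.sum_congr rfl fun a _ => Finset.sum_comm, Finset.sum_comm]
    refine Finset.sum_congr rfl fun a _ => ?_
    rw [Finset.sum_comm]
    exact Finset.sum_congr rfl fun b _ => Finset.sum_congr rfl fun m _ => by ring
  have h4 : contr (h * Mᵀ) A i
      = ∑ a, ∑ b, h a b * ∑ m, M m b * A (Fin.cons a (Fin.cons m i)) := by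
    simp only [contr, Matrix.mul_apply, Finset.sum_mul, Finset.mul_sum]
    refine Finset.sum_congr rfl fun a _ => ?_
    rw [Finset.sum_comm]
    exact Finset.sum_congr rfl fun b _ => Finset.sum_congr rfl fun m _ => by
      simp only [Matrix.transpose_apply]; ring
  have h5 : contr (M * h + h * Mᵀ) A i = contr (M * h) A i + contr (h * Mᵀ) A i := by
    simp [contr, add_mul, Finset.sum_add_distrib]
  rw [h1, h2, h5, h3, h4]; ring

namespace IsMetricOn

lemma pdM_inv (hG : IsMetricOn G U) (hy : y ∈ U) (k : Fin n) :
    pdM k (fun z => (G z)⁻¹) y = -(conn G k y * (G y)⁻¹ + (G y)⁻¹ * (conn G k y)ᵀ) := by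
  have h1 : pdM k (fun z => G z * (G z)⁻¹) y = 0 := by
    rw [pdM_congr_on (B := fun _ => 1) k hG.isOpen hy
      fun z hz => Matrix.mul_nonsing_inv _ (hG.det z hz)]
    ext a b
    exact pd_const k _
  rw [pdM_mul k hG.isOpen hG.smooth hG.smooth_inv hy, hG.pdM_eq hy] at h1
  have h2 : (G y)⁻¹ * G y = 1 := Matrix.nonsing_inv_mul _ (hG.det y hy)
  have h3 : G y * (G y)⁻¹ = 1 := Matrix.mul_nonsing_inv _ (hG.det y hy)
  calc pdM k (fun z => (G z)⁻¹) y
      = ((G y)⁻¹ * G y) * pdM k (fun z => (G z)⁻¹) y := by rw [h2, one_mul]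
    _ = (G y)⁻¹ * (G y * pdM k (fun z => (G z)⁻¹) y) := by rw [Matrix.mul_assoc]
    _ = -((G y)⁻¹ * (conn G k y)ᵀ * (G y * (G y)⁻¹)
        + ((G y)⁻¹ * G y) * conn G k y * (G y)⁻¹) := by
      rw [eq_neg_of_add_eq_zero_right h1]; noncomm_ring
    _ = _ := by rw [h2, h3]; noncomm_ring

lemma smooth_slotAct {M : EuclideanSpace ℝ (Fin n) → Matrix (Fin n) (Fin n) ℝ}
    (hM : SmoothMat M U) {T : TensorField n r} (hT : SmoothTen T U) :
    SmoothTen (fun y => slotAct (M y) (T y)) U := fun _ =>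
  ContDiffOn.sum fun _ _ => ContDiffOn.sum fun _ _ => (hM _ _).mul (hT _)

lemma smooth_contr (hG : IsMetricOn G U) {A : TensorField n (r + 2)} (hA : SmoothTen A U) :
    SmoothTen (fun y => contr (G y)⁻¹ (A y)) U := fun _ =>
  ContDiffOn.sum fun a _ => ContDiffOn.sum fun b _ => (hG.smooth_inv a b).mul (hA _)

lemma smooth_covDeriv (hG : IsMetricOn G U) {T : TensorField n r} (hT : SmoothTen T U) :
    SmoothTen (covDeriv G T) U := by
  intro i
  rw [← Fin.cons_self_tail i]
  simp only [covDeriv_cons]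
  exact (smooth_pd _ hG.isOpen (hT _)).sub (smooth_slotAct (hG.smooth_conn _) hT _)

/-- Covariant differentiation commutes with contraction. -/
lemma covDeriv_contr (hG : IsMetricOn G U) (hy : y ∈ U) {A : TensorField n (r + 2)}
    (hA : SmoothTen A U) (e : Fin n) (i : Fin r → Fin n) :
    covDeriv G (fun z => contr (G z)⁻¹ (A z)) y (Fin.cons e i)
      = contr (G y)⁻¹ (fun j => covDeriv G A y (Fin.cons e j)) i := by
  have hd : ∀ j, DifferentiableAt ℝ (fun z => A z j) y := fun j =>
    diffAt_of_smooth hG.isOpen (hA j) hy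
  have hdi : ∀ a b, DifferentiableAt ℝ (fun z => (G z)⁻¹ a b) y := fun a b =>
    diffAt_of_smooth hG.isOpen (hG.smooth_inv a b) hy
  have h1 : pd e (fun z => contr (G z)⁻¹ (A z) i) y
      = contr (pdM e (fun z => (G z)⁻¹) y) (A y) i
        + contr (G y)⁻¹ (fun j => pd e (fun z => A z j) y) i := by
    simp only [contr]
    have hp : ∀ a b, DifferentiableAt ℝ
        (fun z => (G z)⁻¹ a b * A z (Fin.cons a (Fin.cons b i))) y := fun a b => (hdi a b).mul (hd _)
    rw [pd_sum _ _ _ fun a _ => DifferentiableAt.fun_sum fun b _ => hp a b,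
      ← Finset.sum_add_distrib]
    refine Finset.sum_congr rfl fun a _ => ?_
    rw [pd_sum _ _ _ fun b _ => hp a b, ← Finset.sum_add_distrib]
    exact Finset.sum_congr rfl fun b _ => pd_mul e (hdi a b) (hd _)
  have h2 : contr (G y)⁻¹ (fun j => covDeriv G A y (Fin.cons e j)) i
      = contr (G y)⁻¹ (fun j => pd e (fun z => A z j) y) i
        - contr (G y)⁻¹ (slotAct (conn G e y) (A y)) i := by
    simp only [covDeriv_cons, contr, mul_sub, Finset.sum_sub_distrib]
  have h3 : ∀ M : Matrix (Fin n) (Fin n) ℝ, contr (-M) (A y) i = - contr M (A y) i := by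
    intro M; simp [contr]
  rw [covDeriv_cons, h1, h2, contr_slotAct, hG.pdM_inv hy, h3]
  ring

/-- The Ricci identity. -/
lemma covDeriv_covDeriv_comm (hG : IsMetricOn G U) (hy : y ∈ U) {T : TensorField n r}
    (hT : SmoothTen T U) (f e : Fin n) (i : Fin r → Fin n) :
    covDeriv G (covDeriv G T) y (Fin.cons f (Fin.cons e i))
      - covDeriv G (covDeriv G T) y (Fin.cons e (Fin.cons f i))
      = - slotAct (curv G f e y) (T y) i := by
  have hU := hG.isOpen
  have hd : ∀ j, DifferentiableAt ℝ (fun z => T z j) y := fun j => diffAt_of_smooth hU (hT j) hy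
  have hdc : ∀ e a b, DifferentiableAt ℝ (fun z => conn G e z a b) y := fun e a b =>
    diffAt_of_smooth hU (hG.smooth_conn e a b) hy
  have key : ∀ f e, covDeriv G (covDeriv G T) y (Fin.cons f (Fin.cons e i))
      = pd f (pd e (fun z => T z i)) y - slotAct (pdM f (conn G e) y) (T y) i
        - slotAct (conn G e y) (fun j => pd f (fun z => T z j) y) i
        - (∑ m, conn G f y m e * covDeriv G T y (Fin.cons m i))
        - slotAct (conn G f y) (fun j => pd e (fun z => T z j) y) i
        + slotAct (conn G f y) (slotAct (conn G e y) (T y)) i := by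
    intro f e
    have h1 : pd f (fun z => slotAct (conn G e z) (T z) i) y
        = slotAct (pdM f (conn G e) y) (T y) i
          + slotAct (conn G e y) (fun j => pd f (fun z => T z j) y) i := by
      simp only [slotAct]
      rw [pd_sum _ _ _ fun a _ => by fun_prop, ← Finset.sum_add_distrib]
      refine Finset.sum_congr rfl fun a _ => ?_
      rw [pd_sum _ _ _ fun b _ => by fun_prop, ← Finset.sum_add_distrib]
      exact Finset.sum_congr rfl fun b _ => pd_mul f (hdc _ _ _) (hd _)
    have h2 : pd f (fun z => covDeriv G T z (Fin.cons e i)) y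
        = pd f (pd e (fun z => T z i)) y - pd f (fun z => slotAct (conn G e z) (T z) i) y := by
      simp only [covDeriv_cons]
      exact pd_sub f (diffAt_of_smooth hU (smooth_pd e hU (hT i)) hy)
        (diffAt_of_smooth hU (smooth_slotAct (hG.smooth_conn e) hT i) hy)
    rw [covDeriv_cons, slotAct_cons, h2, h1]
    simp only [covDeriv_cons, slotAct_sub_right]
    have : slotAct (conn G f y) (fun j => slotAct (conn G e y) (T y) j) i
      = slotAct (conn G f y) (slotAct (conn G e y) (T y)) i := rfl
    rw [this]
    ring
  have hc := slotAct_comm (conn G f y) (conn G e y) (T y) i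
  have hs : ∑ m, conn G f y m e * covDeriv G T y (Fin.cons m i)
      = ∑ m, conn G e y m f * covDeriv G T y (Fin.cons m i) :=
    Finset.sum_congr rfl fun m _ => by rw [hG.conn_symm hy f e m]
  rw [key, key, pd_comm f e hU (hT i) hy, hs, curv, slotAct_add, slotAct_sub, slotAct_sub]
  rw [slotAct_sub] at hc
  linarith

lemma covDeriv_mul (hG : IsMetricOn G U) (hy : y ∈ U) {s : ℕ} {A : TensorField n r}
    {B : TensorField n s} (hA : SmoothTen A U) (hB : SmoothTen B U) (e : Fin n)
    (i : Fin (r + s) → Fin n) :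
    covDeriv G (fun z j => A z (fun p => j (Fin.castAdd s p)) * B z (fun p => j (Fin.natAdd r p)))
        y (Fin.cons e i)
      = covDeriv G A y (Fin.cons e fun p => i (Fin.castAdd s p))
          * B y (fun p => i (Fin.natAdd r p))
        + A y (fun p => i (Fin.castAdd s p))
          * covDeriv G B y (Fin.cons e fun p => i (Fin.natAdd r p)) := by
  have h1 : ∀ (p : Fin r) (m : Fin n), (fun q => Function.update i (Fin.castAdd s p) m
      (Fin.castAdd s q)) = Function.update (fun q => i (Fin.castAdd s q)) p m := by
    intro p m; funext q
    by_cases h : q = p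
    · subst h; simp
    · rw [Function.update_of_ne h, Function.update_of_ne]
      simpa using h
  have h2 : ∀ (p : Fin r) (m : Fin n), (fun q => Function.update i (Fin.castAdd s p) m
      (Fin.natAdd r q)) = fun q => i (Fin.natAdd r q) := by
    intro p m; funext q
    rw [Function.update_of_ne]
    simp [Fin.ext_iff]; omega
  have h3 : ∀ (p : Fin s) (m : Fin n), (fun q => Function.update i (Fin.natAdd r p) m
      (Fin.natAdd r q)) = Function.update (fun q => i (Fin.natAdd r q)) p m := by
    intro p m; funext q
    by_cases h : q = p
    · subst h; simp
    · rw [Function.update_of_ne h, Function.update_of_ne]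
      simpa using h
  have h4 : ∀ (p : Fin s) (m : Fin n), (fun q => Function.update i (Fin.natAdd r p) m
      (Fin.castAdd s q)) = fun q => i (Fin.castAdd s q) := by
    intro p m; funext q
    rw [Function.update_of_ne]
    simp [Fin.ext_iff]; omega
  simp only [covDeriv_cons, slotAct, Fin.sum_univ_add, h1, h2, h3, h4]
  rw [pd_mul e (diffAt_of_smooth hG.isOpen (hA _) hy) (diffAt_of_smooth hG.isOpen (hB _) hy)]
  simp only [sub_mul, mul_sub, Finset.sum_mul, Finset.mul_sum]
  have h5 : ∀ x y z : ℝ, x * (y * z) = y * (x * z) := fun x y z => by ring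
  simp only [h5, mul_assoc]
  ring

end IsMetricOn

lemma slotAct_reindex {r' : ℕ} (σ : Fin r ≃ Fin r') (M : Matrix (Fin n) (Fin n) ℝ)
    (A : (Fin r → Fin n) → ℝ) (i : Fin r' → Fin n) :
    slotAct M (fun j => A fun p => j (σ p)) i = slotAct M A fun p => i (σ p) := by
  refine Fintype.sum_equiv σ.symm _ _ fun s => Finset.sum_congr rfl fun m _ => ?_
  have : (fun p => Function.update i s m (σ p))
      = Function.update (fun p => i (σ p)) (σ.symm s) m := by
    funext q
    by_cases h : σ q = s
    · subst h; simp
    · rw [Function.update_of_ne h, Function.update_of_ne]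
      intro h'; exact h (by rw [h']; simp)
  change M m (i s) * A (fun p => Function.update i s m (σ p)) = _
  rw [this]; simp

lemma covDeriv_reindex {r' : ℕ} (σ : Fin r ≃ Fin r') (A : TensorField n r) (e : Fin n)
    (i : Fin r' → Fin n) :
    covDeriv G (fun z j => A z (fun p => j (σ p))) y (Fin.cons e i)
      = covDeriv G A y (Fin.cons e fun p => i (σ p)) := by
  rw [covDeriv_cons, covDeriv_cons, slotAct_reindex]

/-! ### Components of tensors of low rank -/

lemma slotAct_two (M : Matrix (Fin n) (Fin n) ℝ) (T : (Fin 2 → Fin n) → ℝ) (a b : Fin n) :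
    slotAct M T ![a, b] = (∑ m, M m a * T ![m, b]) + ∑ m, M m b * T ![a, m] := by
  have h0 : ∀ m, Function.update ![a, b] 0 m = ![m, b] := by
    intro m; funext q; fin_cases q <;> rfl
  have h1 : ∀ m, Function.update ![a, b] 1 m = ![a, m] := by
    intro m; funext q; fin_cases q <;> rfl
  simp only [slotAct, Fin.sum_univ_two, h0, h1]
  rfl

lemma slotAct_four (M : Matrix (Fin n) (Fin n) ℝ) (T : (Fin 4 → Fin n) → ℝ) (a b c d : Fin n) :
    slotAct M T ![a, b, c, d] = (∑ m, M m a * T ![m, b, c, d]) + (∑ m, M m b * T ![a, m, c, d])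
      + (∑ m, M m c * T ![a, b, m, d]) + ∑ m, M m d * T ![a, b, c, m] := by
  have h0 : ∀ m, Function.update ![a, b, c, d] 0 m = ![m, b, c, d] := by
    intro m; funext q; fin_cases q <;> rfl
  have h1 : ∀ m, Function.update ![a, b, c, d] 1 m = ![a, m, c, d] := by
    intro m; funext q; fin_cases q <;> rfl
  have h2 : ∀ m, Function.update ![a, b, c, d] 2 m = ![a, b, m, d] := by
    intro m; funext q; fin_cases q <;> rfl
  have h3 : ∀ m, Function.update ![a, b, c, d] 3 m = ![a, b, c, m] := by
    intro m; funext q; fin_cases q <;> rfl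
  simp only [slotAct, Fin.sum_univ_four, h0, h1, h2, h3]
  rfl

/-- The metric tensor as a tensor field. -/
def metricTen (G : MetricField n) : TensorField n 2 := fun y i => G y (i 0) (i 1)

/-- The Riemann tensor as a tensor field. -/
abbrev riemannTen (G : MetricField n) : TensorField n 4 := nablaRiemann G 0

lemma riemannTen_apply (G : MetricField n) (y : EuclideanSpace ℝ (Fin n)) (a b c d : Fin n) :
    riemannTen G y ![a, b, c, d] = riemann G y a b c d := rfl

namespace IsMetricOn

lemma smooth_metricTen (hG : IsMetricOn G U) : SmoothTen (metricTen G) U := fun _ => hG.smooth _ _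

lemma smooth_riemannTen (hG : IsMetricOn G U) : SmoothTen (riemannTen G) U := by
  intro i
  have : ∀ z, riemannTen G z i = (G z * curv G (i 2) (i 3) z) (i 0) (i 1) := fun z =>
    riemann_eq_mul_curv G z _ _ _ _
  simp only [this]
  exact hG.smooth.mul (hG.smooth_curv _ _) _ _

lemma covDeriv_metricTen (hG : IsMetricOn G U) (hy : y ∈ U) (e a b : Fin n) :
    covDeriv G (metricTen G) y ![e, a, b] = 0 := by
  have h := congrFun (congrFun (hG.pdM_eq hy e) a) b
  have h1 : covDeriv G (metricTen G) y ![e, a, b] = pd e (fun z => metricTen G z ![a, b]) y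
      - slotAct (conn G e y) (metricTen G y) ![a, b] := covDeriv_cons G _ y e ![a, b]
  rw [h1, slotAct_two]
  simp only [pdM, of_apply, Matrix.add_apply, Matrix.mul_apply, Matrix.transpose_apply] at h
  simp only [metricTen, Matrix.cons_val_zero, Matrix.cons_val_one]
  rw [h]
  simp only [mul_comm (G y a _)]
  ring

lemma covDeriv_riemannTen (hG : IsMetricOn G U) (hy : y ∈ U) (e a b c d : Fin n) :
    covDeriv G (riemannTen G) y ![e, a, b, c, d]
      = (G y * (pdM e (curv G c d) y + conn G e y * curv G c d y - curv G c d y * conn G e y)) a b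
        - (∑ m, conn G e y m c * (G y * curv G m d y) a b)
        - ∑ m, conn G e y m d * (G y * curv G c m y) a b := by
  have h1 : covDeriv G (riemannTen G) y ![e, a, b, c, d]
      = pd e (fun z => riemannTen G z ![a, b, c, d]) y
        - slotAct (conn G e y) (riemannTen G y) ![a, b, c, d] := covDeriv_cons G _ y e ![a, b, c, d]
  have h2 : pd e (fun z => riemannTen G z ![a, b, c, d]) y
      = pdM e (fun z => G z * curv G c d z) y a b := by
    simp only [riemannTen_apply, riemann_eq_mul_curv]; rfl
  have h3 : ∑ m, conn G e y m a * (G y * curv G c d y) m b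
      = ((conn G e y)ᵀ * (G y * curv G c d y)) a b := by
    rw [Matrix.mul_apply]; rfl
  have h4 : ∑ m, conn G e y m b * (G y * curv G c d y) a m
      = (G y * curv G c d y * conn G e y) a b := by
    rw [Matrix.mul_apply]; exact Finset.sum_congr rfl fun m _ => mul_comm _ _
  rw [h1, h2, slotAct_four, pdM_mul e hG.isOpen hG.smooth (hG.smooth_curv c d) hy, hG.pdM_eq hy]
  simp only [riemannTen_apply, riemann_eq_mul_curv, h3, h4]
  have h5 : ((conn G e y)ᵀ * G y + G y * conn G e y) * curv G c d y
      + G y * pdM e (curv G c d) y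
      = G y * (pdM e (curv G c d) y + conn G e y * curv G c d y - curv G c d y * conn G e y)
        + (conn G e y)ᵀ * (G y * curv G c d y) + G y * curv G c d y * conn G e y := by
    noncomm_ring
  rw [h5]
  simp only [Matrix.add_apply]
  ring

/-- The second Bianchi identity. -/
lemma bianchi (hG : IsMetricOn G U) (hy : y ∈ U) (e a b c d : Fin n) :
    covDeriv G (riemannTen G) y ![e, a, b, c, d] + covDeriv G (riemannTen G) y ![c, a, b, d, e]
      + covDeriv G (riemannTen G) y ![d, a, b, e, c] = 0 := by
  have hU := hG.isOpen
  have hpd : ∀ e c d, pdM e (curv G c d) y = pdM e (pdM c (conn G d)) y - pdM e (pdM d (conn G c)) y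
      + ((pdM e (conn G c) y * conn G d y + conn G c y * pdM e (conn G d) y)
        - (pdM e (conn G d) y * conn G c y + conn G d y * pdM e (conn G c) y)) := by
    intro e c d
    have hc := hG.smooth_conn c
    have hd := hG.smooth_conn d
    have : pdM e (curv G c d) y = pdM e (fun z => (pdM c (conn G d) z - pdM d (conn G c) z)
      + (conn G c z * conn G d z - conn G d z * conn G c z)) y := rfl
    rw [this, pdM_add e hU ((hd.pdM hU c).sub (hc.pdM hU d)) ((hc.mul hd).sub (hd.mul hc)) hy,
      pdM_sub e hU (hd.pdM hU c) (hc.pdM hU d) hy, pdM_sub e hU (hc.mul hd) (hd.mul hc) hy,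
      pdM_mul e hU hc hd hy, pdM_mul e hU hd hc hy]
  have hgauge : (pdM e (curv G c d) y + conn G e y * curv G c d y - curv G c d y * conn G e y)
      + (pdM c (curv G d e) y + conn G c y * curv G d e y - curv G d e y * conn G c y)
      + (pdM d (curv G e c) y + conn G d y * curv G e c y - curv G e c y * conn G d y) = 0 := by
    rw [hpd, hpd, hpd, pdM_comm e c hU (hG.smooth_conn d) hy, pdM_comm e d hU (hG.smooth_conn c) hy,
      pdM_comm c d hU (hG.smooth_conn e) hy]
    simp only [curv]
    noncomm_ring
  have hsum : ∀ p q s, ∑ m, conn G p y m q * (G y * curv G s m y) a b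
      = - ∑ m, conn G q y m p * (G y * curv G m s y) a b := by
    intro p q s
    rw [← Finset.sum_neg_distrib]
    refine Finset.sum_congr rfl fun m _ => ?_
    rw [hG.conn_symm hy p q m, curv_antisymm G m s, Matrix.mul_neg, Matrix.neg_apply, mul_neg]
  rw [hG.covDeriv_riemannTen hy, hG.covDeriv_riemannTen hy, hG.covDeriv_riemannTen hy,
    hsum e d c, hsum c e d, hsum d c e]
  have h0 : ∀ A B C : Matrix (Fin n) (Fin n) ℝ, A + B + C = 0 →
      (G y * A) a b + (G y * B) a b + (G y * C) a b = 0 := by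
    intro A B C h
    rw [← Matrix.add_apply, ← Matrix.add_apply, ← Matrix.mul_add, ← Matrix.mul_add, h,
      Matrix.mul_zero, Matrix.zero_apply]
  linarith [h0 _ _ _ hgauge]

end IsMetricOn

end TensorCalculus

/-! ### Behaviour of the curvature under changes of coordinates -/

section Pullback

open Matrix

variable {n : ℕ}

/-- The Jacobian matrix `∂φᵏ/∂xⁱ`. -/
def jacobian (φ : EuclideanSpace ℝ (Fin n) → EuclideanSpace ℝ (Fin n))
    (y : EuclideanSpace ℝ (Fin n)) : Matrix (Fin n) (Fin n) ℝ :=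
  of fun k i => pd i (fun z => φ z k) y

/-- `φ` is a smooth local diffeomorphism from `V` to `U` that pulls the metric `G` back to `G'`. -/
structure IsPullback (G G' : MetricField n) (φ : EuclideanSpace ℝ (Fin n) → EuclideanSpace ℝ (Fin n))
    (U V : Set (EuclideanSpace ℝ (Fin n))) : Prop where
  metric : IsMetricOn G U
  isOpen : IsOpen V
  maps : Set.MapsTo φ V U
  smooth : ContDiffOn ℝ ∞ φ V
  det : ∀ y ∈ V, IsUnit (jacobian φ y).det
  eq : ∀ y ∈ V, G' y = (jacobian φ y)ᵀ * G (φ y) * jacobian φ y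

/-- The pull-back of a rank four tensor by a matrix. -/
def pull4 (C : Fin n → Fin n → Fin n → Fin n → ℝ) (J : Matrix (Fin n) (Fin n) ℝ)
    (a b c d : Fin n) : ℝ :=
  ∑ i, ∑ j, ∑ k, ∑ l, C i j k l * J i a * J j b * J k c * J l d

variable {G G' : MetricField n} {φ : EuclideanSpace ℝ (Fin n) → EuclideanSpace ℝ (Fin n)}
  {U V : Set (EuclideanSpace ℝ (Fin n))} {y : EuclideanSpace ℝ (Fin n)}

namespace IsPullback

lemma smooth_comp (h : IsPullback G G' φ U V) {f : EuclideanSpace ℝ (Fin n) → ℝ}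
    (hf : ContDiffOn ℝ ∞ f U) : ContDiffOn ℝ ∞ (fun z => f (φ z)) V :=
  hf.comp h.smooth h.maps

lemma smooth_apply (h : IsPullback G G' φ U V) (k : Fin n) :
    ContDiffOn ℝ ∞ (fun z => φ z k) V := by
  have : ContDiff ℝ ∞ (fun v : EuclideanSpace ℝ (Fin n) => v k) :=
    (EuclideanSpace.proj (𝕜 := ℝ) k).contDiff
  exact this.comp_contDiffOn h.smooth

lemma smooth_jacobian (h : IsPullback G G' φ U V) : SmoothMat (jacobian φ) V := fun k i =>
  smooth_pd i h.isOpen (h.smooth_apply k)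

/-- The chain rule. -/
lemma pd_comp (h : IsPullback G G' φ U V) (hy : y ∈ V) {f : EuclideanSpace ℝ (Fin n) → ℝ}
    (hf : ContDiffOn ℝ ∞ f U) (i : Fin n) :
    pd i (fun z => f (φ z)) y = ∑ k, jacobian φ y k i * pd k f (φ y) := by
  have hfd := diffAt_of_smooth h.metric.isOpen hf (h.maps hy)
  have hφd : DifferentiableAt ℝ φ y :=
    (h.smooth.contDiffAt (h.isOpen.mem_nhds hy)).differentiableAt (by simp)
  have hk : ∀ k, jacobian φ y k i = (fderiv ℝ φ y (EuclideanSpace.single i 1)) k := by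
    intro k
    have h1 : HasFDerivAt (fun z => φ z k) ((EuclideanSpace.proj (𝕜 := ℝ) k).comp (fderiv ℝ φ y)) y :=
      (EuclideanSpace.proj (𝕜 := ℝ) k).hasFDerivAt.comp y hφd.hasFDerivAt
    simp only [jacobian, of_apply, pd, h1.fderiv]
    rfl
  have hsum : fderiv ℝ φ y (EuclideanSpace.single i 1)
      = ∑ k, jacobian φ y k i • EuclideanSpace.single k (1 : ℝ) := by
    ext k
    simp [hk, Finset.sum_apply, Pi.single_apply]
  have hc : fderiv ℝ (fun z => f (φ z)) y = (fderiv ℝ f (φ y)).comp (fderiv ℝ φ y) :=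
    fderiv_comp y hfd hφd
  unfold pd
  rw [hc, ContinuousLinearMap.comp_apply, hsum, map_sum]
  simp

/-- The pull-back of the connection matrices along `φ`, before the change of frame. -/
def pullConn (G : MetricField n) (φ : EuclideanSpace ℝ (Fin n) → EuclideanSpace ℝ (Fin n))
    (i : Fin n) (y : EuclideanSpace ℝ (Fin n)) : Matrix (Fin n) (Fin n) ℝ :=
  ∑ a, jacobian φ y a i • conn G a (φ y)

lemma pd_jacobian_symm (h : IsPullback G G' φ U V) (hy : y ∈ V) (i j : Fin n) (c : Fin n) :
    pdM i (jacobian φ) y c j = pdM j (jacobian φ) y c i :=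
  pd_comm i j h.isOpen (h.smooth_apply c) hy

lemma isMetricOn (h : IsPullback G G' φ U V) : IsMetricOn G' V where
  isOpen := h.isOpen
  smooth := by
    have hGc : SmoothMat (fun y => G (φ y)) V := fun a b => h.smooth_comp (h.metric.smooth a b)
    have := (h.smooth_jacobian.transpose.mul hGc).mul h.smooth_jacobian
    intro a b
    refine (this a b).congr fun z hz => by rw [h.eq z hz]
  symm := by
    intro z hz
    rw [h.eq z hz, Matrix.transpose_mul, Matrix.transpose_mul, Matrix.transpose_transpose,
      h.metric.symm _ (h.maps hz), Matrix.mul_assoc]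
  det := by
    intro z hz
    rw [h.eq z hz, Matrix.det_mul, Matrix.det_mul, Matrix.det_transpose]
    exact ((h.det z hz).mul (h.metric.det _ (h.maps hz))).mul (h.det z hz)

/-- The Levi-Civita connections are related by the gauge transformation with the Jacobian. -/
lemma jacobian_mul_conn (h : IsPullback G G' φ U V) (hy : y ∈ V) (i : Fin n) :
    jacobian φ y * conn G' i y = pullConn G φ i y * jacobian φ y + pdM i (jacobian φ) y := by
  have hGc : SmoothMat (fun y => G (φ y)) V := fun a b => h.smooth_comp (h.metric.smooth a b)
  have hJ := h.smooth_jacobian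
  have hinv : jacobian φ y * (jacobian φ y)⁻¹ = 1 := Matrix.mul_nonsing_inv _ (h.det y hy)
  have hpdG : ∀ k, pdM k (fun z => G (φ z)) y
      = (pullConn G φ k y)ᵀ * G (φ y) + G (φ y) * pullConn G φ k y := by
    intro k
    have h1 : pdM k (fun z => G (φ z)) y = ∑ a, jacobian φ y a k • pdM a G (φ y) := by
      ext p q
      simp only [pdM, of_apply, h.pd_comp hy (h.metric.smooth p q), Matrix.sum_apply,
        Matrix.smul_apply, smul_eq_mul]
    rw [h1]
    simp only [h.metric.pdM_eq (h.maps hy), pullConn, Matrix.transpose_sum, Matrix.transpose_smul,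
      Matrix.sum_mul, Matrix.mul_sum, Matrix.smul_mul, Matrix.mul_smul, smul_add,
      Finset.sum_add_distrib]
  have key := h.isMetricOn.conn_unique hy
    (fun i => (jacobian φ y)⁻¹ * (pullConn G φ i y * jacobian φ y + pdM i (jacobian φ) y)) ?_ ?_ i
  · rw [key, ← Matrix.mul_assoc, hinv, Matrix.one_mul]
  · intro i j a
    have hs : ∀ c, (pullConn G φ i y * jacobian φ y + pdM i (jacobian φ) y) c j
        = (pullConn G φ j y * jacobian φ y + pdM j (jacobian φ) y) c i := by
      intro c
      rw [Matrix.add_apply, Matrix.add_apply, h.pd_jacobian_symm hy i j c]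
      congr 1
      simp only [pullConn, Matrix.mul_apply, Matrix.sum_apply, Matrix.smul_apply, smul_eq_mul,
        Finset.sum_mul]
      rw [Finset.sum_comm]
      refine Finset.sum_congr rfl fun a _ => Finset.sum_congr rfl fun b _ => ?_
      rw [h.metric.conn_symm (h.maps hy) a b c]; ring
    rw [Matrix.mul_apply, Matrix.mul_apply]
    exact Finset.sum_congr rfl fun c _ => by rw [hs c]
  · intro k
    have e1 : pdM k G' y = pdM k (fun z => (jacobian φ z)ᵀ * G (φ z) * jacobian φ z) y :=
      pdM_congr_on k h.isOpen hy h.eq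
    rw [e1, pdM_mul k h.isOpen (hJ.transpose.mul hGc) hJ hy,
      pdM_mul k h.isOpen hJ.transpose hGc hy, hpdG, h.eq y hy, pdM_transpose]
    have e2 : ∀ X : Matrix (Fin n) (Fin n) ℝ, (jacobian φ y)ᵀ * G (φ y) * jacobian φ y
        * ((jacobian φ y)⁻¹ * X) = (jacobian φ y)ᵀ * G (φ y) * X := by
      intro X
      rw [← Matrix.mul_assoc, Matrix.mul_assoc _ (jacobian φ y), hinv, Matrix.mul_one]
    have e3 : ∀ X : Matrix (Fin n) (Fin n) ℝ, ((jacobian φ y)⁻¹ * X)ᵀ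
        * ((jacobian φ y)ᵀ * G (φ y) * jacobian φ y) = Xᵀ * G (φ y) * jacobian φ y := by
      intro X
      have : ((jacobian φ y)⁻¹)ᵀ * (jacobian φ y)ᵀ = 1 := by
        rw [← Matrix.transpose_mul, hinv, Matrix.transpose_one]
      rw [Matrix.transpose_mul, Matrix.mul_assoc, Matrix.mul_assoc (jacobian φ y)ᵀ,
        ← Matrix.mul_assoc ((jacobian φ y)⁻¹)ᵀ, this, Matrix.one_mul, ← Matrix.mul_assoc]
    rw [e2, e3]
    simp only [Matrix.transpose_add, Matrix.transpose_mul]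
    noncomm_ring

lemma smooth_pullConn (h : IsPullback G G' φ U V) (i : Fin n) : SmoothMat (pullConn G φ i) V := by
  intro a b
  simp only [pullConn, Matrix.sum_apply, Matrix.smul_apply, smul_eq_mul]
  exact ContDiffOn.sum fun c _ => (h.smooth_jacobian c i).mul
    (h.smooth_comp (h.metric.smooth_conn c a b))

lemma jacobian_mul_curv (h : IsPullback G G' φ U V) (hy : y ∈ V) (m i : Fin n) :
    jacobian φ y * curv G' m i y
      = (∑ d, ∑ a, (jacobian φ y d m * jacobian φ y a i) • curv G d a (φ y)) * jacobian φ y := by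
  have hU := h.isOpen
  have hJ := h.smooth_jacobian
  have hc := h.isMetricOn.smooth_conn
  have hp := h.smooth_pullConn
  -- differentiate the transformation law of the connection
  have hd : ∀ m i, pdM m (jacobian φ) y * conn G' i y + jacobian φ y * pdM m (conn G' i) y
      = pdM m (pullConn G φ i) y * jacobian φ y + pullConn G φ i y * pdM m (jacobian φ) y
        + pdM m (pdM i (jacobian φ)) y := by
    intro m i
    have := pdM_congr_on m hU hy fun z hz => h.jacobian_mul_conn hz i
    rwa [pdM_mul m hU hJ (hc i) hy, pdM_add m hU ((hp i).mul hJ) (hJ.pdM hU i) hy,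
      pdM_mul m hU (hp i) hJ hy] at this
  have hpc : ∀ m i, pdM m (pullConn G φ i) y
      = (∑ a, pdM m (jacobian φ) y a i • conn G a (φ y))
        + ∑ d, ∑ a, (jacobian φ y d m * jacobian φ y a i) • pdM d (conn G a) (φ y) := by
    intro m i
    ext p q
    have hdj : ∀ a, DifferentiableAt ℝ (fun z => jacobian φ z a i) y := fun a =>
      diffAt_of_smooth hU (hJ a i) hy
    have hdc : ∀ a, DifferentiableAt ℝ (fun z => conn G a (φ z) p q) y := fun a =>
      diffAt_of_smooth hU (h.smooth_comp (h.metric.smooth_conn a p q)) hy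
    have e : pdM m (pullConn G φ i) y p q
        = pd m (fun z => ∑ a, jacobian φ z a i * conn G a (φ z) p q) y := by
      simp only [pdM, of_apply, pullConn, Matrix.sum_apply, Matrix.smul_apply, smul_eq_mul]
    have hdp : ∀ a, DifferentiableAt ℝ (fun z => jacobian φ z a i * conn G a (φ z) p q) y :=
      fun a => (hdj a).mul (hdc a)
    rw [e, pd_sum _ _ _ fun a _ => hdp a, Finset.sum_comm]
    simp only [Matrix.add_apply, Matrix.sum_apply, Matrix.smul_apply, smul_eq_mul]
    rw [← Finset.sum_add_distrib]
    refine Finset.sum_congr rfl fun a _ => ?_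
    rw [pd_mul m (hdj a) (hdc a), h.pd_comp hy (h.metric.smooth_conn a p q), Finset.mul_sum]
    congr 1
    exact Finset.sum_congr rfl fun d _ => by simp only [pdM, of_apply]; ring
  have hsymm : ∑ a, pdM m (jacobian φ) y a i • conn G a (φ y)
      = ∑ a, pdM i (jacobian φ) y a m • conn G a (φ y) :=
    Finset.sum_congr rfl fun a _ => by rw [h.pd_jacobian_symm hy]
  have hswap : ∑ d, ∑ a, (jacobian φ y d i * jacobian φ y a m) • pdM d (conn G a) (φ y)
      = ∑ d, ∑ a, (jacobian φ y d m * jacobian φ y a i) • pdM a (conn G d) (φ y) := by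
    rw [Finset.sum_comm]
    exact Finset.sum_congr rfl fun d _ => Finset.sum_congr rfl fun a _ => by rw [mul_comm]
  have hprod : ∀ m i, pullConn G φ m y * pullConn G φ i y
      = ∑ d, ∑ a, (jacobian φ y d m * jacobian φ y a i) • (conn G d (φ y) * conn G a (φ y)) := by
    intro m i
    simp only [pullConn, Matrix.sum_mul, Matrix.mul_sum, Matrix.smul_mul, Matrix.mul_smul,
      smul_smul, Finset.smul_sum]
    rw [Finset.sum_comm]
    exact Finset.sum_congr rfl fun d _ => Finset.sum_congr rfl fun a _ => by
      rw [mul_comm]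
  have hprod' : pullConn G φ i y * pullConn G φ m y
      = ∑ d, ∑ a, (jacobian φ y d m * jacobian φ y a i) • (conn G a (φ y) * conn G d (φ y)) := by
    rw [hprod, Finset.sum_comm]
    exact Finset.sum_congr rfl fun d _ => Finset.sum_congr rfl fun a _ => by rw [mul_comm]
  have hF : ∑ d, ∑ a, (jacobian φ y d m * jacobian φ y a i) • curv G d a (φ y)
      = pdM m (pullConn G φ i) y - pdM i (pullConn G φ m) y
        + (pullConn G φ m y * pullConn G φ i y - pullConn G φ i y * pullConn G φ m y) := by
    rw [hpc, hpc, hprod, hprod', hsymm, hswap]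
    simp only [curv, smul_add, smul_sub, Finset.sum_add_distrib, Finset.sum_sub_distrib]
    abel
  rw [hF]
  have e1 := h.jacobian_mul_conn hy m
  have e2 := h.jacobian_mul_conn hy i
  have e3 := hd m i
  have e4 := hd i m
  have e5 := pdM_comm m i hU hJ hy
  have q1 : jacobian φ y * pdM m (conn G' i) y = pdM m (pullConn G φ i) y * jacobian φ y
      + pullConn G φ i y * pdM m (jacobian φ) y
        + pdM m (pdM i (jacobian φ)) y - pdM m (jacobian φ) y * conn G' i y := by
    rw [← e3]; abel
  have q2 : jacobian φ y * pdM i (conn G' m) y = pdM i (pullConn G φ m) y * jacobian φ y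
      + pullConn G φ m y * pdM i (jacobian φ) y
        + pdM i (pdM m (jacobian φ)) y - pdM i (jacobian φ) y * conn G' m y := by
    rw [← e4]; abel
  have q3 : jacobian φ y * (conn G' m y * conn G' i y) = pullConn G φ m y
      * (pullConn G φ i y * jacobian φ y + pdM i (jacobian φ) y)
      + pdM m (jacobian φ) y * conn G' i y := by
    rw [← Matrix.mul_assoc, e1, Matrix.add_mul, Matrix.mul_assoc, e2]
  have q4 : jacobian φ y * (conn G' i y * conn G' m y) = pullConn G φ i y
      * (pullConn G φ m y * jacobian φ y + pdM m (jacobian φ) y)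
      + pdM i (jacobian φ) y * conn G' m y := by
    rw [← Matrix.mul_assoc, e2, Matrix.add_mul, Matrix.mul_assoc, e1]
  rw [curv, Matrix.mul_add, Matrix.mul_sub, Matrix.mul_sub, q1, q2, q3, q4, e5]
  noncomm_ring

/-- The Riemann tensor is a tensor. -/
lemma riemann_eq (h : IsPullback G G' φ U V) (hy : y ∈ V) (a b c d : Fin n) :
    riemann G' y a b c d = pull4 (riemann G (φ y)) (jacobian φ y) a b c d := by
  have e1 : G' y * curv G' c d y = (jacobian φ y)ᵀ * (G (φ y)
      * (∑ k, ∑ l, (jacobian φ y k c * jacobian φ y l d) • curv G k l (φ y))) * jacobian φ y := by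
    rw [h.eq y hy, Matrix.mul_assoc, h.jacobian_mul_curv hy]
    noncomm_ring
  have e2 : G (φ y) * (∑ k, ∑ l, (jacobian φ y k c * jacobian φ y l d) • curv G k l (φ y))
      = ∑ k, ∑ l, (jacobian φ y k c * jacobian φ y l d) • (G (φ y) * curv G k l (φ y)) := by
    simp only [Matrix.mul_sum, Matrix.mul_smul]
  have e3 : ∀ X : Matrix (Fin n) (Fin n) ℝ, ((jacobian φ y)ᵀ * X * jacobian φ y) a b
      = ∑ i, ∑ j, jacobian φ y i a * jacobian φ y j b * X i j := by
    intro X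
    simp only [Matrix.mul_apply, Matrix.transpose_apply, Finset.sum_mul]
    rw [Finset.sum_comm]
    exact Finset.sum_congr rfl fun i _ => Finset.sum_congr rfl fun j _ => by ring
  rw [riemann_eq_mul_curv, e1, e2, e3, pull4]
  refine Finset.sum_congr rfl fun i _ => Finset.sum_congr rfl fun j _ => ?_
  simp only [Matrix.sum_apply, Matrix.smul_apply, smul_eq_mul, ← riemann_eq_mul_curv,
    Finset.mul_sum]
  exact Finset.sum_congr rfl fun k _ => Finset.sum_congr rfl fun l _ => by ring

end IsPullback

end Pullback

/-! ### Tensor algebra at a point: changes of basis -/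

section PointAlgebra

open Matrix
open scoped Kronecker

variable {n : ℕ}

/-- The algebraic symmetries of the Weyl tensor for the scalar product with matrix `G`. -/
structure IsWeyl (G : Matrix (Fin n) (Fin n) ℝ) (C : Fin n → Fin n → Fin n → Fin n → ℝ) :
    Prop where
  left : ∀ a b c d, C b a c d = - C a b c d
  right : ∀ a b c d, C a b d c = - C a b c d
  cyclic : ∀ a b c d, C a b c d + C a c d b + C a d b c = 0
  trace : ∀ b d, ∑ a, ∑ c, G⁻¹ a c * C a b c d = 0

lemma pair_symm_of_cyclic {C : Fin n → Fin n → Fin n → Fin n → ℝ}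
    (A : ∀ a b c d, C b a c d = - C a b c d) (B : ∀ a b c d, C a b d c = - C a b c d)
    (H : ∀ a b c d, C a b c d + C a c d b + C a d b c = 0) (a b c d : Fin n) :
    C a b c d = C c d a b := by
  linarith [H a b c d, H b c d a, H c d a b, H d a b c, A a b c d, A a c d b, A a d b c, A b c d a,
    A b d a c, A c d a b, B a b c d, B c d a b, B b d a c, B a c d b, B b c d a, B a d b c,
    B c a b d, B d b c a, B d c a b, B d a b c, A a b d c, A c d b a, A a c b d, A b d c a,
    A b c a d, A a d c b]

lemma IsWeyl.pair {G : Matrix (Fin n) (Fin n) ℝ} {C : Fin n → Fin n → Fin n → Fin n → ℝ}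
    (h : IsWeyl G C) (a b c d : Fin n) : C a b c d = C c d a b :=
  pair_symm_of_cyclic h.left h.right h.cyclic a b c d

/-- The inverse scalar product is contravariant under a change of basis. -/
lemma mul_inv_pull {G J : Matrix (Fin n) (Fin n) ℝ} (hJ : IsUnit J.det) :
    J * (Jᵀ * G * J)⁻¹ * Jᵀ = G⁻¹ := by
  have hJt : IsUnit Jᵀ.det := by rwa [Matrix.det_transpose]
  have h1 : J * J⁻¹ = 1 := Matrix.mul_nonsing_inv _ hJ
  have h2 : (Jᵀ)⁻¹ * Jᵀ = 1 := Matrix.nonsing_inv_mul _ hJt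
  rw [Matrix.mul_inv_rev, Matrix.mul_inv_rev]
  calc J * (J⁻¹ * (G⁻¹ * Jᵀ⁻¹)) * Jᵀ = (J * J⁻¹) * G⁻¹ * (Jᵀ⁻¹ * Jᵀ) := by noncomm_ring
    _ = G⁻¹ := by rw [h1, h2, one_mul, mul_one]

/-- Contraction of two indices is independent of the basis. -/
lemma sum_inv_pull {h h' J : Matrix (Fin n) (Fin n) ℝ} (hh : J * h' * Jᵀ = h)
    (X : Fin n → Fin n → ℝ) :
    ∑ a, ∑ c, h' a c * ∑ i, ∑ k, X i k * (J i a * J k c) = ∑ i, ∑ k, h i k * X i k := by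
  have e : ∀ i k, h i k = ∑ c, ∑ a, J i a * h' a c * J k c := by
    intro i k
    rw [← hh]
    simp only [Matrix.mul_apply, Matrix.transpose_apply, Finset.sum_mul]
  simp only [e, Finset.mul_sum, Finset.sum_mul]
  calc _ = ∑ p : Fin n × Fin n × Fin n × Fin n,
        h' p.1 p.2.1 * (X p.2.2.1 p.2.2.2 * (J p.2.2.1 p.1 * J p.2.2.2 p.2.1)) := by
        simp only [Fintype.sum_prod_type]
    _ = ∑ p : Fin n × Fin n × Fin n × Fin n,
        J p.1 p.2.2.2 * h' p.2.2.2 p.2.2.1 * J p.2.1 p.2.2.1 * X p.1 p.2.1 := by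
        refine Fintype.sum_equiv ⟨fun p => (p.2.2.1, p.2.2.2, p.2.1, p.1),
          fun p => (p.2.2.2, p.2.2.1, p.1, p.2.1), fun _ => rfl, fun _ => rfl⟩ _ _ fun p => ?_
        simp only [Equiv.coe_fn_mk]; ring
    _ = _ := by simp only [Fintype.sum_prod_type]

lemma pull4_eq_sum13 (C : Fin n → Fin n → Fin n → Fin n → ℝ) (J : Matrix (Fin n) (Fin n) ℝ)
    (a b c d : Fin n) : pull4 C J a b c d
      = ∑ i, ∑ k, (∑ j, ∑ l, C i j k l * (J j b * J l d)) * (J i a * J k c) := by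
  simp only [pull4, Finset.sum_mul]
  refine Finset.sum_congr rfl fun i _ => ?_
  rw [Finset.sum_comm]
  exact Finset.sum_congr rfl fun k _ => Finset.sum_congr rfl fun j _ =>
    Finset.sum_congr rfl fun l _ => by ring

lemma trace_pull4 {G J : Matrix (Fin n) (Fin n) ℝ} (hJ : IsUnit J.det)
    (C : Fin n → Fin n → Fin n → Fin n → ℝ) (b d : Fin n) :
    ∑ a, ∑ c, (Jᵀ * G * J)⁻¹ a c * pull4 C J a b c d
      = ∑ j, ∑ l, (∑ i, ∑ k, G⁻¹ i k * C i j k l) * (J j b * J l d) := by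
  simp only [pull4_eq_sum13]
  rw [sum_inv_pull (mul_inv_pull hJ)]
  simp only [Finset.mul_sum, Finset.sum_mul]
  calc _ = ∑ p : Fin n × Fin n × Fin n × Fin n,
        G⁻¹ p.1 p.2.1 * (C p.1 p.2.2.1 p.2.1 p.2.2.2 * (J p.2.2.1 b * J p.2.2.2 d)) := by
        simp only [Fintype.sum_prod_type]
    _ = ∑ p : Fin n × Fin n × Fin n × Fin n,
        G⁻¹ p.2.2.1 p.2.2.2 * C p.2.2.1 p.1 p.2.2.2 p.2.1 * (J p.1 b * J p.2.1 d) := by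
        refine Fintype.sum_equiv ⟨fun p => (p.2.2.1, p.2.2.2, p.1, p.2.1),
          fun p => (p.2.2.1, p.2.2.2, p.1, p.2.1), fun _ => rfl, fun _ => rfl⟩ _ _ fun p => ?_
        simp only [Equiv.coe_fn_mk]; ring
    _ = _ := by simp only [Fintype.sum_prod_type]

lemma IsWeyl.pull {G J : Matrix (Fin n) (Fin n) ℝ} (hJ : IsUnit J.det)
    {C : Fin n → Fin n → Fin n → Fin n → ℝ} (h : IsWeyl G C) :
    IsWeyl (Jᵀ * G * J) (pull4 C J) where
  left a b c d := by
    simp only [pull4]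
    rw [Finset.sum_comm, ← Finset.sum_neg_distrib]
    refine Finset.sum_congr rfl fun i _ => ?_
    rw [← Finset.sum_neg_distrib]
    refine Finset.sum_congr rfl fun j _ => ?_
    simp only [← Finset.sum_neg_distrib]
    exact Finset.sum_congr rfl fun k _ => Finset.sum_congr rfl fun l _ => by
      rw [h.left i j]; ring
  right a b c d := by
    simp only [pull4, ← Finset.sum_neg_distrib]
    refine Finset.sum_congr rfl fun i _ => Finset.sum_congr rfl fun j _ => ?_
    rw [Finset.sum_comm]
    exact Finset.sum_congr rfl fun k _ => Finset.sum_congr rfl fun l _ => by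
      rw [h.right i j k l]; ring
  cyclic a b c d := by
    simp only [pull4, ← Finset.sum_add_distrib]
    refine Finset.sum_eq_zero fun i _ => ?_
    have e1 : ∑ j, ∑ k, ∑ l, C i j k l * J i a * J j c * J k d * J l b
        = ∑ j, ∑ k, ∑ l, C i k l j * J i a * J k c * J l d * J j b := by
      rw [Finset.sum_congr rfl fun j _ => Finset.sum_comm, Finset.sum_comm]
    have e2 : ∑ j, ∑ k, ∑ l, C i j k l * J i a * J j d * J k b * J l c
        = ∑ j, ∑ k, ∑ l, C i l j k * J i a * J l d * J j b * J k c := by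
      rw [Finset.sum_comm, Finset.sum_congr rfl fun j _ => Finset.sum_comm]
    simp only [Finset.sum_add_distrib]
    rw [e1, e2]
    simp only [← Finset.sum_add_distrib]
    refine Finset.sum_eq_zero fun j _ => Finset.sum_eq_zero fun k _ =>
      Finset.sum_eq_zero fun l _ => ?_
    have := h.cyclic i j k l
    linear_combination (J i a * J j b * J k c * J l d) * this
  trace b d := by
    rw [trace_pull4 hJ]
    exact Finset.sum_eq_zero fun j _ => Finset.sum_eq_zero fun l _ => by rw [h.trace, zero_mul]

lemma frameComp_eq_pull4 (C : Fin n → Fin n → Fin n → Fin n → ℝ) (F : Fin n → Fin n → ℝ) :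
    frameComp C F = pull4 C (of F)ᵀ := rfl

/-- The rank four tensor `C` as a matrix with one row index and three column indices. -/
def rows (C : Fin n → Fin n → Fin n → Fin n → ℝ) : Matrix (Fin n) (Fin n × Fin n × Fin n) ℝ :=
  of fun a p => C a p.1 p.2.1 p.2.2

/-- The rank four tensor `C` as an endomorphism of the tensors of rank two. -/
def pairs (C : Fin n → Fin n → Fin n → Fin n → ℝ) : Matrix (Fin n × Fin n) (Fin n × Fin n) ℝ :=
  of fun p q => C p.1 p.2 q.1 q.2

lemma rows_pull4 (C : Fin n → Fin n → Fin n → Fin n → ℝ) (J : Matrix (Fin n) (Fin n) ℝ) :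
    rows (pull4 C J) = Jᵀ * rows C * (J ⊗ₖ (J ⊗ₖ J)) := by
  ext a p
  simp only [rows, pull4, of_apply, Matrix.mul_apply, Matrix.transpose_apply,
    Matrix.kroneckerMap_apply, Finset.sum_mul]
  conv_rhs => rw [Finset.sum_comm]
  simp only [Fintype.sum_prod_type]
  exact Finset.sum_congr rfl fun i _ => Finset.sum_congr rfl fun j _ =>
    Finset.sum_congr rfl fun k _ => Finset.sum_congr rfl fun l _ => by ring

lemma pairs_pull4 (C : Fin n → Fin n → Fin n → Fin n → ℝ) (J : Matrix (Fin n) (Fin n) ℝ) :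
    pairs (pull4 C J) = (J ⊗ₖ J)ᵀ * pairs C * (J ⊗ₖ J) := by
  ext p q
  simp only [pairs, pull4, of_apply, Matrix.mul_apply, Matrix.transpose_apply,
    Matrix.kroneckerMap_apply, Finset.sum_mul]
  conv_rhs => rw [Finset.sum_comm]
  simp only [Fintype.sum_prod_type]
  exact Finset.sum_congr rfl fun i _ => Finset.sum_congr rfl fun j _ =>
    Finset.sum_congr rfl fun k _ => Finset.sum_congr rfl fun l _ => by ring

lemma S2_eq (G : Matrix (Fin n) (Fin n) ℝ) (C : Fin n → Fin n → Fin n → Fin n → ℝ)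
    (a b : Fin n) : S2 G C a b = (rows C * (G⁻¹ ⊗ₖ (G⁻¹ ⊗ₖ G⁻¹)) * (rows C)ᵀ) a b := by
  simp only [rows, S2, of_apply, Matrix.mul_apply, Matrix.transpose_apply,
    Matrix.kroneckerMap_apply, Finset.sum_mul]
  conv_rhs => rw [Finset.sum_comm]
  simp only [Fintype.sum_prod_type]
  exact Finset.sum_congr rfl fun i _ => Finset.sum_congr rfl fun j _ =>
    Finset.sum_congr rfl fun k _ => Finset.sum_congr rfl fun l _ =>
    Finset.sum_congr rfl fun k _ => Finset.sum_congr rfl fun l _ => by ring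

/-- The matrix `(g a, g' b) ↦ C^{cdef} C_{cdga} C_{efg'b}`. -/
def cubePairs (h : Matrix (Fin n) (Fin n) ℝ) (C : Fin n → Fin n → Fin n → Fin n → ℝ) :
    Matrix (Fin n × Fin n) (Fin n × Fin n) ℝ :=
  (pairs C)ᵀ * (h ⊗ₖ h) * pairs C * (h ⊗ₖ h)ᵀ * pairs C

lemma S3_eq (G : Matrix (Fin n) (Fin n) ℝ) (C : Fin n → Fin n → Fin n → Fin n → ℝ)
    (a b : Fin n) : S3 G C a b = ∑ g, ∑ g', G⁻¹ g g' * cubePairs G⁻¹ C (g, a) (g', b) := by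
  simp only [cubePairs, Matrix.mul_apply, Matrix.transpose_apply, Finset.sum_mul, Finset.mul_sum]
  set h := G⁻¹
  calc S3 G C a b
      = ∑ p : (Fin n × Fin n) × (Fin n × Fin n) × Fin n × (Fin n × Fin n) × (Fin n × Fin n) × Fin n,
        h p.1.1 p.2.2.2.1.1 * h p.1.2 p.2.2.2.1.2 * h p.2.1.1 p.2.2.2.2.1.1
          * h p.2.1.2 p.2.2.2.2.1.2 * h p.2.2.1 p.2.2.2.2.2
          * (pairs C p.2.2.2.1 p.2.2.2.2.1 * pairs C p.1 (p.2.2.1, a)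
            * pairs C p.2.1 (p.2.2.2.2.2, b)) := by
        simp only [Fintype.sum_prod_type]; rfl
    _ = ∑ p : Fin n × Fin n × (Fin n × Fin n) × (Fin n × Fin n) × (Fin n × Fin n) × (Fin n × Fin n),
        h p.1 p.2.1 * (pairs C p.2.2.2.2.2 (p.1, a) * (h ⊗ₖ h) p.2.2.2.2.2 p.2.2.2.2.1
          * pairs C p.2.2.2.2.1 p.2.2.2.1 * (h ⊗ₖ h) p.2.2.1 p.2.2.2.1
          * pairs C p.2.2.1 (p.2.1, b)) := by
        refine Fintype.sum_equiv ⟨fun p => (p.2.2.1, p.2.2.2.2.2, p.2.1, p.2.2.2.2.1, p.2.2.2.1, p.1),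
          fun p => (p.2.2.2.2.2, p.2.2.1, p.1, p.2.2.2.2.1, p.2.2.2.1, p.2.1), fun _ => rfl,
          fun _ => rfl⟩ _ _ fun p => ?_
        simp only [Equiv.coe_fn_mk, Matrix.kroneckerMap_apply]; ring
    _ = _ := by rw [Fintype.sum_prod_type]; simp only [Fintype.sum_prod_type (α₁ := Fin n)
                  (α₂ := (Fin n × Fin n) × (Fin n × Fin n) × (Fin n × Fin n) × (Fin n × Fin n)),
                  Fintype.sum_prod_type (α₁ := Fin n × Fin n)]

section Naturality

variable {G J : Matrix (Fin n) (Fin n) ℝ}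

lemma S2_pull4 (hJ : IsUnit J.det)
    (C : Fin n → Fin n → Fin n → Fin n → ℝ) (a b : Fin n) : S2 (Jᵀ * G * J) (pull4 C J) a b
    = (Jᵀ * of (S2 G C) * J) a b := by
  have h1 : ∀ A B D : Matrix (Fin n) (Fin n) ℝ, (A ⊗ₖ (A ⊗ₖ A)) * (B ⊗ₖ (B ⊗ₖ B))
      * (D ⊗ₖ (D ⊗ₖ D)) = (A * B * D) ⊗ₖ ((A * B * D) ⊗ₖ (A * B * D)) := by
    intro A B D; simp only [← Matrix.mul_kronecker_mul]
  have h2 : ∀ A : Matrix (Fin n) (Fin n) ℝ, (A ⊗ₖ (A ⊗ₖ A))ᵀ = Aᵀ ⊗ₖ (Aᵀ ⊗ₖ Aᵀ) := by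
    intro A; rfl
  have h3 : of (S2 G C) = rows C * (G⁻¹ ⊗ₖ (G⁻¹ ⊗ₖ G⁻¹)) * (rows C)ᵀ := by
    ext a b; exact S2_eq G C a b
  rw [S2_eq, rows_pull4, h3, ← mul_inv_pull (G := G) hJ, ← h1, ← h2, Matrix.transpose_mul,
    Matrix.transpose_mul, Matrix.transpose_transpose]
  simp only [Matrix.mul_assoc]

lemma S3_pull4 (hJ : IsUnit J.det)
    (C : Fin n → Fin n → Fin n → Fin n → ℝ) (a b : Fin n) : S3 (Jᵀ * G * J) (pull4 C J) a b
    = ∑ i, ∑ j, S3 G C i j * (J i a * J j b) := by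
  have hcube : cubePairs (Jᵀ * G * J)⁻¹ (pull4 C J)
      = (J ⊗ₖ J)ᵀ * cubePairs G⁻¹ C * (J ⊗ₖ J) := by
    have h1 : (J ⊗ₖ J) * ((Jᵀ * G * J)⁻¹ ⊗ₖ (Jᵀ * G * J)⁻¹) * (J ⊗ₖ J)ᵀ = G⁻¹ ⊗ₖ G⁻¹ := by
      have : (J ⊗ₖ J)ᵀ = Jᵀ ⊗ₖ Jᵀ := rfl
      rw [this, ← Matrix.mul_kronecker_mul, ← Matrix.mul_kronecker_mul, mul_inv_pull hJ]
    have h2 : (J ⊗ₖ J) * ((Jᵀ * G * J)⁻¹ ⊗ₖ (Jᵀ * G * J)⁻¹)ᵀ * (J ⊗ₖ J)ᵀ = (G⁻¹ ⊗ₖ G⁻¹)ᵀ := by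
      rw [← h1, Matrix.transpose_mul, Matrix.transpose_mul, Matrix.transpose_transpose,
        Matrix.mul_assoc]
    rw [cubePairs, cubePairs, pairs_pull4, ← h2, ← h1]
    simp only [Matrix.transpose_mul, Matrix.transpose_transpose, Matrix.mul_assoc]
  have hX : ∀ g g', cubePairs (Jᵀ * G * J)⁻¹ (pull4 C J) (g, a) (g', b)
      = ∑ i, ∑ k, (∑ j, ∑ l, cubePairs G⁻¹ C (i, j) (k, l) * (J j a * J l b))
        * (J i g * J k g') := by
    intro g g'
    rw [hcube]
    simp only [Matrix.mul_apply, Matrix.transpose_apply, Matrix.kroneckerMap_apply, Finset.sum_mul]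
    rw [Finset.sum_comm]
    simp only [Fintype.sum_prod_type]
    refine Finset.sum_congr rfl fun i _ => ?_
    rw [Finset.sum_comm]
    exact Finset.sum_congr rfl fun k _ => Finset.sum_congr rfl fun j _ =>
      Finset.sum_congr rfl fun l _ => by ring
  simp only [S3_eq, hX]
  rw [sum_inv_pull (mul_inv_pull hJ)]
  simp only [Finset.mul_sum, Finset.sum_mul]
  calc _ = ∑ p : Fin n × Fin n × Fin n × Fin n,
        G⁻¹ p.1 p.2.1 * (cubePairs G⁻¹ C (p.1, p.2.2.1) (p.2.1, p.2.2.2)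
          * (J p.2.2.1 a * J p.2.2.2 b)) := by
        simp only [Fintype.sum_prod_type]
    _ = ∑ p : Fin n × Fin n × Fin n × Fin n,
        G⁻¹ p.2.2.1 p.2.2.2 * cubePairs G⁻¹ C (p.2.2.1, p.1) (p.2.2.2, p.2.1)
          * (J p.1 a * J p.2.1 b) := by
        refine Fintype.sum_equiv ⟨fun p => (p.2.2.1, p.2.2.2, p.1, p.2.1),
          fun p => (p.2.2.1, p.2.2.2, p.1, p.2.1), fun _ => rfl, fun _ => rfl⟩ _ _ fun p => ?_
        simp only [Equiv.coe_fn_mk]; ring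
    _ = _ := by simp only [Fintype.sum_prod_type]

end Naturality

end PointAlgebra

/-! ### Weyl-type tensors in a null basis of a five-dimensional space -/

section NullBasis

open Matrix

/-- The Gram matrix of a null frame. -/
def nullMat : Matrix (Fin 5) (Fin 5) ℝ := of nullGram

/-- The involution of the frame indices that exchanges `ℓ` and `n`; it raises and lowers indices. -/
def dual : Fin 5 → Fin 5 := ![1, 0, 2, 3, 4]

lemma dual_dual (a : Fin 5) : dual (dual a) = a := by revert a; decide

lemma nullMat_apply (a b : Fin 5) : nullMat a b = if b = dual a then 1 else 0 := by
  fin_cases a <;> fin_cases b <;> simp [nullMat, nullGram, dual]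

lemma nullMat_transpose : nullMatᵀ = nullMat := by
  ext a b
  rw [transpose_apply, nullMat_apply, nullMat_apply]
  congr 1
  rw [eq_iff_iff]
  constructor <;> (rintro rfl; rw [dual_dual])

lemma nullMat_mul_self : nullMat * nullMat = 1 := by
  ext a b
  simp only [Matrix.mul_apply, nullMat_apply, ite_mul, one_mul, zero_mul, Finset.sum_ite_eq',
    Finset.mem_univ, if_true, dual_dual, Matrix.one_apply, eq_comm]

lemma nullMat_inv : nullMat⁻¹ = nullMat := Matrix.inv_eq_right_inv nullMat_mul_self

lemma isUnit_det_nullMat : IsUnit nullMat.det := by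
  have := congrArg Matrix.det nullMat_mul_self
  rw [Matrix.det_mul, Matrix.det_one] at this
  exact IsUnit.of_mul_eq_one _ this

lemma sum_nullMat (X : Fin 5 → Fin 5 → ℝ) :
    ∑ a, ∑ b, nullMat a b * X a b = ∑ a, X a (dual a) := by
  simp [nullMat_apply]

lemma isNullFrame_iff (G : Matrix (Fin 5) (Fin 5) ℝ) (F : Fin 5 → Fin 5 → ℝ) :
    IsNullFrame G F ↔ ((of F)ᵀ)ᵀ * G * (of F)ᵀ = nullMat := by
  rw [IsNullFrame, ← Matrix.ext_iff]
  refine forall_congr' fun a => forall_congr' fun b => ?_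
  simp only [nullMat, of_apply, Matrix.mul_apply, Matrix.transpose_apply, Finset.sum_mul]
  rw [Finset.sum_comm]
  simp only [mul_comm (G _ _) (F a _)]

lemma isUnit_det_of_pull {G J : Matrix (Fin 5) (Fin 5) ℝ} (h : Jᵀ * G * J = nullMat) :
    IsUnit G.det ∧ IsUnit J.det := by
  have := isUnit_det_nullMat
  rw [← h, Matrix.det_mul, Matrix.det_mul, Matrix.det_transpose] at this
  exact ⟨isUnit_of_mul_isUnit_right (isUnit_of_mul_isUnit_left this),
    isUnit_of_mul_isUnit_right this⟩

lemma S2_nullMat (C : Fin 5 → Fin 5 → Fin 5 → Fin 5 → ℝ) (a b : Fin 5) :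
    S2 nullMat C a b = ∑ c, ∑ d, ∑ e, C a c d e * C b (dual c) (dual d) (dual e) := by
  simp only [S2, nullMat_inv, nullMat_apply]
  refine Finset.sum_congr rfl fun c _ => Finset.sum_congr rfl fun d _ =>
    Finset.sum_congr rfl fun e _ => ?_
  rw [Finset.sum_eq_single (dual c) (by simp +contextual) (by simp),
    Finset.sum_eq_single (dual d) (by simp +contextual) (by simp),
    Finset.sum_eq_single (dual e) (by simp +contextual) (by simp)]
  simp

lemma S3_nullMat (C : Fin 5 → Fin 5 → Fin 5 → Fin 5 → ℝ) (a b : Fin 5) :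
    S3 nullMat C a b = ∑ c, ∑ d, ∑ e, ∑ f, ∑ g, C (dual c) (dual d) (dual e) (dual f) * C c d g a
      * C e f (dual g) b := by
  simp only [S3, nullMat_inv, nullMat_apply]
  refine Finset.sum_congr rfl fun c _ => Finset.sum_congr rfl fun d _ =>
    Finset.sum_congr rfl fun e _ => Finset.sum_congr rfl fun f _ =>
    Finset.sum_congr rfl fun g _ => ?_
  rw [Finset.sum_eq_single (dual c) (by simp +contextual) (by simp),
    Finset.sum_eq_single (dual d) (by simp +contextual) (by simp),
    Finset.sum_eq_single (dual e) (by simp +contextual) (by simp),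
    Finset.sum_eq_single (dual f) (by simp +contextual) (by simp),
    Finset.sum_eq_single (dual g) (by simp +contextual) (by simp)]
  simp

/-- All components of positive boost weight vanish. -/
def NonposWeight (C : Fin 5 → Fin 5 → Fin 5 → Fin 5 → ℝ) : Prop :=
  ∀ a b c d, 0 < boostWeight a b c d → C a b c d = 0

section Components

variable {C : Fin 5 → Fin 5 → Fin 5 → Fin 5 → ℝ}

/-! The following rewriting rules bring the indices of a component into the canonical order. -/

lemma IsWeyl.swap_left {G} (h : IsWeyl G C) {a b : Fin 5} (_ : b < a) (c d : Fin 5) :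
    C a b c d = - C b a c d := h.left b a c d

lemma IsWeyl.swap_right {G} (h : IsWeyl G C) (a b : Fin 5) {c d : Fin 5} (_ : d < c) :
    C a b c d = - C a b d c := h.right a b d c

lemma IsWeyl.swap_pair {G} (h : IsWeyl G C) {a b c d : Fin 5} (_ : c < a ∨ c = a ∧ d < b) :
    C a b c d = C c d a b := h.pair a b c d

lemma IsWeyl.diag_left {G} (h : IsWeyl G C) (a c d : Fin 5) : C a a c d = 0 := by
  linarith [h.left a a c d]

lemma IsWeyl.diag_right {G} (h : IsWeyl G C) (a b c : Fin 5) : C a b c c = 0 := by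
  linarith [h.right a b c c]

lemma IsWeyl.trace_nullMat (h : IsWeyl nullMat C) (b d : Fin 5) :
    C 0 b 1 d + C 1 b 0 d + C 2 b 2 d + C 3 b 3 d + C 4 b 4 d = 0 := by
  have := h.trace b d
  rw [nullMat_inv, sum_nullMat, Fin.sum_univ_five] at this
  exact this

/-- The components of boost weight zero are determined by the `3 × 3` matrix `C_{0i1j}`. -/
lemma IsWeyl.weight_zero (h : IsWeyl nullMat C) :
    C 0 1 0 1 = C 0 2 1 2 + C 0 3 1 3 + C 0 4 1 4 ∧
    C 0 1 2 3 = C 0 2 1 3 - C 0 3 1 2 ∧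
    C 0 1 2 4 = C 0 2 1 4 - C 0 4 1 2 ∧
    C 0 1 3 4 = C 0 3 1 4 - C 0 4 1 3 ∧
    C 2 3 2 3 = C 0 4 1 4 - C 0 2 1 2 - C 0 3 1 3 ∧
    C 2 4 2 4 = C 0 3 1 3 - C 0 2 1 2 - C 0 4 1 4 ∧
    C 3 4 3 4 = C 0 2 1 2 - C 0 3 1 3 - C 0 4 1 4 ∧
    C 2 3 2 4 = - (C 0 3 1 4 + C 0 4 1 3) ∧
    C 2 3 3 4 = C 0 2 1 4 + C 0 4 1 2 ∧
    C 2 4 3 4 = - (C 0 2 1 3 + C 0 3 1 2) := by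
  have t01 := h.trace_nullMat 0 1
  have t22 := h.trace_nullMat 2 2
  have t33 := h.trace_nullMat 3 3
  have t44 := h.trace_nullMat 4 4
  have t34 := h.trace_nullMat 3 4
  have t24 := h.trace_nullMat 2 4
  have t23 := h.trace_nullMat 2 3
  have c23 := h.cyclic 0 1 2 3
  have c24 := h.cyclic 0 1 2 4
  have c34 := h.cyclic 0 1 3 4
  simp (disch := decide) only [h.diag_left, h.diag_right, h.swap_left, h.swap_right, h.swap_pair]
    at t01 t22 t33 t44 t34 t24 t23 c23 c24 c34
  refine ⟨?_, ?_, ?_, ?_, ?_, ?_, ?_, ?_, ?_, ?_⟩ <;> linarith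

end Components

end NullBasis

/-! ### The normal form of a type II Weyl tensor with `S⁽²⁾ ∝ g` -/

section NormalForm

open Matrix

set_option linter.unusedSimpArgs false

/-- The form `ℓ ∧ n`. -/
def modelU (a b : Fin 5) : ℤ := if a = 0 ∧ b = 1 then 1 else if a = 1 ∧ b = 0 then -1 else 0

/-- The form `m⁽²⁾ ∧ m⁽³⁾`. -/
def modelV (a b : Fin 5) : ℤ := if a = 2 ∧ b = 3 then 1 else if a = 3 ∧ b = 2 then -1 else 0

/-- The metric of the plane of `ℓ` and `n`. -/
def modelP (a b : Fin 5) : ℤ := if a = 0 ∧ b = 1 ∨ a = 1 ∧ b = 0 then 1 else 0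

/-- The metric of the plane of `m⁽²⁾` and `m⁽³⁾`. -/
def modelQ (a b : Fin 5) : ℤ := if a = b ∧ (a = 2 ∨ a = 3) then 1 else 0

/-- The Weyl tensor of type D on the span of `ℓ, n, m⁽²⁾, m⁽³⁾` whose four-dimensional Weyl scalar
`Ψ₂` has the phase of `1 + i`. It is annihilated by `m⁽⁴⁾`, and `C_{acde} C_b^{cde} = 0`. -/
def model (a b c d : Fin 5) : ℤ :=
  2 * modelU a b * modelU c d - 2 * modelV a b * modelV c d
    + 2 * (modelU a b * modelV c d + modelV a b * modelU c d)
    + (modelP a c * modelQ b d + modelQ a c * modelP b d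
      - modelP a d * modelQ b c - modelQ a d * modelP b c)
    + (modelU a c * modelV b d + modelV a c * modelU b d
      - modelU a d * modelV b c - modelV a d * modelU b c)

lemma model_left (a b c d : Fin 5) : model b a c d = - model a b c d := by
  revert a b c d; decide +kernel

lemma model_right (a b c d : Fin 5) : model a b d c = - model a b c d := by
  revert a b c d; decide +kernel

lemma model_cyclic (a b c d : Fin 5) : model a b c d + model a c d b + model a d b c = 0 := by
  revert a b c d; decide +kernel

lemma model_trace (b d : Fin 5) : ∑ a, model a b (dual a) d = 0 := by
  revert b d; decide +kernel

lemma model_weight (a b c d : Fin 5) (h : boostWeight a b c d ≠ 0) : model a b c d = 0 := by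
  revert a b c d; decide +kernel

lemma isWeyl_model (s : ℝ) : IsWeyl nullMat fun a b c d => s * model a b c d where
  left a b c d := by rw [model_left a b]; push_cast; ring
  right a b c d := by rw [model_right a b c d]; push_cast; ring
  cyclic a b c d := by
    have : (model a b c d : ℝ) + model a c d b + model a d b c = 0 := by
      exact_mod_cast model_cyclic a b c d
    linear_combination s * this
  trace b d := by
    rw [nullMat_inv, sum_nullMat, ← Finset.mul_sum]
    have : ∑ a, (model a b (dual a) d : ℝ) = 0 := by exact_mod_cast model_trace b d
    rw [this, mul_zero]

variable {C : Fin 5 → Fin 5 → Fin 5 → Fin 5 → ℝ}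

lemma IsWeyl.sub {G} {C D : Fin 5 → Fin 5 → Fin 5 → Fin 5 → ℝ} (hC : IsWeyl G C)
    (hD : IsWeyl G D) : IsWeyl G fun a b c d => C a b c d - D a b c d where
  left a b c d := by rw [hC.left, hD.left]; ring
  right a b c d := by rw [hC.right, hD.right]; ring
  cyclic a b c d := by linear_combination hC.cyclic a b c d - hD.cyclic a b c d
  trace b d := by
    simp only [mul_sub, Finset.sum_sub_distrib]; rw [hC.trace, hD.trace, sub_zero]

/-- An identity between components that is compatible with the antisymmetries needs to be checked
for increasing pairs of indices only. -/
lemma IsWeyl.eq_zero_of_lt {G} (h : IsWeyl G C) (P : Fin 5 → Fin 5 → Fin 5 → Fin 5 → Prop)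
    (hP1 : ∀ a b c d, P a b c d → P b a c d) (hP2 : ∀ a b c d, P a b c d → P a b d c)
    (H : ∀ a b c d, a < b → c < d → P a b c d → C a b c d = 0) (a b c d : Fin 5)
    (hp : P a b c d) : C a b c d = 0 := by
  have H1 : ∀ a b c d, c < d → P a b c d → C a b c d = 0 := by
    intro a b c d hcd hp
    rcases lt_trichotomy a b with hab | rfl | hab
    · exact H a b c d hab hcd hp
    · exact h.diag_left _ _ _
    · rw [h.left b a, H b a c d hab hcd (hP1 _ _ _ _ hp), neg_zero]
  rcases lt_trichotomy c d with hcd | rfl | hcd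
  · exact H1 a b c d hcd hp
  · exact h.diag_right _ _ _
  · rw [h.right a b d c, H1 a b d c hcd (hP2 _ _ _ _ hp), neg_zero]

lemma boostWeight_swap_left (a b c d : Fin 5) : boostWeight b a c d = boostWeight a b c d := by
  simp only [boostWeight]; ring

lemma boostWeight_swap_right (a b c d : Fin 5) : boostWeight a b d c = boostWeight a b c d := by
  simp only [boostWeight]; ring

/-- The components of boost weight zero vanish if the nine components `C_{0i1j}` do. -/
lemma IsWeyl.weight_zero_eq_zero (h : IsWeyl nullMat C)
    (hΦ : C 0 2 1 2 = 0 ∧ C 0 2 1 3 = 0 ∧ C 0 2 1 4 = 0 ∧ C 0 3 1 2 = 0 ∧ C 0 3 1 3 = 0 ∧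
      C 0 3 1 4 = 0 ∧ C 0 4 1 2 = 0 ∧ C 0 4 1 3 = 0 ∧ C 0 4 1 4 = 0)
    (a b c d : Fin 5) (hw : boostWeight a b c d = 0) : C a b c d = 0 := by
  obtain ⟨p1, p2, p3, p4, p5, p6, p7, p8, p9⟩ := hΦ
  obtain ⟨w1, w2, w3, w4, w5, w6, w7, w8, w9, w10⟩ := h.weight_zero
  simp only [p1, p2, p3, p4, p5, p6, p7, p8, p9, add_zero, sub_zero, neg_zero] at w1 w2 w3 w4 w5 w6 w7 w8 w9 w10
  refine h.eq_zero_of_lt (fun a b c d => boostWeight a b c d = 0)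
    (fun a b c d h' => by rw [boostWeight_swap_left, h'])
    (fun a b c d h' => by rw [boostWeight_swap_right, h']) ?_ a b c d hw
  clear hw a b c d
  intro a b c d hab hcd hw
  fin_cases a <;> fin_cases b <;> first
    | exact absurd hab (by decide)
    | (fin_cases c <;> fin_cases d <;> first
        | exact absurd hcd (by decide)
        | exact absurd hw (by decide)
        | assumption
        | (refine (h.pair _ _ _ _).trans ?_; assumption))

/-- The components of boost weight zero are those of `s` times the model tensor. -/
def HasModel (C : Fin 5 → Fin 5 → Fin 5 → Fin 5 → ℝ) (s : ℝ) : Prop :=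
  ∀ a b c d, boostWeight a b c d = 0 → C a b c d = s * model a b c d

lemma IsWeyl.hasModel (h : IsWeyl nullMat C) (s : ℝ)
    (hΦ : C 0 2 1 2 = s ∧ C 0 2 1 3 = s ∧ C 0 2 1 4 = 0 ∧ C 0 3 1 2 = -s ∧ C 0 3 1 3 = s ∧
      C 0 3 1 4 = 0 ∧ C 0 4 1 2 = 0 ∧ C 0 4 1 3 = 0 ∧ C 0 4 1 4 = 0) : HasModel C s := by
  intro a b c d hw
  rw [← sub_eq_zero]
  have m : model 0 2 1 2 = 1 ∧ model 0 2 1 3 = 1 ∧ model 0 2 1 4 = 0 ∧ model 0 3 1 2 = -1 ∧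
    model 0 3 1 3 = 1 ∧ model 0 3 1 4 = 0 ∧ model 0 4 1 2 = 0 ∧ model 0 4 1 3 = 0 ∧
    model 0 4 1 4 = 0 := by decide +kernel
  refine (h.sub (isWeyl_model s)).weight_zero_eq_zero ?_ a b c d hw
  simp only [hΦ, m]
  norm_num

/-- The components of positive boost weight in canonical order. -/
lemma NonposWeight.canonical (hC : NonposWeight C) :
    (C 0 1 0 2 = 0 ∧ C 0 1 0 3 = 0 ∧ C 0 1 0 4 = 0) ∧
    (C 0 2 0 2 = 0 ∧ C 0 2 0 3 = 0 ∧ C 0 2 0 4 = 0 ∧ C 0 3 0 3 = 0 ∧ C 0 3 0 4 = 0 ∧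
      C 0 4 0 4 = 0) ∧
    (C 0 2 2 3 = 0 ∧ C 0 2 2 4 = 0 ∧ C 0 2 3 4 = 0) ∧
    (C 0 3 2 3 = 0 ∧ C 0 3 2 4 = 0 ∧ C 0 3 3 4 = 0) ∧
    (C 0 4 2 3 = 0 ∧ C 0 4 2 4 = 0 ∧ C 0 4 3 4 = 0) := by
  refine ⟨⟨?_, ?_, ?_⟩, ⟨?_, ?_, ?_, ?_, ?_, ?_⟩, ⟨?_, ?_, ?_⟩, ⟨?_, ?_, ?_⟩, ⟨?_, ?_, ?_⟩⟩ <;>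
    exact hC _ _ _ _ (by decide)

lemma dual_values : dual 0 = 1 ∧ dual 1 = 0 ∧ dual 2 = 2 ∧ dual 3 = 3 ∧ dual 4 = 4 :=
  ⟨rfl, rfl, rfl, rfl, rfl⟩

/-- The components of boost weight zero of `S⁽²⁾` when the symmetric part of `C_{0i1j}` is
diagonal. -/
lemma S2_of_diagonal (h : IsWeyl nullMat C) (hC : NonposWeight C) (h3 : C 0 3 1 2 = - C 0 2 1 3)
    (h4 : C 0 4 1 2 = - C 0 2 1 4) (h5 : C 0 4 1 3 = - C 0 3 1 4) :
    S2 nullMat C 2 3 = 12 * (C 0 2 1 4 * C 0 3 1 4) * (-1) ∧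
    S2 nullMat C 2 4 = 12 * (C 0 2 1 3 * C 0 3 1 4) ∧
    S2 nullMat C 3 4 = 12 * (C 0 2 1 3 * C 0 2 1 4) * (-1) ∧
    S2 nullMat C 0 1 = 2 * (C 0 2 1 2 + C 0 3 1 3 + C 0 4 1 4) ^ 2
      + 2 * (C 0 2 1 2 ^ 2 + C 0 3 1 3 ^ 2 + C 0 4 1 4 ^ 2)
      - 12 * (C 0 2 1 3 ^ 2 + C 0 2 1 4 ^ 2 + C 0 3 1 4 ^ 2) ∧
    S2 nullMat C 2 2 = 8 * C 0 2 1 2 ^ 2 + 4 * (C 0 3 1 3 - C 0 4 1 4) ^ 2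
      - 12 * (C 0 2 1 3 ^ 2 + C 0 2 1 4 ^ 2) ∧
    S2 nullMat C 3 3 = 8 * C 0 3 1 3 ^ 2 + 4 * (C 0 2 1 2 - C 0 4 1 4) ^ 2
      - 12 * (C 0 2 1 3 ^ 2 + C 0 3 1 4 ^ 2) ∧
    S2 nullMat C 4 4 = 8 * C 0 4 1 4 ^ 2 + 4 * (C 0 2 1 2 - C 0 3 1 3) ^ 2
      - 12 * (C 0 2 1 4 ^ 2 + C 0 3 1 4 ^ 2) := by
  obtain ⟨⟨p1, p2, p3⟩, ⟨p4, p5, p6, p7, p8, p9⟩, ⟨p10, p11, p12⟩, ⟨p13, p14, p15⟩,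
    ⟨p16, p17, p18⟩⟩ := hC.canonical
  obtain ⟨w1, w2, w3, w4, w5, w6, w7, w8, w9, w10⟩ := h.weight_zero
  obtain ⟨d0, d1, d2, d3, d4⟩ := dual_values
  simp only [S2_nullMat, Fin.sum_univ_five, d0, d1, d2, d3, d4]
  refine ⟨?_, ?_, ?_, ?_, ?_, ?_, ?_⟩ <;>
  · simp (disch := decide) only [h.diag_left, h.diag_right, h.swap_left, h.swap_right, h.swap_pair,
      mul_zero, zero_mul, add_zero, zero_add, neg_zero,
      p1, p2, p3, p4, p5, p6, p7, p8, p9, p10, p11, p12, p13, p14, p15, p16, p17, p18,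
      w1, w2, w3, w4, w5, w6, w7, w8, w9, w10, h3, h4, h5]
    ring

/-- The real solutions of the diagonal equations of `S⁽²⁾ ∝ g`. -/
lemma solve_diagonal {x y z a : ℝ}
    (h1 : 8 * x ^ 2 + 4 * (y - z) ^ 2 = 2 * (x + y + z) ^ 2 + 2 * (x ^ 2 + y ^ 2 + z ^ 2))
    (h2 : 8 * y ^ 2 + 4 * (x - z) ^ 2 = 2 * (x + y + z) ^ 2 + 2 * (x ^ 2 + y ^ 2 + z ^ 2))
    (h3 : 8 * z ^ 2 + 4 * (x - y) ^ 2 + 12 * a ^ 2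
      = 2 * (x + y + z) ^ 2 + 2 * (x ^ 2 + y ^ 2 + z ^ 2)) :
    x = y ∧ z = 0 ∧ (a = x ∨ a = -x) := by
  have hprod : (x - y) * (x + y + 2 * z) = 0 := by linear_combination (h1 - h2) / 4
  have hsq : ∀ t : ℝ, t ^ 2 = 0 → t = 0 := fun t ht => by simpa using ht
  rcases mul_eq_zero.1 hprod with hxy | hxyz
  · have hxy : x = y := by linarith
    subst hxy
    have hxz : x * z = 0 := by linear_combination (-1 / 16) * h1
    rcases mul_eq_zero.1 hxz with hx | hz
    · subst hx
      have hz : z = 0 := hsq z (by nlinarith [sq_nonneg z, sq_nonneg a])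
      subst hz
      have ha : a = 0 := hsq a (by nlinarith)
      simp [ha]
    · subst hz
      have ha : (a - x) * (a + x) = 0 := by linear_combination h3 / 12
      rcases mul_eq_zero.1 ha with ha | ha
      · exact ⟨rfl, rfl, Or.inl (by linarith)⟩
      · exact ⟨rfl, rfl, Or.inr (by linarith)⟩
  · have hy : y = -x - 2 * z := by linarith
    subst hy
    have hz : z = 0 := hsq z (by nlinarith [sq_nonneg z, sq_nonneg (x + z)])
    subst hz
    have hx : x = 0 := hsq x (by nlinarith [sq_nonneg x])
    subst hx
    have ha : a = 0 := hsq a (by nlinarith)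
    simp [ha]

end NormalForm

/-! ### Changes of null frame that preserve the filtration by boost weight -/

section Adapted

set_option linter.unusedSimpArgs false

open Matrix
open scoped Kronecker

variable {C : Fin 5 → Fin 5 → Fin 5 → Fin 5 → ℝ} {J J' : Matrix (Fin 5) (Fin 5) ℝ}

lemma pull4_pull4 {n : ℕ} (C : Fin n → Fin n → Fin n → Fin n → ℝ)
    (J J' : Matrix (Fin n) (Fin n) ℝ) : pull4 (pull4 C J) J' = pull4 C (J * J') := by
  have h : pairs (pull4 (pull4 C J) J') = pairs (pull4 C (J * J')) := by
    rw [pairs_pull4, pairs_pull4, pairs_pull4, Matrix.mul_kronecker_mul, Matrix.transpose_mul]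
    simp only [Matrix.mul_assoc]
  funext a b c d
  exact congrFun (congrFun h (a, b)) (c, d)

/-- A change of null frame, the columns of `J` being the new frame, in which each new vector is a
combination of old vectors of at least its boost weight. These are the changes that fix the
direction of `ℓ`. -/
structure IsAdapted (J : Matrix (Fin 5) (Fin 5) ℝ) : Prop where
  gram : Jᵀ * nullMat * J = nullMat
  tri : ∀ i a, indexWeight i < indexWeight a → J i a = 0

lemma IsAdapted.mul (h : IsAdapted J) (h' : IsAdapted J') : IsAdapted (J * J') where
  gram := by
    calc (J * J')ᵀ * nullMat * (J * J') = J'ᵀ * (Jᵀ * nullMat * J) * J' := by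
          simp only [Matrix.transpose_mul, Matrix.mul_assoc]
      _ = nullMat := by rw [h.gram, h'.gram]
  tri i a hia := by
    rw [Matrix.mul_apply]
    refine Finset.sum_eq_zero fun k _ => ?_
    rcases lt_or_ge (indexWeight i) (indexWeight k) with hk | hk
    · rw [h.tri i k hk, zero_mul]
    · rw [h'.tri k a (hk.trans_lt hia), mul_zero]

lemma indexWeight_dual (a : Fin 5) : indexWeight (dual a) = - indexWeight a := by
  revert a; decide

lemma IsAdapted.isUnit_det (h : IsAdapted J) : IsUnit J.det := (isUnit_det_of_pull h.gram).2

lemma IsAdapted.exists_inv (h : IsAdapted J) : ∃ J', IsAdapted J' ∧ J * J' = 1 := by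
  have hl : (nullMat * Jᵀ * nullMat) * J = 1 := by
    rw [Matrix.mul_assoc, Matrix.mul_assoc, ← Matrix.mul_assoc Jᵀ, h.gram, nullMat_mul_self]
  have hr : J * (nullMat * Jᵀ * nullMat) = 1 := mul_eq_one_comm.1 hl
  refine ⟨_, ⟨?_, fun i a hia => ?_⟩, hr⟩
  · calc (nullMat * Jᵀ * nullMat)ᵀ * nullMat * (nullMat * Jᵀ * nullMat)
        = nullMat * (J * (nullMat * nullMat) * (nullMat * Jᵀ * nullMat)) := by
          simp only [Matrix.transpose_mul, nullMat_transpose, Matrix.transpose_transpose,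
            Matrix.mul_assoc]
      _ = nullMat := by rw [nullMat_mul_self, Matrix.mul_one, hr, Matrix.mul_one]
  · have : (nullMat * Jᵀ * nullMat) i a = J (dual a) (dual i) := by
      have h1 : ∀ k, nullMat k a = if k = dual a then 1 else 0 := fun k => by
        rw [← nullMat_transpose, Matrix.transpose_apply, nullMat_apply]
      simp only [Matrix.mul_apply, nullMat_apply i, h1]
      simp
    rw [this]
    exact h.tri _ _ (by rw [indexWeight_dual, indexWeight_dual]; linarith)

lemma IsWeyl.pull_adapted (h : IsWeyl nullMat C) (hJ : IsAdapted J) :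
    IsWeyl nullMat (pull4 C J) := by
  have := h.pull hJ.isUnit_det
  rwa [hJ.gram] at this

/-- An adapted change of frame preserves the vanishing of the components of large boost weight. -/
lemma IsAdapted.pull_eq_zero (hJ : IsAdapted J) {w : ℤ}
    (hC : ∀ a b c d, w < boostWeight a b c d → C a b c d = 0) (a b c d : Fin 5)
    (hw : w < boostWeight a b c d) : pull4 C J a b c d = 0 := by
  refine Finset.sum_eq_zero fun i _ => Finset.sum_eq_zero fun j _ => Finset.sum_eq_zero fun k _ =>
    Finset.sum_eq_zero fun l _ => ?_
  by_cases hi : indexWeight i < indexWeight a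
  · simp [hJ.tri i a hi]
  by_cases hj : indexWeight j < indexWeight b
  · simp [hJ.tri j b hj]
  by_cases hk : indexWeight k < indexWeight c
  · simp [hJ.tri k c hk]
  by_cases hl : indexWeight l < indexWeight d
  · simp [hJ.tri l d hl]
  rw [hC i j k l (by simp only [boostWeight] at hw ⊢; omega)]
  simp

lemma NonposWeight.pull (hJ : IsAdapted J) (hC : NonposWeight C) : NonposWeight (pull4 C J) :=
  hJ.pull_eq_zero hC

lemma gram_apply (X : Matrix (Fin 5) (Fin 5) ℝ) (a b : Fin 5) : (Xᵀ * nullMat * X) a b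
    = X 1 a * X 0 b + X 0 a * X 1 b + X 2 a * X 2 b + X 3 a * X 3 b + X 4 a * X 4 b := by
  obtain ⟨d0, d1, d2, d3, d4⟩ := dual_values
  have h1 : ∀ k, (Xᵀ * nullMat) a k = X (dual k) a := fun k => by
    have h2 : ∀ i, nullMat i k = if i = dual k then 1 else 0 := fun i => by
      rw [← nullMat_transpose, Matrix.transpose_apply, nullMat_apply]
    simp [Matrix.mul_apply, h2]
  simp only [Matrix.mul_apply (M := Xᵀ * nullMat), h1, Fin.sum_univ_five, d0, d1, d2, d3, d4]

/-- The spin by an orthogonal matrix. -/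
def spin (U : Matrix (Fin 3) (Fin 3) ℝ) : Matrix (Fin 5) (Fin 5) ℝ :=
  !![1, 0, 0, 0, 0; 0, 1, 0, 0, 0; 0, 0, U 0 0, U 0 1, U 0 2; 0, 0, U 1 0, U 1 1, U 1 2;
    0, 0, U 2 0, U 2 1, U 2 2]

lemma isAdapted_spin {U : Matrix (Fin 3) (Fin 3) ℝ} (hU : Uᵀ * U = 1) : IsAdapted (spin U) where
  gram := by
    have e : ∀ i j, U 0 i * U 0 j + U 1 i * U 1 j + U 2 i * U 2 j = if i = j then 1 else 0 := by
      intro i j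
      have := congrFun (congrFun hU i) j
      simpa [Matrix.mul_apply, Fin.sum_univ_three, Matrix.one_apply] using this
    ext a b
    rw [gram_apply]
    fin_cases a <;> fin_cases b <;>
      simp [spin, nullMat, nullGram, e]
  tri i a h := by
    fin_cases i <;> fin_cases a <;> first
      | exact absurd h (by decide)
      | simp [spin]

/-- The spatial index `m⁽ⁱ⁺²⁾`. -/
def sp : Fin 3 → Fin 5 := ![2, 3, 4]

lemma pull4_spin (C : Fin 5 → Fin 5 → Fin 5 → Fin 5 → ℝ) (U : Matrix (Fin 3) (Fin 3) ℝ)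
    (i j : Fin 3) : pull4 C (spin U) 0 (sp i) 1 (sp j)
      = (Uᵀ * of (fun k l => C 0 (sp k) 1 (sp l)) * U) i j := by
  have h0 : ∀ k, spin U k 0 = if k = 0 then 1 else 0 := by intro k; fin_cases k <;> simp [spin]
  have h1 : ∀ k, spin U k 1 = if k = 1 then 1 else 0 := by intro k; fin_cases k <;> simp [spin]
  have h2 : ∀ (i : Fin 3) (X : Fin 5 → ℝ), ∑ k, X k * spin U k (sp i) = ∑ k, X (sp k) * U k i := by
    intro i X
    fin_cases i <;> simp [spin, Fin.sum_univ_five, Fin.sum_univ_three, sp]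
  calc pull4 C (spin U) 0 (sp i) 1 (sp j)
      = ∑ b, (∑ d, C 0 b 1 d * spin U d (sp j)) * spin U b (sp i) := by
        simp only [pull4, h0, h1]
        simp only [mul_ite, mul_one, mul_zero, ite_mul, zero_mul, Finset.sum_ite_irrel,
          Finset.sum_const_zero, Finset.sum_ite_eq', Finset.mem_univ, if_true, Finset.sum_mul]
        exact Finset.sum_congr rfl fun b _ => Finset.sum_congr rfl fun d _ => by ring
    _ = ∑ b, (∑ d, C 0 (sp b) 1 (sp d) * U d j) * U b i := by
        rw [h2 i fun b => ∑ d, C 0 b 1 d * spin U d (sp j)]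
        simp only [h2]
    _ = _ := by
        simp only [Matrix.mul_apply, Matrix.transpose_apply, of_apply, Finset.sum_mul]
        rw [Finset.sum_comm]
        exact Finset.sum_congr rfl fun b _ => Finset.sum_congr rfl fun d _ => by ring

/-- The null rotation about `ℓ` with parameters `x, y, z`. -/
def nullRot (x y z : ℝ) : Matrix (Fin 5) (Fin 5) ℝ :=
  !![1, - (x ^ 2 + y ^ 2 + z ^ 2) / 2, -x, -y, -z; 0, 1, 0, 0, 0; 0, x, 1, 0, 0; 0, y, 0, 1, 0;
    0, z, 0, 0, 1]

lemma isAdapted_nullRot (x y z : ℝ) : IsAdapted (nullRot x y z) where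
  gram := by
    ext a b
    rw [gram_apply]
    fin_cases a <;> fin_cases b <;> simp [nullRot, nullMat, nullGram]
    ring
  tri i a h := by
    fin_cases i <;> fin_cases a <;> first
      | exact absurd h (by decide)
      | simp [nullRot]

/-! #### The normal form -/

/-- In a suitable null frame with the same direction of `ℓ`, the components of boost weight zero are
a multiple of the model. -/
def Normalizable (C : Fin 5 → Fin 5 → Fin 5 → Fin 5 → ℝ) : Prop :=
  ∃ J, IsAdapted J ∧ ∃ s, HasModel (pull4 C J) s

lemma IsAdapted.normalizable (hJ : IsAdapted J) (h : Normalizable (pull4 C J)) :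
    Normalizable C := by
  obtain ⟨J', h', s, hs⟩ := h
  exact ⟨J * J', hJ.mul h', s, by rwa [← pull4_pull4]⟩

lemma pull4_one {n : ℕ} (C : Fin n → Fin n → Fin n → Fin n → ℝ) : pull4 C 1 = C := by
  have : pairs (pull4 C 1) = pairs C := by
    rw [pairs_pull4, Matrix.one_kronecker_one, Matrix.transpose_one, Matrix.one_mul, Matrix.mul_one]
  funext a b c d
  exact congrFun (congrFun this (a, b)) (c, d)

lemma isAdapted_one : IsAdapted 1 where
  gram := by rw [Matrix.transpose_one, Matrix.one_mul, Matrix.mul_one]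
  tri i a h := Matrix.one_apply_ne fun e => by simp [e] at h

lemma HasModel.normalizable {s : ℝ} (h : HasModel C s) : Normalizable C :=
  ⟨1, isAdapted_one, s, by rwa [pull4_one]⟩

/-- The matrix `C_{0i1j}`. -/
def weightZero (C : Fin 5 → Fin 5 → Fin 5 → Fin 5 → ℝ) : Matrix (Fin 3) (Fin 3) ℝ :=
  of fun i j => C 0 (sp i) 1 (sp j)

lemma weightZero_spin (C : Fin 5 → Fin 5 → Fin 5 → Fin 5 → ℝ) (U : Matrix (Fin 3) (Fin 3) ℝ) :
    weightZero (pull4 C (spin U)) = Uᵀ * weightZero C * U := by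
  ext i j
  exact pull4_spin C U i j

lemma S2_adapted (hJ : IsAdapted J) {K : ℝ} (hK : ∀ a b, S2 nullMat C a b = K * nullMat a b)
    (a b : Fin 5) : S2 nullMat (pull4 C J) a b = K * nullMat a b := by
  have := S2_pull4 (G := nullMat) hJ.isUnit_det C a b
  rw [hJ.gram] at this
  rw [this]
  have : of (S2 nullMat C) = K • nullMat := by ext a b; exact hK a b
  rw [this, Matrix.mul_smul, Matrix.smul_mul, hJ.gram]
  rfl

/-- The permutation of the spatial indices by `σ`, as an orthogonal matrix. -/
lemma weightZero_perm (C : Fin 5 → Fin 5 → Fin 5 → Fin 5 → ℝ) (σ : Equiv.Perm (Fin 3)) :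
    ∃ J, IsAdapted J ∧ ∀ i j, weightZero (pull4 C J) i j = weightZero C (σ i) (σ j) := by
  refine ⟨spin (of fun k i => if k = σ i then 1 else 0), isAdapted_spin ?_, fun i j => ?_⟩
  · ext i j
    simp [Matrix.mul_apply, Matrix.one_apply, eq_comm]
  · rw [weightZero_spin]
    simp [Matrix.mul_apply]

lemma normalizable_of_planar (h : IsWeyl nullMat C) (hC : NonposWeight C) {K : ℝ}
    (hK : ∀ a b, S2 nullMat C a b = K * nullMat a b)
    (hd : ∀ i j, i ≠ j → weightZero C i j = - weightZero C j i)
    (h02 : weightZero C 0 2 = 0) (h12 : weightZero C 1 2 = 0) : Normalizable C := by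
  have e10 := hd 1 0 (by decide)
  have e20 := hd 2 0 (by decide)
  have e21 := hd 2 1 (by decide)
  simp only [weightZero, of_apply, sp, Matrix.cons_val] at e10 e20 e21 h02 h12
  obtain ⟨-, -, -, s01, s22, s33, s44⟩ := S2_of_diagonal h hC e10 e20 e21
  rw [hK, nullMat_apply] at s01 s22 s33 s44
  simp only [dual_values, if_true, mul_one] at s01 s22 s33 s44
  rw [h02, h12] at s01
  rw [h02] at s22
  rw [h12] at s33
  rw [h02, h12] at s44
  obtain ⟨hxy, hz, ha⟩ := solve_diagonal (x := C 0 2 1 2) (y := C 0 3 1 3) (z := C 0 4 1 4)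
    (a := C 0 2 1 3) (by linarith) (by linarith) (by linarith)
  have fin : ∀ {C : Fin 5 → Fin 5 → Fin 5 → Fin 5 → ℝ}, IsWeyl nullMat C →
      ∀ s, weightZero C = !![s, s, 0; -s, s, 0; 0, 0, 0] → Normalizable C := by
    intro C h s hs
    have e : ∀ i j, C 0 (sp i) 1 (sp j) = (!![s, s, 0; -s, s, 0; 0, 0, 0] : Matrix _ _ ℝ) i j :=
      fun i j => congrFun (congrFun hs i) j
    refine (h.hasModel s ⟨?_, ?_, ?_, ?_, ?_, ?_, ?_, ?_, ?_⟩).normalizable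
    exacts [e 0 0, e 0 1, e 0 2, e 1 0, e 1 1, e 1 2, e 2 0, e 2 1, e 2 2]
  rw [h02, neg_zero] at e20
  rw [h12, neg_zero] at e21
  rcases ha with ha | ha
  · refine fin h (C 0 2 1 2) ?_
    ext i j
    fin_cases i <;> fin_cases j <;>
      simp [weightZero, sp, h02, h12, e10, e20, e21, ha, ← hxy, hz]
  · obtain ⟨J, hJ, e⟩ := weightZero_perm C (Equiv.swap 0 1)
    refine hJ.normalizable (fin (h.pull_adapted hJ) (C 0 2 1 2) ?_)
    ext i j
    rw [e]
    fin_cases i <;> fin_cases j <;>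
      simp [weightZero, sp, h02, h12, e10, e20, e21, ha, ← hxy, hz, Equiv.swap_apply_def]

lemma normalizable_of_diagonal (h : IsWeyl nullMat C) (hC : NonposWeight C) {K : ℝ}
    (hK : ∀ a b, S2 nullMat C a b = K * nullMat a b)
    (hd : ∀ i j, i ≠ j → weightZero C i j = - weightZero C j i) : Normalizable C := by
  have step : ∀ σ : Equiv.Perm (Fin 3), weightZero C (σ 0) (σ 2) = 0 →
      weightZero C (σ 1) (σ 2) = 0 → Normalizable C := by
    intro σ h1 h2
    obtain ⟨J, hJ, e⟩ := weightZero_perm C σ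
    refine hJ.normalizable (normalizable_of_planar (h.pull_adapted hJ) (hC.pull hJ)
      (S2_adapted hJ hK) (fun i j hij => ?_) (by rw [e, h1]) (by rw [e, h2]))
    rw [e, e]
    exact hd _ _ (σ.injective.ne hij)
  have e10 := hd 1 0 (by decide)
  have e20 := hd 2 0 (by decide)
  have e21 := hd 2 1 (by decide)
  have E10 := e10
  have E20 := e20
  have E21 := e21
  simp only [weightZero, of_apply, sp, Matrix.cons_val] at E10 E20 E21
  obtain ⟨s23, s24, s34, -⟩ := S2_of_diagonal h hC E10 E20 E21
  rw [hK, nullMat_apply] at s23 s24 s34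
  -- at most one of the three off-diagonal entries is different from zero
  have m1 : weightZero C 0 2 * weightZero C 1 2 = 0 := by
    simp [dual_values] at s23
    simpa [weightZero, sp] using s23
  have m2 : weightZero C 0 1 * weightZero C 1 2 = 0 := by
    simp [dual_values] at s24
    simpa [weightZero, sp] using s24
  have m3 : weightZero C 0 1 * weightZero C 0 2 = 0 := by
    simp [dual_values] at s34
    simpa [weightZero, sp] using s34
  rcases mul_eq_zero.1 m1 with h02 | h12
  · rcases mul_eq_zero.1 m2 with h01 | h12
    · refine step (Equiv.swap 0 2) ?_ ?_ <;>
        simp [Equiv.swap_apply_def, e20, h02, e10, h01]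
    · exact step 1 h02 h12
  · rcases mul_eq_zero.1 m3 with h01 | h02
    · refine step (Equiv.swap 1 2) ?_ ?_ <;>
        simp [Equiv.swap_apply_def, e21, h01, h12]
    · exact step 1 h02 h12

/-- A Weyl tensor of type II with `S⁽²⁾ ∝ g` is a multiple of the model up to terms of negative
boost weight: a spin that diagonalizes the symmetric part of `C_{0i1j}` makes the equations
`S⁽²⁾ ∝ g` solvable by hand. -/
theorem normalizable_of_S2 (h : IsWeyl nullMat C) (hC : NonposWeight C) {K : ℝ}
    (hK : ∀ a b, S2 nullMat C a b = K * nullMat a b) : Normalizable C := by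
  have hH : (weightZero C + (weightZero C)ᵀ).IsHermitian := by
    rw [Matrix.IsHermitian, Matrix.conjTranspose_eq_transpose_of_trivial, Matrix.transpose_add,
      Matrix.transpose_transpose, add_comm]
  set U : Matrix (Fin 3) (Fin 3) ℝ := hH.eigenvectorUnitary.1 with hU
  have hUU : Uᵀ * U = 1 := by
    have := Unitary.coe_star_mul_self hH.eigenvectorUnitary
    rwa [Matrix.star_eq_conjTranspose, Matrix.conjTranspose_eq_transpose_of_trivial] at this
  have hdiag : Uᵀ * (weightZero C + (weightZero C)ᵀ) * U = diagonal hH.eigenvalues := by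
    have := hH.conjStarAlgAut_star_eigenvectorUnitary
    rw [Unitary.conjStarAlgAut_star_apply] at this
    rw [Matrix.star_eq_conjTranspose, Matrix.conjTranspose_eq_transpose_of_trivial] at this
    exact this
  have hJ := isAdapted_spin hUU
  refine hJ.normalizable (normalizable_of_diagonal (h.pull_adapted hJ) (hC.pull hJ)
    (S2_adapted hJ hK) fun i j hij => ?_)
  have e : weightZero (pull4 C (spin U)) + (weightZero (pull4 C (spin U)))ᵀ
      = diagonal hH.eigenvalues := by
    rw [← hdiag, weightZero_spin, Matrix.transpose_mul, Matrix.transpose_mul,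
      Matrix.transpose_transpose]
    noncomm_ring
  have := congrFun (congrFun e i) j
  rw [Matrix.diagonal_apply_ne _ hij, Matrix.add_apply, Matrix.transpose_apply] at this
  linarith

/-! #### Fixing the null rotations -/

lemma nullRot_eq (x y z : ℝ) (i a : Fin 5) (h : indexWeight i = indexWeight a) :
    nullRot x y z i a = if i = a then 1 else 0 := by
  fin_cases i <;> fin_cases a <;> first
    | exact absurd h (by decide)
    | simp [nullRot]

/-- Null rotations about `ℓ` do not affect the components of leading boost weight. -/
lemma pull4_nullRot (hC : NonposWeight C) (x y z : ℝ) (a b c d : Fin 5)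
    (hw : boostWeight a b c d = 0) : pull4 C (nullRot x y z) a b c d = C a b c d := by
  have hJ := (isAdapted_nullRot x y z).tri
  have key : ∀ i j k l, C i j k l * nullRot x y z i a * nullRot x y z j b * nullRot x y z k c
      * nullRot x y z l d = C i j k l * (if i = a then 1 else 0) * (if j = b then 1 else 0)
        * (if k = c then 1 else 0) * (if l = d then 1 else 0) := by
    intro i j k l
    have hz : ∀ {i a : Fin 5}, indexWeight i < indexWeight a → i ≠ a := fun h e => by simp [e] at h
    by_cases hi : indexWeight i < indexWeight a
    · simp [hJ i a hi, hz hi]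
    by_cases hj : indexWeight j < indexWeight b
    · simp [hJ j b hj, hz hj]
    by_cases hk : indexWeight k < indexWeight c
    · simp [hJ k c hk, hz hk]
    by_cases hl : indexWeight l < indexWeight d
    · simp [hJ l d hl, hz hl]
    by_cases ht : 0 < boostWeight i j k l
    · simp [hC i j k l ht]
    simp only [boostWeight] at ht hw
    rw [nullRot_eq x y z i a (by omega), nullRot_eq x y z j b (by omega),
      nullRot_eq x y z k c (by omega), nullRot_eq x y z l d (by omega)]
  simp only [pull4, key]
  simp

/-- Normalization of a null frame at a tensor of type II with leading part `s` times the model. The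
last three conditions fix the null rotations about `ℓ`. -/
structure IsNormalized (C : Fin 5 → Fin 5 → Fin 5 → Fin 5 → ℝ) (s : ℝ) : Prop where
  isWeyl : IsWeyl nullMat C
  nonpos : NonposWeight C
  model : HasModel C s
  c2 : C 0 1 1 2 = 0
  c3 : C 0 1 1 3 = 0
  c4 : C 0 1 1 4 = 0

lemma HasModel.values {s : ℝ} (h : HasModel C s) :
    (C 0 1 0 1 = 2 * s ∧ C 0 1 2 3 = 2 * s ∧ C 0 1 2 4 = 0 ∧ C 0 1 3 4 = 0 ∧ C 2 3 2 3 = -2 * s ∧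
      C 2 3 2 4 = 0 ∧ C 2 3 3 4 = 0 ∧ C 2 4 2 4 = 0 ∧ C 2 4 3 4 = 0 ∧ C 3 4 3 4 = 0) ∧
    (C 0 2 1 2 = s ∧ C 0 2 1 3 = s ∧ C 0 2 1 4 = 0 ∧ C 0 3 1 2 = -s ∧ C 0 3 1 3 = s ∧
      C 0 3 1 4 = 0 ∧ C 0 4 1 2 = 0 ∧ C 0 4 1 3 = 0 ∧ C 0 4 1 4 = 0) := by
  have m : (model 0 1 0 1 = 2 ∧ model 0 1 2 3 = 2 ∧ model 0 1 2 4 = 0 ∧ model 0 1 3 4 = 0 ∧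
      model 2 3 2 3 = -2 ∧ model 2 3 2 4 = 0 ∧ model 2 3 3 4 = 0 ∧ model 2 4 2 4 = 0 ∧
      model 2 4 3 4 = 0 ∧ model 3 4 3 4 = 0) ∧
    (model 0 2 1 2 = 1 ∧ model 0 2 1 3 = 1 ∧ model 0 2 1 4 = 0 ∧ model 0 3 1 2 = -1 ∧
      model 0 3 1 3 = 1 ∧ model 0 3 1 4 = 0 ∧ model 0 4 1 2 = 0 ∧ model 0 4 1 3 = 0 ∧
      model 0 4 1 4 = 0) := by decide +kernel
  refine ⟨⟨?_, ?_, ?_, ?_, ?_, ?_, ?_, ?_, ?_, ?_⟩, ⟨?_, ?_, ?_, ?_, ?_, ?_, ?_, ?_, ?_⟩⟩ <;>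
  · rw [h _ _ _ _ (by decide)]
    simp only [m]
    push_cast
    ring

/-- The weight `-1` components `C_{011i}` after a null rotation. -/
lemma pull4_nullRot_neg (h : IsWeyl nullMat C) (hC : NonposWeight C) {s : ℝ} (hs : HasModel C s)
    (x y z : ℝ) :
    pull4 C (nullRot x y z) 0 1 1 2 = C 0 1 1 2 + s * (3 * x - 3 * y) ∧
    pull4 C (nullRot x y z) 0 1 1 3 = C 0 1 1 3 + s * (3 * x + 3 * y) ∧
    pull4 C (nullRot x y z) 0 1 1 4 = C 0 1 1 4 + s * (2 * z) := by
  obtain ⟨⟨p1, p2, p3⟩, ⟨p4, p5, p6, p7, p8, p9⟩, ⟨p10, p11, p12⟩, ⟨p13, p14, p15⟩,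
    ⟨p16, p17, p18⟩⟩ := hC.canonical
  obtain ⟨⟨w1, w2, w3, w4, w5, w6, w7, w8, w9, w10⟩, ⟨v1, v2, v3, v4, v5, v6, v7, v8, v9⟩⟩ :=
    hs.values
  have h0 : ∀ X : Fin 5 → ℝ, ∑ k, X k * nullRot x y z k 0 = X 0 := by
    intro X; simp [nullRot, Fin.sum_univ_five]
  have h1 : ∀ X : Fin 5 → ℝ, ∑ k, X k * nullRot x y z k 1
      = X 1 + x * X 2 + y * X 3 + z * X 4 - (x ^ 2 + y ^ 2 + z ^ 2) / 2 * X 0 := by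
    intro X; simp [nullRot, Fin.sum_univ_five]; ring
  have h2 : ∀ X : Fin 5 → ℝ, ∑ k, X k * nullRot x y z k 2 = X 2 - x * X 0 := by
    intro X; simp [nullRot, Fin.sum_univ_five]; ring
  have h3 : ∀ X : Fin 5 → ℝ, ∑ k, X k * nullRot x y z k 3 = X 3 - y * X 0 := by
    intro X; simp [nullRot, Fin.sum_univ_five]; ring
  have h4 : ∀ X : Fin 5 → ℝ, ∑ k, X k * nullRot x y z k 4 = X 4 - z * X 0 := by
    intro X; simp [nullRot, Fin.sum_univ_five]; ring
  have hp : ∀ a b c d, pull4 C (nullRot x y z) a b c d = ∑ i, (∑ j, (∑ k, (∑ l, C i j k l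
      * nullRot x y z l d) * nullRot x y z k c) * nullRot x y z j b) * nullRot x y z i a := by
    intro a b c d
    simp only [pull4, Finset.sum_mul]
    exact Finset.sum_congr rfl fun i _ => Finset.sum_congr rfl fun j _ =>
      Finset.sum_congr rfl fun k _ => Finset.sum_congr rfl fun l _ => by ring
  simp only [hp, h0, h1, h2, h3, h4]
  simp (disch := decide) only [h.diag_left, h.diag_right, h.swap_left, h.swap_right, h.swap_pair,
    p1, p2, p3, p4, p5, p6, p7, p8, p9, p10, p11, p12, p13, p14, p15, p16, p17, p18,
    w1, w2, w3, w4, w5, w6, w7, w8, w9, w10, v1, v2, v3, v4, v5, v6, v7, v8, v9]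
  refine ⟨?_, ?_, ?_⟩ <;> ring

/-- Every Weyl tensor of type II with `S⁽²⁾ ∝ g` that is not of type III can be normalized. -/
theorem exists_isNormalized (h : IsWeyl nullMat C) (hC : NonposWeight C) {K : ℝ}
    (hK : ∀ a b, S2 nullMat C a b = K * nullMat a b)
    (h0 : ∃ a b c d, boostWeight a b c d = 0 ∧ C a b c d ≠ 0) :
    ∃ J, IsAdapted J ∧ ∃ s, s ≠ 0 ∧ IsNormalized (pull4 C J) s := by
  obtain ⟨J, hJ, s, hs⟩ := normalizable_of_S2 h hC hK
  have hs0 : s ≠ 0 := by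
    rintro rfl
    obtain ⟨a, b, c, d, hw, hne⟩ := h0
    obtain ⟨J', hJ', hmul⟩ := hJ.exists_inv
    have hneg : ∀ a b c d, -1 < boostWeight a b c d → pull4 C J a b c d = 0 := by
      intro a b c d hw
      rcases (show 0 ≤ boostWeight a b c d by omega).lt_or_eq with hw | hw
      · exact hC.pull hJ _ _ _ _ hw
      · rw [hs _ _ _ _ hw.symm, zero_mul]
    have := hJ'.pull_eq_zero hneg a b c d (by omega)
    rw [pull4_pull4, hmul, pull4_one] at this
    exact hne this
  have hW := h.pull_adapted hJ
  have hN := hC.pull hJ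
  set B := pull4 C J with hB
  -- the parameters solve the equations `c2`, `c3`, `c4`, which are linear in a null rotation about `ℓ`
  have hR := isAdapted_nullRot (-(B 0 1 1 2 + B 0 1 1 3) / (6 * s))
    ((B 0 1 1 2 - B 0 1 1 3) / (6 * s)) (- B 0 1 1 4 / (2 * s))
  obtain ⟨e2, e3, e4⟩ := pull4_nullRot_neg hW hN hs (-(B 0 1 1 2 + B 0 1 1 3) / (6 * s))
    ((B 0 1 1 2 - B 0 1 1 3) / (6 * s)) (- B 0 1 1 4 / (2 * s))
  refine ⟨_, hJ.mul hR, s, hs0, ?_⟩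
  rw [← pull4_pull4]
  exact { isWeyl := hW.pull_adapted hR
          nonpos := hN.pull hR
          model := fun a b c d hw => by rw [pull4_nullRot hN _ _ _ _ _ _ _ hw, hs _ _ _ _ hw]
          c2 := by rw [e2]; field_simp; ring
          c3 := by rw [e3]; field_simp; ring
          c4 := by rw [e4]; field_simp; ring }

end Adapted

/-! ### The two algebraic conditions -/

section Cubic

open Matrix

variable {C : Fin 5 → Fin 5 → Fin 5 → Fin 5 → ℝ} {J : Matrix (Fin 5) (Fin 5) ℝ} {s : ℝ}

/-- In a cubic expression of boost weight zero only the leading parts contribute. -/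
lemma HasModel.mul_mul_eq (hs : HasModel C s) (hC : NonposWeight C)
    {a b c d a' b' c' d' a'' b'' c'' d'' : Fin 5}
    (hw : boostWeight a b c d + boostWeight a' b' c' d' + boostWeight a'' b'' c'' d'' = 0) :
    C a b c d * C a' b' c' d' * C a'' b'' c'' d''
      = s ^ 3 * ((model a b c d * model a' b' c' d' * model a'' b'' c'' d'' : ℤ) : ℝ) := by
  by_cases h1 : 0 < boostWeight a b c d
  · rw [hC _ _ _ _ h1, model_weight _ _ _ _ h1.ne']; simp
  by_cases h2 : 0 < boostWeight a' b' c' d'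
  · rw [hC _ _ _ _ h2, model_weight a' b' c' d' h2.ne']; simp
  by_cases h3 : 0 < boostWeight a'' b'' c'' d''
  · rw [hC _ _ _ _ h3, model_weight a'' b'' c'' d'' h3.ne']; simp
  rw [hs a b c d (by omega), hs a' b' c' d' (by omega), hs a'' b'' c'' d'' (by omega)]
  push_cast
  ring

lemma S3_of_hasModel (hs : HasModel C s) (hC : NonposWeight C) {a b : Fin 5}
    (hab : indexWeight a + indexWeight b = 0) : S3 nullMat C a b = s ^ 3 *
      ((∑ c, ∑ d, ∑ e, ∑ f, ∑ g, model (dual c) (dual d) (dual e) (dual f) * model c d g a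
        * model e f (dual g) b : ℤ) : ℝ) := by
  rw [S3_nullMat]
  push_cast
  simp only [Finset.mul_sum]
  refine Finset.sum_congr rfl fun c _ => Finset.sum_congr rfl fun d _ =>
    Finset.sum_congr rfl fun e _ => Finset.sum_congr rfl fun f _ =>
    Finset.sum_congr rfl fun g _ => ?_
  rw [hs.mul_mul_eq hC]
  · push_cast; rfl
  · simp only [boostWeight, indexWeight_dual]; linarith

lemma S3_adapted (hJ : IsAdapted J) {K : ℝ} (hK : ∀ a b, S3 nullMat C a b = K * nullMat a b)
    (a b : Fin 5) : S3 nullMat (pull4 C J) a b = K * nullMat a b := by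
  have := S3_pull4 (G := nullMat) hJ.isUnit_det C a b
  rw [hJ.gram] at this
  rw [this]
  simp only [hK]
  rw [show nullMat a b = (Jᵀ * nullMat * J) a b by rw [hJ.gram]]
  simp only [Matrix.mul_apply, Matrix.transpose_apply, Finset.mul_sum, Finset.sum_mul]
  rw [Finset.sum_comm]
  exact Finset.sum_congr rfl fun i _ => Finset.sum_congr rfl fun j _ => by ring

/-- For the normal form of `S⁽²⁾ ∝ g`, the component `44` of `S⁽³⁾` vanishes and the component `01`
does not. -/
theorem weight_zero_of_S2_S3 (h : IsWeyl nullMat C) (hC : NonposWeight C) {K K' : ℝ}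
    (hK : ∀ a b, S2 nullMat C a b = K * nullMat a b)
    (hK' : ∀ a b, S3 nullMat C a b = K' * nullMat a b) (a b c d : Fin 5)
    (hw : boostWeight a b c d = 0) : C a b c d = 0 := by
  by_contra hne
  obtain ⟨J, hJ, s, hs, hN⟩ := exists_isNormalized h hC hK ⟨a, b, c, d, hw, hne⟩
  have h44 := S3_of_hasModel hN.model hN.nonpos (a := 4) (b := 4) (by decide)
  have h01 := S3_of_hasModel hN.model hN.nonpos (a := 0) (b := 1) (by decide)
  have e44 : (∑ c, ∑ d, ∑ e, ∑ f, ∑ g, model (dual c) (dual d) (dual e) (dual f) * model c d g 4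
        * model e f (dual g) 4) = 0 := by decide +kernel
  have e01 : (∑ c, ∑ d, ∑ e, ∑ f, ∑ g, model (dual c) (dual d) (dual e) (dual f) * model c d g 0
        * model e f (dual g) 1) ≠ 0 := by decide +kernel
  rw [S3_adapted hJ hK', e44, nullMat_apply, if_pos (by decide)] at h44
  rw [S3_adapted hJ hK', nullMat_apply, if_pos (by decide)] at h01
  have hK0 : K' = 0 := by simpa using h44
  rw [hK0, zero_mul, eq_comm, mul_eq_zero] at h01
  rcases h01 with h | h
  · exact hs (by simpa using h)
  · exact e01 (by exact_mod_cast h)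

end Cubic

/-! ### First covariant derivatives of a normalized Weyl tensor -/

section FirstOrder

open Matrix

set_option linter.unusedSimpArgs false

variable {C E : Fin 5 → Fin 5 → Fin 5 → Fin 5 → ℝ}

/-- The polarization of `S⁽²⁾` in a null frame. -/
def polar (C E : Fin 5 → Fin 5 → Fin 5 → Fin 5 → ℝ) (a b : Fin 5) : ℝ :=
  ∑ c, ∑ d, ∑ f, C a c d f * E b (dual c) (dual d) (dual f)

lemma polar_comm (C E : Fin 5 → Fin 5 → Fin 5 → Fin 5 → ℝ) (a b : Fin 5) :
    polar C E a b = polar E C b a := by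
  have hd : Function.Involutive dual := dual_dual
  simp only [polar]
  rw [← Equiv.sum_comp hd.toPerm]
  refine Finset.sum_congr rfl fun c _ => ?_
  rw [← Equiv.sum_comp hd.toPerm]
  refine Finset.sum_congr rfl fun d _ => ?_
  rw [← Equiv.sum_comp hd.toPerm]
  refine Finset.sum_congr rfl fun f _ => ?_
  simp only [Function.Involutive.coe_toPerm, dual_dual]
  ring

/-- A variation `E` of a Weyl tensor `C` along which the conditions `S⁽²⁾ = 0` and of type II are
preserved to first order: for some infinitesimal null rotation with parameters `z`, the components
of positive boost weight of `E - z·C` vanish. -/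
structure IsVariation (C E : Fin 5 → Fin 5 → Fin 5 → Fin 5 → ℝ) : Prop where
  isWeyl : IsWeyl nullMat E
  tangent : ∃ z : Fin 5 → ℝ, z 0 = 0 ∧ ∀ i j k, i ≠ 1 → j ≠ 1 → k ≠ 1 → E 0 i j k =
    z i * C 0 1 j k + z j * C 0 i 1 k + z k * C 0 i j 1
      - (z 2 * C 2 i j k + z 3 * C 3 i j k + z 4 * C 4 i j k)
  polar_add : ∀ a b, polar E C a b + polar C E a b = 0

/-- The components of boost weight `-1` of a normalized Weyl tensor with `S⁽²⁾ = 0`. -/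
lemma IsNormalized.weight_neg (h : IsNormalized C 1) (hS : ∀ a b, S2 nullMat C a b = 0) :
    C 1 2 2 3 = 0 ∧ C 1 3 2 3 = 0 ∧ C 1 4 2 3 = 0 ∧ C 1 3 2 4 = C 1 2 3 4 ∧
      C 1 3 3 4 = - C 1 2 2 4 ∧ C 1 4 2 4 = 0 ∧ C 1 4 3 4 = 0 := by
  have hW := h.isWeyl
  obtain ⟨⟨p1, p2, p3⟩, ⟨p4, p5, p6, p7, p8, p9⟩, ⟨p10, p11, p12⟩, ⟨p13, p14, p15⟩,
    ⟨p16, p17, p18⟩⟩ := h.nonpos.canonical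
  obtain ⟨⟨w1, w2, w3, w4, w5, w6, w7, w8, w9, w10⟩, ⟨v1, v2, v3, v4, v5, v6, v7, v8, v9⟩⟩ :=
    h.model.values
  have t2 := hW.trace_nullMat 1 2
  have t3 := hW.trace_nullMat 1 3
  have t4 := hW.trace_nullMat 1 4
  have c := hW.cyclic 1 2 3 4
  have s2 := hS 1 2
  have s3 := hS 1 3
  have s4 := hS 1 4
  obtain ⟨d0, d1, d2, d3, d4⟩ := dual_values
  simp only [S2_nullMat, Fin.sum_univ_five, d0, d1, d2, d3, d4] at s2 s3 s4
  simp (disch := decide) only [hW.diag_left, hW.diag_right, hW.swap_left, hW.swap_right,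
    hW.swap_pair, mul_zero, zero_mul, add_zero, zero_add, neg_zero,
    p1, p2, p3, p4, p5, p6, p7, p8, p9, p10, p11, p12, p13, p14, p15, p16, p17, p18,
    w1, w2, w3, w4, w5, w6, w7, w8, w9, w10, v1, v2, v3, v4, v5, v6, v7, v8, v9, h.c2, h.c3, h.c4]
    at t2 t3 t4 c s2 s3 s4
  refine ⟨?_, ?_, ?_, ?_, ?_, ?_, ?_⟩ <;> linarith only [t2, t3, t4, c, s2, s3, s4]

/-- The components of positive boost weight of a variation. -/
lemma IsVariation.weight_pos (hE : IsVariation C E) (h : IsNormalized C 1) :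
    (E 0 2 0 2 = 0 ∧ E 0 2 0 3 = 0 ∧ E 0 2 0 4 = 0 ∧ E 0 3 0 3 = 0 ∧ E 0 3 0 4 = 0 ∧
      E 0 4 0 4 = 0) ∧
    (E 0 2 2 3 = - E 0 1 0 3 ∧ E 0 2 2 4 = - E 0 1 0 4 / 2 ∧ E 0 2 3 4 = - E 0 1 0 4 / 2) ∧
    (E 0 3 2 3 = E 0 1 0 2 ∧ E 0 3 2 4 = E 0 1 0 4 / 2 ∧ E 0 3 3 4 = - E 0 1 0 4 / 2) ∧
    (E 0 4 2 3 = E 0 1 0 4 ∧ E 0 4 2 4 = 0 ∧ E 0 4 3 4 = 0) := by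
  have hW := h.isWeyl
  have hV := hE.isWeyl
  obtain ⟨⟨p1, p2, p3⟩, ⟨p4, p5, p6, p7, p8, p9⟩, ⟨p10, p11, p12⟩, ⟨p13, p14, p15⟩,
    ⟨p16, p17, p18⟩⟩ := h.nonpos.canonical
  obtain ⟨⟨w1, w2, w3, w4, w5, w6, w7, w8, w9, w10⟩, ⟨v1, v2, v3, v4, v5, v6, v7, v8, v9⟩⟩ :=
    h.model.values
  obtain ⟨z, z0, H⟩ := hE.tangent
  have t2 := hV.trace_nullMat 0 2
  have t3 := hV.trace_nullMat 0 3
  have t4 := hV.trace_nullMat 0 4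
  have H' := fun i j k (hijk : i ≠ 1 ∧ j ≠ 1 ∧ k ≠ 1) => H i j k hijk.1 hijk.2.1 hijk.2.2
  have e1 := H' 2 0 2 (by decide)
  have e2 := H' 2 0 3 (by decide)
  have e3 := H' 2 0 4 (by decide)
  have e4 := H' 3 0 3 (by decide)
  have e5 := H' 3 0 4 (by decide)
  have e6 := H' 4 0 4 (by decide)
  have e7 := H' 2 2 3 (by decide)
  have e8 := H' 2 2 4 (by decide)
  have e9 := H' 2 3 4 (by decide)
  have e10 := H' 3 2 3 (by decide)
  have e11 := H' 3 2 4 (by decide)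
  have e12 := H' 3 3 4 (by decide)
  have e13 := H' 4 2 3 (by decide)
  have e14 := H' 4 2 4 (by decide)
  have e15 := H' 4 3 4 (by decide)
  simp (disch := decide) only [hW.diag_left, hW.diag_right, hW.swap_left, hW.swap_right,
    hW.swap_pair, hV.diag_left, hV.diag_right, hV.swap_left, hV.swap_right, hV.swap_pair,
    mul_zero, zero_mul, add_zero, zero_add, neg_zero, z0,
    p1, p2, p3, p4, p5, p6, p7, p8, p9, p10, p11, p12, p13, p14, p15, p16, p17, p18,
    w1, w2, w3, w4, w5, w6, w7, w8, w9, w10, v1, v2, v3, v4, v5, v6, v7, v8, v9]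
    at t2 t3 t4 e1 e2 e3 e4 e5 e6 e7 e8 e9 e10 e11 e12 e13 e14 e15
  refine ⟨⟨?_, ?_, ?_, ?_, ?_, ?_⟩, ⟨?_, ?_, ?_⟩, ⟨?_, ?_, ?_⟩, ⟨?_, ?_, ?_⟩⟩ <;>
    linarith only [t2, t3, t4, e1, e2, e3, e4, e5, e6, e7, e8, e9, e10, e11, e12, e13, e14, e15]

set_option maxHeartbeats 800000 in
/-- The components of boost weight zero of a variation. -/
lemma IsVariation.weight_zero (hE : IsVariation C E) (h : IsNormalized C 1)
    (hS : ∀ a b, S2 nullMat C a b = 0) : E 0 3 1 3 = E 0 2 1 2 - E 0 1 0 4 * C 1 2 2 4 ∧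
      E 0 4 1 4 = 0 ∧
      E 0 2 1 3 = E 0 2 1 2 + E 0 1 0 4 * (C 1 2 3 4 - C 1 2 2 4) / 2 ∧
      E 0 3 1 2 = - E 0 2 1 2 + E 0 1 0 4 * (C 1 2 3 4 + C 1 2 2 4) / 2 ∧
      E 0 4 1 2 = - E 0 3 1 4 - (E 0 1 0 2 * (C 1 2 3 4 + C 1 2 2 4)
        + E 0 1 0 3 * (C 1 2 3 4 - C 1 2 2 4)) / 6 ∧
      E 0 4 1 3 = E 0 2 1 4 - (E 0 1 0 2 * (C 1 2 3 4 - C 1 2 2 4)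
        - E 0 1 0 3 * (C 1 2 3 4 + C 1 2 2 4)) / 6 := by
  have hW := h.isWeyl
  have hV := hE.isWeyl
  obtain ⟨⟨p1, p2, p3⟩, ⟨p4, p5, p6, p7, p8, p9⟩, ⟨p10, p11, p12⟩, ⟨p13, p14, p15⟩,
    ⟨p16, p17, p18⟩⟩ := h.nonpos.canonical
  obtain ⟨⟨w1, w2, w3, w4, w5, w6, w7, w8, w9, w10⟩, ⟨v1, v2, v3, v4, v5, v6, v7, v8, v9⟩⟩ :=
    h.model.values
  obtain ⟨n1, n2, n3, n4, n5, n6, n7⟩ := h.weight_neg hS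
  obtain ⟨⟨q1, q2, q3, q4, q5, q6⟩, ⟨q7, q8, q9⟩, ⟨q10, q11, q12⟩, ⟨q13, q14, q15⟩⟩ :=
    hE.weight_pos h
  obtain ⟨x1, x2, x3, x4, x5, x6, x7, x8, x9, x10⟩ := hV.weight_zero
  obtain ⟨d0, d1, d2, d3, d4⟩ := dual_values
  have H : polar E C 0 1 + polar C E 0 1 = 2 * (E 0 2 1 2 * 6 + E 0 3 1 3 * 6 + E 0 4 1 4 * 4
        - E 0 2 1 3 * 6 + E 0 3 1 2 * 6) ∧
      polar E C 2 2 + polar C E 2 2 = 4 * (E 0 2 1 2 * 4 + E 0 3 1 3 * 2 - E 0 4 1 4 * 2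
        - E 0 2 1 3 * 3 + E 0 3 1 2 * 3 - E 0 1 0 4 * C 1 2 2 4) ∧
      polar E C 3 3 + polar C E 3 3 = 4 * (E 0 2 1 2 * 2 + E 0 3 1 3 * 4 - E 0 4 1 4 * 2
        - E 0 2 1 3 * 3 + E 0 3 1 2 * 3 + E 0 1 0 4 * C 1 2 2 4) ∧
      polar E C 2 3 + polar C E 2 3 = 4 * (E 0 2 1 3 + E 0 3 1 2 - E 0 1 0 4 * C 1 2 3 4) ∧
      polar E C 2 4 + polar C E 2 4 = 2 * (C 1 2 2 4 * E 0 1 0 2 + C 1 2 3 4 * E 0 1 0 3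
        + E 0 2 1 4 * 3 + E 0 3 1 4 * 3 + E 0 4 1 2 * 3 - E 0 4 1 3 * 3) ∧
      polar E C 3 4 + polar C E 3 4 = 2 * (C 1 2 3 4 * E 0 1 0 2 - C 1 2 2 4 * E 0 1 0 3
        - E 0 2 1 4 * 3 + E 0 3 1 4 * 3 + E 0 4 1 2 * 3 + E 0 4 1 3 * 3) := by
    simp only [polar_comm E, polar, Fin.sum_univ_five, d0, d1, d2, d3, d4]
    refine ⟨?_, ?_, ?_, ?_, ?_, ?_⟩ <;>
    · simp (disch := decide) only [hW.diag_left, hW.diag_right, hW.swap_left, hW.swap_right,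
        hW.swap_pair, hV.diag_left, hV.diag_right, hV.swap_left, hV.swap_right, hV.swap_pair,
        mul_zero, zero_mul, add_zero, zero_add, neg_zero,
        p1, p2, p3, p4, p5, p6, p7, p8, p9, p10, p11, p12, p13, p14, p15, p16, p17, p18,
        w1, w2, w3, w4, w5, w6, w7, w8, w9, w10, v1, v2, v3, v4, v5, v6, v7, v8, v9,
        h.c2, h.c3, h.c4, n1, n2, n3, n4, n5, n6, n7,
        q1, q2, q3, q4, q5, q6, q7, q8, q9, q10, q11, q12, q13, q14, q15,
        x1, x2, x3, x4, x5, x6, x7, x8, x9, x10]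
      ring
  simp only [hE.polar_add, zero_eq_mul, OfNat.ofNat_ne_zero, false_or] at H
  obtain ⟨e1, e2, e3, e5, e6, e7⟩ := H
  refine ⟨?_, ?_, ?_, ?_, ?_, ?_⟩ <;> linarith only [e1, e2, e3, e5, e6, e7]

/-- The first-order data of an Einstein metric with `S⁽²⁾ = 0` and of type II, at a point with a
normalized frame: `D e` are the components of `∇_e C`. -/
structure IsFirstJet (C : Fin 5 → Fin 5 → Fin 5 → Fin 5 → ℝ)
    (D : Fin 5 → Fin 5 → Fin 5 → Fin 5 → Fin 5 → ℝ) : Prop where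
  norm : IsNormalized C 1
  S2_eq_zero : ∀ a b, S2 nullMat C a b = 0
  variation : ∀ e, IsVariation C (D e)
  bianchi : ∀ e a b c d, D e a b c d + D c a b d e + D d a b e c = 0

variable {D : Fin 5 → Fin 5 → Fin 5 → Fin 5 → Fin 5 → ℝ}

/-- The Bianchi identity removes the components of `∇ C` of boost weight two. -/
lemma IsFirstJet.weight_two (h : IsFirstJet C D) :
    D 0 0 1 0 2 = 0 ∧ D 0 0 1 0 3 = 0 ∧ D 0 0 1 0 4 = 0 := by
  have hV := fun e => (h.variation e).isWeyl
  have hp := fun e => (h.variation e).weight_pos h.norm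
  simp only [forall_and] at hp
  obtain ⟨⟨q1, q2, q3, q4, q5, q6⟩, ⟨q7, q8, q9⟩, ⟨q10, q11, q12⟩, ⟨q13, q14, q15⟩⟩ := hp
  have b1 := h.bianchi 0 0 2 2 3
  have b2 := h.bianchi 0 0 3 2 3
  have b3 := h.bianchi 0 0 4 2 3
  simp (disch := decide) only [(hV _).diag_left, (hV _).diag_right, (hV _).swap_left,
    (hV _).swap_right, (hV _).swap_pair, q1, q2, q3, q4, q5, q6, q7, q8, q9, q10, q11, q12, q13, q14, q15] at b1 b2 b3
  refine ⟨?_, ?_, ?_⟩ <;> linarith only [b1, b2, b3]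

/-- The Bianchi identity leaves one parameter, `D 2 0 1 0 2`, among the components of `∇ C` of boost
weight one that are not already determined by `C`. -/
lemma IsFirstJet.weight_one (h : IsFirstJet C D) :
    (D 2 0 1 0 3 = - D 2 0 1 0 2 ∧ D 2 0 1 0 4 = 0 ∧ D 3 0 1 0 2 = D 2 0 1 0 2 ∧
      D 3 0 1 0 3 = D 2 0 1 0 2 ∧ D 3 0 1 0 4 = 0 ∧ D 4 0 1 0 2 = 0 ∧ D 4 0 1 0 3 = 0 ∧
      D 4 0 1 0 4 = 0) ∧
    D 0 0 2 1 2 = - D 2 0 1 0 2 ∧ D 0 0 2 1 4 = 0 ∧ D 0 0 3 1 4 = 0 := by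
  have hV := fun e => (h.variation e).isWeyl
  have hp := fun e => (h.variation e).weight_pos h.norm
  have h0 := fun e => (h.variation e).weight_zero h.norm h.S2_eq_zero
  have hx := fun e => (hV e).weight_zero
  simp only [forall_and] at hp h0 hx
  obtain ⟨⟨q1, q2, q3, q4, q5, q6⟩, ⟨q7, q8, q9⟩, ⟨q10, q11, q12⟩, ⟨q13, q14, q15⟩⟩ := hp
  obtain ⟨y1, y2, y3, y4, y5, y6⟩ := h0
  obtain ⟨x1, x2, x3, x4, x5, x6, x7, x8, x9, x10⟩ := hx
  obtain ⟨r1, r2, r3⟩ := h.weight_two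
  have b1 := h.bianchi 0 0 2 1 2
  have b2 := h.bianchi 0 0 3 1 2
  have b3 := h.bianchi 0 0 4 1 2
  have b4 := h.bianchi 0 0 2 1 3
  have b5 := h.bianchi 0 0 3 1 3
  have b6 := h.bianchi 0 0 4 1 3
  have b7 := h.bianchi 0 0 2 1 4
  have b8 := h.bianchi 0 0 3 1 4
  have b9 := h.bianchi 0 0 4 1 4
  have b10 := h.bianchi 0 2 3 3 4
  have b11 := h.bianchi 2 0 3 3 4
  simp (disch := decide) only [(hV _).diag_left, (hV _).diag_right, (hV _).swap_left,
    (hV _).swap_right, (hV _).swap_pair, q1, q2, q3, q4, q5, q6, q7, q8, q9, q10, q11, q12, q13,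
    q14, q15, x1, x2, x3, x4, x5, x6, x7, x8, x9, x10, y1, y2, y3, y4, y5, y6, r1, r2, r3]
    at b1 b2 b3 b4 b5 b6 b7 b8 b9 b10 b11
  refine ⟨⟨?_, ?_, ?_, ?_, ?_, ?_, ?_, ?_⟩, ?_, ?_, ?_⟩ <;>
    linarith only [b1, b2, b3, b4, b5, b6, b7, b8, b9, b10, b11]

set_option maxHeartbeats 1000000 in
/-- In boost weight zero the Bianchi identity leaves three further parameters, `D 1 0 1 0 i`. -/
lemma IsFirstJet.weight_zero (h : IsFirstJet C D) :
    (D 2 0 2 1 2 = (D 1 0 1 0 2 - D 1 0 1 0 3) / 2 ∧ D 2 0 2 1 4 = D 1 0 1 0 4 / 2 ∧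
      D 2 0 3 1 4 = - D 1 0 1 0 4 / 2) ∧
    (D 3 0 2 1 2 = (D 1 0 1 0 2 + D 1 0 1 0 3) / 2 ∧ D 3 0 2 1 4 = D 1 0 1 0 4 / 2 ∧
      D 3 0 3 1 4 = D 1 0 1 0 4 / 2) ∧
    (D 4 0 2 1 2 = D 1 0 1 0 4 ∧ D 4 0 2 1 4 = 0 ∧ D 4 0 3 1 4 = 0) ∧
    (D 0 0 1 1 2 = D 1 0 1 0 3 ∧ D 0 0 1 1 3 = - D 1 0 1 0 2 ∧ D 0 0 1 1 4 = - D 1 0 1 0 4) ∧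
    (D 0 1 2 2 3 = - D 1 0 1 0 2 ∧ D 0 1 3 2 3 = - D 1 0 1 0 3 ∧ D 0 1 4 2 3 = - D 1 0 1 0 4) ∧
    (D 0 1 2 2 4 = - D 1 0 1 0 4 / 2 - D 2 0 1 0 2 * C 1 2 2 4 / 3 ∧
      D 0 1 3 2 4 = - D 1 0 1 0 4 / 2 - D 2 0 1 0 2 * C 1 2 3 4 / 3 ∧ D 0 1 4 2 4 = 0) ∧
    (D 0 1 2 3 4 = D 1 0 1 0 4 / 2 - D 2 0 1 0 2 * C 1 2 3 4 / 3 ∧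
      D 0 1 3 3 4 = - D 1 0 1 0 4 / 2 + D 2 0 1 0 2 * C 1 2 2 4 / 3 ∧ D 0 1 4 3 4 = 0) := by
  have hV := fun e => (h.variation e).isWeyl
  have hp := fun e => (h.variation e).weight_pos h.norm
  have h0 := fun e => (h.variation e).weight_zero h.norm h.S2_eq_zero
  have hx := fun e => (hV e).weight_zero
  simp only [forall_and] at hp h0 hx
  obtain ⟨⟨q1, q2, q3, q4, q5, q6⟩, ⟨q7, q8, q9⟩, ⟨q10, q11, q12⟩, ⟨q13, q14, q15⟩⟩ := hp
  obtain ⟨y1, y2, y3, y4, y5, y6⟩ := h0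
  obtain ⟨x1, x2, x3, x4, x5, x6, x7, x8, x9, x10⟩ := hx
  obtain ⟨r1, r2, r3⟩ := h.weight_two
  obtain ⟨⟨u1, u2, u3, u4, u5, u6, u7, u8⟩, u9, u10, u11⟩ := h.weight_one
  have b1 := h.bianchi 0 2 3 1 2
  have b2 := h.bianchi 0 2 3 1 3
  have b3 := h.bianchi 0 2 3 1 4
  have b4 := h.bianchi 0 2 4 1 2
  have b5 := h.bianchi 0 2 4 1 3
  have b6 := h.bianchi 0 2 4 1 4
  have b7 := h.bianchi 0 3 4 1 2
  have b8 := h.bianchi 0 3 4 1 3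
  have b9 := h.bianchi 0 3 4 1 4
  have b10 := h.bianchi 0 0 1 1 2
  have b11 := h.bianchi 0 0 1 1 3
  have b12 := h.bianchi 0 0 1 1 4
  have b13 := h.bianchi 1 0 2 2 3
  have b14 := h.bianchi 1 0 2 2 4
  have b15 := h.bianchi 1 0 2 3 4
  have b16 := h.bianchi 1 0 3 2 3
  have b17 := h.bianchi 1 0 3 2 4
  have b18 := h.bianchi 1 0 3 3 4
  have b19 := h.bianchi 1 0 4 2 3
  have b20 := h.bianchi 1 0 4 2 4
  have b21 := h.bianchi 1 0 4 3 4
  simp (disch := decide) only [(hV _).diag_left, (hV _).diag_right, (hV _).swap_left,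
    (hV _).swap_right, (hV _).swap_pair, q1, q2, q3, q4, q5, q6, q7, q8, q9, q10, q11, q12, q13,
    q14, q15, x1, x2, x3, x4, x5, x6, x7, x8, x9, x10, y1, y2, y3, y4, y5, y6, r1, r2, r3,
    u1, u2, u3, u4, u5, u6, u7, u8, u9, u10, u11]
    at b1 b2 b3 b4 b5 b6 b7 b8 b9 b10 b11 b12 b13 b14 b15 b16 b17 b18 b19 b20 b21
  refine ⟨⟨?_, ?_, ?_⟩, ⟨?_, ?_, ?_⟩, ⟨?_, ?_, ?_⟩, ⟨?_, ?_, ?_⟩, ⟨?_, ?_, ?_⟩, ⟨?_, ?_, ?_⟩,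
    ⟨?_, ?_, ?_⟩⟩ <;>
      linarith only [b1, b2, b3, b4, b5, b6, b7, b8, b9, b10, b11, b12, b13, b14, b15, b16, b17,
        b18, b19, b20, b21]

/-- The component of lowest boost weight of `S⁽²⁾ = 0`. -/
lemma IsFirstJet.S2_one_one (h : IsFirstJet C D) :
    C 1 3 1 3 = - C 1 2 1 2 - C 1 2 2 4 ^ 2 - C 1 2 3 4 ^ 2 := by
  have hW := h.norm.isWeyl
  obtain ⟨⟨p1, p2, p3⟩, ⟨p4, p5, p6, p7, p8, p9⟩, ⟨p10, p11, p12⟩, ⟨p13, p14, p15⟩,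
    ⟨p16, p17, p18⟩⟩ := h.norm.nonpos.canonical
  obtain ⟨⟨w1, w2, w3, w4, w5, w6, w7, w8, w9, w10⟩, ⟨v1, v2, v3, v4, v5, v6, v7, v8, v9⟩⟩ :=
    h.norm.model.values
  obtain ⟨n1, n2, n3, n4, n5, n6, n7⟩ := h.norm.weight_neg h.S2_eq_zero
  obtain ⟨d0, d1, d2, d3, d4⟩ := dual_values
  have s := h.S2_eq_zero 1 1
  simp only [S2_nullMat, Fin.sum_univ_five, d0, d1, d2, d3, d4] at s
  simp (disch := decide) only [mul_zero, zero_mul, add_zero, zero_add, neg_zero,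
    hW.diag_left, hW.diag_right, hW.swap_left, hW.swap_right, hW.swap_pair,
    p1, p2, p3, p4, p5, p6, p7, p8, p9, p10, p11, p12, p13, p14, p15, p16, p17, p18,
    w1, w2, w3, w4, w5, w6, w7, w8, w9, w10, v1, v2, v3, v4, v5, v6, v7, v8, v9,
    n1, n2, n3, n4, n5, n6, n7, h.norm.c2, h.norm.c3, h.norm.c4] at s
  linarith only [s]

set_option maxHeartbeats 800000 in
/-- The four combinations of weight `-1` components that enter the square of the first derivative. -/
lemma IsFirstJet.weight_neg (h : IsFirstJet C D) :
    D 2 1 3 2 3 = - D 2 0 1 1 2 - D 2 0 1 0 2 * (C 1 2 3 4 ^ 2 + C 1 2 2 4 ^ 2) / 3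
      - D 1 0 1 0 4 * C 1 2 2 4 / 2 ∧
    D 2 1 2 2 3 = D 2 0 1 1 3 + D 1 0 1 0 4 * C 1 2 3 4 / 2 ∧
    D 3 1 3 2 3 = - D 3 0 1 1 2 - D 1 0 1 0 4 * C 1 2 3 4 / 2 ∧
    D 3 1 2 2 3 = D 3 0 1 1 3 + D 2 0 1 0 2 * (C 1 2 3 4 ^ 2 + C 1 2 2 4 ^ 2) / 3
      - D 1 0 1 0 4 * C 1 2 2 4 / 2 := by
  have hV := fun e => (h.variation e).isWeyl
  have hp := fun e => (h.variation e).weight_pos h.norm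
  have h0 := fun e => (h.variation e).weight_zero h.norm h.S2_eq_zero
  have hx := fun e => (hV e).weight_zero
  simp only [forall_and] at hp h0 hx
  obtain ⟨⟨q1, q2, q3, q4, q5, q6⟩, ⟨q7, q8, q9⟩, ⟨q10, q11, q12⟩, ⟨q13, q14, q15⟩⟩ := hp
  obtain ⟨y1, y2, y3, y4, y5, y6⟩ := h0
  obtain ⟨x1, x2, x3, x4, x5, x6, x7, x8, x9, x10⟩ := hx
  obtain ⟨r1, r2, r3⟩ := h.weight_two
  obtain ⟨⟨u1, u2, u3, u4, u5, u6, u7, u8⟩, u9, u10, u11⟩ := h.weight_one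
  obtain ⟨⟨m1, m2, m3⟩, ⟨m4, m5, m6⟩, ⟨m7, m8, m9⟩, ⟨m10, m11, m12⟩, ⟨m13, m14, m15⟩,
    ⟨m16, m17, m18⟩, ⟨m19, m20, m21⟩⟩ := h.weight_zero
  have hW := h.norm.isWeyl
  obtain ⟨⟨p1, p2, p3⟩, ⟨p4, p5, p6, p7, p8, p9⟩, ⟨p10, p11, p12⟩, ⟨p13, p14, p15⟩,
    ⟨p16, p17, p18⟩⟩ := h.norm.nonpos.canonical
  obtain ⟨⟨w1, w2, w3, w4, w5, w6, w7, w8, w9, w10⟩, ⟨v1, v2, v3, v4, v5, v6, v7, v8, v9⟩⟩ :=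
    h.norm.model.values
  obtain ⟨n1, n2, n3, n4, n5, n6, n7⟩ := h.norm.weight_neg h.S2_eq_zero
  obtain ⟨d0, d1, d2, d3, d4⟩ := dual_values
  have H : polar (D 2) C 1 2 + polar C (D 2) 1 2 = - 2 * (D 2 0 1 1 2 + D 2 1 3 2 3)
        - 6 * (D 2 0 1 1 3 - D 2 1 2 2 3) - 2 / 3 * (D 2 0 1 0 2 * (C 1 2 3 4 ^ 2 + C 1 2 2 4 ^ 2))
        - D 1 0 1 0 4 * (3 * C 1 2 3 4 + C 1 2 2 4) ∧
      polar (D 2) C 1 3 + polar C (D 2) 1 3 = 6 * (D 2 0 1 1 2 + D 2 1 3 2 3)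
        - 2 * (D 2 0 1 1 3 - D 2 1 2 2 3) + 2 * (D 2 0 1 0 2 * (C 1 2 3 4 ^ 2 + C 1 2 2 4 ^ 2))
        - D 1 0 1 0 4 * (C 1 2 3 4 - 3 * C 1 2 2 4) ∧
      polar (D 3) C 1 2 + polar C (D 3) 1 2 = - 2 * (D 3 0 1 1 2 + D 3 1 3 2 3)
        - 6 * (D 3 0 1 1 3 - D 3 1 2 2 3) - 2 * (D 2 0 1 0 2 * (C 1 2 3 4 ^ 2 + C 1 2 2 4 ^ 2))
        - D 1 0 1 0 4 * (C 1 2 3 4 - 3 * C 1 2 2 4) ∧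
      polar (D 3) C 1 3 + polar C (D 3) 1 3 = 6 * (D 3 0 1 1 2 + D 3 1 3 2 3)
        - 2 * (D 3 0 1 1 3 - D 3 1 2 2 3) - 2 / 3 * (D 2 0 1 0 2 * (C 1 2 3 4 ^ 2 + C 1 2 2 4 ^ 2))
        + D 1 0 1 0 4 * (3 * C 1 2 3 4 + C 1 2 2 4) := by
    simp only [polar, Fin.sum_univ_five, d0, d1, d2, d3, d4]
    refine ⟨?_, ?_, ?_, ?_⟩ <;>
    · simp (disch := decide) only [(hV _).diag_left, (hV _).diag_right, (hV _).swap_left,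
        (hV _).swap_right, (hV _).swap_pair, q1, q2, q3, q4, q5, q6, q7, q8, q9, q10, q11, q12, q13,
        q14, q15, x1, x2, x3, x4, x5, x6, x7, x8, x9, x10, y1, y2, y3, y4, y5, y6, r1, r2, r3,
        u1, u2, u3, u4, u5, u6, u7, u8, u9, u10, u11, m1, m2, m3, m4, m5, m6, m7, m8, m9, m10, m11,
        m12, m13, m14, m15, m16, m17, m18, m19, m20, m21,
        mul_zero, zero_mul, add_zero, zero_add, neg_zero,
        hW.diag_left, hW.diag_right, hW.swap_left, hW.swap_right, hW.swap_pair,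
        p1, p2, p3, p4, p5, p6, p7, p8, p9, p10, p11, p12, p13, p14, p15, p16, p17, p18,
        w1, w2, w3, w4, w5, w6, w7, w8, w9, w10, v1, v2, v3, v4, v5, v6, v7, v8, v9,
        n1, n2, n3, n4, n5, n6, n7, h.norm.c2, h.norm.c3, h.norm.c4, h.S2_one_one]
      ring
  simp only [(h.variation _).polar_add] at H
  obtain ⟨e2, f2, e3, f3⟩ := H
  refine ⟨?_, ?_, ?_, ?_⟩ <;> linarith only [e2, e3, f2, f3]

/-- The shear-like parameter `D₂₀₁₀₂` vanishes unless the components of weight `-1` do. -/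
lemma IsFirstJet.eq_zero_or (h : IsFirstJet C D) :
    D 2 0 1 0 2 = 0 ∨ C 1 2 3 4 = 0 ∧ C 1 2 2 4 = 0 := by
  have key : D 2 0 1 0 2 * (C 1 2 3 4 ^ 2 + C 1 2 2 4 ^ 2) = 0 := by
    have hV := fun e => (h.variation e).isWeyl
    have hp := fun e => (h.variation e).weight_pos h.norm
    have h0 := fun e => (h.variation e).weight_zero h.norm h.S2_eq_zero
    have hx := fun e => (hV e).weight_zero
    simp only [forall_and] at hp h0 hx
    obtain ⟨⟨q1, q2, q3, q4, q5, q6⟩, ⟨q7, q8, q9⟩, ⟨q10, q11, q12⟩, ⟨q13, q14, q15⟩⟩ := hp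
    obtain ⟨y1, y2, y3, y4, y5, y6⟩ := h0
    obtain ⟨x1, x2, x3, x4, x5, x6, x7, x8, x9, x10⟩ := hx
    obtain ⟨r1, r2, r3⟩ := h.weight_two
    obtain ⟨⟨u1, u2, u3, u4, u5, u6, u7, u8⟩, u9, u10, u11⟩ := h.weight_one
    obtain ⟨⟨m1, m2, m3⟩, ⟨m4, m5, m6⟩, ⟨m7, m8, m9⟩, ⟨m10, m11, m12⟩, ⟨m13, m14, m15⟩,
      ⟨m16, m17, m18⟩, ⟨m19, m20, m21⟩⟩ := h.weight_zero
    obtain ⟨l1, l2, l3, l4⟩ := h.weight_neg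
    have a2 := (hV 2).trace_nullMat 1 2
    have b2 := (hV 2).trace_nullMat 1 3
    have a3 := (hV 3).trace_nullMat 1 2
    have b3 := (hV 3).trace_nullMat 1 3
    have a4 := (hV 4).trace_nullMat 1 4
    have c4 := (hV 4).cyclic 1 2 3 4
    have k4 := (h.variation 4).polar_add 1 4
    have b14 := h.bianchi 1 2 4 2 4
    have b15 := h.bianchi 1 3 4 2 4
    have b17 := h.bianchi 1 2 4 3 4
    have b18 := h.bianchi 1 3 4 3 4
    obtain ⟨d0, d1, d2, d3, d4⟩ := dual_values
    simp only [polar, Fin.sum_univ_five, d0, d1, d2, d3, d4] at k4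
    have hW := h.norm.isWeyl
    obtain ⟨⟨p1, p2, p3⟩, ⟨p4, p5, p6, p7, p8, p9⟩, ⟨p10, p11, p12⟩, ⟨p13, p14, p15⟩,
      ⟨p16, p17, p18⟩⟩ := h.norm.nonpos.canonical
    obtain ⟨⟨w1, w2, w3, w4, w5, w6, w7, w8, w9, w10⟩, ⟨v1, v2, v3, v4, v5, v6, v7, v8, v9⟩⟩ :=
      h.norm.model.values
    obtain ⟨n1, n2, n3, n4, n5, n6, n7⟩ := h.norm.weight_neg h.S2_eq_zero
    simp (disch := decide) only [(hV _).diag_left, (hV _).diag_right, (hV _).swap_left,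
      (hV _).swap_right, (hV _).swap_pair, q1, q2, q3, q4, q5, q6, q7, q8, q9, q10, q11, q12, q13,
      q14, q15, x1, x2, x3, x4, x5, x6, x7, x8, x9, x10, y1, y2, y3, y4, y5, y6, r1, r2, r3,
      u1, u2, u3, u4, u5, u6, u7, u8, u9, u10, u11, m1, m2, m3, m4, m5, m6, m7, m8, m9, m10, m11,
      m12, m13, m14, m15, m16, m17, m18, m19, m20, m21,
      mul_zero, zero_mul, add_zero, zero_add, neg_zero,
      hW.diag_left, hW.diag_right, hW.swap_left, hW.swap_right, hW.swap_pair,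
      p1, p2, p3, p4, p5, p6, p7, p8, p9, p10, p11, p12, p13, p14, p15, p16, p17, p18,
      w1, w2, w3, w4, w5, w6, w7, w8, w9, w10, v1, v2, v3, v4, v5, v6, v7, v8, v9,
      n1, n2, n3, n4, n5, n6, n7, h.norm.c2, h.norm.c3, h.norm.c4, l1, l2, l3, l4]
      at a2 b2 a3 b3 a4 c4 k4 b14 b15 b17 b18
    linarith only [a2, b2, a3, b3, a4, c4, k4, b14, b15, b17, b18]
  rcases mul_eq_zero.1 key with h0 | h0
  · exact Or.inl h0
  · refine Or.inr ⟨?_, ?_⟩ <;> refine pow_eq_zero_iff two_ne_zero |>.1 ?_ <;>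
      nlinarith [sq_nonneg (C 1 2 3 4), sq_nonneg (C 1 2 2 4)]

/-- The square of the first derivative has no component along `m⁽²⁾ m⁽²⁾`. -/
theorem IsFirstJet.sum_polar_eq_zero (h : IsFirstJet C D) :
    ∑ e, polar (D e) (D (dual e)) 2 2 = 0 := by
  have hV := fun e => (h.variation e).isWeyl
  have hp := fun e => (h.variation e).weight_pos h.norm
  have h0 := fun e => (h.variation e).weight_zero h.norm h.S2_eq_zero
  have hx := fun e => (hV e).weight_zero
  simp only [forall_and] at hp h0 hx
  obtain ⟨⟨q1, q2, q3, q4, q5, q6⟩, ⟨q7, q8, q9⟩, ⟨q10, q11, q12⟩, ⟨q13, q14, q15⟩⟩ := hp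
  obtain ⟨y1, y2, y3, y4, y5, y6⟩ := h0
  obtain ⟨x1, x2, x3, x4, x5, x6, x7, x8, x9, x10⟩ := hx
  obtain ⟨r1, r2, r3⟩ := h.weight_two
  obtain ⟨⟨u1, u2, u3, u4, u5, u6, u7, u8⟩, u9, u10, u11⟩ := h.weight_one
  obtain ⟨⟨m1, m2, m3⟩, ⟨m4, m5, m6⟩, ⟨m7, m8, m9⟩, ⟨m10, m11, m12⟩, ⟨m13, m14, m15⟩,
    ⟨m16, m17, m18⟩, ⟨m19, m20, m21⟩⟩ := h.weight_zero
  obtain ⟨l1, l2, l3, l4⟩ := h.weight_neg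
  have b10 := h.bianchi 1 2 3 2 3
  have b19 := h.bianchi 1 0 1 2 3
  obtain ⟨d0, d1, d2, d3, d4⟩ := dual_values
  rw [Fin.sum_univ_five, d0, d1, d2, d3, d4, polar_comm (D 1)]
  simp only [polar, Fin.sum_univ_five, d0, d1, d2, d3, d4]
  simp (disch := decide) only [(hV _).diag_left, (hV _).diag_right, (hV _).swap_left,
    (hV _).swap_right, (hV _).swap_pair, q1, q2, q3, q4, q5, q6, q7, q8, q9, q10, q11, q12, q13,
    q14, q15, x1, x2, x3, x4, x5, x6, x7, x8, x9, x10, y1, y2, y3, y4, y5, y6, r1, r2, r3,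
    u1, u2, u3, u4, u5, u6, u7, u8, u9, u10, u11, m1, m2, m3, m4, m5, m6, m7, m8, m9, m10, m11,
    m12, m13, m14, m15, m16, m17, m18, m19, m20, m21,
    mul_zero, zero_mul, add_zero, zero_add, neg_zero, l1, l2, l3, l4] at b10 b19 ⊢
  rcases h.eq_zero_or with h0 | ⟨hp, hq⟩
  · simp only [h0]
    ring
  · simp only [hp, hq] at b10 b19 ⊢
    linear_combination D 2 0 1 0 2 * (- 8 * b19 - 8 * b10)

end FirstOrder

/-! ### Second covariant derivatives of a normalized Weyl tensor -/

section SecondOrder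

open Matrix

variable {C : Fin 5 → Fin 5 → Fin 5 → Fin 5 → ℝ}
  {D : Fin 5 → Fin 5 → Fin 5 → Fin 5 → Fin 5 → ℝ}
  {H : Fin 5 → Fin 5 → Fin 5 → Fin 5 → Fin 5 → Fin 5 → ℝ} {s κ : ℝ}

/-- The frame components `g_{ac} g_{bd} - g_{ad} g_{bc}` of the curvature of constant curvature
one. -/
def unitCurv (a b c d : Fin 5) : ℤ :=
  (if c = dual a ∧ d = dual b then 1 else 0) - (if d = dual a ∧ c = dual b then 1 else 0)

lemma unitCurv_weight (a b c d : Fin 5) (h : boostWeight a b c d ≠ 0) : unitCurv a b c d = 0 := by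
  revert a b c d; decide +kernel

/-- The derivation of the tensors of rank four that is induced by the endomorphism `Rᵐ_{· f e}`. -/
def curvAct {A : Type*} [CommRing A] (R C : Fin 5 → Fin 5 → Fin 5 → Fin 5 → A)
    (f e a b c d : Fin 5) : A :=
  ∑ m, (R (dual m) a f e * C m b c d + R (dual m) b f e * C a m c d + R (dual m) c f e * C a b m d
    + R (dual m) d f e * C a b c m)

/-- The first and second covariant derivatives `D` and `H` of the Weyl tensor `C` of an Einstein
metric with `S⁽²⁾ = 0` and of type II, at a point with a normalized frame. -/
structure IsSecondJet (C : Fin 5 → Fin 5 → Fin 5 → Fin 5 → ℝ)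
    (D : Fin 5 → Fin 5 → Fin 5 → Fin 5 → Fin 5 → ℝ)
    (H : Fin 5 → Fin 5 → Fin 5 → Fin 5 → Fin 5 → Fin 5 → ℝ) (s κ : ℝ) : Prop where
  norm : IsNormalized C s
  S2_eq_zero : ∀ a b, S2 nullMat C a b = 0
  variation : ∀ e, IsVariation C (D e)
  bianchi : ∀ e a b c d, D e a b c d + D c a b d e + D d a b e c = 0
  isWeyl : ∀ f e, IsWeyl nullMat (H f e)
  bianchi_two : ∀ f e a b c d, H f e a b c d + H f c a b d e + H f d a b e c = 0
  polar_two : ∀ f e a b, polar (H f e) C a b + polar (D e) (D f) a b + polar (D f) (D e) a b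
    + polar C (H f e) a b = 0
  ricci : ∀ f e a b c d, H f e a b c d - H e f a b c d
    = - curvAct (fun a b c d => C a b c d + κ * unitCurv a b c d) C f e a b c d

lemma HasModel.mul_eq (hs : HasModel C s) (hC : NonposWeight C)
    {a b c d a' b' c' d' : Fin 5} (hw : boostWeight a b c d + boostWeight a' b' c' d' = 0) :
    C a b c d * C a' b' c' d' = s ^ 2 * ((model a b c d * model a' b' c' d' : ℤ) : ℝ) := by
  by_cases h1 : 0 < boostWeight a b c d
  · rw [hC _ _ _ _ h1, model_weight _ _ _ _ h1.ne']; simp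
  by_cases h2 : 0 < boostWeight a' b' c' d'
  · rw [hC _ _ _ _ h2, model_weight a' b' c' d' h2.ne']; simp
  rw [hs a b c d (by omega), hs a' b' c' d' (by omega)]
  push_cast
  ring

/-- In a product of total boost weight zero only the leading parts of the factors count. -/
lemma curvature_mul_mul_eq (hs : HasModel C s) (hC : NonposWeight C) (κ : ℝ)
    {a b c d a' b' c' d' a'' b'' c'' d'' : Fin 5}
    (hw : boostWeight a b c d + boostWeight a' b' c' d' + boostWeight a'' b'' c'' d'' = 0) :
    (C a b c d + κ * unitCurv a b c d) * C a' b' c' d' * C a'' b'' c'' d''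
      = s ^ 3 * ((model a b c d * model a' b' c' d' * model a'' b'' c'' d'' : ℤ) : ℝ)
        + κ * s ^ 2 * ((unitCurv a b c d * model a' b' c' d' * model a'' b'' c'' d'' : ℤ) : ℝ) := by
  rw [add_mul, add_mul, hs.mul_mul_eq hC hw]
  congr 1
  by_cases h : boostWeight a b c d = 0
  · rw [mul_assoc, hs.mul_eq hC (by omega)]
    push_cast
    ring
  · rw [unitCurv_weight _ _ _ _ h]
    simp

/-- The cubic form in the curvature that the Ricci identity produces from `C · □C`, for the leading
parts. -/
lemma curvAct_model (hs : HasModel C s) (hC : NonposWeight C) (κ : ℝ) :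
    ∑ b, ∑ c, ∑ d, ∑ e, curvAct (fun a b c d => C a b c d + κ * unitCurv a b c d) C (dual e) c 2 b e d
        * C 2 (dual b) (dual c) (dual d)
      = s ^ 3 * ((∑ b, ∑ c, ∑ d, ∑ e, curvAct model model (dual e) c 2 b e d
          * model 2 (dual b) (dual c) (dual d) : ℤ) : ℝ)
        + κ * s ^ 2 * ((∑ b, ∑ c, ∑ d, ∑ e, curvAct unitCurv model (dual e) c 2 b e d
          * model 2 (dual b) (dual c) (dual d) : ℤ) : ℝ) := by
  push_cast
  simp only [Finset.mul_sum, ← Finset.sum_add_distrib]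
  refine Finset.sum_congr rfl fun b _ => Finset.sum_congr rfl fun c _ =>
    Finset.sum_congr rfl fun d _ => Finset.sum_congr rfl fun e _ => ?_
  simp only [curvAct, Finset.sum_mul, Int.cast_sum, Finset.mul_sum, ← Finset.sum_add_distrib]
  refine Finset.sum_congr rfl fun m _ => ?_
  have w : indexWeight (2 : Fin 5) = 0 := rfl
  rw [add_mul, add_mul, add_mul, curvature_mul_mul_eq hs hC, curvature_mul_mul_eq hs hC,
    curvature_mul_mul_eq hs hC, curvature_mul_mul_eq hs hC]
  · push_cast; ring
  all_goals simp only [boostWeight, indexWeight_dual, w]; ring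

/-- For the leading parts, the scalar curvature does not contribute to the cubic form of the Ricci
identity, and the contribution of the Weyl tensor does not vanish. -/
lemma cubic_values :
    (∑ b, ∑ c, ∑ d, ∑ e, curvAct model model (dual e) c 2 b e d
      * model 2 (dual b) (dual c) (dual d)) ≠ 0 ∧
    (∑ b, ∑ c, ∑ d, ∑ e, curvAct unitCurv model (dual e) c 2 b e d
      * model 2 (dual b) (dual c) (dual d)) = 0 := by
  constructor <;> decide +kernel

lemma IsWeyl.sum_dual (h : IsWeyl nullMat C) (b d : Fin 5) : ∑ a, C a b (dual a) d = 0 := by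
  have := h.trace b d
  rwa [nullMat_inv, sum_nullMat] at this

/-- The second Bianchi identity for trace-free tensors makes the divergence vanish. -/
lemma sum_divergence_eq_zero (hW : ∀ e, IsWeyl nullMat (D e))
    (hB : ∀ e a b c d, D e a b c d + D c a b d e + D d a b e c = 0) (a b d : Fin 5) :
    ∑ e, D (dual e) a b e d = 0 := by
  have h1 : ∀ e, D (dual e) a b e d = D a e d (dual e) b - D b e d (dual e) a := by
    intro e
    rw [(hW _).pair, (hW a).right e d b (dual e)]
    linarith [hB (dual e) e d a b]
  simp only [h1, Finset.sum_sub_distrib, (hW _).sum_dual, sub_zero]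

lemma polar_smul (r t : ℝ) (E F : Fin 5 → Fin 5 → Fin 5 → Fin 5 → ℝ) (a b : Fin 5) :
    polar (fun a b c d => r * E a b c d) (fun a b c d => t * F a b c d) a b
      = r * t * polar E F a b := by
  simp only [polar, Finset.mul_sum]
  exact Finset.sum_congr rfl fun c _ => Finset.sum_congr rfl fun d _ =>
    Finset.sum_congr rfl fun f _ => by ring

lemma S2_eq_polar (a b : Fin 5) : S2 nullMat C a b = polar C C a b := S2_nullMat C a b

lemma IsWeyl.smul {G : Matrix (Fin 5) (Fin 5) ℝ} (h : IsWeyl G C) (r : ℝ) :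
    IsWeyl G fun a b c d => r * C a b c d where
  left a b c d := by rw [h.left]; ring
  right a b c d := by rw [h.right]; ring
  cyclic a b c d := by linear_combination r * h.cyclic a b c d
  trace b d := by
    have := h.trace b d
    simp only [mul_left_comm _ r, ← Finset.mul_sum, this, mul_zero]

/-- Dividing by `s` reduces the leading part to the model itself. -/
lemma IsSecondJet.isFirstJet (h : IsSecondJet C D H s κ) (hs : s ≠ 0) :
    IsFirstJet (fun a b c d => s⁻¹ * C a b c d) fun e a b c d => s⁻¹ * D e a b c d where
  norm :=
    { isWeyl := h.norm.isWeyl.smul _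
      nonpos := fun a b c d hw => by beta_reduce; rw [h.norm.nonpos a b c d hw, mul_zero]
      model := fun a b c d hw => by
        beta_reduce
        rw [h.norm.model a b c d hw, inv_mul_cancel_left₀ hs, one_mul]
      c2 := by rw [h.norm.c2, mul_zero]
      c3 := by rw [h.norm.c3, mul_zero]
      c4 := by rw [h.norm.c4, mul_zero] }
  S2_eq_zero a b := by rw [S2_eq_polar, polar_smul, ← S2_eq_polar, h.S2_eq_zero, mul_zero]
  variation e :=
    { isWeyl := (h.variation e).isWeyl.smul _
      tangent := by
        obtain ⟨z, hz, H⟩ := (h.variation e).tangent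
        refine ⟨z, hz, fun i j k hi hj hk => ?_⟩
        rw [H i j k hi hj hk]
        ring
      polar_add := fun a b => by
        rw [polar_smul, polar_smul, ← mul_add, (h.variation e).polar_add, mul_zero] }
  bianchi e a b c d := by linear_combination s⁻¹ * h.bianchi e a b c d

/-- The second derivative of `S⁽²⁾ = 0` leaves the cubic form of the curvature, since the square of
the first derivative does not contribute. -/
theorem IsSecondJet.eq_zero (h : IsSecondJet C D H s κ) : s = 0 := by
  by_contra hs
  have hN : ∑ e, polar (D e) (D (dual e)) 2 2 = 0 := by
    have := (h.isFirstJet hs).sum_polar_eq_zero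
    simp only [polar_smul, ← Finset.mul_sum] at this
    simpa [hs] using this
  have hL : ∑ e, polar (H (dual e) e) C 2 2 = 0 := by
    have : ∀ e, polar (H (dual e) e) C 2 2 = - polar (D e) (D (dual e)) 2 2 := by
      intro e
      have := h.polar_two (dual e) e 2 2
      rw [polar_comm C, polar_comm (D (dual e))] at this
      linarith
    simp only [this, Finset.sum_neg_distrib, hN, neg_zero]
  have hdiv : ∀ a b c d, ∑ e, H (dual e) c a b e d = - ∑ e, curvAct
      (fun a b c d => C a b c d + κ * unitCurv a b c d) C (dual e) c a b e d := by
    intro a b c d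
    have h1 := sum_divergence_eq_zero (h.isWeyl c) (h.bianchi_two c) a b d
    rw [← Finset.sum_neg_distrib, ← sub_zero (∑ e, H (dual e) c a b e d), ← h1,
      ← Finset.sum_sub_distrib]
    exact Finset.sum_congr rfl fun e _ => h.ricci _ _ _ _ _ _
  have hcub : ∑ b, ∑ c, ∑ d, (∑ e, H (dual e) c 2 b e d) * C 2 (dual b) (dual c) (dual d) = 0 := by
    have h1 : ∑ e, polar (H (dual e) e) C 2 2 = ∑ b, ∑ c, ∑ d, (∑ e, H (dual e) c 2 b e d)
        * C 2 (dual b) (dual c) (dual d) + ∑ b, ∑ c, ∑ d, (∑ e, H (dual e) d 2 b e c)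
        * C 2 (dual b) (dual d) (dual c) := by
      simp only [polar]
      rw [Finset.sum_comm, ← Finset.sum_add_distrib]
      refine Finset.sum_congr rfl fun b _ => ?_
      rw [Finset.sum_comm, ← Finset.sum_add_distrib]
      refine Finset.sum_congr rfl fun c _ => ?_
      rw [Finset.sum_comm, ← Finset.sum_add_distrib]
      refine Finset.sum_congr rfl fun d _ => ?_
      rw [h.norm.isWeyl.right 2 (dual b) (dual c) (dual d), Finset.sum_mul, Finset.sum_mul,
        ← Finset.sum_add_distrib]
      refine Finset.sum_congr rfl fun e _ => ?_
      have := h.bianchi_two (dual e) e 2 b c d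
      rw [(h.isWeyl (dual e) c).right 2 b e d] at this
      linear_combination C 2 (dual b) (dual c) (dual d) * this
    have h2 : ∑ b, ∑ c, ∑ d, (∑ e, H (dual e) d 2 b e c) * C 2 (dual b) (dual d) (dual c)
        = ∑ b, ∑ c, ∑ d, (∑ e, H (dual e) c 2 b e d) * C 2 (dual b) (dual c) (dual d) :=
      Finset.sum_congr rfl fun b _ => Finset.sum_comm
    rw [h2, hL] at h1
    linarith
  simp only [hdiv, neg_mul, Finset.sum_neg_distrib, neg_eq_zero, Finset.sum_mul] at hcub
  obtain ⟨v1, v2⟩ := cubic_values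
  rw [curvAct_model h.norm.model h.norm.nonpos κ, v2, Int.cast_zero, mul_zero, add_zero,
    mul_eq_zero] at hcub
  rcases hcub with h0 | h0
  · exact hs (by simpa using h0)
  · exact v1 (by exact_mod_cast h0)

end SecondOrder

/-! ### The Ricci and Weyl tensors -/

section Weyl

open Matrix

variable {n : ℕ} {G G' : MetricField n} {U V : Set (EuclideanSpace ℝ (Fin n))}
  {φ : EuclideanSpace ℝ (Fin n) → EuclideanSpace ℝ (Fin n)} {y : EuclideanSpace ℝ (Fin n)}

lemma IsMetricOn.inv_symm (hG : IsMetricOn G U) (hy : y ∈ U) (a b : Fin n) :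
    (G y)⁻¹ a b = (G y)⁻¹ b a := by
  have h : ((G y)⁻¹)ᵀ = (G y)⁻¹ := by rw [Matrix.transpose_nonsing_inv, hG.symm y hy]
  conv_lhs => rw [← h]
  rfl

lemma IsMetricOn.ricci_eq_trace (hG : IsMetricOn G U) (hy : y ∈ U) (b d : Fin n) :
    ricci G y b d = ∑ a, ∑ c, (G y)⁻¹ a c * riemann G y a b c d := by
  have h1 : ∀ a, riemannUp G y a b a d = ∑ c, (G y)⁻¹ a c * riemann G y c b a d := by
    intro a
    have h : curv G a d y = (G y)⁻¹ * (G y * curv G a d y) := by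
      rw [Matrix.nonsing_inv_mul_cancel_left _ _ (hG.det y hy)]
    rw [riemannUp_eq_curv, h, Matrix.mul_apply]
    simp only [riemann_eq_mul_curv]
  rw [ricci, Finset.sum_congr rfl fun a _ => h1 a, Finset.sum_comm]
  exact Finset.sum_congr rfl fun a _ => Finset.sum_congr rfl fun c _ => by
    rw [hG.inv_symm hy c a]

lemma IsMetricOn.ricci_symm (hG : IsMetricOn G U) (hy : y ∈ U) (b d : Fin n) :
    ricci G y b d = ricci G y d b := by
  rw [hG.ricci_eq_trace hy, hG.ricci_eq_trace hy, Finset.sum_comm]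
  exact Finset.sum_congr rfl fun a _ => Finset.sum_congr rfl fun c _ => by
    rw [hG.inv_symm hy c a, hG.riemann_pair_symm hy c b a d]

lemma IsMetricOn.sum_inv_mul (hG : IsMetricOn G U) (hy : y ∈ U) (X : Fin n → ℝ) (d : Fin n) :
    ∑ a, ∑ c, (G y)⁻¹ a c * (G y a d * X c) = X d := by
  have h : ∀ c, ∑ a, (G y)⁻¹ a c * (G y a d * X c) = (if c = d then 1 else 0) * X c := by
    intro c
    have : ((G y)⁻¹ * G y) c d = if c = d then 1 else 0 := by
      rw [Matrix.nonsing_inv_mul _ (hG.det y hy), Matrix.one_apply]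
    rw [← this, Matrix.mul_apply, Finset.sum_mul]
    exact Finset.sum_congr rfl fun a _ => by rw [hG.inv_symm hy a c]; ring
  rw [Finset.sum_comm, Finset.sum_congr rfl fun c _ => h c]
  simp

lemma IsMetricOn.sum_inv_self (hG : IsMetricOn G U) (hy : y ∈ U) :
    ∑ a, ∑ c, (G y)⁻¹ a c * G y a c = n := by
  have h : ∀ a, ∑ c, (G y)⁻¹ a c * G y a c = 1 := by
    intro a
    have : ((G y)⁻¹ * G y) a a = 1 := by
      rw [Matrix.nonsing_inv_mul _ (hG.det y hy), Matrix.one_apply_eq]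
    rw [← this, Matrix.mul_apply]
    exact Finset.sum_congr rfl fun c _ => by rw [hG.apply_symm hy a c]
  simp [h]

/-- The Weyl tensor has the symmetries of the Riemann tensor and is trace-free. -/
lemma IsMetricOn.isWeyl (hG : IsMetricOn G U) (hy : y ∈ U) (hn : 3 ≤ n) :
    IsWeyl (G y) (weyl G y) where
  left a b c d := by
    simp only [weyl, hG.riemann_antisymm_left hy a b c d]
    ring
  right a b c d := by
    simp only [weyl, riemann_antisymm_right G y a b c d]
    ring
  cyclic a b c d := by
    simp only [weyl]
    rw [hG.ricci_symm hy c b, hG.ricci_symm hy d b, hG.ricci_symm hy d c, hG.apply_symm hy c b,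
      hG.apply_symm hy d b, hG.apply_symm hy d c]
    linear_combination hG.riemann_cyclic hy a b c d
  trace b d := by
    have h1 : ((n : ℝ) - 2) ≠ 0 := by
      have : (3 : ℝ) ≤ n := by exact_mod_cast hn
      linarith
    have h2 : ((n : ℝ) - 1) ≠ 0 := by
      have : (3 : ℝ) ≤ n := by exact_mod_cast hn
      linarith
    have hr := hG.ricci_eq_trace hy b d
    have hs : ∑ a, ∑ c, (G y)⁻¹ a c * ricci G y a c = scalarCurv G y := rfl
    have e1 := hG.sum_inv_mul hy (fun c => ricci G y b c) d
    have e2 := hG.sum_inv_mul hy (fun c => ricci G y c d) b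
    have e3 := hG.sum_inv_mul hy (fun c => G y b c) d
    have e4 := hG.sum_inv_self hy
    have key : ∀ a c, (G y)⁻¹ a c * weyl G y a b c d = (G y)⁻¹ a c * riemann G y a b c d
        - 1 / ((n : ℝ) - 2) * (((G y)⁻¹ a c * G y a c) * ricci G y b d
          - (G y)⁻¹ a c * (G y a d * ricci G y b c) - (G y)⁻¹ c a * (G y c b * ricci G y a d)
          + ((G y)⁻¹ a c * ricci G y a c) * G y b d)
        + scalarCurv G y / (((n : ℝ) - 1) * ((n : ℝ) - 2)) * (((G y)⁻¹ a c * G y a c) * G y b d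
          - (G y)⁻¹ a c * (G y a d * G y b c)) := by
      intro a c
      rw [hG.inv_symm hy c a, hG.apply_symm hy c b, weyl]
      ring
    simp only [key, Finset.sum_add_distrib, Finset.sum_sub_distrib, ← Finset.mul_sum,
      ← Finset.sum_mul]
    rw [Finset.sum_comm (f := fun a c => (G y)⁻¹ c a * (G y c b * ricci G y a d)), ← hr, e1, e2, e3,
      e4, hs]
    field_simp
    ring

namespace IsPullback

lemma ricci_eq (h : IsPullback G G' φ U V) (hy : y ∈ V) (b d : Fin n) :
    ricci G' y b d = ∑ j, ∑ l, ricci G (φ y) j l * (jacobian φ y j b * jacobian φ y l d) := by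
  rw [h.isMetricOn.ricci_eq_trace hy, h.eq y hy]
  simp only [h.riemann_eq hy]
  rw [trace_pull4 (h.det y hy)]
  simp only [← h.metric.ricci_eq_trace (h.maps hy)]

lemma scalarCurv_eq (h : IsPullback G G' φ U V) (hy : y ∈ V) :
    scalarCurv G' y = scalarCurv G (φ y) := by
  simp only [scalarCurv, h.ricci_eq hy]
  rw [h.eq y hy, sum_inv_pull (mul_inv_pull (h.det y hy))]

lemma metric_eq (h : IsPullback G G' φ U V) (hy : y ∈ V) (b d : Fin n) :
    G' y b d = ∑ j, ∑ l, G (φ y) j l * (jacobian φ y j b * jacobian φ y l d) := by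
  rw [h.eq y hy]
  simp only [Matrix.mul_apply, Matrix.transpose_apply, Finset.sum_mul]
  rw [Finset.sum_comm]
  exact Finset.sum_congr rfl fun i _ => Finset.sum_congr rfl fun j _ => by ring

end IsPullback

lemma pull4_mul (X Y : Fin n → Fin n → ℝ) (J : Matrix (Fin n) (Fin n) ℝ) (a b c d : Fin n) :
    pull4 (fun a b c d => X a c * Y b d) J a b c d
      = (∑ i, ∑ k, X i k * (J i a * J k c)) * ∑ j, ∑ l, Y j l * (J j b * J l d) := by
  rw [pull4_eq_sum13, Finset.sum_mul]
  refine Finset.sum_congr rfl fun i _ => ?_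
  rw [Finset.sum_mul]
  refine Finset.sum_congr rfl fun k _ => ?_
  simp only [Finset.mul_sum, Finset.sum_mul]
  exact Finset.sum_congr rfl fun j _ => Finset.sum_congr rfl fun l _ => by ring

lemma pull4_swap (C : Fin n → Fin n → Fin n → Fin n → ℝ) (J : Matrix (Fin n) (Fin n) ℝ)
    (a b c d : Fin n) : pull4 (fun a b c d => C a b d c) J a b c d = pull4 C J a b d c := by
  simp only [pull4]
  refine Finset.sum_congr rfl fun i _ => Finset.sum_congr rfl fun j _ => ?_
  rw [Finset.sum_comm]
  exact Finset.sum_congr rfl fun k _ => Finset.sum_congr rfl fun l _ => by ring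

lemma pull4_add (C D : Fin n → Fin n → Fin n → Fin n → ℝ) (J : Matrix (Fin n) (Fin n) ℝ)
    (a b c d : Fin n) : pull4 (fun a b c d => C a b c d + D a b c d) J a b c d
      = pull4 C J a b c d + pull4 D J a b c d := by
  simp only [pull4, add_mul, Finset.sum_add_distrib]

lemma pull4_smul (r : ℝ) (C : Fin n → Fin n → Fin n → Fin n → ℝ) (J : Matrix (Fin n) (Fin n) ℝ)
    (a b c d : Fin n) : pull4 (fun a b c d => r * C a b c d) J a b c d = r * pull4 C J a b c d := by
  simp only [pull4, mul_assoc, Finset.mul_sum]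

/-- The Weyl tensor is a tensor. -/
lemma IsPullback.weyl_eq (h : IsPullback G G' φ U V) (hy : y ∈ V) :
    weyl G' y = pull4 (weyl G (φ y)) (jacobian φ y) := by
  funext a b c d
  set r : Fin n → Fin n → ℝ := ricci G (φ y) with hr
  set g : Fin n → Fin n → ℝ := G (φ y) with hg
  have e : weyl G (φ y) = fun a b c d => riemann G (φ y) a b c d
      + (-(1 / ((n : ℝ) - 2)) * (g a c * r b d + (-1) * (g a d * r b c)
        + ((-1) * (r a d * g b c) + r a c * g b d))
      + scalarCurv G (φ y) / (((n : ℝ) - 1) * ((n : ℝ) - 2)) *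
        (g a c * g b d + (-1) * (g a d * g b c))) := by
    funext a b c d
    simp only [weyl, hg, hr]
    ring
  rw [e]
  have s : ∀ X Y : Fin n → Fin n → ℝ, pull4 (fun a b c d => X a d * Y b c) (jacobian φ y) a b c d
      = pull4 (fun a b c d => X a c * Y b d) (jacobian φ y) a b d c :=
    fun X Y => pull4_swap (fun a b c d => X a c * Y b d) _ a b c d
  simp only [pull4_add, pull4_smul]
  rw [s g r, s r g, s g g, pull4_mul g r, pull4_mul g r, pull4_mul r g, pull4_mul r g,
    pull4_mul g g, pull4_mul g g, ← h.riemann_eq hy]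
  simp only [hg, hr, ← h.ricci_eq hy, ← h.metric_eq hy, ← h.scalarCurv_eq hy]
  simp only [weyl]
  ring

end Weyl

/-! ### Linearity of the covariant derivative and triple contractions -/

section Contractions

open Matrix

variable {n r s t : ℕ} {G : MetricField n} {U : Set (EuclideanSpace ℝ (Fin n))}
  {y : EuclideanSpace ℝ (Fin n)} {T S : TensorField n r}

lemma covDeriv_congr_on (hU : IsOpen U) (hy : y ∈ U) (h : ∀ z ∈ U, T z = S z) (e : Fin n)
    (i : Fin r → Fin n) : covDeriv G T y (Fin.cons e i) = covDeriv G S y (Fin.cons e i) := by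
  rw [covDeriv_cons, covDeriv_cons, h y hy, pd_congr_on e hU hy fun z hz => by rw [h z hz]]

lemma covDeriv_add (hU : IsOpen U) (hy : y ∈ U) (hT : SmoothTen T U) (hS : SmoothTen S U)
    (e : Fin n) (i : Fin r → Fin n) :
    covDeriv G (fun z j => T z j + S z j) y (Fin.cons e i)
      = covDeriv G T y (Fin.cons e i) + covDeriv G S y (Fin.cons e i) := by
  simp only [covDeriv_cons]
  rw [pd_add e (diffAt_of_smooth hU (hT i) hy) (diffAt_of_smooth hU (hS i) hy)]
  simp only [slotAct, mul_add, Finset.sum_add_distrib]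
  ring

/-- The Leibniz rule for the product with a function. -/
lemma covDeriv_fun_mul (hU : IsOpen U) (hy : y ∈ U) {f : EuclideanSpace ℝ (Fin n) → ℝ}
    (hf : ContDiffOn ℝ ∞ f U) (hT : SmoothTen T U) (e : Fin n) (i : Fin r → Fin n) :
    covDeriv G (fun z j => f z * T z j) y (Fin.cons e i)
      = pd e f y * T y i + f y * covDeriv G T y (Fin.cons e i) := by
  simp only [covDeriv_cons]
  rw [pd_mul e (diffAt_of_smooth hU hf hy) (diffAt_of_smooth hU (hT i) hy)]
  simp only [slotAct, mul_sub, Finset.mul_sum]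
  have h5 : ∀ x y z : ℝ, x * (y * z) = y * (x * z) := fun x y z => by ring
  simp only [h5 (conn _ _ _ _ _)]
  ring

lemma covDeriv_const_mul (hU : IsOpen U) (hy : y ∈ U) (c : ℝ) (hT : SmoothTen T U) (e : Fin n)
    (i : Fin r → Fin n) :
    covDeriv G (fun z j => c * T z j) y (Fin.cons e i) = c * covDeriv G T y (Fin.cons e i) := by
  rw [covDeriv_fun_mul hU hy contDiffOn_const hT, pd_const, zero_mul, zero_add]

lemma covDeriv_zero (e : Fin n) (i : Fin r → Fin n) :
    covDeriv G (fun _ _ => (0 : ℝ)) y (Fin.cons e i) = 0 := by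
  rw [covDeriv_cons, pd_const]
  simp [slotAct]

lemma covDeriv_sum {ι : Type*} [Fintype ι] (hU : IsOpen U) (hy : y ∈ U)
    (A : ι → TensorField n r) (hA : ∀ k, SmoothTen (A k) U) (e : Fin n) (i : Fin r → Fin n) :
    covDeriv G (fun z j => ∑ k, A k z j) y (Fin.cons e i)
      = ∑ k, covDeriv G (A k) y (Fin.cons e i) := by
  simp only [covDeriv_cons]
  rw [pd_sum _ _ _ fun k _ => diffAt_of_smooth hU (hA k i) hy, Finset.sum_sub_distrib]
  congr 1
  simp only [slotAct, Finset.mul_sum]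
  rw [Finset.sum_comm (s := (Finset.univ : Finset ι))]
  refine Finset.sum_congr rfl fun p _ => ?_
  rw [Finset.sum_comm]

lemma SmoothTen.reindex {r' : ℕ} (hT : SmoothTen T U) (σ : Fin r → Fin r') :
    SmoothTen (fun z (j : Fin r' → Fin n) => T z fun p => j (σ p)) U := fun _ => hT _

/-- A linear identity between the components of a tensor field with permuted indices is inherited
by the covariant derivative. -/
lemma covDeriv_identity {m : ℕ} (hU : IsOpen U) (hy : y ∈ U) (hT : SmoothTen T U)
    (c : Fin m → ℝ) (σ : Fin m → Equiv.Perm (Fin r))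
    (h : ∀ z ∈ U, ∀ i : Fin r → Fin n, ∑ k, c k * T z (fun p => i (σ k p)) = 0)
    (e : Fin n) (i : Fin r → Fin n) :
    ∑ k, c k * covDeriv G T y (Fin.cons e fun p => i (σ k p)) = 0 := by
  have h1 : ∀ k, c k * covDeriv G T y (Fin.cons e fun p => i (σ k p))
      = covDeriv G (fun z j => c k * T z (fun p => j (σ k p))) y (Fin.cons e i) := by
    intro k
    rw [covDeriv_const_mul hU hy _ (hT.reindex (σ k)), covDeriv_reindex]
  rw [Finset.sum_congr rfl fun k _ => h1 k, ← covDeriv_sum hU hy (e := e) (i := i)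
    (fun k z j => c k * T z (fun p => j (σ k p)))
    (fun k j => contDiffOn_const.mul (hT _))]
  rw [covDeriv_congr_on hU hy (S := fun _ _ => 0) fun z hz => by funext j; exact h z hz j]
  exact covDeriv_zero e i

/-- The contraction of three pairs of slots of `A ⊗ B`, after the slots of `A ⊗ B` have been moved
to the places that `σ` prescribes; the contracted places come first. -/
def dot3 (h : Matrix (Fin n) (Fin n) ℝ) (σ : Fin (r + s) ≃ Fin (t + 2 + 2 + 2))
    (A : (Fin r → Fin n) → ℝ) (B : (Fin s → Fin n) → ℝ) : (Fin t → Fin n) → ℝ :=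
  contr h (contr h (contr h fun j => A (fun p => j (σ (Fin.castAdd s p)))
    * B (fun p => j (σ (Fin.natAdd r p)))))

lemma contr_add (h : Matrix (Fin n) (Fin n) ℝ) (A B : (Fin (r + 2) → Fin n) → ℝ) :
    contr h (fun j => A j + B j) = fun i => contr h A i + contr h B i := by
  funext i
  simp only [contr, mul_add, Finset.sum_add_distrib]

lemma SmoothTen.mul_reindex {A : TensorField n r} {B : TensorField n s} (hA : SmoothTen A U)
    (hB : SmoothTen B U) (σ : Fin (r + s) ≃ Fin t) :
    SmoothTen (fun z j => A z (fun p => j (σ (Fin.castAdd s p)))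
      * B z (fun p => j (σ (Fin.natAdd r p)))) U := fun _ => (hA _).mul (hB _)

lemma IsMetricOn.smooth_dot3 (hG : IsMetricOn G U) (σ : Fin (r + s) ≃ Fin (t + 2 + 2 + 2))
    {A : TensorField n r} {B : TensorField n s} (hA : SmoothTen A U) (hB : SmoothTen B U) :
    SmoothTen (fun z => dot3 (G z)⁻¹ σ (A z) (B z)) U :=
  hG.smooth_contr (hG.smooth_contr (hG.smooth_contr (hA.mul_reindex hB σ)))

/-- The Leibniz rule for contracted products. -/
lemma IsMetricOn.covDeriv_dot3 (hG : IsMetricOn G U) (hy : y ∈ U)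
    (σ : Fin (r + s) ≃ Fin (t + 2 + 2 + 2)) {A : TensorField n r} {B : TensorField n s}
    (hA : SmoothTen A U) (hB : SmoothTen B U) (e : Fin n) (i : Fin t → Fin n) :
    covDeriv G (fun z => dot3 (G z)⁻¹ σ (A z) (B z)) y (Fin.cons e i)
      = dot3 (G y)⁻¹ σ (fun j => covDeriv G A y (Fin.cons e j)) (B y) i
        + dot3 (G y)⁻¹ σ (A y) (fun j => covDeriv G B y (Fin.cons e j)) i := by
  have hP := hA.mul_reindex hB σ
  have h0 : ∀ j, covDeriv G (fun z j => A z (fun p => j (σ (Fin.castAdd s p)))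
      * B z (fun p => j (σ (Fin.natAdd r p)))) y (Fin.cons e j)
      = covDeriv G A y (Fin.cons e fun p => j (σ (Fin.castAdd s p)))
          * B y (fun p => j (σ (Fin.natAdd r p)))
        + A y (fun p => j (σ (Fin.castAdd s p)))
          * covDeriv G B y (Fin.cons e fun p => j (σ (Fin.natAdd r p))) := by
    intro j
    exact (covDeriv_reindex σ (fun z j => A z (fun p => j (Fin.castAdd s p))
      * B z (fun p => j (Fin.natAdd r p))) e j).trans
      (hG.covDeriv_mul hy hA hB e fun p => j (σ p))
  simp only [dot3]
  rw [hG.covDeriv_contr hy (hG.smooth_contr (hG.smooth_contr hP))]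
  simp only [hG.covDeriv_contr hy (hG.smooth_contr hP), hG.covDeriv_contr hy hP, h0, contr_add]

end Contractions

/-! ### Contracted Bianchi identities -/

section Conservation

open Matrix

variable {n r : ℕ} {G : MetricField n} {U : Set (EuclideanSpace ℝ (Fin n))}
  {y : EuclideanSpace ℝ (Fin n)}

lemma covDeriv_antisymm {T : TensorField n r} (hU : IsOpen U) (hy : y ∈ U) (hT : SmoothTen T U)
    (σ : Equiv.Perm (Fin r)) (h : ∀ z ∈ U, ∀ i : Fin r → Fin n, T z (fun p => i (σ p)) = - T z i)
    (e : Fin n) (i : Fin r → Fin n) :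
    covDeriv G T y (Fin.cons e fun p => i (σ p)) = - covDeriv G T y (Fin.cons e i) := by
  have := covDeriv_identity (G := G) hU hy hT ![1, 1] ![σ, 1] (fun z hz j => by
    simp [Fin.sum_univ_two, h z hz j]) e i
  simp [Fin.sum_univ_two] at this
  linarith

lemma covDeriv_cyclic {T : TensorField n r} (hU : IsOpen U) (hy : y ∈ U) (hT : SmoothTen T U)
    (σ τ : Equiv.Perm (Fin r)) (h : ∀ z ∈ U, ∀ i : Fin r → Fin n,
      T z i + T z (fun p => i (σ p)) + T z (fun p => i (τ p)) = 0) (e : Fin n) (i : Fin r → Fin n) :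
    covDeriv G T y (Fin.cons e i) + covDeriv G T y (Fin.cons e fun p => i (σ p))
      + covDeriv G T y (Fin.cons e fun p => i (τ p)) = 0 := by
  have := covDeriv_identity (G := G) hU hy hT ![1, 1, 1] ![1, σ, τ] (fun z hz j => by
    simpa [Fin.sum_univ_three] using h z hz j) e i
  simpa [Fin.sum_univ_three] using this

/-- The algebraic symmetries of the Riemann tensor. -/
structure IsCurvLike (C : Fin n → Fin n → Fin n → Fin n → ℝ) : Prop where
  left : ∀ a b c d, C b a c d = - C a b c d
  right : ∀ a b c d, C a b d c = - C a b c d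
  cyclic : ∀ a b c d, C a b c d + C a c d b + C a d b c = 0

lemma IsCurvLike.pair {C : Fin n → Fin n → Fin n → Fin n → ℝ}
    (h : IsCurvLike C) (a b c d : Fin n) : C a b c d = C c d a b :=
  pair_symm_of_cyclic h.left h.right h.cyclic a b c d

lemma IsWeyl.isCurvLike {g : Matrix (Fin n) (Fin n) ℝ} {C : Fin n → Fin n → Fin n → Fin n → ℝ}
    (h : IsWeyl g C) : IsCurvLike C := ⟨h.left, h.right, h.cyclic⟩

lemma IsMetricOn.isCurvLike (hG : IsMetricOn G U) (hy : y ∈ U) : IsCurvLike (riemann G y) :=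
  ⟨hG.riemann_antisymm_left hy, riemann_antisymm_right G y, hG.riemann_cyclic hy⟩

/-- The cyclic permutation of the last three of four slots. -/
def rotFour : Equiv.Perm (Fin 4) := ⟨![0, 2, 3, 1], ![0, 3, 1, 2], by decide, by decide⟩

/-- The cyclic permutation of the last three of five slots. -/
def rotFive : Equiv.Perm (Fin 5) := ⟨![0, 1, 3, 4, 2], ![0, 1, 4, 2, 3], by decide, by decide⟩

/-- The cyclic permutation of the first and the last two of five slots. -/
def rotBianchi : Equiv.Perm (Fin 5) := ⟨![3, 1, 2, 4, 0], ![4, 1, 2, 0, 3], by decide, by decide⟩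

lemma eta_four {α : Type*} (i : Fin 4 → α) : i = ![i 0, i 1, i 2, i 3] := by
  funext p; fin_cases p <;> rfl

lemma eta_five {α : Type*} (i : Fin 5 → α) : i = ![i 0, i 1, i 2, i 3, i 4] := by
  funext p; fin_cases p <;> rfl

lemma IsCurvLike.covDeriv {T : TensorField n 4} (hU : IsOpen U) (hy : y ∈ U) (hT : SmoothTen T U)
    (h : ∀ z ∈ U, IsCurvLike fun a b c d => T z ![a, b, c, d]) (e : Fin n) :
    IsCurvLike fun a b c d => covDeriv G T y ![e, a, b, c, d] where
  left a b c d := by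
    have e1 : ∀ i : Fin 4 → Fin n, (fun p => i (Equiv.swap 0 1 p)) = ![i 1, i 0, i 2, i 3] :=
      fun i => by funext p; fin_cases p <;> rfl
    have := covDeriv_antisymm (G := G) hU hy hT (Equiv.swap 0 1) (fun z hz i => by
      rw [e1, congrArg (T z) (eta_four i)]
      exact (h z hz).left (i 0) (i 1) (i 2) (i 3)) e ![a, b, c, d]
    rw [e1] at this
    exact this
  right a b c d := by
    have e1 : ∀ i : Fin 4 → Fin n, (fun p => i (Equiv.swap 2 3 p)) = ![i 0, i 1, i 3, i 2] :=
      fun i => by funext p; fin_cases p <;> rfl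
    have := covDeriv_antisymm (G := G) hU hy hT (Equiv.swap 2 3) (fun z hz i => by
      rw [e1, congrArg (T z) (eta_four i)]
      exact (h z hz).right (i 0) (i 1) (i 2) (i 3)) e ![a, b, c, d]
    rw [e1] at this
    exact this
  cyclic a b c d := by
    have e1 : ∀ i : Fin 4 → Fin n, (fun p => i (rotFour p))
        = ![i 0, i 2, i 3, i 1] := fun i => by funext p; fin_cases p <;> rfl
    have e2 : ∀ i : Fin 4 → Fin n, (fun p => i (rotFour.symm p))
        = ![i 0, i 3, i 1, i 2] := fun i => by funext p; fin_cases p <;> rfl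
    have := covDeriv_cyclic (G := G) hU hy hT rotFour
      rotFour.symm (fun z hz i => by
        rw [e1, e2]; nth_rw 1 [eta_four i]
        exact (h z hz).cyclic (i 0) (i 1) (i 2) (i 3)) e ![a, b, c, d]
    rw [e1, e2] at this
    exact this

lemma IsCurvLike.covDeriv_covDeriv {T : TensorField n 5} (hU : IsOpen U) (hy : y ∈ U)
    (hT : SmoothTen T U) (f : Fin n)
    (h : ∀ z ∈ U, ∀ f, IsCurvLike fun a b c d => T z ![f, a, b, c, d]) (e : Fin n) :
    IsCurvLike fun a b c d => Lorentz.covDeriv G T y ![e, f, a, b, c, d] where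
  left a b c d := by
    have e1 : ∀ i : Fin 5 → Fin n, (fun p => i (Equiv.swap 1 2 p)) = ![i 0, i 2, i 1, i 3, i 4] :=
      fun i => by funext p; fin_cases p <;> rfl
    have := covDeriv_antisymm (G := G) hU hy hT (Equiv.swap 1 2) (fun z hz i => by
      rw [e1, congrArg (T z) (eta_five i)]
      exact (h z hz (i 0)).left (i 1) (i 2) (i 3) (i 4)) e ![f, a, b, c, d]
    rw [e1] at this
    exact this
  right a b c d := by
    have e1 : ∀ i : Fin 5 → Fin n, (fun p => i (Equiv.swap 3 4 p)) = ![i 0, i 1, i 2, i 4, i 3] :=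
      fun i => by funext p; fin_cases p <;> rfl
    have := covDeriv_antisymm (G := G) hU hy hT (Equiv.swap 3 4) (fun z hz i => by
      rw [e1, congrArg (T z) (eta_five i)]
      exact (h z hz (i 0)).right (i 1) (i 2) (i 3) (i 4)) e ![f, a, b, c, d]
    rw [e1] at this
    exact this
  cyclic a b c d := by
    have e1 : ∀ i : Fin 5 → Fin n, (fun p => i (rotFive p))
        = ![i 0, i 1, i 3, i 4, i 2] := fun i => by funext p; fin_cases p <;> rfl
    have e2 : ∀ i : Fin 5 → Fin n, (fun p => i (rotFive.symm p))
        = ![i 0, i 1, i 4, i 2, i 3] := fun i => by funext p; fin_cases p <;> rfl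
    have := covDeriv_cyclic (G := G) hU hy hT rotFive
      rotFive.symm (fun z hz i => by
        rw [e1, e2]; nth_rw 1 [eta_five i]
        exact (h z hz (i 0)).cyclic (i 1) (i 2) (i 3) (i 4)) e ![f, a, b, c, d]
    rw [e1, e2] at this
    exact this

/-- The second Bianchi identity is inherited by the next covariant derivative. -/

lemma covDeriv_bianchi {T : TensorField n 5} (hU : IsOpen U) (hy : y ∈ U) (hT : SmoothTen T U)
    (h : ∀ z ∈ U, ∀ e a b c d, T z ![e, a, b, c, d] + T z ![c, a, b, d, e]
      + T z ![d, a, b, e, c] = 0) (f e a b c d : Fin n) :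
    covDeriv G T y ![f, e, a, b, c, d] + covDeriv G T y ![f, c, a, b, d, e]
      + covDeriv G T y ![f, d, a, b, e, c] = 0 := by
  have e1 : ∀ i : Fin 5 → Fin n, (fun p => i (rotBianchi p))
      = ![i 3, i 1, i 2, i 4, i 0] := fun i => by funext p; fin_cases p <;> rfl
  have e2 : ∀ i : Fin 5 → Fin n, (fun p => i (rotBianchi.symm p))
      = ![i 4, i 1, i 2, i 0, i 3] := fun i => by funext p; fin_cases p <;> rfl
  have := covDeriv_cyclic (G := G) hU hy hT rotBianchi
    rotBianchi.symm (fun z hz i => by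
      rw [e1, e2]; nth_rw 1 [eta_five i]
      exact h z hz (i 0) (i 1) (i 2) (i 3) (i 4)) f ![e, a, b, c, d]
  rw [e1, e2] at this
  exact this

/-- The contraction of the first and the third slot of a tensor of rank four. -/
def trace13 (G : MetricField n) (T : TensorField n 4) : TensorField n 2 :=
  fun y => contr (G y)⁻¹ fun j => T y fun p => j (Equiv.swap 1 2 p)

lemma trace13_apply (T : TensorField n 4) (b d : Fin n) :
    trace13 G T y ![b, d] = ∑ a, ∑ c, (G y)⁻¹ a c * T y ![a, b, c, d] := by
  rw [trace13, contr]
  exact Finset.sum_congr rfl fun a _ => Finset.sum_congr rfl fun c _ =>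
    congrArg (fun i => (G y)⁻¹ a c * T y i)
      (show (fun p => (Fin.cons a (Fin.cons c ![b, d]) : Fin 4 → Fin n) (Equiv.swap 1 2 p))
        = ![a, b, c, d] by funext p; fin_cases p <;> rfl)

lemma IsMetricOn.smooth_trace13 (hG : IsMetricOn G U) {T : TensorField n 4} (hT : SmoothTen T U) :
    SmoothTen (trace13 G T) U :=
  hG.smooth_contr (A := fun z j => T z fun p => j (Equiv.swap 1 2 p)) (hT.reindex _)

lemma IsMetricOn.covDeriv_trace13 (hG : IsMetricOn G U) (hy : y ∈ U) {T : TensorField n 4}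
    (hT : SmoothTen T U) (e b d : Fin n) : covDeriv G (trace13 G T) y ![e, b, d]
      = ∑ a, ∑ c, (G y)⁻¹ a c * covDeriv G T y ![e, a, b, c, d] := by
  have := hG.covDeriv_contr hy (A := fun z j => T z fun p => j (Equiv.swap 1 2 p))
    (hT.reindex (Equiv.swap 1 2)) e ![b, d]
  refine Eq.trans this ?_
  refine Finset.sum_congr rfl fun a _ => Finset.sum_congr rfl fun c _ => ?_
  have h2 := covDeriv_reindex (G := G) (y := y) (Equiv.swap 1 2) T e
    (Fin.cons a (Fin.cons c ![b, d]))
  refine Eq.trans (congrArg _ h2) ?_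
  exact congrArg (fun i => (G y)⁻¹ a c * covDeriv G T y i) (by funext p; fin_cases p <;> rfl)

lemma covDeriv_rank_zero (f : EuclideanSpace ℝ (Fin n) → ℝ) (e : Fin n) (i : Fin 0 → Fin n) :
    covDeriv G (fun z _ => f z) y (Fin.cons e i) = pd e f y := by
  rw [covDeriv_cons]; simp [slotAct]

/-- The full contraction of a tensor of rank two. -/
def trace (G : MetricField n) (T : TensorField n 2) (y : EuclideanSpace ℝ (Fin n)) : ℝ :=
  ∑ a, ∑ b, (G y)⁻¹ a b * T y ![a, b]

lemma IsMetricOn.smooth_trace (hG : IsMetricOn G U) {T : TensorField n 2} (hT : SmoothTen T U) :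
    ContDiffOn ℝ ∞ (trace G T) U :=
  ContDiffOn.sum fun a _ => ContDiffOn.sum fun b _ => (hG.smooth_inv a b).mul (hT _)

lemma contr_eq_trace (T : TensorField n 2) (i : Fin 0 → Fin n) :
    contr (G y)⁻¹ (T y) i = trace G T y :=
  Finset.sum_congr rfl fun a _ => Finset.sum_congr rfl fun b _ =>
    congrArg (fun i => (G y)⁻¹ a b * T y i) (by funext p; fin_cases p <;> rfl)

lemma IsMetricOn.pd_trace (hG : IsMetricOn G U) (hy : y ∈ U) {T : TensorField n 2}
    (hT : SmoothTen T U) (e : Fin n) :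
    pd e (trace G T) y = ∑ a, ∑ b, (G y)⁻¹ a b * covDeriv G T y ![e, a, b] := by
  rw [← covDeriv_rank_zero (G := G) (trace G T) e ![]]
  have := hG.covDeriv_contr hy (r := 0) hT e ![]
  refine Eq.trans (congrFun (congrFun (congrArg _ ?_) _) _) (this.trans ?_)
  · funext z i; exact (contr_eq_trace T i).symm
  · exact Finset.sum_congr rfl fun a _ => Finset.sum_congr rfl fun b _ =>
      congrArg (fun i => (G y)⁻¹ a b * covDeriv G T y i) (by funext p; fin_cases p <;> rfl)

lemma IsMetricOn.ricci_eq_trace13 (hG : IsMetricOn G U) (hy : y ∈ U) (b d : Fin n) :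
    trace13 G (riemannTen G) y ![b, d] = ricci G y b d := by
  rw [trace13_apply, hG.ricci_eq_trace hy]
  rfl

lemma IsMetricOn.scalarCurv_eq_trace (hG : IsMetricOn G U) (hy : y ∈ U) :
    trace G (trace13 G (riemannTen G)) y = scalarCurv G y := by
  simp only [trace, hG.ricci_eq_trace13 hy, scalarCurv]

lemma sum_four_reverse (F : Fin n → Fin n → Fin n → Fin n → ℝ) :
    ∑ a, ∑ b, ∑ c, ∑ d, F a b c d = ∑ d, ∑ c, ∑ b, ∑ a, F a b c d := by
  calc _ = ∑ p : Fin n × Fin n × Fin n × Fin n, F p.1 p.2.1 p.2.2.1 p.2.2.2 := by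
        simp only [Fintype.sum_prod_type]
    _ = ∑ q : Fin n × Fin n × Fin n × Fin n, F q.2.2.2 q.2.2.1 q.2.1 q.1 :=
        Fintype.sum_equiv ⟨fun p => (p.2.2.2, p.2.2.1, p.2.1, p.1),
          fun p => (p.2.2.2, p.2.2.1, p.2.1, p.1), fun _ => rfl, fun _ => rfl⟩ _ _ fun _ => rfl
    _ = _ := by simp only [Fintype.sum_prod_type]

/-- The twice contracted second Bianchi identity, `2 ∇ᵇ R_{bd} = ∇_d R`. -/

lemma IsMetricOn.contracted_bianchi (hG : IsMetricOn G U) (hy : y ∈ U) (d : Fin n) :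
    2 * divergence G (trace13 G (riemannTen G)) y d
      = pd d (trace G (trace13 G (riemannTen G))) y := by
  have hR := hG.smooth_riemannTen
  have hsymm : ∀ a c, (G y)⁻¹ a c = (G y)⁻¹ c a := hG.inv_symm hy
  have hB := hG.bianchi hy
  have hW : ∀ e, IsCurvLike fun a b c d => covDeriv G (riemannTen G) y ![e, a, b, c, d] :=
    IsCurvLike.covDeriv hG.isOpen hy hR fun z hz => hG.isCurvLike hz
  rw [divergence, hG.pd_trace hy (hG.smooth_trace13 hR)]
  simp only [hG.covDeriv_trace13 hy hR]
  generalize hWd : (fun e a b c d => covDeriv G (riemannTen G) y ![e, a, b, c, d]) = W at *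
  have hWd' : ∀ e a b c d, covDeriv G (riemannTen G) y ![e, a, b, c, d] = W e a b c d := by
    intros; rw [← hWd]
  simp only [hWd'] at hB hW ⊢
  generalize (G y)⁻¹ = h at *
  have h1 : ∀ e b a c, h b e * (h a c * W d a b c e) = h e b * (h a c * W e a b c d)
      + h c a * (h b e * W c b a e d) := by
    intro e b a c
    have e1 := hB e a b c d
    rw [(hW d).right a b c e, (hW c).left b a, (hW c).right b a e d] at e1
    rw [hsymm c a, hsymm b e]
    linear_combination - h e b * h a c * e1
  have h2 : ∑ e, ∑ b, h e b * ∑ a, ∑ c, h a c * W e a b c d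
      = ∑ e, ∑ b, ∑ a, ∑ c, h c a * (h b e * W c b a e d) := by
    simp only [Finset.mul_sum]
    rw [sum_four_reverse]
  have h3 : ∑ e, ∑ b, h e b * ∑ a, ∑ c, h a c * W d a e c b
      = ∑ e, ∑ b, ∑ a, ∑ c, h b e * (h a c * W d a b c e) := by
    rw [Finset.sum_comm]
    simp only [Finset.mul_sum]
  rw [h3, two_mul]
  nth_rw 2 [h2]
  simp only [h1, Finset.sum_add_distrib, Finset.mul_sum]

end Conservation

/-! ### Two conserved tensors -/

section ConservedTensors

open Matrix

variable {n r : ℕ} {G : MetricField n} {U : Set (EuclideanSpace ℝ (Fin n))}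
  {y : EuclideanSpace ℝ (Fin n)}

lemma IsMetricOn.covDeriv_add_mul_metric (hG : IsMetricOn G U) (hy : y ∈ U) {T : TensorField n 2}
    (hT : SmoothTen T U) {f : EuclideanSpace ℝ (Fin n) → ℝ} (hf : ContDiffOn ℝ ∞ f U)
    (e a b : Fin n) : covDeriv G (fun z j => T z j + f z * metricTen G z j) y ![e, a, b]
      = covDeriv G T y ![e, a, b] + pd e f y * G y a b := by
  have h1 := covDeriv_add (G := G) hG.isOpen hy hT (S := fun z j => f z * metricTen G z j)
    (fun j => hf.mul (hG.smooth_metricTen j)) e ![a, b]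
  have h2 := covDeriv_fun_mul (G := G) hG.isOpen hy hf hG.smooth_metricTen e ![a, b]
  have h3 : covDeriv G (metricTen G) y (Fin.cons e ![a, b]) = 0 := hG.covDeriv_metricTen hy e a b
  rw [h2, h3, mul_zero, add_zero] at h1
  exact h1

lemma IsMetricOn.divergence_add_mul_metric (hG : IsMetricOn G U) (hy : y ∈ U) {T : TensorField n 2}
    (hT : SmoothTen T U) {f : EuclideanSpace ℝ (Fin n) → ℝ} (hf : ContDiffOn ℝ ∞ f U) (a : Fin n) :
    divergence G (fun z j => T z j + f z * metricTen G z j) y a = divergence G T y a + pd a f y := by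
  simp only [divergence, hG.covDeriv_add_mul_metric hy hT hf, mul_add, Finset.sum_add_distrib]
  congr 1
  have := hG.sum_inv_mul hy (fun b => pd b f y) a
  rw [Finset.sum_comm] at this
  refine Eq.trans ?_ this
  exact Finset.sum_congr rfl fun b _ => Finset.sum_congr rfl fun c _ => by
    rw [hG.inv_symm hy b c]; ring

/-- The Ricci tensor as a curvature expression. -/
def ricciExpr (k : ℕ) : CurvExpr k 2 :=
  .contract (.perm (Equiv.swap 1 2) (.riem 0 (Nat.zero_le k)))

/-- The Einstein tensor as a curvature expression. -/
def einsteinExpr (k : ℕ) : CurvExpr k 2 :=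
  .add (ricciExpr k) (.smul (-1 / 2) (.mul .metric (.contract (r := 0) (ricciExpr k))))

lemma einsteinExpr_eval (k : ℕ) : (einsteinExpr k).eval G = fun z j =>
    trace13 G (riemannTen G) z j
      + (-1 / 2 * trace G (trace13 G (riemannTen G)) z) * metricTen G z j := by
  funext z j
  have h : ∀ i : Fin 0 → Fin n, ((ricciExpr k).contract (r := 0)).eval G z i
      = trace G (trace13 G (riemannTen G)) z := contr_eq_trace _
  change trace13 G (riemannTen G) z j
    + (-1 / 2) * (metricTen G z j * ((ricciExpr k).contract (r := 0)).eval G z _) = _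
  rw [h]
  ring

lemma IsMetricOn.divergence_einstein (hG : IsMetricOn G U) (k : ℕ) (hy : y ∈ U) (a : Fin n) :
    divergence G ((einsteinExpr k).eval G) y a = 0 := by
  have hs := hG.smooth_trace (hG.smooth_trace13 hG.smooth_riemannTen)
  have h := hG.contracted_bianchi hy a
  rw [einsteinExpr_eval, hG.divergence_add_mul_metric hy (hG.smooth_trace13 hG.smooth_riemannTen)
    (contDiffOn_const.mul hs), pd_const_mul a _ (diffAt_of_smooth hG.isOpen hs hy)]
  linarith

lemma IsMetricOn.einstein_apply (hG : IsMetricOn G U) (k : ℕ) (hy : y ∈ U) (a b : Fin n) :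
    (einsteinExpr k).eval G y ![a, b] = ricci G y a b - scalarCurv G y / 2 * G y a b := by
  rw [einsteinExpr_eval]
  simp only [hG.ricci_eq_trace13 hy, hG.scalarCurv_eq_trace hy]
  change _ + _ * G y a b = _
  ring

/-- The places of the slots of `A ⊗ B` in the contraction `A_{acdf} B_b^{cdf}`. -/
def slots44 : Fin (4 + 4) ≃ Fin (2 + 2 + 2 + 2) :=
  ⟨![6, 4, 2, 0, 7, 5, 3, 1], ![3, 7, 2, 6, 1, 5, 0, 4], by decide, by decide⟩

/-- The contraction `A_{acdf} B_b^{cdf}`. -/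
def polarWith (h : Matrix (Fin n) (Fin n) ℝ) (A B : Fin n → Fin n → Fin n → Fin n → ℝ)
    (a b : Fin n) : ℝ :=
  ∑ c, ∑ c', h c c' * ∑ d, ∑ d', h d d' * ∑ f, ∑ f', h f f' * (A a c d f * B b c' d' f')

lemma dot3_slots44 (h : Matrix (Fin n) (Fin n) ℝ) (A B : (Fin 4 → Fin n) → ℝ) (a b : Fin n) :
    dot3 h slots44 A B ![a, b] = polarWith h (fun a b c d => A ![a, b, c, d])
      (fun a b c d => B ![a, b, c, d]) a b := by
  simp only [dot3, polarWith, contr]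
  refine Finset.sum_congr rfl fun c _ => Finset.sum_congr rfl fun c' _ => congrArg _ ?_
  refine Finset.sum_congr rfl fun d _ => Finset.sum_congr rfl fun d' _ => congrArg _ ?_
  refine Finset.sum_congr rfl fun f _ => Finset.sum_congr rfl fun f' _ => congrArg _ ?_
  congr 2
  · funext p; fin_cases p <;> rfl
  · funext p; fin_cases p <;> rfl

lemma polarWith_self (g : Matrix (Fin n) (Fin n) ℝ) (C : Fin n → Fin n → Fin n → Fin n → ℝ)
    (a b : Fin n) : polarWith g⁻¹ C C a b = S2 g C a b := by
  simp only [polarWith, S2, Finset.mul_sum]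
  calc _ = ∑ p : Fin n × Fin n × Fin n × Fin n × Fin n × Fin n,
      g⁻¹ p.1 p.2.1 * (g⁻¹ p.2.2.1 p.2.2.2.1 * (g⁻¹ p.2.2.2.2.1 p.2.2.2.2.2
        * (C a p.1 p.2.2.1 p.2.2.2.2.1 * C b p.2.1 p.2.2.2.1 p.2.2.2.2.2))) := by
        simp only [Fintype.sum_prod_type]
    _ = ∑ q : Fin n × Fin n × Fin n × Fin n × Fin n × Fin n,
      g⁻¹ q.1 q.2.2.2.1 * g⁻¹ q.2.1 q.2.2.2.2.1 * g⁻¹ q.2.2.1 q.2.2.2.2.2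
        * (C a q.1 q.2.1 q.2.2.1 * C b q.2.2.2.1 q.2.2.2.2.1 q.2.2.2.2.2) :=
        Fintype.sum_equiv
          ⟨fun p => (p.1, p.2.2.1, p.2.2.2.2.1, p.2.1, p.2.2.2.1, p.2.2.2.2.2),
            fun q => (q.1, q.2.2.2.1, q.2.1, q.2.2.2.2.1, q.2.2.1, q.2.2.2.2.2),
            fun _ => rfl, fun _ => rfl⟩ _ _ fun p => by simp only [Equiv.coe_fn_mk]; ring
    _ = _ := by simp only [Fintype.sum_prod_type]

/-- The last three indices of `B` raised with `h`. -/
def raise3 (h : Matrix (Fin n) (Fin n) ℝ) (B : Fin n → Fin n → Fin n → Fin n → ℝ)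
    (b c d f : Fin n) : ℝ :=
  ∑ c', ∑ d', ∑ f', h c c' * (h d d' * (h f f' * B b c' d' f'))

lemma polarWith_eq_sum (h : Matrix (Fin n) (Fin n) ℝ) (A B : Fin n → Fin n → Fin n → Fin n → ℝ)
    (a b : Fin n) : polarWith h A B a b = ∑ c, ∑ d, ∑ f, A a c d f * raise3 h B b c d f := by
  simp only [polarWith, raise3, Finset.mul_sum]
  refine Finset.sum_congr rfl fun c _ => ?_
  rw [Finset.sum_comm]
  refine Finset.sum_congr rfl fun d _ => ?_
  calc _ = ∑ c', ∑ f, ∑ d', ∑ f', h c c' * (h d d' * (h f f' * (A a c d f * B b c' d' f'))) :=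
        Finset.sum_congr rfl fun _ _ => Finset.sum_comm
    _ = _ := by
      rw [Finset.sum_comm]
      exact Finset.sum_congr rfl fun f _ => Finset.sum_congr rfl fun c' _ =>
        Finset.sum_congr rfl fun d' _ => Finset.sum_congr rfl fun f' _ => by ring

lemma polarWith_comm {h : Matrix (Fin n) (Fin n) ℝ} (hh : ∀ a b, h a b = h b a)
    (A B : Fin n → Fin n → Fin n → Fin n → ℝ) (a b : Fin n) :
    polarWith h A B a b = polarWith h B A b a := by
  rw [polarWith, polarWith, Finset.sum_comm]
  refine Finset.sum_congr rfl fun c _ => Finset.sum_congr rfl fun c' _ => ?_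
  rw [hh, Finset.sum_comm]
  refine congrArg _ (Finset.sum_congr rfl fun d _ => Finset.sum_congr rfl fun d' _ => ?_)
  rw [hh, Finset.sum_comm]
  refine congrArg _ (Finset.sum_congr rfl fun f _ => Finset.sum_congr rfl fun f' _ => ?_)
  rw [hh, mul_comm (A _ _ _ _)]

/-- The square `R_{acdf} R_b^{cdf}` as a tensor field. -/
def squareTen (G : MetricField n) (T : TensorField n 4) : TensorField n 2 :=
  fun z => dot3 (G z)⁻¹ slots44 (T z) (T z)

lemma squareTen_apply (T : TensorField n 4) (a b : Fin n) :
    squareTen G T y ![a, b] = S2 (G y) (fun a b c d => T y ![a, b, c, d]) a b := by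
  rw [squareTen, dot3_slots44, polarWith_self]

lemma IsMetricOn.smooth_squareTen (hG : IsMetricOn G U) {T : TensorField n 4}
    (hT : SmoothTen T U) : SmoothTen (squareTen G T) U := hG.smooth_dot3 slots44 hT hT

lemma IsMetricOn.covDeriv_squareTen (hG : IsMetricOn G U) (hy : y ∈ U) {T : TensorField n 4}
    (hT : SmoothTen T U) (e a b : Fin n) : covDeriv G (squareTen G T) y ![e, a, b]
      = polarWith (G y)⁻¹ (fun a b c d => covDeriv G T y ![e, a, b, c, d])
          (fun a b c d => T y ![a, b, c, d]) a b
        + polarWith (G y)⁻¹ (fun a b c d => covDeriv G T y ![e, a, b, c, d])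
          (fun a b c d => T y ![a, b, c, d]) b a := by
  have := hG.covDeriv_dot3 hy slots44 hT hT e ![a, b]
  rw [dot3_slots44, dot3_slots44, polarWith_comm (hG.inv_symm hy) (fun a b c d => T y ![a, b, c, d])]
    at this
  exact this

/-- The algebraic identity behind the conservation of `R_{acde} R_b^{cde} - ¼ R² g_{ab}`. -/
lemma sum_square_eq {h : Matrix (Fin n) (Fin n) ℝ} (hh : ∀ a b, h a b = h b a)
    {R : Fin n → Fin n → Fin n → Fin n → ℝ} {W : Fin n → Fin n → Fin n → Fin n → Fin n → ℝ}
    (hR : IsCurvLike R) (hW : ∀ e, IsCurvLike (W e))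
    (hB : ∀ e a b c d, W e a b c d + W c a b d e + W d a b e c = 0)
    (hdiv : ∀ b c d, ∑ e, ∑ a, h e a * W e a b c d = 0) (b : Fin n) :
    4 * ∑ e, ∑ a, h e a * (polarWith h (W e) R a b + polarWith h (W e) R b a)
      = ∑ e, ∑ a, h e a * (polarWith h (W b) R e a + polarWith h (W b) R a e) := by
  set B : Fin n → Fin n → Fin n → Fin n → ℝ := fun e c d f => ∑ a, h e a * raise3 h R a c d f with hBd
  have hBanti : ∀ e c d f, B c e d f = - B e c d f := by
    intro e c d f
    simp only [hBd, raise3, Finset.mul_sum]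
    rw [Finset.sum_comm, ← Finset.sum_neg_distrib]
    refine Finset.sum_congr rfl fun i _ => ?_
    rw [← Finset.sum_neg_distrib]
    refine Finset.sum_congr rfl fun j _ => ?_
    rw [← Finset.sum_neg_distrib]
    refine Finset.sum_congr rfl fun k _ => ?_
    rw [← Finset.sum_neg_distrib]
    refine Finset.sum_congr rfl fun l _ => ?_
    rw [hR.left i j]
    ring
  have key : ∀ (A : Fin n → Fin n → Fin n → Fin n → Fin n → ℝ) (b : Fin n),
      ∑ e, ∑ a, h e a * polarWith h (A e) R b a = ∑ e, ∑ c, ∑ d, ∑ f, A e b c d f * B e c d f := by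
    intro A b
    refine Finset.sum_congr rfl fun e _ => ?_
    simp only [polarWith_eq_sum, hBd, Finset.mul_sum]
    rw [Finset.sum_comm]
    refine Finset.sum_congr rfl fun c _ => ?_
    rw [Finset.sum_comm]
    refine Finset.sum_congr rfl fun d _ => ?_
    rw [Finset.sum_comm]
    exact Finset.sum_congr rfl fun f _ => Finset.sum_congr rfl fun a _ => by ring
  have h1 : ∑ e, ∑ a, h e a * polarWith h (W e) R a b = 0 := by
    have : ∑ e, ∑ a, h e a * polarWith h (W e) R a b
        = ∑ c, ∑ d, ∑ f, (∑ e, ∑ a, h e a * W e a c d f) * raise3 h R b c d f := by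
      simp only [polarWith_eq_sum, Finset.mul_sum, Finset.sum_mul]
      calc _ = ∑ p : Fin n × Fin n × Fin n × Fin n × Fin n, h p.1 p.2.1
            * (W p.1 p.2.1 p.2.2.1 p.2.2.2.1 p.2.2.2.2
              * raise3 h R b p.2.2.1 p.2.2.2.1 p.2.2.2.2) := by
            simp only [Fintype.sum_prod_type]
        _ = ∑ q : Fin n × Fin n × Fin n × Fin n × Fin n, h q.2.2.2.1 q.2.2.2.2
            * W q.2.2.2.1 q.2.2.2.2 q.1 q.2.1 q.2.2.1 * raise3 h R b q.1 q.2.1 q.2.2.1 :=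
            Fintype.sum_equiv ⟨fun p => (p.2.2.1, p.2.2.2.1, p.2.2.2.2, p.1, p.2.1),
              fun q => (q.2.2.2.1, q.2.2.2.2, q.1, q.2.1, q.2.2.1), fun _ => rfl, fun _ => rfl⟩
              _ _ fun p => by simp only [Equiv.coe_fn_mk]; ring
        _ = _ := by simp only [Fintype.sum_prod_type]
    simp [this, hdiv]
  have h2 := key W b
  have h3 : ∑ e, ∑ a, h e a * polarWith h (W b) R e a
      = ∑ e, ∑ c, ∑ d, ∑ f, W b e c d f * B e c d f := by
    have : ∀ e, ∑ a, h e a * polarWith h (W b) R e a = ∑ c, ∑ d, ∑ f, W b e c d f * B e c d f := by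
      intro e
      simp only [polarWith_eq_sum, hBd, Finset.mul_sum]
      rw [Finset.sum_comm]
      refine Finset.sum_congr rfl fun c _ => ?_
      rw [Finset.sum_comm]
      refine Finset.sum_congr rfl fun d _ => ?_
      rw [Finset.sum_comm]
      exact Finset.sum_congr rfl fun f _ => Finset.sum_congr rfl fun a _ => by ring
    exact Finset.sum_congr rfl fun e _ => this e
  have h4 : ∑ e, ∑ a, h e a * polarWith h (W b) R a e
      = ∑ e, ∑ a, h e a * polarWith h (W b) R e a := by
    rw [Finset.sum_comm]
    exact Finset.sum_congr rfl fun e _ => Finset.sum_congr rfl fun a _ => by rw [hh a e]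
  -- the Bianchi identity for the first pair of indices, contracted with `B`
  have h5 : ∑ e, ∑ c, ∑ d, ∑ f, W b e c d f * B e c d f
      = 2 * ∑ e, ∑ c, ∑ d, ∑ f, W e b c d f * B e c d f := by
    have e1 : ∀ e c d f, W b e c d f * B e c d f
        = W e b c d f * B e c d f + W c b e d f * B c e d f := by
      intro e c d f
      have := hB e d f b c
      rw [(hW e).pair d f, (hW b).pair d f, (hW c).pair d f, (hW b).left e c, (hW c).left b e] at this
      rw [hBanti e c]
      linear_combination - B e c d f * this
    have e2 : ∑ e, ∑ c, ∑ d, ∑ f, W c b e d f * B c e d f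
        = ∑ e, ∑ c, ∑ d, ∑ f, W e b c d f * B e c d f := Finset.sum_comm
    simp only [e1, Finset.sum_add_distrib]
    rw [e2]
    ring
  simp only [mul_add, Finset.sum_add_distrib]
  rw [h1, h2, h4, h3, h5]
  ring

/-- The square of the Riemann tensor as a curvature expression. -/
def squareExpr (k : ℕ) : CurvExpr k 2 :=
  .contract (r := 2) (.contract (r := 2 + 2) (.contract (r := 2 + 2 + 2)
    (.perm (r := 4 + 4) slots44 (CurvExpr.mul (r := 4) (s := 4) (.riem 0 (Nat.zero_le k))
      (.riem 0 (Nat.zero_le k))))))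

lemma squareExpr_eval (k : ℕ) : (squareExpr k).eval G = squareTen G (riemannTen G) := by
  funext z i
  simp only [squareExpr, CurvExpr.eval, squareTen, dot3, contr]

/-- The trace-adjusted square `R_{acde} R_b^{cde} - ¼ R_{cdef} R^{cdef} g_{ab}` as a curvature
expression. -/
def squareTraceExpr (k : ℕ) : CurvExpr k 2 :=
  .add (squareExpr k) (.smul (-1 / 4) (.mul .metric (.contract (r := 0) (squareExpr k))))

lemma squareTraceExpr_eval (k : ℕ) : (squareTraceExpr k).eval G = fun z j =>
    squareTen G (riemannTen G) z j
      + (-1 / 4 * trace G (squareTen G (riemannTen G)) z) * metricTen G z j := by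
  funext z j
  have h : ∀ i : Fin 0 → Fin n, ((squareExpr k).contract (r := 0)).eval G z i
      = trace G (squareTen G (riemannTen G)) z := by
    intro i
    rw [← contr_eq_trace _ i, ← squareExpr_eval k]
    simp only [CurvExpr.eval, contr]
  simp only [squareTraceExpr, CurvExpr.eval, squareExpr_eval] at h ⊢
  change squareTen G (riemannTen G) z j
    + (-1 / 4) * (metricTen G z j * _) = _
  rw [h]
  ring

lemma IsMetricOn.divergence_squareTrace (hG : IsMetricOn G U) (k : ℕ) (hy : y ∈ U)
    (hdiv : ∀ b c d, ∑ e, ∑ a, (G y)⁻¹ e a * covDeriv G (riemannTen G) y ![e, a, b, c, d] = 0)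
    (b : Fin n) : divergence G ((squareTraceExpr k).eval G) y b = 0 := by
  have hR := hG.smooth_riemannTen
  have hQ := hG.smooth_squareTen hR
  have hs := hG.smooth_trace hQ
  rw [squareTraceExpr_eval, hG.divergence_add_mul_metric hy hQ (contDiffOn_const.mul hs),
    pd_const_mul b _ (diffAt_of_smooth hG.isOpen hs hy), hG.pd_trace hy hQ, divergence]
  have hRR : (fun a b c d => riemannTen G y ![a, b, c, d]) = riemann G y := rfl
  simp only [hG.covDeriv_squareTen hy hR, hRR]
  have := sum_square_eq (hG.inv_symm hy) (hG.isCurvLike hy)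
    (IsCurvLike.covDeriv hG.isOpen hy hR fun z hz => hG.isCurvLike hz) (hG.bianchi hy) hdiv b
  linarith

lemma squareTraceExpr_apply (k : ℕ) (a b : Fin n) :
    (squareTraceExpr k).eval G y ![a, b] = S2 (G y) (riemann G y) a b
      - trace G (squareTen G (riemannTen G)) y / 4 * G y a b := by
  rw [squareTraceExpr_eval]
  simp only [squareTen_apply]
  change S2 (G y) (riemann G y) a b + _ * G y a b = _
  ring

end ConservedTensors

/-! ### Einstein metrics in five dimensions -/

section Einstein

open Matrix

variable {G : MetricField 5} {U : Set (EuclideanSpace ℝ (Fin 5))} {y : EuclideanSpace ℝ (Fin 5)}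

/-- `G` is an Einstein metric on `U`. -/
structure IsEinsteinOn (G : MetricField 5) (U : Set (EuclideanSpace ℝ (Fin 5))) : Prop where
  metric : IsMetricOn G U
  ricci_eq : ∀ y ∈ U, ∀ b d, ricci G y b d = scalarCurv G y / 5 * G y b d

/-- The components `g_{ac} g_{bd} - g_{ad} g_{bc}`. -/
def kulkTen {n : ℕ} (G : MetricField n) : TensorField n 4 := fun y i =>
  G y (i 0) (i 2) * G y (i 1) (i 3) - G y (i 0) (i 3) * G y (i 1) (i 2)

/-- The Weyl tensor as a tensor field. -/
def weylTen {n : ℕ} (G : MetricField n) : TensorField n 4 := fun y i =>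
  weyl G y (i 0) (i 1) (i 2) (i 3)

lemma weylTen_apply {n : ℕ} (G : MetricField n) (y : EuclideanSpace ℝ (Fin n)) (a b c d : Fin n) :
    weylTen G y ![a, b, c, d] = weyl G y a b c d := rfl

lemma IsMetricOn.smooth_kulkTen {n : ℕ} {G : MetricField n} {U : Set (EuclideanSpace ℝ (Fin n))}
    (hG : IsMetricOn G U) : SmoothTen (kulkTen G) U := fun _ =>
  ((hG.smooth _ _).mul (hG.smooth _ _)).sub ((hG.smooth _ _).mul (hG.smooth _ _))

lemma IsMetricOn.covDeriv_kulkTen {n : ℕ} {G : MetricField n} {U : Set (EuclideanSpace ℝ (Fin n))}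
    {y : EuclideanSpace ℝ (Fin n)} (hG : IsMetricOn G U) (hy : y ∈ U) (e : Fin n)
    (i : Fin 4 → Fin n) : covDeriv G (kulkTen G) y (Fin.cons e i) = 0 := by
  set X : TensorField n 4 := fun z j => G z (j 0) (j 1) * G z (j 2) (j 3) with hX
  have hXs : SmoothTen X U := fun _ => (hG.smooth _ _).mul (hG.smooth _ _)
  have hm : ∀ j : Fin 2 → Fin n, covDeriv G (metricTen G) y (Fin.cons e j) = 0 := by
    intro j
    have : j = ![j 0, j 1] := by funext p; fin_cases p <;> rfl
    rw [this]
    exact hG.covDeriv_metricTen hy e _ _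
  have h0 : ∀ j : Fin 4 → Fin n, covDeriv G X y (Fin.cons e j) = 0 := by
    intro j
    have := hG.covDeriv_mul hy hG.smooth_metricTen hG.smooth_metricTen e j
    rw [hm, hm, zero_mul, mul_zero, add_zero] at this
    exact this
  have h1 : kulkTen G = fun z j => X z (fun p => j (Equiv.swap 1 2 p))
      + (-1) * X z (fun p => j (rotFour.symm p)) := by
    funext z j
    change G z (j 0) (j 2) * G z (j 1) (j 3) - G z (j 0) (j 3) * G z (j 1) (j 2)
      = G z (j 0) (j 2) * G z (j 1) (j 3) + (-1) * (G z (j 0) (j 3) * G z (j 1) (j 2))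
    ring
  rw [h1, covDeriv_add hG.isOpen hy (hXs.reindex (Equiv.swap 1 2))
    (S := fun z j => (-1) * X z fun p => j (rotFour.symm p))
    (fun j => contDiffOn_const.mul (hXs fun p => j (rotFour.symm p))), covDeriv_const_mul hG.isOpen hy _ (hXs.reindex _),
    covDeriv_reindex, covDeriv_reindex, h0, h0]
  ring

/-- The contraction of the second and the fourth slot of a tensor of rank five. -/
def slots24 : Equiv.Perm (Fin 5) := ⟨![2, 0, 3, 1, 4], ![1, 3, 0, 2, 4], by decide, by decide⟩

lemma cons_cons_slots24 {α : Type*} (a c : α) (j : Fin 3 → α) :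
    (fun p => (Fin.cons a (Fin.cons c j) : Fin 5 → α) (slots24 p)) = ![j 0, a, j 1, c, j 2] := by
  funext p; fin_cases p <;> rfl

namespace IsEinsteinOn

/-- The metric is Einstein if its Einstein tensor is pointwise a multiple of the metric. -/
lemma of_multiple (hG : IsMetricOn G U) {c : EuclideanSpace ℝ (Fin 5) → ℝ} (k : ℕ)
    (h : ∀ y ∈ U, ∀ a b, (einsteinExpr k).eval G y ![a, b] = c y * G y a b) : IsEinsteinOn G U where
  metric := hG
  ricci_eq y hy b d := by
    have h1 : ∀ a b, ricci G y a b = (c y + scalarCurv G y / 2) * G y a b := by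
      intro a b
      have := h y hy a b
      rw [hG.einstein_apply k hy] at this
      linarith
    have h2 : scalarCurv G y = (c y + scalarCurv G y / 2) * 5 := by
      have h3 := hG.sum_inv_self hy
      nth_rw 1 [scalarCurv]
      simp only [h1, mul_left_comm _ (c y + scalarCurv G y / 2), ← Finset.mul_sum]
      rw [h3]
      norm_num
    rw [h1]
    congr 1
    linarith

variable (h : IsEinsteinOn G U)
include h

lemma smooth_scalarCurv : ContDiffOn ℝ ∞ (scalarCurv G) U :=
  (h.metric.smooth_trace (h.metric.smooth_trace13 h.metric.smooth_riemannTen)).congr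
    fun _ hz => (h.metric.scalarCurv_eq_trace hz).symm

lemma covDeriv_ricci (hy : y ∈ U) (e b d : Fin 5) :
    covDeriv G (trace13 G (riemannTen G)) y ![e, b, d]
      = pd e (fun z => scalarCurv G z / 5) y * G y b d := by
  have hs : ContDiffOn ℝ ∞ (fun z => scalarCurv G z / 5) U := h.smooth_scalarCurv.div_const 5
  have h1 := covDeriv_congr_on (G := G) (T := trace13 G (riemannTen G))
    (S := fun z j => scalarCurv G z / 5 * metricTen G z j) h.metric.isOpen hy (fun z hz => by
      funext j
      have : j = ![j 0, j 1] := by funext p; fin_cases p <;> rfl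
      rw [this, h.metric.ricci_eq_trace13 hz, h.ricci_eq z hz]
      rfl) e ![b, d]
  have h2 := covDeriv_fun_mul (G := G) h.metric.isOpen hy hs h.metric.smooth_metricTen e ![b, d]
  have h3 : covDeriv G (metricTen G) y (Fin.cons e ![b, d]) = 0 :=
    h.metric.covDeriv_metricTen hy e b d
  rw [h2, h3, mul_zero, add_zero] at h1
  exact h1

/-- The scalar curvature of an Einstein metric is locally constant. -/
lemma pd_scalarCurv (hy : y ∈ U) (e : Fin 5) : pd e (scalarCurv G) y = 0 := by
  have h1 := h.metric.contracted_bianchi hy e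
  have h2 : pd e (trace G (trace13 G (riemannTen G))) y = pd e (scalarCurv G) y :=
    pd_congr_on e h.metric.isOpen hy fun z hz => h.metric.scalarCurv_eq_trace hz
  have h3 : ∀ e, pd e (fun z => scalarCurv G z / 5) y = 1 / 5 * pd e (scalarCurv G) y := by
    intro e
    rw [← pd_const_mul e (1 / 5 : ℝ) (diffAt_of_smooth h.metric.isOpen h.smooth_scalarCurv hy)]
    congr 1
    funext z
    ring
  have h4 := h.metric.sum_inv_mul hy (fun b => 1 / 5 * pd b (scalarCurv G) y) e
  rw [h2, divergence] at h1
  simp only [h.covDeriv_ricci hy, h3] at h1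
  have h5 : ∑ b, ∑ c, (G y)⁻¹ b c * (1 / 5 * pd b (scalarCurv G) y * G y c e)
      = 1 / 5 * pd e (scalarCurv G) y := by
    rw [← h4, Finset.sum_comm]
    exact Finset.sum_congr rfl fun b _ => Finset.sum_congr rfl fun c _ => by
      rw [h.metric.inv_symm hy c b]; ring
  rw [h5] at h1
  linarith

lemma weyl_eq (hy : y ∈ U) (a b c d : Fin 5) : weyl G y a b c d = riemann G y a b c d
    - scalarCurv G y / 20 * (G y a c * G y b d - G y a d * G y b c) := by
  simp only [weyl, h.ricci_eq y hy]
  norm_num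
  ring

lemma weylTen_eq (hy : y ∈ U) (i : Fin 4 → Fin 5) : weylTen G y i
    = riemannTen G y i + (-1 / 20 * scalarCurv G y) * kulkTen G y i := by
  change weyl G y _ _ _ _ = riemann G y _ _ _ _ + _ * (_ - _)
  rw [h.weyl_eq hy]
  ring

lemma smooth_weylTen : SmoothTen (weylTen G) U := fun i =>
  ((h.metric.smooth_riemannTen i).add
    ((contDiffOn_const.mul h.smooth_scalarCurv).mul (h.metric.smooth_kulkTen i))).congr
    fun _ hz => h.weylTen_eq hz i

lemma covDeriv_weylTen (hy : y ∈ U) (e : Fin 5) (i : Fin 4 → Fin 5) :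
    covDeriv G (weylTen G) y (Fin.cons e i) = covDeriv G (riemannTen G) y (Fin.cons e i) := by
  have hs := contDiffOn_const (c := (-1 / 20 : ℝ)).mul h.smooth_scalarCurv
  rw [covDeriv_congr_on h.metric.isOpen hy fun z hz => funext fun i => h.weylTen_eq hz i,
    covDeriv_add h.metric.isOpen hy h.metric.smooth_riemannTen
      (fun i => hs.mul (h.metric.smooth_kulkTen i)),
    covDeriv_fun_mul h.metric.isOpen hy hs h.metric.smooth_kulkTen, h.metric.covDeriv_kulkTen hy,
    pd_const_mul e _ (diffAt_of_smooth h.metric.isOpen h.smooth_scalarCurv hy),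
    h.pd_scalarCurv hy]
  ring

/-- The first covariant derivatives of the Weyl tensor. -/
lemma isWeyl_covDeriv (hy : y ∈ U) (e : Fin 5) :
    IsWeyl (G y) fun a b c d => covDeriv G (weylTen G) y ![e, a, b, c, d] := by
  have hC := IsCurvLike.covDeriv (G := G) h.metric.isOpen hy h.smooth_weylTen
    (fun z hz => (h.metric.isWeyl hz (by norm_num)).isCurvLike) e
  refine ⟨hC.left, hC.right, hC.cyclic, fun b d => ?_⟩
  rw [← h.metric.covDeriv_trace13 hy h.smooth_weylTen]
  have h1 := covDeriv_congr_on (G := G) (T := trace13 G (weylTen G)) (S := fun _ _ => 0)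
    h.metric.isOpen hy (fun z hz => by
      funext j
      have : j = ![j 0, j 1] := by funext p; fin_cases p <;> rfl
      rw [this, trace13_apply]
      exact (h.metric.isWeyl hz (by norm_num)).trace _ _) e ![b, d]
  rw [covDeriv_zero] at h1
  exact h1

lemma bianchi_covDeriv (hy : y ∈ U) (e a b c d : Fin 5) :
    covDeriv G (weylTen G) y ![e, a, b, c, d] + covDeriv G (weylTen G) y ![c, a, b, d, e]
      + covDeriv G (weylTen G) y ![d, a, b, e, c] = 0 := by
  have h1 : ∀ e a b c d, covDeriv G (weylTen G) y ![e, a, b, c, d]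
      = covDeriv G (riemannTen G) y ![e, a, b, c, d] := fun e a b c d =>
    h.covDeriv_weylTen hy e ![a, b, c, d]
  rw [h1, h1, h1, h.metric.bianchi hy]

lemma divergence_riemann (hy : y ∈ U) (b c d : Fin 5) :
    ∑ e, ∑ a, (G y)⁻¹ e a * covDeriv G (riemannTen G) y ![e, a, b, c, d] = 0 := by
  have h1 : ∀ e a b c d, covDeriv G (riemannTen G) y ![e, a, b, c, d]
      = covDeriv G (weylTen G) y ![e, a, b, c, d] := fun e a b c d =>
    (h.covDeriv_weylTen hy e ![a, b, c, d]).symm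
  simp only [h1]
  have hW := h.isWeyl_covDeriv hy
  have hB := h.bianchi_covDeriv hy
  have h2 : ∀ e a, (G y)⁻¹ e a * covDeriv G (weylTen G) y ![e, a, b, c, d]
      = (G y)⁻¹ e a * covDeriv G (weylTen G) y ![c, e, d, a, b]
        - (G y)⁻¹ e a * covDeriv G (weylTen G) y ![d, e, c, a, b] := by
    intro e a
    have e1 := (hW e).pair a b c d
    have e2 := (hW c).left e d a b
    have e3 := (hW c).pair d e a b
    have e4 := (hW c).pair a b d e
    have e5 := (hW d).pair a b e c
    have e6 := hB e a b c d
    beta_reduce at e1 e2 e3 e4 e5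
    linear_combination (G y)⁻¹ e a * (e6 - e4 - e5 - e2)
  simp only [h2, Finset.sum_sub_distrib, (hW _).trace, sub_zero]

lemma isWeyl_covDeriv_covDeriv (hy : y ∈ U) (f e : Fin 5) :
    IsWeyl (G y) fun a b c d => covDeriv G (covDeriv G (weylTen G)) y ![f, e, a, b, c, d] := by
  have hs := h.metric.smooth_covDeriv h.smooth_weylTen
  have hC := IsCurvLike.covDeriv_covDeriv (G := G) h.metric.isOpen hy hs e
    (fun z hz e => (h.isWeyl_covDeriv hz e).isCurvLike) f
  refine ⟨hC.left, hC.right, hC.cyclic, fun b d => ?_⟩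
  have h0 := h.metric.covDeriv_contr hy
    (A := fun z j => covDeriv G (weylTen G) z fun p => j (slots24 p)) (hs.reindex slots24) f ![e, b, d]
  have h1 : covDeriv G (fun z => contr (G z)⁻¹ fun j => covDeriv G (weylTen G) z fun p =>
      j (slots24 p)) y (Fin.cons f ![e, b, d]) = 0 := by
    rw [covDeriv_congr_on (S := fun _ _ => 0) h.metric.isOpen hy, covDeriv_zero]
    intro z hz
    funext j
    refine Eq.trans ?_ ((h.isWeyl_covDeriv hz (j 0)).trace (j 1) (j 2))
    refine Finset.sum_congr rfl fun a _ => Finset.sum_congr rfl fun c _ => ?_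
    beta_reduce
    rw [cons_cons_slots24]
  rw [h1] at h0
  rw [h0]
  refine Finset.sum_congr rfl fun a _ => Finset.sum_congr rfl fun c _ => ?_
  have h2 := covDeriv_reindex (G := G) (y := y) slots24 (covDeriv G (weylTen G)) f
    (Fin.cons a (Fin.cons c ![e, b, d]))
  beta_reduce
  rw [h2, cons_cons_slots24]
  rfl

/-- The Ricci identity for the Weyl tensor. -/
lemma ricci_identity (hy : y ∈ U) (f e a b c d : Fin 5) :
    covDeriv G (covDeriv G (weylTen G)) y ![f, e, a, b, c, d]
      - covDeriv G (covDeriv G (weylTen G)) y ![e, f, a, b, c, d]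
      = - slotAct (curv G f e y) (weylTen G y) ![a, b, c, d] :=
  h.metric.covDeriv_covDeriv_comm hy h.smooth_weylTen f e ![a, b, c, d]

end IsEinsteinOn

/-- The places of the slots of `A ⊗ B` in the contraction `A_{eacdf} B_b^{cdf}`. -/
def slots54 : Fin (5 + 4) ≃ Fin (3 + 2 + 2 + 2) :=
  ⟨![6, 7, 4, 2, 0, 8, 5, 3, 1], ![4, 8, 3, 7, 2, 6, 0, 1, 5], by decide, by decide⟩

/-- The places of the slots of `A ⊗ B` in the contraction `A_{acdf} B_{eb}^{cdf}`. -/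
def slots45 : Fin (4 + 5) ≃ Fin (3 + 2 + 2 + 2) :=
  ⟨![7, 4, 2, 0, 6, 8, 5, 3, 1], ![3, 8, 2, 7, 1, 6, 4, 0, 5], by decide, by decide⟩

lemma dot3_slots54 {n : ℕ} (h : Matrix (Fin n) (Fin n) ℝ) (A : (Fin 5 → Fin n) → ℝ)
    (B : (Fin 4 → Fin n) → ℝ) (e a b : Fin n) :
    dot3 h slots54 A B ![e, a, b] = polarWith h (fun a b c d => A ![e, a, b, c, d])
      (fun a b c d => B ![a, b, c, d]) a b := by
  simp only [dot3, polarWith, contr]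
  refine Finset.sum_congr rfl fun c _ => Finset.sum_congr rfl fun c' _ => congrArg _ ?_
  refine Finset.sum_congr rfl fun d _ => Finset.sum_congr rfl fun d' _ => congrArg _ ?_
  refine Finset.sum_congr rfl fun f _ => Finset.sum_congr rfl fun f' _ => congrArg _ ?_
  congr 2
  · funext p; fin_cases p <;> rfl
  · funext p; fin_cases p <;> rfl

lemma dot3_slots45 {n : ℕ} (h : Matrix (Fin n) (Fin n) ℝ) (A : (Fin 4 → Fin n) → ℝ)
    (B : (Fin 5 → Fin n) → ℝ) (e a b : Fin n) :
    dot3 h slots45 A B ![e, a, b] = polarWith h (fun a b c d => A ![a, b, c, d])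
      (fun a b c d => B ![e, a, b, c, d]) a b := by
  simp only [dot3, polarWith, contr]
  refine Finset.sum_congr rfl fun c _ => Finset.sum_congr rfl fun c' _ => congrArg _ ?_
  refine Finset.sum_congr rfl fun d _ => Finset.sum_congr rfl fun d' _ => congrArg _ ?_
  refine Finset.sum_congr rfl fun f _ => Finset.sum_congr rfl fun f' _ => congrArg _ ?_
  congr 2
  · funext p; fin_cases p <;> rfl
  · funext p; fin_cases p <;> rfl

section Square

variable {n : ℕ} {G : MetricField n} {U : Set (EuclideanSpace ℝ (Fin n))}
  {y : EuclideanSpace ℝ (Fin n)} {T : TensorField n 4}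

/-- The first derivative of the condition `T_{acdf} T_b^{cdf} = 0`. -/
lemma polarWith_covDeriv (hG : IsMetricOn G U) (hT : SmoothTen T U)
    (h0 : ∀ z ∈ U, ∀ a b, S2 (G z) (fun a b c d => T z ![a, b, c, d]) a b = 0) (hy : y ∈ U)
    (e a b : Fin n) :
    polarWith (G y)⁻¹ (fun a b c d => covDeriv G T y ![e, a, b, c, d])
        (fun a b c d => T y ![a, b, c, d]) a b
      + polarWith (G y)⁻¹ (fun a b c d => T y ![a, b, c, d])
        (fun a b c d => covDeriv G T y ![e, a, b, c, d]) a b = 0 := by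
  rw [polarWith_comm (hG.inv_symm hy) (fun a b c d => T y ![a, b, c, d]),
    ← hG.covDeriv_squareTen hy hT]
  have h1 := covDeriv_congr_on (G := G) (T := squareTen G T) (S := fun _ _ => 0) hG.isOpen hy
    (fun z hz => by
      funext j
      have : j = ![j 0, j 1] := by funext p; fin_cases p <;> rfl
      rw [this, squareTen_apply, h0 z hz]) e ![a, b]
  rw [covDeriv_zero] at h1
  exact h1

/-- The second derivative of the condition `T_{acdf} T_b^{cdf} = 0`. -/
lemma polarWith_covDeriv_covDeriv (hG : IsMetricOn G U) (hT : SmoothTen T U)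
    (h0 : ∀ z ∈ U, ∀ a b, S2 (G z) (fun a b c d => T z ![a, b, c, d]) a b = 0) (hy : y ∈ U)
    (f e a b : Fin n) :
    polarWith (G y)⁻¹ (fun a b c d => covDeriv G (covDeriv G T) y ![f, e, a, b, c, d])
        (fun a b c d => T y ![a, b, c, d]) a b
      + polarWith (G y)⁻¹ (fun a b c d => covDeriv G T y ![e, a, b, c, d])
        (fun a b c d => covDeriv G T y ![f, a, b, c, d]) a b
      + polarWith (G y)⁻¹ (fun a b c d => covDeriv G T y ![f, a, b, c, d])
        (fun a b c d => covDeriv G T y ![e, a, b, c, d]) a b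
      + polarWith (G y)⁻¹ (fun a b c d => T y ![a, b, c, d])
        (fun a b c d => covDeriv G (covDeriv G T) y ![f, e, a, b, c, d]) a b = 0 := by
  have hT' := hG.smooth_covDeriv hT
  have h1 := covDeriv_congr_on (G := G) (T := fun z j =>
      dot3 (G z)⁻¹ slots54 (covDeriv G T z) (T z) j + dot3 (G z)⁻¹ slots45 (T z) (covDeriv G T z) j)
    (S := fun _ _ => 0) hG.isOpen hy (fun z hz => by
      funext j
      have : j = ![j 0, j 1, j 2] := by funext p; fin_cases p <;> rfl
      rw [this, dot3_slots54, dot3_slots45, polarWith_covDeriv hG hT h0 hz]) f ![e, a, b]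
  rw [covDeriv_zero, covDeriv_add hG.isOpen hy (hG.smooth_dot3 _ hT' hT) (hG.smooth_dot3 _ hT hT'),
    hG.covDeriv_dot3 hy _ hT' hT, hG.covDeriv_dot3 hy _ hT hT', dot3_slots54, dot3_slots54,
    dot3_slots45, dot3_slots45] at h1
  rw [← h1, add_assoc, add_assoc]
  simp only [add_assoc]
  rfl

end Square

end Einstein

/-! ### The two-jet of the Weyl tensor at a point -/

section Jet

open Matrix

lemma polarWith_nullMat (A B : Fin 5 → Fin 5 → Fin 5 → Fin 5 → ℝ) (a b : Fin 5) :
    polarWith nullMat A B a b = polar A B a b := by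
  simp only [polarWith, polar, nullMat_apply, ite_mul, one_mul, zero_mul, Finset.sum_ite_eq',
    Finset.mem_univ, if_true]

lemma unitCurv_eq (a b c d : Fin 5) : (unitCurv a b c d : ℝ)
    = nullMat a c * nullMat b d - nullMat a d * nullMat b c := by
  simp only [unitCurv, nullMat_apply, ← ite_and, ite_mul, one_mul, zero_mul, Int.cast_sub,
    Int.cast_ite, Int.cast_one, Int.cast_zero]

variable {G : MetricField 5} {U : Set (EuclideanSpace ℝ (Fin 5))} {x : EuclideanSpace ℝ (Fin 5)}
  {s : ℝ}

lemma IsEinsteinOn.curv_eq (h : IsEinsteinOn G U) (hx : x ∈ U) (hGx : G x = nullMat)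
    (f e m a : Fin 5) : curv G f e x m a
      = weyl G x (dual m) a f e + scalarCurv G x / 20 * unitCurv (dual m) a f e := by
  have h1 : curv G f e x = nullMat * (G x * curv G f e x) := by
    rw [hGx, ← Matrix.mul_assoc, nullMat_mul_self, Matrix.one_mul]
  have h2 : ∀ p, (G x * curv G f e x) p a = riemann G x p a f e := fun p =>
    (riemann_eq_mul_curv G x p a f e).symm
  rw [h1, Matrix.mul_apply]
  simp only [h2, nullMat_apply, ite_mul, one_mul, zero_mul, Finset.sum_ite_eq',
    Finset.mem_univ, if_true]
  rw [h.weyl_eq hx, hGx, unitCurv_eq]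
  ring

/-- The covariant derivatives of the Weyl tensor of an Einstein metric of type II with
`C_{acde} C_b^{cde} = 0`, in coordinates that are normalized at the point `x`. -/
lemma IsEinsteinOn.isSecondJet (h : IsEinsteinOn G U)
    (hS : ∀ y ∈ U, ∀ a b, S2 (G y) (weyl G y) a b = 0) (hx : x ∈ U) (hGx : G x = nullMat)
    (hn : IsNormalized (weyl G x) s)
    (ht : ∀ e, ∃ z : Fin 5 → ℝ, z 0 = 0 ∧ ∀ i j k, i ≠ 1 → j ≠ 1 → k ≠ 1 →
      covDeriv G (weylTen G) x ![e, 0, i, j, k]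
        = z i * weyl G x 0 1 j k + z j * weyl G x 0 i 1 k + z k * weyl G x 0 i j 1
          - (z 2 * weyl G x 2 i j k + z 3 * weyl G x 3 i j k + z 4 * weyl G x 4 i j k)) :
    IsSecondJet (weyl G x) (fun e a b c d => covDeriv G (weylTen G) x ![e, a, b, c, d])
      (fun f e a b c d => covDeriv G (covDeriv G (weylTen G)) x ![f, e, a, b, c, d]) s
      (scalarCurv G x / 20) := by
  have hinv : (G x)⁻¹ = nullMat := by rw [hGx, nullMat_inv]
  have hs := h.metric.smooth_covDeriv h.smooth_weylTen
  refine ⟨hn, fun a b => ?_, fun e => ⟨?_, ht e, fun a b => ?_⟩, h.bianchi_covDeriv hx,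
    fun f e => ?_, ?_, fun f e a b => ?_, fun f e a b c d => ?_⟩
  · rw [← hGx]; exact hS x hx a b
  · rw [← hGx]; exact h.isWeyl_covDeriv hx e
  · have := polarWith_covDeriv h.metric h.smooth_weylTen (fun z hz => hS z hz) hx e a b
    simp only [hinv, polarWith_nullMat] at this
    exact this
  · rw [← hGx]; exact h.isWeyl_covDeriv_covDeriv hx f e
  · exact covDeriv_bianchi h.metric.isOpen hx hs fun z hz => h.bianchi_covDeriv hz
  · have := polarWith_covDeriv_covDeriv h.metric h.smooth_weylTen (fun z hz => hS z hz) hx f e a b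
    simp only [hinv, polarWith_nullMat] at this
    exact this
  · rw [h.ricci_identity hx, slotAct_four]
    simp only [h.curv_eq hx hGx, weylTen_apply, curvAct, Finset.sum_add_distrib]

/-- For type II, `S⁽²⁾ = K g` forces `K = 0`, as the component `(4, 4)` of `S⁽²⁾` vanishes for the
model. -/
lemma eq_zero_of_S2 {C : Fin 5 → Fin 5 → Fin 5 → Fin 5 → ℝ} (h : IsWeyl nullMat C)
    (hC : NonposWeight C) {K : ℝ} (hK : ∀ a b, S2 nullMat C a b = K * nullMat a b) : K = 0 := by
  obtain ⟨J, hJ, s, hs⟩ := normalizable_of_S2 h hC hK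
  have h4 := S2_adapted hJ hK 4 4
  have hm : ∑ c, ∑ d, ∑ e, model 4 c d e * model 4 (dual c) (dual d) (dual e) = 0 := by
    decide +kernel
  have h5 : S2 nullMat (pull4 C J) 4 4 = s ^ 2 * ((∑ c, ∑ d, ∑ e, model 4 c d e
      * model 4 (dual c) (dual d) (dual e) : ℤ) : ℝ) := by
    rw [S2_nullMat]
    push_cast
    simp only [Finset.mul_sum]
    refine Finset.sum_congr rfl fun c _ => Finset.sum_congr rfl fun d _ =>
      Finset.sum_congr rfl fun e _ => ?_
    rw [hs.mul_eq (hC.pull hJ)]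
    · push_cast; ring
    · simp only [boostWeight, indexWeight_dual]
      have : indexWeight (4 : Fin 5) = 0 := rfl
      rw [this]
      ring
  have h6 : nullMat 4 4 = 1 := by simp [nullMat_apply, dual]
  rw [h5, hm, h6] at h4
  simpa using h4.symm

lemma IsWeyl.polar_unitCurv {C : Fin 5 → Fin 5 → Fin 5 → Fin 5 → ℝ} (h : IsWeyl nullMat C)
    (a b : Fin 5) : polar C (fun a b c d => (unitCurv a b c d : ℝ)) a b = 0 := by
  have e : ∀ c d f, C a c d f * (unitCurv b (dual c) (dual d) (dual f) : ℝ)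
      = (if d = b then (if f = dual c then C a c d f else 0) else 0)
        - (if f = b then (if d = dual c then C a c d f else 0) else 0) := by
    intro c d f
    have i1 : (dual d = dual b) ↔ d = b :=
      ⟨fun h => by rw [← dual_dual d, h, dual_dual], fun h => by rw [h]⟩
    have i2 : (dual f = dual b) ↔ f = b :=
      ⟨fun h => by rw [← dual_dual f, h, dual_dual], fun h => by rw [h]⟩
    have i3 : ∀ f, (dual f = dual (dual c)) ↔ f = dual c := fun f =>
      ⟨fun h => by rw [← dual_dual f, h, dual_dual], fun h => by rw [h]⟩
    simp only [unitCurv, i1, i2, i3, Int.cast_sub, Int.cast_ite, Int.cast_one, Int.cast_zero,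
      mul_sub, mul_ite, mul_one, mul_zero, ite_and]
  have t1 : ∑ c, C a c b (dual c) = 0 := by
    have := h.sum_dual a b
    rw [← this]
    exact Finset.sum_congr rfl fun c _ => by rw [h.left a c, h.right a c b]; ring
  have t2 : ∑ c, C a c (dual c) b = 0 := by
    have := h.sum_dual a b
    rw [← neg_zero, ← this, ← Finset.sum_neg_distrib]
    exact Finset.sum_congr rfl fun c _ => by rw [h.left c a]
  have t3 : ∀ c, ∑ d, ∑ f, (if d = b then (if f = dual c then C a c d f else 0) else 0)
      = C a c b (dual c) := by
    intro c; rw [Finset.sum_comm]; simp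
  have t4 : ∀ c, ∑ d, ∑ f, (if f = b then (if d = dual c then C a c d f else 0) else 0)
      = C a c (dual c) b := by
    intro c; simp
  simp only [polar, e, Finset.sum_sub_distrib, t3, t4, t1, t2, sub_zero]

/-- Adding a curvature of constant curvature to a Weyl tensor changes the square `S⁽²⁾` by a
multiple of the metric. -/
lemma IsWeyl.S2_add_unitCurv {C : Fin 5 → Fin 5 → Fin 5 → Fin 5 → ℝ} (h : IsWeyl nullMat C)
    (κ : ℝ) (a b : Fin 5) : S2 nullMat (fun a b c d => C a b c d + κ * unitCurv a b c d) a b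
      = S2 nullMat C a b + 8 * κ ^ 2 * nullMat a b := by
  have h1 := h.polar_unitCurv a b
  have h2 := h.polar_unitCurv b a
  rw [polar_comm] at h2
  have h3 : polar (fun a b c d => (unitCurv a b c d : ℝ)) (fun a b c d => (unitCurv a b c d : ℝ)) a b
      = 8 * nullMat a b := by
    have : ∀ a b, ∑ c, ∑ d, ∑ f, unitCurv a c d f * unitCurv b (dual c) (dual d) (dual f)
        = 8 * if b = dual a then 1 else 0 := by decide +kernel
    have h4 : ((∑ c, ∑ d, ∑ f, unitCurv a c d f * unitCurv b (dual c) (dual d) (dual f) : ℤ) : ℝ)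
        = ((8 * if b = dual a then 1 else 0 : ℤ) : ℝ) := by rw [this]
    push_cast at h4
    rw [nullMat_apply, polar, h4]
  have h5 : ∀ c d f, (C a c d f + κ * unitCurv a c d f)
      * (C b (dual c) (dual d) (dual f) + κ * unitCurv b (dual c) (dual d) (dual f))
      = C a c d f * C b (dual c) (dual d) (dual f)
        + κ * (C a c d f * unitCurv b (dual c) (dual d) (dual f))
        + κ * (unitCurv a c d f * C b (dual c) (dual d) (dual f))
        + κ ^ 2 * (unitCurv a c d f * unitCurv b (dual c) (dual d) (dual f)) := by
    intros; ring
  simp only [polar] at h1 h2 h3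
  simp only [S2_nullMat, h5, Finset.sum_add_distrib, ← Finset.mul_sum]
  rw [h1, h2, h3]
  ring

lemma pull4_metric (g : Fin 5 → Fin 5 → ℝ) (J : Matrix (Fin 5) (Fin 5) ℝ)
    (hJ : Jᵀ * of g * J = nullMat) (a b c d : Fin 5) :
    pull4 (fun a b c d => g a c * g b d - g a d * g b c) J a b c d = unitCurv a b c d := by
  have e : ∀ b d, ∑ j, ∑ l, g j l * (J j b * J l d) = nullMat b d := by
    intro b d
    rw [← hJ]
    simp only [Matrix.mul_apply, Matrix.transpose_apply, Finset.sum_mul, of_apply]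
    rw [Finset.sum_comm]
    exact Finset.sum_congr rfl fun i _ => Finset.sum_congr rfl fun j _ => by ring
  have s := pull4_swap (fun a b c d => g a c * g b d) J a b c d
  have e1 : (fun a b c d => g a c * g b d - g a d * g b c)
      = fun a b c d => g a c * g b d + (-1) * (g a d * g b c) := by
    funext a b c d; ring
  rw [e1, pull4_add, pull4_smul, s, pull4_mul, pull4_mul, e, e, e, e, unitCurv_eq]
  ring

/-- For an Einstein metric of type II, the square `S⁽²⁾` of the Weyl tensor vanishes as soon as
that of the Riemann tensor is a multiple of the metric. -/
lemma IsEinsteinOn.S2_weyl_eq_zero (h : IsEinsteinOn G U) (hx : x ∈ U) {K : ℝ}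
    (hK : ∀ a b, S2 (G x) (riemann G x) a b = K * G x a b)
    (hII : ∃ F, IsNullFrame (G x) F ∧ BoostOrderLE (weyl G x) F 0) (a b : Fin 5) :
    S2 (G x) (weyl G x) a b = 0 := by
  obtain ⟨F, hF, hF0⟩ := hII
  set J : Matrix (Fin 5) (Fin 5) ℝ := (of F)ᵀ with hJdef
  have hJ : Jᵀ * G x * J = nullMat := (isNullFrame_iff _ _).1 hF
  have hJdet := (isUnit_det_of_pull hJ).2
  have hW : IsWeyl nullMat (pull4 (weyl G x) J) := by
    rw [← hJ]; exact (h.metric.isWeyl hx (by norm_num)).pull hJdet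
  have hC : NonposWeight (pull4 (weyl G x) J) := hF0
  have hR : pull4 (riemann G x) J = fun a b c d => pull4 (weyl G x) J a b c d
      + scalarCurv G x / 20 * unitCurv a b c d := by
    have e : riemann G x = fun a b c d => weyl G x a b c d + scalarCurv G x / 20
        * (G x a c * G x b d - G x a d * G x b c) := by
      funext a b c d
      rw [h.weyl_eq hx]
      ring
    funext a b c d
    rw [e, pull4_add, pull4_smul, pull4_metric (G x) J hJ]
  have h1 : ∀ a b, S2 nullMat (pull4 (riemann G x) J) a b = K * nullMat a b := by
    intro a b
    have := S2_pull4 (G := G x) hJdet (riemann G x) a b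
    have e : of (S2 (G x) (riemann G x)) = K • G x := by ext a b; exact hK a b
    rw [hJ, e, Matrix.mul_smul, Matrix.smul_mul, hJ] at this
    exact this
  have h2 : ∀ a b, S2 nullMat (pull4 (weyl G x) J) a b
      = (K - 8 * (scalarCurv G x / 20) ^ 2) * nullMat a b := by
    intro a b
    have := hW.S2_add_unitCurv (scalarCurv G x / 20) a b
    rw [← hR, h1] at this
    linarith
  have h3 := eq_zero_of_S2 hW hC h2
  have h4 : Jᵀ * of (S2 (G x) (weyl G x)) * J = 0 := by
    ext a b
    have := S2_pull4 (G := G x) hJdet (weyl G x) a b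
    rw [← this, hJ, h2, h3, zero_mul]
    rfl
  have h5 : of (S2 (G x) (weyl G x)) = 0 := by
    have hJt : IsUnit Jᵀ.det := by rwa [Matrix.det_transpose]
    calc of (S2 (G x) (weyl G x)) = Jᵀ⁻¹ * (Jᵀ * of (S2 (G x) (weyl G x)) * J) * J⁻¹ := by
          rw [Matrix.mul_assoc Jᵀ, Matrix.nonsing_inv_mul_cancel_left _ _ hJt,
            Matrix.mul_nonsing_inv_cancel_right _ _ hJdet]
      _ = 0 := by rw [h4, Matrix.mul_zero, Matrix.zero_mul]
  exact congrFun (congrFun h5 a) b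

end Jet

/-! ### Selecting a differentiable branch of solutions -/

section Selection

open Filter Topology

variable {E F W : Type*} [NormedAddCommGroup E] [NormedSpace ℝ E] [NormedAddCommGroup F]
  [NormedSpace ℝ F] [FiniteDimensional ℝ F] [NormedAddCommGroup W] [NormedSpace ℝ W]

lemma exists_antilipschitz_inr {L : E × F →L[ℝ] W} (hnd : ∀ δ, L (0, δ) = 0 → δ = 0) :
    ∃ c, AntilipschitzWith c (L.comp (ContinuousLinearMap.inr ℝ E F)) := by
  obtain ⟨c, -, hc⟩ := LinearMap.exists_antilipschitzWith
    (L.comp (ContinuousLinearMap.inr ℝ E F)).toLinearMap (by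
      rw [LinearMap.ker_eq_bot']
      intro δ hδ
      exact hnd δ hδ)
  exact ⟨c, hc⟩

/-- If the zeros `(x + t_k e, l_k)` of `f` converge to a zero `(x, l)` at which the derivative of
`f` in the second variable is injective, the difference quotients are bounded, so that the
direction `e` can be completed to a direction in which the derivative of `f` vanishes. -/
lemma exists_direction_of_tendsto {f : E × F → W} {L : E × F →L[ℝ] W} {x : E} {l : F}
    (hf : HasFDerivAt f L (x, l)) (hf0 : f (x, l) = 0) (hnd : ∀ δ, L (0, δ) = 0 → δ = 0)
    {e : E} {t : ℕ → ℝ} {u : ℕ → F} (ht0 : ∀ k, 0 < t k) (ht : Tendsto t atTop (𝓝 0))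
    (hu : Tendsto u atTop (𝓝 l)) (hz : ∀ k, f (x + t k • e, u k) = 0) :
    ∃ δ, L (e, δ) = 0 := by
  obtain ⟨c, hc⟩ := exists_antilipschitz_inr hnd
  set A := L.comp (ContinuousLinearMap.inr ℝ E F) with hA
  have hAb : ∀ δ, ‖δ‖ ≤ c * ‖A δ‖ := fun δ => hc.le_mul_norm (map_zero A) δ
  have hsplit : ∀ v δ, L (v, δ) = L (v, 0) + A δ := by
    intro v δ
    have : ((v, δ) : E × F) = (v, 0) + (0, δ) := by simp
    rw [this, map_add]
    rfl
  have htend : Tendsto (fun k => (x + t k • e, u k)) atTop (𝓝 (x, l)) := by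
    have h1 : Tendsto (fun k => x + t k • e) atTop (𝓝 x) := by
      simpa using tendsto_const_nhds.add (ht.smul_const e)
    exact h1.prodMk_nhds hu
  -- the linearized equation holds up to `ε (t + |u - l|)`
  have hlin : ∀ ε > 0, ∀ᶠ k in atTop, ‖L (t k • e, u k - l)‖ ≤ ε * (t k * ‖e‖ + ‖u k - l‖) := by
    intro ε hε
    have h1 := (hf.isLittleO.comp_tendsto htend).def hε
    filter_upwards [h1] with k hk
    simp only [Function.comp, hz k, hf0, Prod.mk_sub_mk, add_sub_cancel_left, sub_zero, zero_sub,
      norm_neg] at hk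
    refine hk.trans (mul_le_mul_of_nonneg_left ?_ hε.le)
    refine (Prod.norm_mk _ _).trans_le (max_le ?_ ?_)
    · rw [norm_smul, Real.norm_of_nonneg (ht0 k).le]
      exact le_add_of_nonneg_right (norm_nonneg _)
    · exact le_add_of_nonneg_left (mul_nonneg (ht0 k).le (norm_nonneg _))
  have hLe : ∀ k, L (t k • e, u k - l) = t k • L (e, 0) + A (u k - l) := by
    intro k
    rw [hsplit]
    congr 1
    rw [← map_smul, Prod.smul_mk, smul_zero]
  set B : ℝ := 2 * (c * (‖L (e, 0)‖)) + ‖e‖ with hB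
  have hBnd : ∀ᶠ k in atTop, ‖u k - l‖ ≤ t k * B := by
    have hε : 0 < 1 / (2 * ((c : ℝ) + 1)) := by positivity
    filter_upwards [hlin _ hε] with k hk
    set d := ‖u k - l‖ with hd
    have h1 : ‖A (u k - l)‖ ≤ t k * ‖L (e, 0)‖ + 1 / (2 * ((c : ℝ) + 1)) * (t k * ‖e‖ + d) := by
      have : A (u k - l) = L (t k • e, u k - l) - t k • L (e, 0) := by rw [hLe]; abel
      rw [this]
      refine (norm_sub_le _ _).trans ?_
      rw [norm_smul, Real.norm_of_nonneg (ht0 k).le]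
      linarith
    have h2 : d ≤ c * (t k * ‖L (e, 0)‖ + 1 / (2 * ((c : ℝ) + 1)) * (t k * ‖e‖ + d)) :=
      (hAb _).trans (mul_le_mul_of_nonneg_left h1 c.2)
    have h3 : (c : ℝ) * (1 / (2 * ((c : ℝ) + 1))) ≤ 1 / 2 := by
      rw [mul_one_div, div_le_div_iff₀ (by positivity) (by norm_num)]
      nlinarith [c.2]
    have h4 : 0 ≤ t k * ‖e‖ + d := by
      have := ht0 k
      positivity
    nlinarith [mul_le_mul_of_nonneg_right h3 h4]
  have hrange : L (e, 0) ∈ (LinearMap.range A.toLinearMap : Submodule ℝ W) := by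
    have hcl : IsClosed ((LinearMap.range A.toLinearMap : Submodule ℝ W) : Set W) :=
      Submodule.closed_of_finiteDimensional _
    rw [← SetLike.mem_coe, ← hcl.closure_eq, Metric.mem_closure_iff]
    intro ε hε
    have hε' : 0 < ε / (2 * (‖e‖ + B + 1)) := by
      have : 0 ≤ B := by positivity
      positivity
    obtain ⟨k, hk1, hk2⟩ := ((hlin _ hε').and hBnd).exists
    refine ⟨A (-((t k)⁻¹ • (u k - l))), ⟨_, rfl⟩, ?_⟩
    have htk := ht0 k
    have h1 : L (e, 0) - A (-((t k)⁻¹ • (u k - l))) = (t k)⁻¹ • L (t k • e, u k - l) := by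
      rw [hLe, smul_add, smul_smul, inv_mul_cancel₀ htk.ne', one_smul, map_neg, map_smul,
        sub_neg_eq_add]
    rw [dist_eq_norm, h1, norm_smul, norm_inv, Real.norm_of_nonneg htk.le, inv_mul_lt_iff₀ htk]
    have hB0 : 0 ≤ B := by positivity
    have h2 : ε / (2 * (‖e‖ + B + 1)) * (t k * ‖e‖ + ‖u k - l‖)
        ≤ ε / (2 * (‖e‖ + B + 1)) * (t k * (‖e‖ + B)) :=
      mul_le_mul_of_nonneg_left (by linarith) hε'.le
    refine (hk1.trans h2).trans_lt ?_
    have hD : 0 < 2 * (‖e‖ + B + 1) := by positivity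
    rw [div_mul_eq_mul_div, div_lt_iff₀ hD]
    have : 0 < ε * t k := by positivity
    nlinarith [norm_nonneg e]
  obtain ⟨δ, hδ⟩ := hrange
  refine ⟨-δ, ?_⟩
  rw [hsplit, map_neg, ← hδ]
  exact add_neg_cancel _

/-- Suppose that the equation `Z y l` has solutions `l` in a compact set for all `y` near `x`, and
that its solutions over `x` are non-degenerate. Then one solution `l` over `x` has the property that
the linearized equation at `(x, l)` is solvable for every direction in the `y`-space: the solutions
over `x` are isolated, hence finite in number, and the directions for which the linearized equation
is solvable form finitely many subspaces that cover the `y`-space. -/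
theorem exists_tangent_solution [FiniteDimensional ℝ E] {Z : E → F → Prop} {x : E} {K : Set F}
    (hK : IsCompact K)
    (hcl : ∀ (v : ℕ → E) (u : ℕ → F) (l : F), Tendsto v atTop (𝓝 x) → Tendsto u atTop (𝓝 l) →
      (∀ k, Z (v k) (u k)) → Z x l)
    (hex : ∀ᶠ y in 𝓝 x, ∃ l ∈ K, Z y l)
    {ψ : F → E × F → W} {ψ' : F → E × F →L[ℝ] W}
    (hψ : ∀ l, Z x l → HasFDerivAt (ψ l) (ψ' l) (x, l))
    (hψ0 : ∀ l, Z x l → ∀ y l', Z y l' → ψ l (y, l') = 0)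
    (hnd : ∀ l, Z x l → ∀ δ, ψ' l (0, δ) = 0 → δ = 0) :
    ∃ l, Z x l ∧ ∀ e, ∃ δ, ψ' l (e, δ) = 0 := by
  -- an accumulation point of the solutions over `x` would be a solution, and solutions are isolated
  have hfin : {l ∈ K | Z x l}.Finite := by
    by_contra hinf
    obtain ⟨l, -, hl⟩ := Set.Infinite.exists_accPt_of_subset_isCompact hinf hK fun _ h => h.1
    obtain ⟨u, hu, hul⟩ := mem_closure_iff_seq_limit.1 hl.clusterPt.mem_closure
    have hZ : Z x l := hcl (fun _ => x) u l tendsto_const_nhds hul fun k => (hu k).2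
    have hd : HasFDerivAt (fun l' => ψ l (x, l'))
        ((ψ' l).comp (ContinuousLinearMap.inr ℝ E F)) l :=
      (hψ l hZ).comp l (hasFDerivAt_prodMk_right x l)
    have hne := hd.eventually_ne (c := 0) (exists_antilipschitz_inr (hnd l hZ))
    obtain ⟨l', hl', hl''⟩ := ((accPt_iff_frequently_nhdsNE.1 hl).and_eventually hne).exists
    exact hl'' (hψ0 l hZ x l' hl'.2)
  -- the solutions over `x + e / k` accumulate at a solution over `x`
  have hcov : ∀ e, ∃ l, l ∈ {l ∈ K | Z x l} ∧ ∃ δ, ψ' l (e, δ) = 0 := by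
    intro e
    have h1 : Tendsto (fun k : ℕ => 1 / ((k : ℝ) + 1)) atTop (𝓝 0) :=
      tendsto_one_div_add_atTop_nhds_zero_nat
    have h2 : Tendsto (fun k : ℕ => x + (1 / ((k : ℝ) + 1)) • e) atTop (𝓝 x) := by
      simpa using tendsto_const_nhds.add (h1.smul_const e)
    obtain ⟨N, hN⟩ := eventually_atTop.1 (h2.eventually hex)
    choose u huK huZ using fun k : ℕ => hN (k + N) (Nat.le_add_left _ _)
    obtain ⟨l, hl, φ, hφ, hφl⟩ := hK.tendsto_subseq huK
    have hsub : Tendsto (fun k => φ k + N) atTop atTop :=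
      (tendsto_add_atTop_nat N).comp hφ.tendsto_atTop
    have hZ : Z x l := hcl _ _ l (h2.comp hsub) hφl fun k => huZ (φ k)
    refine ⟨l, ⟨hl, hZ⟩, exists_direction_of_tendsto (hψ l hZ) (hψ0 l hZ x l hZ) (hnd l hZ)
      (t := fun k => 1 / (((φ k + N : ℕ) : ℝ) + 1)) (u := u ∘ φ) (fun k => by positivity)
      (h1.comp hsub) hφl fun k => hψ0 l hZ _ _ (huZ (φ k))⟩
  -- a real vector space is not a finite union of proper subspaces
  have := hfin.to_subtype
  obtain ⟨l, hl⟩ := Subspace.exists_eq_top_of_iUnion_eq_univ (k := ℝ)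
    (p := fun l : {l ∈ K | Z x l} => (LinearMap.ker (ψ' l).toLinearMap).map (LinearMap.fst ℝ E F))
    (by
      rw [Set.eq_univ_iff_forall]
      intro e
      obtain ⟨l, hl, δ, hδ⟩ := hcov e
      exact Set.mem_iUnion.2 ⟨⟨l, hl⟩, (e, δ), hδ, rfl⟩)
  refine ⟨l, l.2.2, fun e => ?_⟩
  have he : e ∈ (LinearMap.ker (ψ' l).toLinearMap).map (LinearMap.fst ℝ E F) := by
    rw [hl]; trivial
  obtain ⟨⟨e', δ⟩, h1, h2⟩ := he
  obtain rfl : e' = e := h2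
  exact ⟨δ, h1⟩

end Selection

/-! ### Null directions of type II -/

section Wand

open Matrix

variable {n : ℕ} {C : Fin 5 → Fin 5 → Fin 5 → Fin 5 → ℝ}

/-- The value of a tensor of rank four on four vectors. -/
def ev4 (C : Fin n → Fin n → Fin n → Fin n → ℝ) (a b c d : Fin n → ℝ) : ℝ :=
  ∑ i, ∑ j, ∑ k, ∑ l, C i j k l * a i * b j * c k * d l

/-- The contraction `l ⌟ (p ∧ q) = (p·l) q - (q·l) p`. These vectors span the orthogonal complement
of `l`. -/
def wedge (G : Matrix (Fin n) (Fin n) ℝ) (l p q : Fin n → ℝ) : Fin n → ℝ :=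
  (p ⬝ᵥ G *ᵥ l) • q - (q ⬝ᵥ G *ᵥ l) • p

lemma ev4_single (C : Fin n → Fin n → Fin n → Fin n → ℝ) (a b c d : Fin n) :
    ev4 C (Pi.single a 1) (Pi.single b 1) (Pi.single c 1) (Pi.single d 1) = C a b c d := by
  simp [ev4, Pi.single_apply]

lemma ev4_pull4 (C : Fin 5 → Fin 5 → Fin 5 → Fin 5 → ℝ) (J : Matrix (Fin 5) (Fin 5) ℝ)
    (a b c d : Fin 5 → ℝ) :
    ev4 (pull4 C J) a b c d = ev4 C (J *ᵥ a) (J *ᵥ b) (J *ᵥ c) (J *ᵥ d) :=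
  -- the four vectors are the first four columns of a matrix
  congrFun (congrFun (congrFun (congrFun
    (pull4_pull4 C J (of fun i k => (![a, b, c, d, 0] : Fin 5 → Fin 5 → ℝ) k i)) 0) 1) 2) 3

lemma dotProduct_pull (G J : Matrix (Fin n) (Fin n) ℝ) (v w : Fin n → ℝ) :
    v ⬝ᵥ (Jᵀ * G * J) *ᵥ w = (J *ᵥ v) ⬝ᵥ G *ᵥ (J *ᵥ w) := by
  rw [← Matrix.mulVec_mulVec, ← Matrix.mulVec_mulVec, Matrix.dotProduct_mulVec, Matrix.vecMul_transpose]

lemma wedge_pull (G J : Matrix (Fin n) (Fin n) ℝ) (l p q : Fin n → ℝ) :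
    J *ᵥ wedge (Jᵀ * G * J) l p q = wedge G (J *ᵥ l) (J *ᵥ p) (J *ᵥ q) := by
  simp only [wedge, dotProduct_pull, Matrix.mulVec_sub, Matrix.mulVec_smul]

lemma wedge_smul (G : Matrix (Fin n) (Fin n) ℝ) (r : ℝ) (l p q : Fin n → ℝ) :
    wedge G (r • l) p q = r • wedge G l p q := by
  simp only [wedge, Matrix.mulVec_smul, dotProduct_smul, smul_eq_mul, smul_sub, mul_smul]

lemma ev4_smul (C : Fin n → Fin n → Fin n → Fin n → ℝ) (r : ℝ) (a b c d : Fin n → ℝ) :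
    ev4 C (r • a) (r • b) (r • c) (r • d) = r ^ 4 * ev4 C a b c d := by
  simp only [ev4, Finset.mul_sum, Pi.smul_apply, smul_eq_mul]
  exact Finset.sum_congr rfl fun i _ => Finset.sum_congr rfl fun j _ =>
    Finset.sum_congr rfl fun k _ => Finset.sum_congr rfl fun l _ => by ring

/-- A null vector, normalized in an auxiliary way, along which the components of positive boost
weight of `C` vanish. -/
structure IsWand (G : Matrix (Fin n) (Fin n) ℝ) (C : Fin n → Fin n → Fin n → Fin n → ℝ)
    (l : Fin n → ℝ) : Prop where
  null : l ⬝ᵥ G *ᵥ l = 0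
  norm : l ⬝ᵥ l = 1
  ev4 : ∀ p q r s t u, ev4 C l (wedge G l p q) (wedge G l r s) (wedge G l t u) = 0

lemma nullMat_mulVec (v : Fin 5 → ℝ) (a : Fin 5) : (nullMat *ᵥ v) a = v (dual a) := by
  simp [Matrix.mulVec, dotProduct, nullMat_apply]

lemma nullMat_mulVec_single : nullMat *ᵥ (Pi.single 0 1 : Fin 5 → ℝ) = Pi.single 1 1 := by
  ext a
  rw [nullMat_mulVec]
  fin_cases a <;> simp [dual]

lemma wedge_nullMat_single {i : Fin 5} (hi : i ≠ 1) :
    wedge nullMat (Pi.single 0 1) (Pi.single 1 1) (Pi.single i 1) = Pi.single i 1 := by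
  rw [wedge, nullMat_mulVec_single]
  simp [Pi.single_eq_of_ne hi.symm]

lemma wedge_nullMat_apply (p q : Fin 5 → ℝ) : wedge nullMat (Pi.single 0 1) p q 1 = 0 := by
  rw [wedge, nullMat_mulVec_single]
  simp [mul_comm]

/-- The first vector of a null frame in which the boost order is non-positive. -/
lemma exists_isWand {G : Matrix (Fin 5) (Fin 5) ℝ} {F : Fin 5 → Fin 5 → ℝ} (hF : IsNullFrame G F)
    (hC : BoostOrderLE C F 0) : ∃ l, IsWand G C l := by
  set J : Matrix (Fin 5) (Fin 5) ℝ := (of F)ᵀ with hJdef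
  have hJ : Jᵀ * G * J = nullMat := (isNullFrame_iff _ _).1 hF
  have hJdet := (isUnit_det_of_pull hJ).2
  have hN : NonposWeight (pull4 C J) := hC
  set v : Fin 5 → ℝ := J *ᵥ Pi.single 0 1 with hv
  have hsurj : ∀ p : Fin 5 → ℝ, J *ᵥ (J⁻¹ *ᵥ p) = p := fun p => by
    rw [Matrix.mulVec_mulVec, Matrix.mul_nonsing_inv _ hJdet, Matrix.one_mulVec]
  have hv0 : v ≠ 0 := by
    intro h
    have : J⁻¹ *ᵥ v = Pi.single 0 1 := by
      rw [hv, Matrix.mulVec_mulVec, Matrix.nonsing_inv_mul _ hJdet, Matrix.one_mulVec]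
    rw [h, Matrix.mulVec_zero] at this
    simpa using congrFun this 0
  have hpos : 0 < v ⬝ᵥ v := by
    refine lt_of_le_of_ne (Finset.sum_nonneg fun i _ => mul_self_nonneg _) fun h => hv0 ?_
    exact dotProduct_self_eq_zero.1 h.symm
  have hnull : v ⬝ᵥ G *ᵥ v = 0 := by
    rw [hv, ← dotProduct_pull, hJ, nullMat_mulVec_single]
    simp
  have hev : ∀ p q r s t u, Lorentz.ev4 C v (wedge G v p q) (wedge G v r s) (wedge G v t u) = 0 := by
    intro p q r s t u
    have hw : ∀ p q, wedge G v p q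
        = J *ᵥ wedge nullMat (Pi.single 0 1) (J⁻¹ *ᵥ p) (J⁻¹ *ᵥ q) := by
      intro p q
      rw [← hJ, wedge_pull, hsurj, hsurj]
    rw [hw, hw, hw, hv, ← ev4_pull4]
    refine Finset.sum_eq_zero fun i _ => Finset.sum_eq_zero fun j _ => Finset.sum_eq_zero fun k _ =>
      Finset.sum_eq_zero fun l _ => ?_
    by_cases hi : i = 0
    · by_cases hj : j = 1
      · rw [hj, wedge_nullMat_apply]; ring
      by_cases hk : k = 1
      · rw [hk, wedge_nullMat_apply]; ring
      by_cases hl : l = 1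
      · rw [hl, wedge_nullMat_apply]; ring
      have : 0 < boostWeight i j k l := by
        subst hi
        revert j k l
        decide
      rw [hN i j k l this]
      ring
    · rw [Pi.single_eq_of_ne hi]; ring
  refine ⟨(√(v ⬝ᵥ v))⁻¹ • v, ?_, ?_, fun p q r s t u => ?_⟩
  · simp [Matrix.mulVec_smul, hnull]
  · rw [smul_dotProduct, dotProduct_smul, smul_eq_mul, smul_eq_mul, ← mul_assoc, ← mul_inv,
      Real.mul_self_sqrt hpos.le, inv_mul_cancel₀ hpos.ne']
  · rw [wedge_smul, wedge_smul, wedge_smul, ev4_smul, hev, mul_zero]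

/-- A non-zero null vector is, up to a factor, the first vector of a null basis. -/
lemma exists_null_basis {v : Fin 5 → ℝ} (hv : v ≠ 0) (hnull : v ⬝ᵥ nullMat *ᵥ v = 0) :
    ∃ M : Matrix (Fin 5) (Fin 5) ℝ, Mᵀ * nullMat * M = nullMat ∧ ∃ r : ℝ, r ≠ 0 ∧
      v = r • (M *ᵥ Pi.single 0 1) := by
  have hq : 2 * (v 0 * v 1) + v 2 ^ 2 + v 3 ^ 2 + v 4 ^ 2 = 0 := by
    simp only [dotProduct, nullMat_mulVec, Fin.sum_univ_five] at hnull
    simp [dual] at hnull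
    linarith
  have hcol : ∀ M : Matrix (Fin 5) (Fin 5) ℝ, M *ᵥ Pi.single 0 1 = fun i => M i 0 := fun M => by
    ext i; simp
  by_cases h0 : v 0 = 0
  · rw [h0] at hq
    have h2 : v 2 = 0 := by nlinarith [sq_nonneg (v 2), sq_nonneg (v 3), sq_nonneg (v 4)]
    have h3 : v 3 = 0 := by nlinarith [sq_nonneg (v 2), sq_nonneg (v 3), sq_nonneg (v 4)]
    have h4 : v 4 = 0 := by nlinarith [sq_nonneg (v 2), sq_nonneg (v 3), sq_nonneg (v 4)]
    refine ⟨nullMat, ?_, v 1, ?_, ?_⟩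
    · rw [nullMat_transpose, nullMat_mul_self, Matrix.one_mul]
    · intro h1
      exact hv (by ext i; fin_cases i <;> assumption)
    · rw [hcol]
      ext i
      fin_cases i <;> simp [nullMat_apply, dual, h0, h2, h3, h4]
  · refine ⟨nullMat * nullRot (v 2 / v 0) (v 3 / v 0) (v 4 / v 0) * nullMat, ?_, v 0, h0, ?_⟩
    · have h := (isAdapted_nullRot (v 2 / v 0) (v 3 / v 0) (v 4 / v 0)).gram
      set R := nullRot (v 2 / v 0) (v 3 / v 0) (v 4 / v 0)
      calc (nullMat * R * nullMat)ᵀ * nullMat * (nullMat * R * nullMat)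
          = nullMat * (Rᵀ * (nullMat * nullMat * nullMat) * R) * nullMat := by
            simp only [Matrix.transpose_mul, nullMat_transpose, Matrix.mul_assoc]
        _ = nullMat := by
            rw [nullMat_mul_self, Matrix.one_mul, h, nullMat_mul_self, Matrix.one_mul]
    · have e : ∀ i, ((nullMat * nullRot (v 2 / v 0) (v 3 / v 0) (v 4 / v 0) * nullMat)
          *ᵥ Pi.single 0 1) i = nullRot (v 2 / v 0) (v 3 / v 0) (v 4 / v 0) (dual i) 1 := by
        intro i
        rw [← Matrix.mulVec_mulVec, ← Matrix.mulVec_mulVec, nullMat_mulVec_single, nullMat_mulVec]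
        simp
      ext i
      rw [Pi.smul_apply, e]
      fin_cases i
      · simp [nullRot, dual]
      · simp [nullRot, dual]
        field_simp
        linarith
      · simp [nullRot, dual]; field_simp
      · simp [nullRot, dual]; field_simp
      · simp [nullRot, dual]; field_simp

/-- The components of positive boost weight are determined by those with a single index `0` and no
index `1`. -/
lemma IsWeyl.nonposWeight (h : IsWeyl nullMat C)
    (h0 : ∀ i j k, i ≠ 1 → j ≠ 1 → k ≠ 1 → C 0 i j k = 0) : NonposWeight C := by
  have t : ∀ i, i ≠ 1 → C 0 1 0 i = 0 := by
    intro i hi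
    have h1 := h.trace_nullMat 0 i
    rw [h.diag_left, h.left 0 1, h.left 0 2, h.left 0 3, h.left 0 4,
      h0 2 2 i (by decide) (by decide) hi, h0 3 3 i (by decide) (by decide) hi,
      h0 4 4 i (by decide) (by decide) hi] at h1
    linarith
  refine h.eq_zero_of_lt (fun a b c d => 0 < boostWeight a b c d)
    (fun a b c d hw => by rwa [boostWeight_swap_left])
    (fun a b c d hw => by rwa [boostWeight_swap_right]) ?_
  intro a b c d hab hcd hw
  have key : (a = 0 ∧ b ≠ 1 ∧ c ≠ 1 ∧ d ≠ 1) ∨ (c = 0 ∧ d ≠ 1 ∧ a ≠ 1 ∧ b ≠ 1) ∨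
      (a = 0 ∧ b = 1 ∧ c = 0 ∧ d ≠ 1) ∨ (c = 0 ∧ d = 1 ∧ a = 0 ∧ b ≠ 1) := by
    revert a b c d
    decide
  rcases key with ⟨rfl, h1, h2, h3⟩ | ⟨rfl, h1, h2, h3⟩ | ⟨rfl, rfl, rfl, h1⟩ | ⟨rfl, rfl, rfl, h1⟩
  · exact h0 _ _ _ h1 h2 h3
  · rw [h.pair]; exact h0 _ _ _ h1 h2 h3
  · exact t d h1
  · rw [h.pair]; exact t b h1

/-- A null direction of type II can be completed to a normalized frame, if `C_{acde} C_b^{cde} = 0`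
and `C` is of genuine type II. -/
lemma IsWand.exists_frame {G : Matrix (Fin 5) (Fin 5) ℝ} {l : Fin 5 → ℝ} (hl : IsWand G C l)
    (hC : IsWeyl G C) (hS : ∀ a b, S2 G C a b = 0) (hII : IsGenuineTypeII G C) :
    ∃ J : Matrix (Fin 5) (Fin 5) ℝ, Jᵀ * G * J = nullMat ∧
      (∃ r : ℝ, r ≠ 0 ∧ l = r • (J *ᵥ Pi.single 0 1)) ∧ ∃ s, s ≠ 0 ∧ IsNormalized (pull4 C J) s := by
  obtain ⟨⟨F, hF, -⟩, hgen⟩ := hII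
  set A : Matrix (Fin 5) (Fin 5) ℝ := (of F)ᵀ with hAdef
  have hA : Aᵀ * G * A = nullMat := (isNullFrame_iff _ _).1 hF
  have hAdet := (isUnit_det_of_pull hA).2
  have hAl : A *ᵥ (A⁻¹ *ᵥ l) = l := by
    rw [Matrix.mulVec_mulVec, Matrix.mul_nonsing_inv _ hAdet, Matrix.one_mulVec]
  obtain ⟨M, hM, r, hr, hv⟩ := exists_null_basis (v := A⁻¹ *ᵥ l)
    (fun h => by
      have := hl.norm
      rw [← hAl, h, Matrix.mulVec_zero, zero_dotProduct] at this
      exact zero_ne_one this)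
    (by rw [← hA, dotProduct_pull, hAl]; exact hl.null)
  set B := A * M with hB
  have hBG : Bᵀ * G * B = nullMat := by
    rw [← hM, ← hA, hB]
    simp only [Matrix.transpose_mul, Matrix.mul_assoc]
  have hBdet := (isUnit_det_of_pull hBG).2
  have hlB : l = r • (B *ᵥ Pi.single 0 1) := by
    rw [hB, ← Matrix.mulVec_mulVec, ← Matrix.mulVec_smul, ← hv, hAl]
  have hW : IsWeyl nullMat (pull4 C B) := by rw [← hBG]; exact hC.pull hBdet
  have hN : NonposWeight (pull4 C B) := by
    refine hW.nonposWeight fun i j k hi hj hk => ?_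
    have h1 := hl.ev4 (B *ᵥ Pi.single 1 1) (B *ᵥ Pi.single i 1) (B *ᵥ Pi.single 1 1)
      (B *ᵥ Pi.single j 1) (B *ᵥ Pi.single 1 1) (B *ᵥ Pi.single k 1)
    rw [hlB, wedge_smul, wedge_smul, wedge_smul, ev4_smul, ← wedge_pull, ← wedge_pull, ← wedge_pull,
      hBG, wedge_nullMat_single hi, wedge_nullMat_single hj,
      wedge_nullMat_single hk, ← ev4_pull4, ev4_single] at h1
    exact (mul_eq_zero.1 h1).resolve_left (pow_ne_zero 4 hr)
  have hS' : ∀ a b, S2 nullMat (pull4 C B) a b = 0 * nullMat a b := by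
    intro a b
    have := S2_pull4 (G := G) hBdet C a b
    rw [hBG] at this
    have e : of (S2 G C) = 0 := by ext a b; exact hS a b
    rw [this, e, Matrix.mul_zero, Matrix.zero_mul, zero_mul]
    rfl
  have hne : ∃ a b c d, boostWeight a b c d = 0 ∧ pull4 C B a b c d ≠ 0 := by
    by_contra hcon
    push Not at hcon
    refine hgen ⟨fun a i => B i a, (isNullFrame_iff _ _).2 hBG, fun a b c d hw => ?_⟩
    change pull4 C B a b c d = 0
    rcases (show (-1 : ℤ) + 1 ≤ boostWeight a b c d from hw).lt_or_eq with h | h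
    · exact hN a b c d (by simpa using h)
    · exact hcon a b c d (by simpa using h.symm)
  obtain ⟨J, hJ, s, hs, hn⟩ := exists_isNormalized hW hN hS' hne
  have hcol : J *ᵥ Pi.single 0 1 = J 0 0 • (Pi.single 0 1 : Fin 5 → ℝ) := by
    ext i
    by_cases hi : i = 0
    · subst hi; simp
    · have : J i 0 = 0 := hJ.tri i 0 (by revert i; decide)
      simp [this, hi]
  have hJ0 : J 0 0 ≠ 0 := by
    intro h0
    rw [h0, zero_smul] at hcol
    have := congrFun (congrArg (fun v => J⁻¹ *ᵥ v) hcol) 0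
    simp only [Matrix.mulVec_mulVec, Matrix.nonsing_inv_mul _ hJ.isUnit_det] at this
    simp at this
  refine ⟨B * J, ?_, ⟨r / J 0 0, div_ne_zero hr hJ0, ?_⟩, s, hs, by rwa [← pull4_pull4]⟩
  · have := hJ.gram
    rw [← hBG] at this ⊢
    rw [← this]
    simp only [Matrix.transpose_mul, Matrix.mul_assoc]
  · rw [← Matrix.mulVec_mulVec, hcol, Matrix.mulVec_smul, smul_smul, div_mul_cancel₀ _ hJ0, ← hlB]

/-- The components of a normalized Weyl tensor determine the infinitesimal null rotations. -/
lemma IsNormalized.rotation_eq_zero {s : ℝ} (h : IsNormalized C s) (hs : s ≠ 0) {z : Fin 5 → ℝ}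
    (hz : ∀ i j k, i ≠ 1 → j ≠ 1 → k ≠ 1 → 0 =
      z i * C 0 1 j k + z j * C 0 i 1 k + z k * C 0 i j 1
        - (z 2 * C 2 i j k + z 3 * C 3 i j k + z 4 * C 4 i j k)) :
    z 2 = 0 ∧ z 3 = 0 ∧ z 4 = 0 := by
  have hW := h.isWeyl
  obtain ⟨⟨w1, w2, w3, w4, w5, w6, w7, w8, w9, w10⟩, ⟨v1, v2, v3, v4, v5, v6, v7, v8, v9⟩⟩ :=
    h.model.values
  have e1 := hz 2 2 3 (by decide) (by decide) (by decide)
  have e2 := hz 3 2 3 (by decide) (by decide) (by decide)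
  have e3 := hz 4 2 3 (by decide) (by decide) (by decide)
  simp (disch := decide) only [hW.diag_left, hW.swap_left, hW.swap_right, hW.swap_pair, mul_zero,
    add_zero, zero_add, neg_zero, w2, w5, w6, w7, v1, v2, v4, v5, v7, v8] at e1 e2 e3
  have f : ∀ t : ℝ, s * t = 0 → t = 0 := fun t ht => (mul_eq_zero.1 ht).resolve_left hs
  refine ⟨f _ ?_, f _ ?_, f _ ?_⟩ <;> linarith only [e1, e2, e3]

end Wand

/-! ### Linearization of the equations of a null direction of type II -/

section Linearize

open Matrix

variable {n : ℕ}

lemma hasDerivAt_ev4 {C : ℝ → Fin n → Fin n → Fin n → Fin n → ℝ}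
    {C' : Fin n → Fin n → Fin n → Fin n → ℝ} {a b c d : ℝ → Fin n → ℝ} {a' b' c' d' : Fin n → ℝ}
    (hC : ∀ i j k l, HasDerivAt (fun t => C t i j k l) (C' i j k l) 0)
    (ha : ∀ i, HasDerivAt (fun t => a t i) (a' i) 0) (hb : ∀ i, HasDerivAt (fun t => b t i) (b' i) 0)
    (hc : ∀ i, HasDerivAt (fun t => c t i) (c' i) 0) (hd : ∀ i, HasDerivAt (fun t => d t i) (d' i) 0) :
    HasDerivAt (fun t => ev4 (C t) (a t) (b t) (c t) (d t))
      (ev4 C' (a 0) (b 0) (c 0) (d 0) + ev4 (C 0) a' (b 0) (c 0) (d 0)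
        + ev4 (C 0) (a 0) b' (c 0) (d 0) + ev4 (C 0) (a 0) (b 0) c' (d 0)
        + ev4 (C 0) (a 0) (b 0) (c 0) d') 0 := by
  simp only [ev4, ← Finset.sum_add_distrib]
  refine HasDerivAt.fun_sum fun i _ => HasDerivAt.fun_sum fun j _ => HasDerivAt.fun_sum fun k _ =>
    HasDerivAt.fun_sum fun l _ => ?_
  exact ((((((hC i j k l).mul (ha i)).mul (hb j)).mul (hc k)).mul (hd l))).congr_deriv (by
    simp only [Pi.mul_apply]
    ring)

lemma hasDerivAt_form {A : ℝ → Matrix (Fin n) (Fin n) ℝ} {A' : Matrix (Fin n) (Fin n) ℝ}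
    {p l : ℝ → Fin n → ℝ} {p' l' : Fin n → ℝ}
    (hA : ∀ i j, HasDerivAt (fun t => A t i j) (A' i j) 0)
    (hp : ∀ i, HasDerivAt (fun t => p t i) (p' i) 0) (hl : ∀ i, HasDerivAt (fun t => l t i) (l' i) 0) :
    HasDerivAt (fun t => p t ⬝ᵥ A t *ᵥ l t)
      (p 0 ⬝ᵥ A' *ᵥ l 0 + p' ⬝ᵥ A 0 *ᵥ l 0 + p 0 ⬝ᵥ A 0 *ᵥ l') 0 := by
  simp only [dotProduct, Matrix.mulVec, Finset.mul_sum, ← Finset.sum_add_distrib]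
  refine HasDerivAt.fun_sum fun i _ => HasDerivAt.fun_sum fun j _ => ?_
  exact ((hp i).mul ((hA i j).mul (hl j))).congr_deriv (by
    simp only [Pi.mul_apply]
    ring)

variable {G : MetricField 5} {U : Set (EuclideanSpace ℝ (Fin 5))} {x v : EuclideanSpace ℝ (Fin 5)}
  {δ : Fin 5 → ℝ}

/-- The derivative along `t ↦ (x + t v, ℓ + t δ)` of the equations for a null direction of type II,
in coordinates that are adapted to a null frame at `x` with first vector `ℓ`. -/
lemma IsEinsteinOn.linearize (h : IsEinsteinOn G U) (hx : x ∈ U) (hGx : G x = nullMat)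
    (hC0 : ∀ i j k, i ≠ 1 → j ≠ 1 → k ≠ 1 → weyl G x 0 i j k = 0)
    (hnull : HasDerivAt (fun t : ℝ => (Pi.single 0 1 + t • δ) ⬝ᵥ
      G (x + t • v) *ᵥ (Pi.single 0 1 + t • δ)) 0 0)
    (hev : ∀ i j k, i ≠ 1 → j ≠ 1 → k ≠ 1 → HasDerivAt (fun t : ℝ => ev4 (weyl G (x + t • v))
      (Pi.single 0 1 + t • δ)
      (wedge (G (x + t • v)) (Pi.single 0 1 + t • δ) (Pi.single 1 1) (Pi.single i 1))
      (wedge (G (x + t • v)) (Pi.single 0 1 + t • δ) (Pi.single 1 1) (Pi.single j 1))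
      (wedge (G (x + t • v)) (Pi.single 0 1 + t • δ) (Pi.single 1 1) (Pi.single k 1))) 0 0) :
    fderiv ℝ (fun z => G z 0 0) x v + 2 * δ 1 = 0 ∧
    ∀ i j k, i ≠ 1 → j ≠ 1 → k ≠ 1 →
      fderiv ℝ (fun z => weyl G z 0 i j k) x v + ∑ a, δ a * weyl G x a i j k
        = (fderiv ℝ (fun z => G z i 0) x v + δ (dual i)) * weyl G x 0 1 j k
          + (fderiv ℝ (fun z => G z j 0) x v + δ (dual j)) * weyl G x 0 i 1 k
          + (fderiv ℝ (fun z => G z k 0) x v + δ (dual k)) * weyl G x 0 i j 1 := by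
  have hline : HasDerivAt (fun t : ℝ => x + t • v) v 0 := by
    simpa using ((hasDerivAt_id (0 : ℝ)).smul_const v).const_add x
  have hcomp : ∀ f : EuclideanSpace ℝ (Fin 5) → ℝ, ContDiffOn ℝ ∞ f U →
      HasDerivAt (fun t : ℝ => f (x + t • v)) (fderiv ℝ f x v) 0 := by
    intro f hf
    have h1 : HasFDerivAt f (fderiv ℝ f x) (x + (0 : ℝ) • v) := by
      rw [zero_smul, add_zero]
      exact (diffAt_of_smooth h.metric.isOpen hf hx).hasFDerivAt
    exact h1.comp_hasDerivAt 0 hline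
  have hG : ∀ i j, HasDerivAt (fun t : ℝ => G (x + t • v) i j)
      ((of fun i j => fderiv ℝ (fun z => G z i j) x v) i j) 0 := fun i j =>
    hcomp _ (h.metric.smooth i j)
  have hC : ∀ a b c d, HasDerivAt (fun t : ℝ => weyl G (x + t • v) a b c d)
      (fderiv ℝ (fun z => weyl G z a b c d) x v) 0 := fun a b c d =>
    hcomp _ (h.smooth_weylTen ![a, b, c, d])
  have hl : ∀ i, HasDerivAt (fun t : ℝ => ((Pi.single 0 1 + t • δ : Fin 5 → ℝ)) i) (δ i) 0 := by
    intro i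
    simpa using ((hasDerivAt_id (0 : ℝ)).mul_const (δ i)).const_add ((Pi.single 0 1 : Fin 5 → ℝ) i)
  have hconst : ∀ p : Fin 5 → ℝ, ∀ i, HasDerivAt (fun _ : ℝ => p i) ((0 : Fin 5 → ℝ) i) 0 :=
    fun p i => hasDerivAt_const _ _
  have hform : ∀ i : Fin 5, HasDerivAt (fun t : ℝ => (Pi.single i 1 : Fin 5 → ℝ) ⬝ᵥ
      G (x + t • v) *ᵥ (Pi.single 0 1 + t • δ)) (fderiv ℝ (fun z => G z i 0) x v + δ (dual i)) 0 := by
    intro i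
    refine (hasDerivAt_form hG (hconst _) hl).congr_deriv ?_
    simp [hGx, nullMat_mulVec]
  have hform0 : ∀ i : Fin 5, (Pi.single i 1 : Fin 5 → ℝ) ⬝ᵥ
      G (x + (0 : ℝ) • v) *ᵥ (Pi.single 0 1 + (0 : ℝ) • δ) = if i = 1 then 1 else 0 := by
    intro i
    rw [zero_smul, zero_smul, add_zero, add_zero, hGx, nullMat_mulVec_single]
    simp [Pi.single_apply, eq_comm]
  have hw : ∀ i : Fin 5, i ≠ 1 → ∀ m, HasDerivAt (fun t : ℝ =>
      wedge (G (x + t • v)) (Pi.single 0 1 + t • δ) (Pi.single 1 1) (Pi.single i 1) m)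
      (((fderiv ℝ (fun z => G z 1 0) x v + δ 0) • (Pi.single i 1 : Fin 5 → ℝ)
        - (fderiv ℝ (fun z => G z i 0) x v + δ (dual i)) • (Pi.single 1 1 : Fin 5 → ℝ)) m) 0 := by
    intro i hi m
    exact ((hform 1).mul_const _).sub ((hform i).mul_const _)
  have hw0 : ∀ i : Fin 5, i ≠ 1 → wedge (G (x + (0 : ℝ) • v)) (Pi.single 0 1 + (0 : ℝ) • δ)
      (Pi.single 1 1) (Pi.single i 1) = Pi.single i 1 := by
    intro i hi
    rw [wedge, hform0, hform0, if_pos rfl, if_neg hi, one_smul, zero_smul, sub_zero]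
  constructor
  · have h1 := hnull.unique (hasDerivAt_form hG hl hl)
    rw [zero_smul, zero_smul, add_zero, add_zero, hGx, nullMat_mulVec_single] at h1
    simp [nullMat_mulVec, dual] at h1
    linarith only [h1]
  · intro i j k hi hj hk
    have h1 := (hev i j k hi hj hk).unique (hasDerivAt_ev4 hC hl (hw i hi) (hw j hj) (hw k hk))
    rw [hw0 i hi, hw0 j hj, hw0 k hk, zero_smul, zero_smul, add_zero, add_zero, ev4_single] at h1
    have e0 : ∀ b c d : Fin 5, ev4 (weyl G x) δ (Pi.single b 1) (Pi.single c 1) (Pi.single d 1)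
        = ∑ a, δ a * weyl G x a b c d := by
      intro b c d
      simp [ev4, Pi.single_apply, mul_comm]
    have e1 : ∀ (r s : ℝ) (b b' c d : Fin 5), ev4 (weyl G x) (Pi.single 0 1)
        (r • Pi.single b 1 - s • Pi.single b' 1) (Pi.single c 1) (Pi.single d 1)
        = r * weyl G x 0 b c d - s * weyl G x 0 b' c d := by
      intro r s b b' c d
      simp [ev4, Pi.single_apply, mul_sub, Finset.sum_sub_distrib, mul_comm]
    have e2 : ∀ (r s : ℝ) (b c c' d : Fin 5), ev4 (weyl G x) (Pi.single 0 1) (Pi.single b 1)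
        (r • Pi.single c 1 - s • Pi.single c' 1) (Pi.single d 1)
        = r * weyl G x 0 b c d - s * weyl G x 0 b c' d := by
      intro r s b c c' d
      simp [ev4, Pi.single_apply, mul_sub, Finset.sum_sub_distrib, mul_comm]
    have e3 : ∀ (r s : ℝ) (b c d d' : Fin 5), ev4 (weyl G x) (Pi.single 0 1) (Pi.single b 1)
        (Pi.single c 1) (r • Pi.single d 1 - s • Pi.single d' 1)
        = r * weyl G x 0 b c d - s * weyl G x 0 b c d' := by
      intro r s b c d d'
      simp [ev4, Pi.single_apply, mul_sub, Finset.sum_sub_distrib, mul_comm]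
    rw [e0, e1, e2, e3, hC0 i j k hi hj hk] at h1
    linarith only [h1]

/-- The linearized equations determine the infinitesimal null rotation. -/
lemma rotation_of_linearized {s : ℝ} (hn : IsNormalized (weyl G x) s) (hs : s ≠ 0) (h1 : δ 1 = 0)
    (h2 : ∀ i j k, i ≠ 1 → j ≠ 1 → k ≠ 1 → ∑ a, δ a * weyl G x a i j k
      = δ (dual i) * weyl G x 0 1 j k + δ (dual j) * weyl G x 0 i 1 k
        + δ (dual k) * weyl G x 0 i j 1) : δ 1 = 0 ∧ δ 2 = 0 ∧ δ 3 = 0 ∧ δ 4 = 0 := by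
  have := hn.rotation_eq_zero hs (z := fun a => δ (dual a)) fun i j k hi hj hk => ?_
  · exact ⟨h1, this⟩
  · have hw : ∀ i j k : Fin 5, i ≠ 1 → j ≠ 1 → k ≠ 1 → 0 < boostWeight 0 i j k := by decide
    have h3 := h2 i j k hi hj hk
    rw [Fin.sum_univ_five, h1, hn.nonpos 0 i j k (hw i j k hi hj hk)] at h3
    change 0 = δ (dual i) * _ + δ (dual j) * _ + δ (dual k) * _ - (δ 2 * _ + δ 3 * _ + δ 4 * _)
    linarith only [h3]

/-- The linearized equations in the direction of a coordinate vector, in terms of the covariant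
derivative of the Weyl tensor. -/
lemma IsEinsteinOn.covDeriv_of_linearized (h : IsEinsteinOn G U) (hx : x ∈ U) (hGx : G x = nullMat)
    (hC0 : ∀ i j k, i ≠ 1 → j ≠ 1 → k ≠ 1 → weyl G x 0 i j k = 0) (e : Fin 5)
    (h1 : pd e (fun z => G z 0 0) x + 2 * δ 1 = 0)
    (h2 : ∀ i j k, i ≠ 1 → j ≠ 1 → k ≠ 1 →
      pd e (fun z => weyl G z 0 i j k) x + ∑ a, δ a * weyl G x a i j k
        = (pd e (fun z => G z i 0) x + δ (dual i)) * weyl G x 0 1 j k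
          + (pd e (fun z => G z j 0) x + δ (dual j)) * weyl G x 0 i 1 k
          + (pd e (fun z => G z k 0) x + δ (dual k)) * weyl G x 0 i j 1) :
    ∃ z : Fin 5 → ℝ, z 0 = 0 ∧ ∀ i j k, i ≠ 1 → j ≠ 1 → k ≠ 1 →
      covDeriv G (weylTen G) x ![e, 0, i, j, k]
        = z i * weyl G x 0 1 j k + z j * weyl G x 0 i 1 k + z k * weyl G x 0 i j 1
          - (z 2 * weyl G x 2 i j k + z 3 * weyl G x 3 i j k + z 4 * weyl G x 4 i j k) := by
  have hpd : ∀ i, pd e (fun z => G z i 0) x = conn G e x (dual i) 0 + conn G e x 1 i := by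
    intro i
    have := congrFun (congrFun (h.metric.pdM_eq hx e) i) 0
    rw [hGx] at this
    change pd e (fun z => G z i 0) x = _ at this
    rw [this]
    simp only [Matrix.add_apply, Matrix.mul_apply, Matrix.transpose_apply, nullMat_apply]
    have hd : ∀ b : Fin 5, 0 = dual b ↔ b = 1 := by decide
    simp [hd, add_comm]
  refine ⟨fun a => δ (dual a) + conn G e x (dual a) 0, ?_, fun i j k hi hj hk => ?_⟩
  · have := hpd 0
    change pd e (fun z => G z 0 0) x = conn G e x 1 0 + conn G e x 1 0 at this
    change δ 1 + conn G e x 1 0 = 0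
    linarith
  · have h3 := h2 i j k hi hj hk
    have e0 : ∀ b c d, ![e, 0, b, c, d] = Fin.cons e ![0, b, c, d] := fun _ _ _ => rfl
    rw [e0, covDeriv_cons, slotAct_four]
    simp only [weylTen_apply]
    change pd e (fun z => weyl G z 0 i j k) x - _ = _
    have h4 := hpd 0
    change pd e (fun z => G z 0 0) x = conn G e x 1 0 + conn G e x 1 0 at h4
    rw [hpd, hpd, hpd] at h3
    simp only [Fin.sum_univ_five] at h3 ⊢
    have a1 : ∀ m, m ≠ 1 → weyl G x 0 m j k = 0 := fun m hm => hC0 m j k hm hj hk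
    have a2 : ∀ m, m ≠ 1 → weyl G x 0 i m k = 0 := fun m hm => hC0 i m k hi hm hk
    have a3 : ∀ m, m ≠ 1 → weyl G x 0 i j m = 0 := fun m hm => hC0 i j m hi hj hm
    have hδ : δ 1 = - conn G e x 1 0 := by linarith
    change _ = (δ (dual i) + conn G e x (dual i) 0) * _ + (δ (dual j) + conn G e x (dual j) 0) * _
      + (δ (dual k) + conn G e x (dual k) 0) * _ - ((δ 2 + conn G e x 2 0) * _
        + (δ 3 + conn G e x 3 0) * _ + (δ 4 + conn G e x 4 0) * _)
    simp only [a1 0 (by decide), a1 2 (by decide), a1 3 (by decide), a1 4 (by decide),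
      a2 0 (by decide), a2 2 (by decide), a2 3 (by decide), a2 4 (by decide),
      a3 0 (by decide), a3 2 (by decide), a3 3 (by decide), a3 4 (by decide), hC0 i j k hi hj hk, hδ]
      at h3 ⊢
    linarith only [h3]

end Linearize

/-! ### Einstein metrics of genuine type II in a coordinate chart -/

section Core

open Matrix Filter Topology

section

variable {n : ℕ} {G : MetricField n} {U : Set (EuclideanSpace ℝ (Fin n))}

/-- The metric `G` in the affine coordinates `z ↦ x + J z`. -/
def affinePull (G : MetricField n) (x : EuclideanSpace ℝ (Fin n)) (J : Matrix (Fin n) (Fin n) ℝ) :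
    MetricField n :=
  fun z => Jᵀ * G (x + Matrix.toEuclideanCLM (𝕜 := ℝ) J z) * J

lemma jacobian_affine (x : EuclideanSpace ℝ (Fin n)) (J : Matrix (Fin n) (Fin n) ℝ)
    (y : EuclideanSpace ℝ (Fin n)) :
    jacobian (fun z => x + Matrix.toEuclideanCLM (𝕜 := ℝ) J z) y = J := by
  ext k i
  have h1 : HasFDerivAt (fun z => (x + Matrix.toEuclideanCLM (𝕜 := ℝ) J z) k)
      ((EuclideanSpace.proj (𝕜 := ℝ) k).comp (Matrix.toEuclideanCLM (𝕜 := ℝ) J)) y :=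
    (EuclideanSpace.proj (𝕜 := ℝ) k).hasFDerivAt.comp y
      ((Matrix.toEuclideanCLM (𝕜 := ℝ) J).hasFDerivAt.const_add x)
  simp only [jacobian, of_apply, pd, h1.fderiv]
  simp [Matrix.ofLp_toEuclideanCLM]

lemma IsMetricOn.isPullback_affine (hG : IsMetricOn G U) (x : EuclideanSpace ℝ (Fin n))
    {J : Matrix (Fin n) (Fin n) ℝ} (hJ : IsUnit J.det) :
    IsPullback G (affinePull G x J) (fun z => x + Matrix.toEuclideanCLM (𝕜 := ℝ) J z) U
      ((fun z => x + Matrix.toEuclideanCLM (𝕜 := ℝ) J z) ⁻¹' U) where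
  metric := hG
  isOpen := hG.isOpen.preimage (by fun_prop)
  maps := Set.mapsTo_preimage _ _
  smooth := (contDiff_const.add (Matrix.toEuclideanCLM (𝕜 := ℝ) J).contDiff).contDiffOn
  det y _ := by rwa [jacobian_affine]
  eq y _ := by rw [jacobian_affine, affinePull]

end

variable {G G' : MetricField 5} {U V : Set (EuclideanSpace ℝ (Fin 5))}
  {φ : EuclideanSpace ℝ (Fin 5) → EuclideanSpace ℝ (Fin 5)} {x y : EuclideanSpace ℝ (Fin 5)}
  {J : Matrix (Fin 5) (Fin 5) ℝ} {l : Fin 5 → ℝ} {r s : ℝ}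

lemma IsEinsteinOn.pullback (h : IsEinsteinOn G U) (hp : IsPullback G G' φ U V) :
    IsEinsteinOn G' V where
  metric := hp.isMetricOn
  ricci_eq y hy b d := by
    rw [hp.ricci_eq hy, hp.scalarCurv_eq hy, hp.metric_eq hy, Finset.mul_sum]
    refine Finset.sum_congr rfl fun j _ => ?_
    rw [Finset.mul_sum]
    refine Finset.sum_congr rfl fun k _ => ?_
    rw [h.ricci_eq _ (hp.maps hy)]
    ring

lemma IsPullback.S2_weyl_eq_zero (hp : IsPullback G G' φ U V) (hy : y ∈ V)
    (hS : ∀ a b, S2 (G (φ y)) (weyl G (φ y)) a b = 0) (a b : Fin 5) :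
    S2 (G' y) (weyl G' y) a b = 0 := by
  have h1 : of (S2 (G (φ y)) (weyl G (φ y))) = 0 := by ext a b; exact hS a b
  rw [hp.weyl_eq hy, hp.eq y hy]
  rw [S2_pull4 (hp.det y hy), h1, Matrix.mul_zero, Matrix.zero_mul]
  rfl

/-- The equations for a null direction `l` of type II at `y`: `l` is null, it is normalized, and
sufficiently many components of positive boost weight vanish. -/
def wandMap (G : MetricField 5) (J : Matrix (Fin 5) (Fin 5) ℝ)
    (p : EuclideanSpace ℝ (Fin 5) × (Fin 5 → ℝ)) : ℝ × ℝ × (Fin 5 → Fin 5 → Fin 5 → ℝ) :=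
  (p.2 ⬝ᵥ G p.1 *ᵥ p.2, p.2 ⬝ᵥ p.2 - 1, fun i j k => ev4 (weyl G p.1) p.2
    (wedge (G p.1) p.2 (J *ᵥ Pi.single 1 1) (J *ᵥ Pi.single i 1))
    (wedge (G p.1) p.2 (J *ᵥ Pi.single 1 1) (J *ᵥ Pi.single j 1))
    (wedge (G p.1) p.2 (J *ᵥ Pi.single 1 1) (J *ᵥ Pi.single k 1)))

lemma IsWand.wandMap_eq_zero (h : IsWand (G y) (weyl G y) l) : wandMap G J (y, l) = 0 := by
  refine Prod.ext h.null (Prod.ext ?_ ?_)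
  · exact sub_eq_zero.2 h.norm
  · funext i j k
    exact h.ev4 _ _ _ _ _ _

lemma differentiableAt_form (hG : IsMetricOn G U) (hx : x ∈ U)
    {q : EuclideanSpace ℝ (Fin 5) × (Fin 5 → ℝ) → Fin 5 → ℝ}
    (hq : ∀ i, DifferentiableAt ℝ (fun p => q p i) (x, l)) :
    DifferentiableAt ℝ (fun p => q p ⬝ᵥ G p.1 *ᵥ p.2) (x, l) := by
  simp only [dotProduct, Matrix.mulVec]
  refine DifferentiableAt.fun_sum fun i _ => (hq i).mul (DifferentiableAt.fun_sum fun j _ => ?_)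
  have h1 : DifferentiableAt ℝ (fun p : EuclideanSpace ℝ (Fin 5) × (Fin 5 → ℝ) => G p.1 i j)
      (x, l) :=
    DifferentiableAt.comp (x, l) (f := Prod.fst) (diffAt_of_smooth hG.isOpen (hG.smooth i j) hx)
      differentiableAt_fst
  exact h1.mul (by fun_prop)

lemma differentiableAt_wedge (hG : IsMetricOn G U) (hx : x ∈ U)
    (p q : Fin 5 → ℝ) (m : Fin 5) : DifferentiableAt ℝ
    (fun y : EuclideanSpace ℝ (Fin 5) × (Fin 5 → ℝ) => wedge (G y.1) y.2 p q m) (x, l) :=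
  ((differentiableAt_form hG hx (q := fun _ => p) fun _ => differentiableAt_const _).mul_const _).sub
    ((differentiableAt_form hG hx (q := fun _ => q) fun _ => differentiableAt_const _).mul_const _)

lemma differentiableAt_ev4_wedge (hG : IsMetricOn G U) (hx : x ∈ U)
    (hW : SmoothTen (weylTen G) U) (p q r s t u : Fin 5 → ℝ) :
    DifferentiableAt ℝ (fun y : EuclideanSpace ℝ (Fin 5) × (Fin 5 → ℝ) => ev4 (weyl G y.1) y.2
      (wedge (G y.1) y.2 p q) (wedge (G y.1) y.2 r s) (wedge (G y.1) y.2 t u)) (x, l) := by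
  refine DifferentiableAt.fun_sum fun a _ => DifferentiableAt.fun_sum fun b _ =>
    DifferentiableAt.fun_sum fun c _ => DifferentiableAt.fun_sum fun d _ => ?_
  have h1 : DifferentiableAt ℝ (fun p : EuclideanSpace ℝ (Fin 5) × (Fin 5 → ℝ) =>
      weyl G p.1 a b c d) (x, l) :=
    DifferentiableAt.comp (x, l) (f := Prod.fst)
      (diffAt_of_smooth hG.isOpen (hW ![a, b, c, d]) hx) differentiableAt_fst
  have h2 : DifferentiableAt ℝ (fun p : EuclideanSpace ℝ (Fin 5) × (Fin 5 → ℝ) => p.2 a) (x, l) := by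
    fun_prop
  exact (((h1.mul h2).mul (differentiableAt_wedge hG hx _ _ b)).mul
    (differentiableAt_wedge hG hx _ _ c)).mul (differentiableAt_wedge hG hx _ _ d)

lemma differentiableAt_wandMap (hG : IsMetricOn G U) (hx : x ∈ U)
    (hW : SmoothTen (weylTen G) U) (J : Matrix (Fin 5) (Fin 5) ℝ)
    (l : Fin 5 → ℝ) : DifferentiableAt ℝ (wandMap G J) (x, l) := by
  refine (differentiableAt_form hG hx fun i => by fun_prop).prodMk (DifferentiableAt.prodMk ?_ ?_)
  · simp only [dotProduct]
    fun_prop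
  · exact differentiableAt_pi.2 fun i => differentiableAt_pi.2 fun j => differentiableAt_pi.2
      fun k => differentiableAt_ev4_wedge hG hx hW _ _ _ _ _ _

/-- Limits of null directions of type II are of the same kind. -/
lemma isWand_of_tendsto (hG : IsMetricOn G U) (hx : x ∈ U)
    (hW : SmoothTen (weylTen G) U) {y : ℕ → EuclideanSpace ℝ (Fin 5)}
    {u : ℕ → Fin 5 → ℝ} (hy : Tendsto y atTop (𝓝 x)) (hu : Tendsto u atTop (𝓝 l))
    (h : ∀ k, IsWand (G (y k)) (weyl G (y k)) (u k)) : IsWand (G x) (weyl G x) l := by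
  have hyu := hy.prodMk_nhds hu
  refine ⟨?_, ?_, fun p q r s t w => ?_⟩
  · have h1 := (differentiableAt_form hG hx (l := l) (q := fun p => p.2)
      fun i => by fun_prop).continuousAt.tendsto.comp hyu
    exact tendsto_nhds_unique h1 (tendsto_const_nhds.congr fun k => (h k).null.symm)
  · have h1 : Continuous fun v : Fin 5 → ℝ => v ⬝ᵥ v := by
      simp only [dotProduct]
      fun_prop
    exact tendsto_nhds_unique ((h1.tendsto l).comp hu)
      (tendsto_const_nhds.congr fun k => (h k).norm.symm)
  · have h1 := (differentiableAt_ev4_wedge hG hx (l := l) hW p q r s t w).continuousAt.tendsto.comp hyu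
    exact tendsto_nhds_unique h1 (tendsto_const_nhds.congr fun k => ((h k).ev4 p q r s t w).symm)

/-- The linearized equations for a null direction of type II, in coordinates adapted to a normalized
frame. -/
lemma IsEinsteinOn.linearize_wandMap (h : IsEinsteinOn G U) (hx : x ∈ U)
    (hJ : Jᵀ * G x * J = nullMat) (hr : r ≠ 0) (hl : l = r • (J *ᵥ Pi.single 0 1))
    (hn : IsNormalized (pull4 (weyl G x) J) s) {v : EuclideanSpace ℝ (Fin 5)} {δ : Fin 5 → ℝ}
    (hz : fderiv ℝ (wandMap G J) (x, l) (Matrix.toEuclideanCLM (𝕜 := ℝ) J v, r • (J *ᵥ δ)) = 0) :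
    l ⬝ᵥ (r • (J *ᵥ δ)) = 0 ∧
    fderiv ℝ (fun z => affinePull G x J z 0 0) 0 v + 2 * δ 1 = 0 ∧
    ∀ i j k, i ≠ 1 → j ≠ 1 → k ≠ 1 →
      fderiv ℝ (fun z => weyl (affinePull G x J) z 0 i j k) 0 v
          + ∑ a, δ a * weyl (affinePull G x J) 0 a i j k
        = (fderiv ℝ (fun z => affinePull G x J z i 0) 0 v + δ (dual i))
              * weyl (affinePull G x J) 0 0 1 j k
          + (fderiv ℝ (fun z => affinePull G x J z j 0) 0 v + δ (dual j))
              * weyl (affinePull G x J) 0 0 i 1 k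
          + (fderiv ℝ (fun z => affinePull G x J z k 0) 0 v + δ (dual k))
              * weyl (affinePull G x J) 0 0 i j 1 := by
  have hJdet := (isUnit_det_of_pull hJ).2
  have hp := h.metric.isPullback_affine x hJdet
  set L := Matrix.toEuclideanCLM (𝕜 := ℝ) J with hL
  have h0 : (0 : EuclideanSpace ℝ (Fin 5)) ∈ (fun z => x + L z) ⁻¹' U := by
    simpa using hx
  have hweyl : ∀ z ∈ (fun z => x + L z) ⁻¹' U, weyl (affinePull G x J) z = pull4 (weyl G (x + L z)) J :=
    fun z hz => by rw [hp.weyl_eq hz, jacobian_affine]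
  have hG0 : affinePull G x J 0 = nullMat := by rw [affinePull, map_zero, add_zero, hJ]
  have hw0 : weyl (affinePull G x J) 0 = pull4 (weyl G x) J := by
    rw [hweyl 0 h0, map_zero, add_zero]
  have hcurve : HasDerivAt (fun t : ℝ => (x + t • L v, l + t • (r • (J *ᵥ δ))))
      (L v, r • (J *ᵥ δ)) 0 := by
    have h1 : HasDerivAt (fun t : ℝ => x + t • L v) (L v) 0 := by
      simpa using ((hasDerivAt_id (0 : ℝ)).smul_const (L v)).const_add x
    have h2 : HasDerivAt (fun t : ℝ => l + t • (r • (J *ᵥ δ))) (r • (J *ᵥ δ)) 0 := by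
      simpa using ((hasDerivAt_id (0 : ℝ)).smul_const (r • (J *ᵥ δ))).const_add l
    exact h1.prodMk h2
  have hψ : HasDerivAt (fun t : ℝ => wandMap G J (x + t • L v, l + t • (r • (J *ᵥ δ)))) 0 0 := by
    have h1 : HasFDerivAt (wandMap G J) (fderiv ℝ (wandMap G J) (x, l))
        (x + (0 : ℝ) • L v, l + (0 : ℝ) • (r • (J *ᵥ δ))) := by
      rw [zero_smul, zero_smul, add_zero, add_zero]
      exact (differentiableAt_wandMap h.metric hx h.smooth_weylTen J l).hasFDerivAt
    rw [← hz]
    exact h1.comp_hasDerivAt 0 hcurve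
  have hl' : ∀ t : ℝ, l + t • (r • (J *ᵥ δ)) = r • (J *ᵥ (Pi.single 0 1 + t • δ)) := by
    intro t
    rw [hl, Matrix.mulVec_add, Matrix.mulVec_smul, smul_add, smul_comm t r]
  have hy : ∀ t : ℝ, x + t • L v = x + L (0 + t • v) := by
    intro t
    rw [zero_add, map_smul]
  have hG' : ∀ t : ℝ, Jᵀ * G (x + t • L v) * J = affinePull G x J (0 + t • v) := by
    intro t
    rw [affinePull, hy]
  have hψ1 := (ContinuousLinearMap.fst ℝ ℝ (ℝ × (Fin 5 → Fin 5 → Fin 5 → ℝ))).hasFDerivAt.comp_hasDerivAt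
    0 hψ
  have hψ23 := (ContinuousLinearMap.snd ℝ ℝ (ℝ × (Fin 5 → Fin 5 → Fin 5 → ℝ))).hasFDerivAt.comp_hasDerivAt
    0 hψ
  have hψ2 := (ContinuousLinearMap.fst ℝ ℝ (Fin 5 → Fin 5 → Fin 5 → ℝ)).hasFDerivAt.comp_hasDerivAt
    0 hψ23
  have hψ3 := (ContinuousLinearMap.snd ℝ ℝ (Fin 5 → Fin 5 → Fin 5 → ℝ)).hasFDerivAt.comp_hasDerivAt
    0 hψ23
  simp only [map_zero] at hψ1 hψ2 hψ3
  refine ⟨?_, ?_⟩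
  · have h1 : HasDerivAt (fun t : ℝ => (l + t • (r • (J *ᵥ δ))) ⬝ᵥ (l + t • (r • (J *ᵥ δ))) - 1)
        (2 * (l ⬝ᵥ (r • (J *ᵥ δ)))) 0 := by
      have h2 : ∀ i, HasDerivAt (fun t : ℝ => (l + t • (r • (J *ᵥ δ))) i) ((r • (J *ᵥ δ)) i) 0 :=
        fun i => by
          simpa using ((hasDerivAt_id (0 : ℝ)).mul_const ((r • (J *ᵥ δ)) i)).const_add (l i)
      refine ((HasDerivAt.fun_sum fun i _ => (h2 i).mul (h2 i)).sub_const 1).congr_deriv ?_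
      simp only [zero_smul, add_zero, dotProduct, Finset.mul_sum]
      exact Finset.sum_congr rfl fun i _ => by ring
    have h2 := h1.unique hψ2
    linarith only [h2]
  · refine (h.pullback hp).linearize h0 hG0 ?_ ?_ ?_
    · intro i j k hi hj hk
      have hw : ∀ i j k : Fin 5, i ≠ 1 → j ≠ 1 → k ≠ 1 → 0 < boostWeight 0 i j k := by decide
      rw [hw0]
      exact hn.nonpos 0 i j k (hw i j k hi hj hk)
    · have h1 : HasDerivAt (fun t : ℝ => (l + t • (r • (J *ᵥ δ))) ⬝ᵥ G (x + t • L v) *ᵥ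
          (l + t • (r • (J *ᵥ δ)))) 0 0 := hψ1
      have h2 := h1.const_mul ((r * r)⁻¹)
      rw [mul_zero] at h2
      refine h2.congr_of_eventuallyEq (Filter.Eventually.of_forall fun t => ?_)
      beta_reduce
      rw [hl', Matrix.mulVec_smul, smul_dotProduct, dotProduct_smul, smul_eq_mul, smul_eq_mul,
        ← mul_assoc r r, inv_mul_cancel_left₀ (mul_ne_zero hr hr), ← hG', dotProduct_pull]
    · intro i j k hi hj hk
      have h1 := hasDerivAt_pi.1 (hasDerivAt_pi.1 (hasDerivAt_pi.1 hψ3 i) j) k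
      have h2 := h1.const_mul ((r ^ 4)⁻¹)
      simp only [Pi.zero_apply, mul_zero] at h2
      have hev : ∀ᶠ t : ℝ in nhds 0, (0 : EuclideanSpace ℝ (Fin 5)) + t • v ∈
          (fun z => x + L z) ⁻¹' U := by
        have : ContinuousAt (fun t : ℝ => (0 : EuclideanSpace ℝ (Fin 5)) + t • v) 0 := by fun_prop
        exact this.eventually_mem (hp.isOpen.mem_nhds (by simpa using hx))
      refine h2.congr_of_eventuallyEq (hev.mono fun t ht => ?_)
      beta_reduce
      rw [hweyl _ ht, ev4_pull4, ← hG', wedge_pull, wedge_pull, wedge_pull, ← hy]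
      change _ = (r ^ 4)⁻¹ * ev4 _ _ _ _ _
      dsimp only
      rw [hl', wedge_smul, wedge_smul, wedge_smul, ev4_smul, inv_mul_cancel_left₀ (pow_ne_zero 4 hr)]

lemma isCompact_unit_sphere_dotProduct : IsCompact {l : Fin 5 → ℝ | l ⬝ᵥ l = 1} := by
  refine Metric.isCompact_of_isClosed_isBounded (isClosed_eq ?_ continuous_const) ?_
  · simp only [dotProduct]
    fun_prop
  · refine (Metric.isBounded_iff_subset_closedBall 0).2 ⟨1, fun l hl => ?_⟩
    rw [mem_closedBall_zero_iff, pi_norm_le_iff_of_nonneg zero_le_one]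
    intro i
    have h1 : l i * l i ≤ 1 := by
      rw [← show l ⬝ᵥ l = 1 from hl]
      exact Finset.single_le_sum (f := fun i => l i * l i) (fun j _ => mul_self_nonneg _)
        (Finset.mem_univ i)
    rw [Real.norm_eq_abs]
    exact abs_le_one_iff_mul_self_le_one.2 h1

/-- An Einstein metric with `C_{acde} C_b^{cde} = 0` is not of genuine type II on any open set. -/
theorem IsEinsteinOn.not_isGenuineTypeII (h : IsEinsteinOn G U) (hx : x ∈ U)
    (hS : ∀ y ∈ U, ∀ a b, S2 (G y) (weyl G y) a b = 0)
    (hII : ∀ y ∈ U, IsGenuineTypeII (G y) (weyl G y)) : False := by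
  have hW := h.smooth_weylTen
  have hframe : ∀ l, ∃ (J : Matrix (Fin 5) (Fin 5) ℝ) (r s : ℝ), IsWand (G x) (weyl G x) l →
      Jᵀ * G x * J = nullMat ∧ r ≠ 0 ∧ l = r • (J *ᵥ Pi.single 0 1) ∧ s ≠ 0 ∧
        IsNormalized (pull4 (weyl G x) J) s := by
    intro l
    by_cases hl : IsWand (G x) (weyl G x) l
    · obtain ⟨J, hJ, ⟨r, hr, hlr⟩, s, hs, hn⟩ :=
        hl.exists_frame (h.metric.isWeyl hx (by norm_num)) (hS x hx) (hII x hx)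
      exact ⟨J, r, s, fun _ => ⟨hJ, hr, hlr, hs, hn⟩⟩
    · exact ⟨0, 0, 0, fun h => absurd h hl⟩
  choose J r s hframe using hframe
  have hnorm : ∀ l, IsWand (G x) (weyl G x) l → IsNormalized (weyl (affinePull G x (J l)) 0) (s l) := by
    intro l hl
    obtain ⟨hJ, -, -, -, hn⟩ := hframe l hl
    have hp := h.metric.isPullback_affine x (isUnit_det_of_pull hJ).2
    rw [hp.weyl_eq (y := 0) (by simpa using hx), jacobian_affine, map_zero, add_zero]
    exact hn
  obtain ⟨l, hl, htan⟩ := exists_tangent_solution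
    (Z := fun y l => y ∈ U ∧ IsWand (G y) (weyl G y) l) (x := x) isCompact_unit_sphere_dotProduct
    (fun v u l hv hu hZ => ⟨hx, isWand_of_tendsto h.metric hx hW hv hu fun k => (hZ k).2⟩)
    (Filter.Eventually.mono (h.metric.isOpen.mem_nhds hx) fun y hy => by
      obtain ⟨F, hF, hC⟩ := (hII y hy).1
      obtain ⟨l, hl⟩ := exists_isWand hF hC
      exact ⟨l, hl.norm, hy, hl⟩)
    (ψ := fun l => wandMap G (J l)) (ψ' := fun l => fderiv ℝ (wandMap G (J l)) (x, l))
    (fun l _ => (differentiableAt_wandMap h.metric hx hW (J l) l).hasFDerivAt)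
    (fun l _ y l' hZ => hZ.2.wandMap_eq_zero)
    (fun l hl δ hδ => by
      obtain ⟨hJ, hr, hlr, hs, hn⟩ := hframe l hl.2
      have hJdet := (isUnit_det_of_pull hJ).2
      have hδ' : δ = r l • (J l *ᵥ ((r l)⁻¹ • ((J l)⁻¹ *ᵥ δ))) := by
        rw [Matrix.mulVec_smul, smul_smul, mul_inv_cancel₀ hr, one_smul, Matrix.mulVec_mulVec,
          Matrix.mul_nonsing_inv _ hJdet, Matrix.one_mulVec]
      -- `δ'` are the coordinates of `δ` in the frame `J`, scaled so that `l` becomes the first vector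
      set δ' := (r l)⁻¹ • ((J l)⁻¹ *ᵥ δ) with hδ'def
      have h1 := h.linearize_wandMap hx hJ hr hlr hn (v := 0) (δ := δ') (by rw [map_zero, ← hδ', hδ])
      simp only [map_zero, zero_add] at h1
      obtain ⟨h2, h3, h4⟩ := h1
      obtain ⟨d1, d2, d3, d4⟩ := rotation_of_linearized (hnorm l hl.2) hs (by linarith) h4
      have h5 : δ = δ' 0 • l := by
        have : δ' = δ' 0 • (Pi.single 0 1 : Fin 5 → ℝ) := by
          ext i
          fin_cases i <;> simp [d1, d2, d3, d4]
        rw [hlr, hδ']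
        conv_lhs => rw [this]
        rw [Matrix.mulVec_smul, smul_comm]
      -- the remaining freedom, a multiple of `l`, is removed by the normalization of `l`
      rw [← hδ', h5, dotProduct_smul, hl.2.norm, smul_eq_mul, mul_one] at h2
      rw [h5, h2, zero_smul])
  obtain ⟨hJ, hr, hlr, hs, hn⟩ := hframe l hl.2
  have hJdet := (isUnit_det_of_pull hJ).2
  have hp := h.metric.isPullback_affine x hJdet
  have h' := h.pullback hp
  have h0 : (0 : EuclideanSpace ℝ (Fin 5)) ∈
      (fun z => x + Matrix.toEuclideanCLM (𝕜 := ℝ) (J l) z) ⁻¹' U := by simpa using hx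
  have hG0 : affinePull G x (J l) 0 = nullMat := by rw [affinePull, map_zero, add_zero, hJ]
  refine hs (IsSecondJet.eq_zero (h'.isSecondJet
    (fun y hy => hp.S2_weyl_eq_zero hy (hS _ hy)) h0 hG0 (hnorm l hl.2) fun e => ?_))
  obtain ⟨δ, hδ⟩ := htan (Matrix.toEuclideanCLM (𝕜 := ℝ) (J l) (EuclideanSpace.single e 1))
  have hδ' : δ = r l • (J l *ᵥ ((r l)⁻¹ • ((J l)⁻¹ *ᵥ δ))) := by
    rw [Matrix.mulVec_smul, smul_smul, mul_inv_cancel₀ hr, one_smul, Matrix.mulVec_mulVec,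
      Matrix.mul_nonsing_inv _ hJdet, Matrix.one_mulVec]
  rw [hδ'] at hδ
  obtain ⟨-, h1, h2⟩ := h.linearize_wandMap hx hJ hr hlr hn hδ
  refine h'.covDeriv_of_linearized h0 hG0 (fun i j k hi hj hk => ?_) e h1 h2
  have hw : ∀ i j k : Fin 5, i ≠ 1 → j ≠ 1 → k ≠ 1 → 0 < boostWeight 0 i j k := by decide
  exact (hnorm l hl.2).nonpos 0 i j k (hw i j k hi hj hk)

end Core

/-! ### Passage from charts to the manifold -/

section Manifold

open Matrix
open scoped Kronecker

namespace LorentzMetric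

variable {n : ℕ} {M : Type*} [TopologicalSpace M] [ChartedSpace (EuclideanSpace ℝ (Fin n)) M]
  [IsManifold (𝓡 n) ∞ M] {e e' : OpenPartialHomeomorph M (EuclideanSpace ℝ (Fin n))}
  {y : EuclideanSpace ℝ (Fin n)}

lemma mdifferentiable_chart (he : e ∈ atlas (EuclideanSpace ℝ (Fin n)) M) :
    e.MDifferentiable (𝓡 n) (𝓡 n) :=
  have : IsManifold (𝓡 n) 1 M := IsManifold.of_le (n := ∞) (by simp)
  mdifferentiable_of_mem_atlas he

/-- The components of a Lorentzian metric in a chart form an invertible matrix. -/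
lemma isUnit_det_comp (g : LorentzMetric n M) (he : e ∈ atlas (EuclideanSpace ℝ (Fin n)) M)
    (hy : y ∈ e.target) : IsUnit (g.comp e y).det := by
  obtain ⟨b, hb⟩ := g.lorentzian (e.symm y)
  let L := ((mdifferentiable_chart he).symm.mfderiv (x := y) hy).toLinearEquiv
  let c : Module.Basis (Fin n) ℝ (TangentSpace (𝓡 n) (e.symm y)) :=
    (EuclideanSpace.basisFun (Fin n) ℝ).toBasis.map L
  have h1 : LinearMap.toMatrix₂ c c (g.form (e.symm y)) = g.comp e y := by
    ext i j
    have hc : ∀ i, c i = mfderiv (𝓡 n) (𝓡 n) e.symm y (EuclideanSpace.single i (1 : ℝ)) := by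
      intro i
      have h0 : (EuclideanSpace.basisFun (Fin n) ℝ).toBasis i = EuclideanSpace.single i 1 := by simp
      exact (Module.Basis.map_apply _ _ i).trans (congrArg L h0)
    rw [LinearMap.toMatrix₂_apply, hc, hc]
    rfl
  have h2 : LinearMap.toMatrix₂ b b (g.form (e.symm y))
      = Matrix.diagonal fun i : Fin n => if (i : ℕ) = 0 then -1 else 1 := by
    ext i j
    rw [LinearMap.toMatrix₂_apply, hb, Matrix.diagonal_apply]
  have h3 := LinearMap.toMatrix₂_mul_basis_toMatrix b b c c (g.form (e.symm y))
  rw [← h1, ← h3, Matrix.det_mul, Matrix.det_mul, Matrix.det_transpose, h2, Matrix.det_diagonal]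
  have h4 : IsUnit (b.toMatrix c).det := by
    rw [← Matrix.isUnit_iff_isUnit_det]
    have := b.invertibleToMatrix c
    exact isUnit_of_invertible _
  refine (h4.mul (isUnit_iff_ne_zero.2 (Finset.prod_ne_zero_iff.2 fun i _ => ?_))).mul h4
  split_ifs <;> norm_num

lemma isMetricOn (g : LorentzMetric n M) (he : e ∈ atlas (EuclideanSpace ℝ (Fin n)) M) :
    IsMetricOn (g.comp e) e.target where
  isOpen := e.open_target
  smooth i j := g.smooth e he i j
  symm y _ := by
    ext i j
    exact g.symm _ _ _
  det y hy := g.isUnit_det_comp he hy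

/-- The components of a metric in two charts are related by a change of coordinates. -/
lemma isPullback (g : LorentzMetric n M) (he : e ∈ atlas (EuclideanSpace ℝ (Fin n)) M)
    (he' : e' ∈ atlas (EuclideanSpace ℝ (Fin n)) M) :
    IsPullback (g.comp e') (g.comp e) (fun y => e' (e.symm y)) e'.target (e.symm ≫ₕ e').source := by
  have hsource : ∀ y ∈ (e.symm ≫ₕ e').source, y ∈ e.target ∧ e.symm y ∈ e'.source := fun y hy => by
    simpa using hy
  have hsmooth : ContDiffOn ℝ ∞ (fun y => e' (e.symm y)) (e.symm ≫ₕ e').source := by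
    have h1 := ((contDiffGroupoid ∞ (𝓡 n)).compatible he he').1
    refine (h1.mono ?_).congr ?_
    · intro y hy
      simpa using hy
    · intro y hy
      rfl
  have heq : ∀ y ∈ (e.symm ≫ₕ e').source, g.comp e y
      = (jacobian (fun y => e' (e.symm y)) y)ᵀ * g.comp e' (e' (e.symm y))
        * jacobian (fun y => e' (e.symm y)) y := by
    intro y hy
    obtain ⟨hy1, hy2⟩ := hsource y hy
    let φ : EuclideanSpace ℝ (Fin n) → EuclideanSpace ℝ (Fin n) := fun y => e' (e.symm y)
    let B : M → EuclideanSpace ℝ (Fin n) →ₗ[ℝ] EuclideanSpace ℝ (Fin n) →ₗ[ℝ] ℝ := g.form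
    let D : EuclideanSpace ℝ (Fin n) →L[ℝ] EuclideanSpace ℝ (Fin n) :=
      mfderiv (𝓡 n) (𝓡 n) e.symm y
    let D' : EuclideanSpace ℝ (Fin n) →L[ℝ] EuclideanSpace ℝ (Fin n) :=
      mfderiv (𝓡 n) (𝓡 n) e'.symm (φ y)
    have hφ : DifferentiableAt ℝ φ y :=
      (hsmooth.contDiffAt ((e.symm ≫ₕ e').open_source.mem_nhds hy)).differentiableAt (by simp)
    have hp : e'.symm (φ y) = e.symm y := e'.left_inv hy2
    have hchain : D = D'.comp (fderiv ℝ φ y) := by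
      have h1 : e.symm =ᶠ[nhds y] e'.symm ∘ φ := by
        filter_upwards [(e.symm ≫ₕ e').open_source.mem_nhds hy] with z hz
        exact (e'.left_inv (hsource z hz).2).symm
      have h2 := h1.mfderiv_eq (I := 𝓡 n) (I' := 𝓡 n)
      have h3 := mfderiv_comp (I := 𝓡 n) (I' := 𝓡 n) (I'' := 𝓡 n) y
        ((mdifferentiable_chart he').mdifferentiableAt_symm (e'.map_source hy2))
        hφ.mdifferentiableAt
      rw [mfderiv_eq_fderiv] at h3
      exact h2.trans h3
    have hfd : ∀ i, fderiv ℝ φ y (EuclideanSpace.single i 1)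
        = ∑ k, jacobian φ y k i • EuclideanSpace.single k (1 : ℝ) := by
      intro i
      ext k
      have h1 : HasFDerivAt (fun z => φ z k)
          ((EuclideanSpace.proj (𝕜 := ℝ) k).comp (fderiv ℝ φ y)) y :=
        (EuclideanSpace.proj (𝕜 := ℝ) k).hasFDerivAt.comp y hφ.hasFDerivAt
      have h2 : jacobian φ y k i = (fderiv ℝ φ y (EuclideanSpace.single i 1)) k := by
        simp only [jacobian, of_apply, pd, h1.fderiv]
        rfl
      simp [← h2, Finset.sum_apply, Pi.single_apply]
    have hD : ∀ i, D (EuclideanSpace.single i 1)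
        = ∑ k, jacobian φ y k i • D' (EuclideanSpace.single k 1) := by
      intro i
      rw [hchain, ContinuousLinearMap.comp_apply, hfd, map_sum]
      simp only [map_smul]
    ext i j
    change B (e.symm y) (D (EuclideanSpace.single i 1)) (D (EuclideanSpace.single j 1)) = _
    simp only [Matrix.mul_apply, Matrix.transpose_apply, Finset.sum_mul]
    simp only [hD, map_sum, map_smul, LinearMap.sum_apply, LinearMap.smul_apply, smul_eq_mul,
      Finset.mul_sum]
    refine Finset.sum_congr rfl fun k _ => Finset.sum_congr rfl fun m _ => ?_
    have h1 : g.comp e' (φ y) m k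
        = B (e.symm y) (D' (EuclideanSpace.single m 1)) (D' (EuclideanSpace.single k 1)) := by
      rw [← hp]
      rfl
    change _ = jacobian φ y m i * g.comp e' (φ y) m k * jacobian φ y k j
    rw [h1]
    ring
  refine ⟨g.isMetricOn he', (e.symm ≫ₕ e').open_source, fun y hy => e'.map_source (hsource y hy).2,
    hsmooth, fun y hy => ?_, heq⟩
  have h1 := g.isUnit_det_comp he (hsource y hy).1
  rw [heq y hy, Matrix.det_mul] at h1
  exact isUnit_of_mul_isUnit_right h1

end LorentzMetric

variable {n : ℕ}

lemma S2_symm {G : Matrix (Fin n) (Fin n) ℝ} (hG : Gᵀ = G)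
    (C : Fin n → Fin n → Fin n → Fin n → ℝ) (a b : Fin n) : S2 G C a b = S2 G C b a := by
  have hi : (G⁻¹)ᵀ = G⁻¹ := by rw [Matrix.transpose_nonsing_inv, hG]
  have hs : (rows C * (G⁻¹ ⊗ₖ (G⁻¹ ⊗ₖ G⁻¹)) * (rows C)ᵀ)ᵀ
      = rows C * (G⁻¹ ⊗ₖ (G⁻¹ ⊗ₖ G⁻¹)) * (rows C)ᵀ := by
    simp only [Matrix.transpose_mul, Matrix.transpose_transpose, ← Matrix.kroneckerMap_transpose, hi,
      Matrix.mul_assoc]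
  rw [S2_eq, S2_eq]
  exact congrFun (congrFun hs b) a

/-- Genuine type II is independent of the choice of coordinates. -/
lemma IsGenuineTypeII.pull {G J : Matrix (Fin n) (Fin n) ℝ} {C : Fin n → Fin n → Fin n → Fin n → ℝ}
    (hJ : IsUnit J.det) (h : IsGenuineTypeII G C) : IsGenuineTypeII (Jᵀ * G * J) (pull4 C J) := by
  have hgram : ∀ (G : Matrix (Fin n) (Fin n) ℝ) (F : Fin n → Fin n → ℝ),
      IsNullFrame G F ↔ (of F) * G * (of F)ᵀ = of nullGram := by
    intro G F
    rw [← Matrix.ext_iff]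
    refine forall_congr' fun a => forall_congr' fun b => ?_
    simp only [Matrix.mul_apply, Matrix.transpose_apply, of_apply, Finset.sum_mul]
    rw [Finset.sum_comm]
    refine Eq.congr ?_ rfl
    exact Finset.sum_congr rfl fun i _ => Finset.sum_congr rfl fun j _ => by ring
  have key : ∀ (A : Matrix (Fin n) (Fin n) ℝ) (w : ℤ), (IsNullFrame (Jᵀ * G * J) (fun a i => A a i) ∧
      BoostOrderLE (pull4 C J) (fun a i => A a i) w) ↔
      (IsNullFrame G (fun a i => (A * Jᵀ) a i) ∧ BoostOrderLE C (fun a i => (A * Jᵀ) a i) w) := by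
    intro A w
    have h1 : frameComp (pull4 C J) (fun a i => A a i) = frameComp C fun a i => (A * Jᵀ) a i := by
      rw [frameComp_eq_pull4, frameComp_eq_pull4, pull4_pull4]
      congr 1
      change J * Aᵀ = (A * Jᵀ)ᵀ
      rw [Matrix.transpose_mul, Matrix.transpose_transpose]
    have h2 : IsNullFrame (Jᵀ * G * J) (fun a i => A a i) ↔
        IsNullFrame G fun a i => (A * Jᵀ) a i := by
      rw [hgram, hgram]
      change A * (Jᵀ * G * J) * Aᵀ = _ ↔ (A * Jᵀ) * G * (A * Jᵀ)ᵀ = _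
      rw [Matrix.transpose_mul, Matrix.transpose_transpose]
      simp only [Matrix.mul_assoc]
    rw [h2]
    simp only [BoostOrderLE, h1]
  constructor
  · obtain ⟨F, hF⟩ := h.1
    refine ⟨_, (key (of F * (Jᵀ)⁻¹) 0).2 ?_⟩
    rw [Matrix.mul_assoc, Matrix.nonsing_inv_mul _ (by rwa [Matrix.det_transpose]), Matrix.mul_one]
    exact hF
  · rintro ⟨F, hF⟩
    exact h.2 ⟨_, (key (of F) (-1)).1 hF⟩

namespace LorentzMetric

variable {M : Type*} [TopologicalSpace M] [ChartedSpace (EuclideanSpace ℝ (Fin n)) M]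
  [IsManifold (𝓡 n) ∞ M] {e : OpenPartialHomeomorph M (EuclideanSpace ℝ (Fin n))}
  {y : EuclideanSpace ℝ (Fin n)}

lemma IsGenuineTypeIISpacetime.chart {g : LorentzMetric n M} (h : g.IsGenuineTypeIISpacetime)
    (he : e ∈ atlas (EuclideanSpace ℝ (Fin n)) M) (hy : y ∈ e.target) :
    IsGenuineTypeII (g.comp e y) (weyl (g.comp e) y) := by
  have hp := g.isPullback he (chart_mem_atlas (EuclideanSpace ℝ (Fin n)) (e.symm y))
  have hy' : y ∈ (e.symm ≫ₕ chartAt (EuclideanSpace ℝ (Fin n)) (e.symm y)).source := by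
    simp [hy]
  rw [hp.eq y hy', hp.weyl_eq hy']
  exact IsGenuineTypeII.pull (hp.det y hy') (h (e.symm y))

end LorentzMetric

section Five

variable {M : Type*} [TopologicalSpace M] [ChartedSpace (EuclideanSpace ℝ (Fin 5)) M]
  [IsManifold (𝓡 5) ∞ M]

/-- A `0`-universal metric is Einstein, because its Einstein tensor is conserved. -/
lemma LorentzMetric.IsKUniversal.isEinsteinOn {g : LorentzMetric 5 M} (h : g.IsKUniversal 0)
    {e : OpenPartialHomeomorph M (EuclideanSpace ℝ (Fin 5))}
    (he : e ∈ atlas (EuclideanSpace ℝ (Fin 5)) M) : IsEinsteinOn (g.comp e) e.target := by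
  obtain ⟨c, hc⟩ := h (einsteinExpr 0)
    (fun e he y hy a b => by
      rw [(g.isMetricOn he).einstein_apply 0 hy, (g.isMetricOn he).einstein_apply 0 hy,
        (g.isMetricOn he).ricci_symm hy b a, (g.isMetricOn he).apply_symm hy b a])
    fun e he y hy a => (g.isMetricOn he).divergence_einstein 0 hy a
  exact IsEinsteinOn.of_multiple (c := fun y => c (e.symm y)) (g.isMetricOn he) 0 (hc e he)

/-- For a `0`-universal metric, `R_{acde} R_b^{cde}` is a multiple of the metric: up to a multiple
of the metric it is conserved, since the divergence of the Riemann tensor of an Einstein metric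
vanishes. -/
lemma LorentzMetric.IsKUniversal.S2_riemann {g : LorentzMetric 5 M} (h : g.IsKUniversal 0)
    {e : OpenPartialHomeomorph M (EuclideanSpace ℝ (Fin 5))}
    (he : e ∈ atlas (EuclideanSpace ℝ (Fin 5)) M) {y : EuclideanSpace ℝ (Fin 5)}
    (hy : y ∈ e.target) : ∃ K, ∀ a b,
      S2 (g.comp e y) (riemann (g.comp e) y) a b = K * g.comp e y a b := by
  obtain ⟨c, hc⟩ := h (squareTraceExpr 0)
    (fun e he y hy a b => by
      rw [squareTraceExpr_apply, squareTraceExpr_apply, S2_symm ((g.isMetricOn he).symm y hy) _ b a,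
        (g.isMetricOn he).apply_symm hy b a])
    fun e he y hy a => (g.isMetricOn he).divergence_squareTrace 0 hy
      (fun b c d => (h.isEinsteinOn he).divergence_riemann hy b c d) a
  refine ⟨c (e.symm y) + trace (g.comp e) (squareTen (g.comp e) (riemannTen (g.comp e))) y / 4,
    fun a b => ?_⟩
  have h1 := hc e he y hy a b
  rw [squareTraceExpr_apply] at h1
  linarith only [h1]

/-- A `0`-universal metric is not of genuine type II. -/
theorem LorentzMetric.IsKUniversal.not_isGenuineTypeIISpacetime [Nonempty M]
    {g : LorentzMetric 5 M} (h : g.IsKUniversal 0) : ¬ g.IsGenuineTypeIISpacetime := by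
  intro hII
  obtain ⟨x⟩ := ‹Nonempty M›
  have he := chart_mem_atlas (EuclideanSpace ℝ (Fin 5)) x
  have hE := h.isEinsteinOn he
  refine hE.not_isGenuineTypeII (mem_chart_target _ x) (fun y hy => ?_) fun y hy => hII.chart he hy
  obtain ⟨K, hK⟩ := h.S2_riemann he hy
  exact hE.S2_weyl_eq_zero hy hK (hII.chart he hy).1

/-- If `S⁽²⁾` and `S⁽³⁾` are multiples of the metric at a point, the Weyl components of boost weight
zero vanish in all frames in which those of positive boost weight do. -/
theorem LorentzMetric.frameComp_eq_zero (g : LorentzMetric 5 M) (x : M) {K K' : ℝ}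
    (h2 : ∀ a b, S2 (g.metricAt x) (g.weylAt x) a b = K * g.metricAt x a b)
    (h3 : ∀ a b, S3 (g.metricAt x) (g.weylAt x) a b = K' * g.metricAt x a b)
    {F : Fin 5 → Fin 5 → ℝ} (hF : IsNullFrame (g.metricAt x) F)
    (hF0 : BoostOrderLE (g.weylAt x) F 0) (a b c d : Fin 5) (hw : boostWeight a b c d = 0) :
    frameComp (g.weylAt x) F a b c d = 0 := by
  have hW : IsWeyl (g.metricAt x) (g.weylAt x) :=
    (g.isMetricOn (chart_mem_atlas (EuclideanSpace ℝ (Fin 5)) x)).isWeyl (mem_chart_target _ x)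
      (by norm_num)
  set J : Matrix (Fin 5) (Fin 5) ℝ := (of F)ᵀ with hJdef
  have hJ : Jᵀ * g.metricAt x * J = nullMat := (isNullFrame_iff _ _).1 hF
  have hJdet := (isUnit_det_of_pull hJ).2
  have hW' : IsWeyl nullMat (pull4 (g.weylAt x) J) := by rw [← hJ]; exact hW.pull hJdet
  have hmul : ∀ {S : Matrix (Fin 5) (Fin 5) ℝ} {K : ℝ}, (∀ a b, S a b = K * g.metricAt x a b) →
      ∀ a b, (Jᵀ * S * J) a b = K * nullMat a b := by
    intro S K h a b
    have : S = K • g.metricAt x := by ext a b; exact h a b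
    rw [this, Matrix.mul_smul, Matrix.smul_mul, hJ]
    rfl
  refine weight_zero_of_S2_S3 hW' hF0 (K := K) (K' := K') (fun a b => ?_) (fun a b => ?_) a b c d hw
  · have := S2_pull4 (G := g.metricAt x) hJdet (g.weylAt x) a b
    rw [hJ] at this
    rw [this]
    exact hmul h2 a b
  · have := S3_pull4 (G := g.metricAt x) hJdet (g.weylAt x) a b
    rw [hJ] at this
    rw [this, ← hmul (S := of (S3 (g.metricAt x) (g.weylAt x))) h3 a b]
    simp only [Matrix.mul_apply, Matrix.transpose_apply, Finset.sum_mul, of_apply]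
    rw [Finset.sum_comm]
    exact Finset.sum_congr rfl fun i _ => Finset.sum_congr rfl fun j _ => by ring

end Five

end Manifold

end Lorentz

end

theorem mainTheorem1 {M : Type*} [TopologicalSpace M]
    [ChartedSpace (EuclideanSpace ℝ (Fin 5)) M] [IsManifold (𝓡 5) ∞ M] [Nonempty M]
    (g : Lorentz.LorentzMetric 5 M) :
    -- no genuine type II universal spacetimes
    ¬ (g.IsUniversal ∧ g.IsGenuineTypeIISpacetime) ∧
    -- no genuine type II 0-universal spacetimes
    ¬ (g.IsKUniversal 0 ∧ g.IsGenuineTypeIISpacetime) ∧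
    -- the two algebraic conditions annihilate the Weyl components of boost weight zero
    (∀ x : M,
      (∃ K : ℝ, ∀ a b, Lorentz.S2 (g.metricAt x) (g.weylAt x) a b = K * g.metricAt x a b) →
      (∃ K' : ℝ, ∀ a b, Lorentz.S3 (g.metricAt x) (g.weylAt x) a b = K' * g.metricAt x a b) →
      ∀ F, Lorentz.IsNullFrame (g.metricAt x) F → Lorentz.BoostOrderLE (g.weylAt x) F 0 →
        ∀ a b c d, Lorentz.boostWeight a b c d = 0 →
          Lorentz.frameComp (g.weylAt x) F a b c d = 0) := by
  refine ⟨fun h => (h.1 0).not_isGenuineTypeIISpacetime h.2,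
    fun h => h.1.not_isGenuineTypeIISpacetime h.2, ?_⟩
  rintro x ⟨K, hK⟩ ⟨K', hK'⟩ F hF hF0 a b c d hw
  exact g.frameComp_eq_zero x hK hK' hF hF0 a b c d hw
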